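/- Fix a real number $r>1$ and a complex number $x$ with $0<|x|<1$, and fix a logarithm $\log x$; put $x^a=e^{a\log x}$ and $[a]_x=\frac{x^a-x^{-a}}{x-x^{-1}}$. **Realizations.** Consider the Heisenberg algebra generated by $a_i(m),Q_i$ ($m\in\mathbb Z$, $i=1,2$) with $[a_i(m),a_j(n)]=\frac1m A_{i,j}(m)\delta_{m+n,0}$ ($m,n\ne0$), $[a_i(0),Q_j]=A_{i,j}(0)$, all other commutators being zero, where $A_{1,1}(m)=A_{2,2}(m)=1$ ($m\neq 0$), $A_{2,1}(m)=A_{1,2}(-m)$, and * Case 2: $A_{1,1}(0)=\frac{2(r-1)}r$, $A_{2,2}(0)=1$, $A_{1,2}(0)=-\frac{r-1}r$, $A_{1,2}(m)=-\frac{[(r-1)m]_x}{[rm]_x}$ $(m>0)$, $A_{1,2}(m)=-\frac{[m]_x}{[2m]_x}$ $(m<0)$; * Case 3: $A_{1,1}(0)=A_{2,2}(0)=1$, $A_{1,2}(0)=-\frac1r$, $A_{1,2}(m)=-\frac{[m]_x}{[rm]_x}$ $(m\ne0)$. It acts on the Fock spaces generated by highest weight vectors $|\mu\rangle=e^{\mu_1Q_1+\mu_2Q_2}|0\rangle$,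 $\mu\in\mathbb C^2$, where $a_i(m)|0\rangle=0$ for $m\ge 0$. For $k=1,2,3$ let $$\Lambda_k(z)=e^{\sum_j\lambda_{k,j}(0)a_j(0)}:\exp\Big(\sum_{j=1}^2\sum_{m\ne0}\lambda_{k,j}(m)a_j(m)z^{-m}\Big):$$ where $:\ :$ is normal ordering (creation operators to the left), $\lambda_{k,j}(0)=\frac{2r\log x}{r+1}\,\lambda^0_{k,j}$ and $\lambda_{k,j}(m)=s_j(m)\frac{[rm]_x}{[(r+1)m]_x}(x-x^{-1})\,\lambda^m_{k,j}$ for $m\neq0$. Here $s_1(m)=s_2(m)=1$ for $m>0$; for $m<0$, $s_1(m)=-\frac{[(r-1)m]_x[2m]_x}{[rm]_x[m]_x}$ and $s_2(m)=-1$ in Case 2, while $s_1(m)=s_2(m)=-1$ in Case 3; and, the rows being indexed by $k$ and the columns by $j$, * Case 2: $\lambda^0=\begin{pmatrix}-r&1-r\\1&1-r\\1&2\end{pmatrix}$, $\lambda^m=\begin{pmatrix}x^{(r-1)m}[rm]_x&x^{(r-1)m}[(r-1)m]_x\\-x^{2rm}[m]_x&x^{(r-1)m}[(r-1)m]_x\\-x^{2rm}[m]_x&-x^{2rm}[2m]_x\end{pmatrix}$;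 * Case 3: $\lambda^0=\begin{pmatrix}-r&-1\\1&-1\\1&r\end{pmatrix}$, $\lambda^m=\begin{pmatrix}x^{(r-1)m}[rm]_x&x^{(r-1)m}[m]_x\\-x^{2rm}[m]_x&x^{(r-1)m}[m]_x\\-x^{2rm}[m]_x&-x^{2rm}[rm]_x\end{pmatrix}$. **Currents.** Put $d_j=\prod_{l=1}^j\frac{[r-l]_x}{[l]_x}$ and, for a word $k_1\cdots k_i$ in the letters $1,2,3$, $\Lambda_{k_1\cdots k_i}(z)=\;:\Lambda_{k_1}(x^{-i+1}z)\Lambda_{k_2}(x^{-i+3}z)\cdots\Lambda_{k_i}(x^{i-1}z):$. Define $T_0(z)=1$ and * Case 2: $T_1=\Lambda_1+\Lambda_2+d_1\Lambda_3$, and $T_i=d_{i-2}\Lambda_{1\,2\,3^{i-2}}+d_{i-1}\Lambda_{1\,3^{i-1}}+d_{i-1}\Lambda_{2\,3^{i-1}}+d_i\Lambda_{3^i}$ for $i\ge2$; * Case 3: $T_1=\Lambda_1+d_1\Lambda_2+\Lambda_3$, and $T_i=d_{i-2}\Lambda_{1\,2^{i-2}\,3}+d_{i-1}\Lambda_{1\,2^{i-1}}+d_{i-1}\Lambda_{2^{i-1}\,3}+d_i\Lambda_{2^i}$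 for $i\ge2$. Let $c=[r]_x[r-1]_x(x-x^{-1})$, $\Delta_1(z)=\frac{(1-x^{2r-1}z)(1-x^{-2r+1}z)}{(1-xz)(1-x^{-1}z)}$, $\delta(z)=\sum_{m\in\mathbb Z}z^m$, and let $f_{i,j}(z)$ be the formal power series $$f_{i,j}(z)=\exp\Big(-\sum_{m\ge1}\frac1m\frac{[(r-1)m]_x[rm]_x[\min(i,j)m]_x[(r+1-\max(i,j))m]_x}{[m]_x[(r+1)m]_x}(x-x^{-1})^2z^m\Big).$$ **Theorem.** In Case 2 and in Case 3, on every Fock space, for all $j\ge i\ge1$, $$\begin{aligned}&f_{i,j}\big(\tfrac{z_2}{z_1}\big)T_i(z_1)T_j(z_2)-f_{j,i}\big(\tfrac{z_1}{z_2}\big)T_j(z_2)T_i(z_1)\\&=c\sum_{k=1}^i\prod_{l=1}^{k-1}\Delta_1(x^{2l+1})\Big(\delta\big(\tfrac{x^{-j+i-2k}z_2}{z_1}\big)f_{i-k,j+k}(x^{j-i})T_{i-k}(x^kz_1)T_{j+k}(x^{-k}z_2)\\&\qquad-\delta\big(\tfrac{x^{j-i+2k}z_2}{z_1}\big)f_{i-k,j+k}(x^{-j+i})T_{i-k}(x^{-k}z_1)T_{j+k}(x^kz_2)\Big)\end{aligned}$$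 as formal series in $z_1^{\pm1},z_2^{\pm1}$ of operators. On the right, the products are defined by analytic continuation: for $a=i-k$, $b=j+k$, $1\le k\le i$, and every vector $v$, each coefficient in $z$ of $f_{a,b}(\zeta)T_a(z)T_b(\zeta z)v$ is the expansion at $\zeta=0$ of a rational function of $\zeta$ that is regular at $\zeta=x^{\pm(j-i)}$, and its value there is meant. In particular the relations are the same in both cases. -/

import Mathlib

noncomputable section

namespace DeformedW

/-- The two free field realizations of the deformed W-superalgebra of `sl(2|1)`, one for each
Dynkin diagram: Case 2 (one fermionic node) and Case 3 (two fermionic nodes). -/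
inductive RealizationCase where
  | two
  | three

/-- `x ^ a`, where `ℓ` is the chosen logarithm of `x`. -/
def xpow (ℓ a : ℂ) : ℂ := Complex.exp (a * ℓ)

/-- The `q`-number `[a]_x = (x ^ a - x ^ (-a)) / (x - x⁻¹)`, where `ℓ` is the chosen logarithm
of `x`. -/
def qnum (ℓ a : ℂ) : ℂ :=
  (xpow ℓ a - xpow ℓ (-a)) / (xpow ℓ 1 - xpow ℓ (-1))

/-- `x - x⁻¹`. -/
def xdiff (ℓ : ℂ) : ℂ := xpow ℓ 1 - xpow ℓ (-1)

/-! ### The parameters of the free field realization -/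

/-- `A_{1,2}(m)`. -/
def A12 (C : RealizationCase) (r : ℝ) (ℓ : ℂ) (m : ℤ) : ℂ :=
  match C with
  | .two =>
      if m = 0 then -((r - 1) / r)
      else if 0 < m then -(qnum ℓ ((r - 1) * m) / qnum ℓ (r * m))
      else -(qnum ℓ m / qnum ℓ (2 * m))
  | .three =>
      if m = 0 then -(1 / r) else -(qnum ℓ m / qnum ℓ (r * m))

/-- `A_{i,i}(0)`. -/
def Adiag0 (C : RealizationCase) (r : ℝ) : Fin 2 → ℂ :=
  match C with
  | .two => ![2 * (r - 1) / r, 1]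
  | .three => ![1, 1]

/-- The structure constants `A_{i,j}(m)` of the Heisenberg algebra. -/
def A (C : RealizationCase) (r : ℝ) (ℓ : ℂ) (i j : Fin 2) (m : ℤ) : ℂ :=
  if i = j then (if m = 0 then Adiag0 C r i else 1)
  else if i = 0 then A12 C r ℓ m
  else A12 C r ℓ (-m)

/-- The coefficients `s_j(m)` (`m ≠ 0`) of the screening currents, which normalize
`λ_{i,j}(m)`. -/
def s (C : RealizationCase) (r : ℝ) (ℓ : ℂ) (j : Fin 2) (m : ℤ) : ℂ :=
  if 0 < m then 1
  else
    match C with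
    | .two =>
        ![-((qnum ℓ ((r - 1) * m) * qnum ℓ (2 * m)) / (qnum ℓ (r * m) * qnum ℓ m)), -1] j
    | .three => -1

/-- `λ_{i,j}(0)`; here `ℓ = log x`. -/
def lam0 (C : RealizationCase) (r : ℝ) (ℓ : ℂ) (i : Fin 3) (j : Fin 2) : ℂ :=
  (2 * r / (r + 1)) * ℓ *
    (match C with
      | .two => (!![-(r : ℂ), 1 - r; 1, 1 - r; 1, 2] : Matrix (Fin 3) (Fin 2) ℂ) i j
      | .three => (!![-(r : ℂ), -1; 1, -1; 1, r] : Matrix (Fin 3) (Fin 2) ℂ) i j)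

/-- The last factor of `λ_{i,j}(m) / s_j(m)` for `m ≠ 0`. -/
def lamTable (C : RealizationCase) (r : ℝ) (ℓ : ℂ) (m : ℤ) : Matrix (Fin 3) (Fin 2) ℂ :=
  let u : ℂ := xpow ℓ ((r - 1) * m)
  let w : ℂ := xpow ℓ (2 * r * m)
  match C with
  | .two =>
      !![u * qnum ℓ (r * m), u * qnum ℓ ((r - 1) * m);
         -(w * qnum ℓ m), u * qnum ℓ ((r - 1) * m);
         -(w * qnum ℓ m), -(w * qnum ℓ (2 * m))]
  | .three =>
      !![u * qnum ℓ (r * m), u * qnum ℓ m;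
         -(w * qnum ℓ m), u * qnum ℓ m;
         -(w * qnum ℓ m), -(w * qnum ℓ (r * m))]

/-- The coefficients `λ_{i,j}(m)` of the vertex operators `Λ_i(z)`. -/
def lam (C : RealizationCase) (r : ℝ) (ℓ : ℂ) (i : Fin 3) (j : Fin 2) (m : ℤ) : ℂ :=
  if m = 0 then lam0 C r ℓ i j
  else s C r ℓ j m * (qnum ℓ (r * m) / qnum ℓ ((r + 1) * m) * xdiff ℓ * lamTable C r ℓ m i j)

/-! ### Fock space -/

/-- The Fock space over a highest weight vector `|μ⟩ = e^{μ₁ Q₁ + μ₂ Q₂}|0⟩`: polynomials in the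
creation operators, the variable `(i, m)` standing for `a_i(-m)`, `m ≥ 1`. -/
abbrev Fock : Type := MvPolynomial (Fin 2 × ℕ+) ℂ

/-- The action of the Heisenberg generator `a_i(n)` on the Fock space over `|μ⟩`. -/
def osc (C : RealizationCase) (r : ℝ) (ℓ : ℂ) (μ : Fin 2 → ℂ) (i : Fin 2) :
    ℤ → Module.End ℂ Fock
  | Int.ofNat 0 => (∑ k, A C r ℓ i k 0 * μ k) • LinearMap.id
  | Int.ofNat (m + 1) =>
      ∑ j, (A C r ℓ i j (m + 1 : ℕ) / (m + 1 : ℕ)) •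
        (MvPolynomial.pderiv (R := ℂ) (j, m.succPNat)).toLinearMap
  | Int.negSucc m => LinearMap.mulLeft ℂ (MvPolynomial.X (i, m.succPNat))

/-- The exponential `∑ P ^ k / k!` of a formal power series `P` without constant term. -/
def expSeries {R : Type*} [Ring R] [Algebra ℂ R] (P : PowerSeries R) : PowerSeries R :=
  PowerSeries.mk fun n =>
    ∑ k ∈ Finset.range (n + 1), ((k.factorial : ℂ)⁻¹) • PowerSeries.coeff n (P ^ k)

/-! ### Normally ordered products of the `Λ_k`

A list `[(k₁, c₁), …, (k_s, c_s)]` stands for the normally ordered product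
`:Λ_{k₁}(c₁ z) ⋯ Λ_{k_s}(c_s z):`. The index `k = 0, 1, 2` means `Λ_1, Λ_2, Λ_3`. -/

/-- The exponent `∑_{m ≥ 1} ∑ λ_{k,j}(m) a_j(m) (c z)^{-m}`, a series in `z⁻¹`. -/
def annExponent (C : RealizationCase) (r : ℝ) (ℓ : ℂ) (μ : Fin 2 → ℂ) (W : List (Fin 3 × ℂ)) :
    PowerSeries (Module.End ℂ Fock) :=
  PowerSeries.mk fun m : ℕ => if m = 0 then 0 else
    (W.map fun kc => ∑ j, (lam C r ℓ kc.1 j m * kc.2 ^ (-(m : ℤ))) • osc C r ℓ μ j m).sum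

/-- The exponent `∑_{m ≥ 1} ∑ λ_{k,j}(-m) a_j(-m) (c z)^m`, a series in `z`. -/
def creExponent (C : RealizationCase) (r : ℝ) (ℓ : ℂ) (μ : Fin 2 → ℂ) (W : List (Fin 3 × ℂ)) :
    PowerSeries (Module.End ℂ Fock) :=
  PowerSeries.mk fun m : ℕ => if m = 0 then 0 else
    (W.map fun kc => ∑ j, (lam C r ℓ kc.1 j (-m) * kc.2 ^ (m : ℤ)) • osc C r ℓ μ j (-m)).sum

/-- The annihilation part of a normally ordered product, a series in `z⁻¹`. -/
def annPart (C : RealizationCase) (r : ℝ) (ℓ : ℂ) (μ : Fin 2 → ℂ) (W : List (Fin 3 × ℂ)) :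
    PowerSeries (Module.End ℂ Fock) :=
  expSeries (annExponent C r ℓ μ W)

/-- The creation part of a normally ordered product, a series in `z`. -/
def crePart (C : RealizationCase) (r : ℝ) (ℓ : ℂ) (μ : Fin 2 → ℂ) (W : List (Fin 3 × ℂ)) :
    PowerSeries (Module.End ℂ Fock) :=
  expSeries (creExponent C r ℓ μ W)

/-- The zero mode part `∏ exp (∑_j λ_{k,j}(0) a_j(0))`, which acts by a scalar. -/
def zeroPart (C : RealizationCase) (r : ℝ) (ℓ : ℂ) (μ : Fin 2 → ℂ) (W : List (Fin 3 × ℂ)) : ℂ :=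
  (W.map fun kc => Complex.exp (∑ j, lam C r ℓ kc.1 j 0 * ∑ k, A C r ℓ j k 0 * μ k)).prod

/-! Every vector is annihilated by all sufficiently high modes of the annihilation part, so that the
sums over modes below are finite. -/

/-- The degree of the oscillator monomials: `a_i(-m)` has degree `m`. -/
def fockWeight (x : Fin 2 × ℕ+) : ℤ := (x.2 : ℕ)

lemma fock_homogeneous_neg {v : Fock} {d : ℤ} (hv : v.IsWeightedHomogeneous fockWeight d)
    (hd : d < 0) : v = 0 := by
  ext e
  rw [MvPolynomial.coeff_zero]
  apply hv.coeff_eq_zero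
  intro h
  have : 0 ≤ Finsupp.weight fockWeight e := by
    rw [Finsupp.weight_apply, Finsupp.sum]
    apply Finset.sum_nonneg
    intro a _
    simp only [fockWeight]
    positivity
  omega

lemma osc_pos_homogeneous (C : RealizationCase) (r : ℝ) (ℓ : ℂ) (μ : Fin 2 → ℂ) (i : Fin 2)
    (m : ℕ) {v : Fock} {d : ℤ} (hv : v.IsWeightedHomogeneous fockWeight d) :
    (osc C r ℓ μ i ((m + 1 : ℕ) : ℤ) v).IsWeightedHomogeneous fockWeight (d - (m + 1 : ℕ)) := by
  have h : osc C r ℓ μ i ((m + 1 : ℕ) : ℤ) =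
      ∑ j, (A C r ℓ i j (m + 1 : ℕ) / (m + 1 : ℕ)) •
        (MvPolynomial.pderiv (R := ℂ) (j, m.succPNat)).toLinearMap := rfl
  rw [h, LinearMap.sum_apply]
  refine Submodule.sum_mem (MvPolynomial.weightedHomogeneousSubmodule ℂ fockWeight _) ?_
  intro j _
  rw [LinearMap.smul_apply]
  refine Submodule.smul_mem _ _ ?_
  refine MvPolynomial.IsWeightedHomogeneous.pderiv hv ?_
  simp [fockWeight]

lemma annPart_homogeneous (C : RealizationCase) (r : ℝ) (ℓ : ℂ) (μ : Fin 2 → ℂ)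
    (W : List (Fin 3 × ℂ)) (n : ℕ) {v : Fock} {d : ℤ}
    (hv : v.IsWeightedHomogeneous fockWeight d) :
    ((PowerSeries.coeff n (annPart C r ℓ μ W)) v).IsWeightedHomogeneous fockWeight (d - n) := by
  unfold annPart expSeries
  set P : PowerSeries (Module.End ℂ Fock) := annExponent C r ℓ μ W with hP
  have h1 : ∀ (m : ℕ) (e : ℤ) (u : Fock), u.IsWeightedHomogeneous fockWeight e →
      ((PowerSeries.coeff m P) u).IsWeightedHomogeneous fockWeight (e - m) := by
    intro m e u hu
    rw [hP, annExponent, PowerSeries.coeff_mk]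
    clear hP P
    cases m with
    | zero => simpa using MvPolynomial.isWeightedHomogeneous_zero ℂ fockWeight _
    | succ m =>
      rw [if_neg (Nat.succ_ne_zero m)]
      induction W with
      | nil => simpa using MvPolynomial.isWeightedHomogeneous_zero ℂ fockWeight _
      | cons a W ih =>
        rw [List.map_cons, List.sum_cons, LinearMap.add_apply]
        refine MvPolynomial.IsWeightedHomogeneous.add ?_ ih
        rw [LinearMap.sum_apply]
        refine Submodule.sum_mem (MvPolynomial.weightedHomogeneousSubmodule ℂ fockWeight _) ?_
        intro j _
        rw [LinearMap.smul_apply]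
        exact Submodule.smul_mem _ _ (osc_pos_homogeneous C r ℓ μ j m hu)
  have h2 : ∀ (k m : ℕ) (e : ℤ) (u : Fock), u.IsWeightedHomogeneous fockWeight e →
      ((PowerSeries.coeff m (P ^ k)) u).IsWeightedHomogeneous fockWeight (e - m) := by
    intro k
    induction k with
    | zero =>
      intro m e u hu
      rw [pow_zero, PowerSeries.coeff_one]
      split_ifs with hm
      · subst hm; simpa using hu
      · simpa using MvPolynomial.isWeightedHomogeneous_zero ℂ fockWeight _
    | succ k ih =>
      intro m e u hu
      rw [pow_succ, PowerSeries.coeff_mul, LinearMap.sum_apply]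
      refine Submodule.sum_mem (MvPolynomial.weightedHomogeneousSubmodule ℂ fockWeight _) ?_
      intro p hp
      rw [Finset.HasAntidiagonal.mem_antidiagonal] at hp
      rw [Module.End.mul_apply, MvPolynomial.mem_weightedHomogeneousSubmodule]
      have := ih p.1 _ _ (h1 p.2 e u hu)
      have he : e - (p.2 : ℤ) - (p.1 : ℤ) = e - m := by rw [← hp]; push_cast; ring
      rwa [he] at this
  rw [PowerSeries.coeff_mk, LinearMap.sum_apply]
  refine Submodule.sum_mem (MvPolynomial.weightedHomogeneousSubmodule ℂ fockWeight _) ?_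
  intro k _
  rw [LinearMap.smul_apply]
  exact Submodule.smul_mem _ _ (h2 k n d v hv)

lemma annPart_eventually_zero (C : RealizationCase) (r : ℝ) (ℓ : ℂ) (μ : Fin 2 → ℂ)
    (W : List (Fin 3 × ℂ)) (v : Fock) :
    ∃ N : ℕ, ∀ n ≥ N, (PowerSeries.coeff n (annPart C r ℓ μ W)) v = 0 := by
  induction v using MvPolynomial.induction_on' with
  | monomial e a =>
    obtain ⟨N, hN⟩ : ∃ N : ℕ, Finsupp.weight fockWeight e < N :=
      ⟨(Finsupp.weight fockWeight e).toNat + 1, by omega⟩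
    refine ⟨N, fun n hn => ?_⟩
    refine fock_homogeneous_neg (annPart_homogeneous C r ℓ μ W n
      (MvPolynomial.isWeightedHomogeneous_monomial fockWeight e a rfl)) ?_
    omega
  | add p q hp hq =>
    obtain ⟨N, hN⟩ := hp
    obtain ⟨M, hM⟩ := hq
    refine ⟨max N M, fun n hn => ?_⟩
    rw [map_add, hN n (le_trans (le_max_left _ _) hn), hM n (le_trans (le_max_right _ _) hn),
      add_zero]

/-- The terms of the coefficient of `z ^ (-n)` of a normally ordered product, applied to `v`:
creation operators stand to the left of annihilation operators. -/
def nopTerm (C : RealizationCase) (r : ℝ) (ℓ : ℂ) (μ : Fin 2 → ℂ) (W : List (Fin 3 × ℂ)) (n : ℤ)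
    (v : Fock) (p : ℕ × ℕ) : Fock :=
  if (p.2 : ℤ) - p.1 = n then
    zeroPart C r ℓ μ W •
      (PowerSeries.coeff p.1 (crePart C r ℓ μ W)) ((PowerSeries.coeff p.2 (annPart C r ℓ μ W)) v)
  else 0

lemma nopTerm_support_finite (C : RealizationCase) (r : ℝ) (ℓ : ℂ) (μ : Fin 2 → ℂ)
    (W : List (Fin 3 × ℂ)) (n : ℤ) (v : Fock) :
    (Function.support (nopTerm C r ℓ μ W n v)).Finite := by
  obtain ⟨N, hN⟩ := annPart_eventually_zero C r ℓ μ W v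
  refine ((Finset.range (N + n.natAbs + 1) ×ˢ Finset.range (N + 1)).finite_toSet).subset ?_
  intro p hp
  rw [Function.mem_support, nopTerm] at hp
  split_ifs at hp with h
  · have h2 : p.2 < N := by
      by_contra hc
      exact hp (by rw [hN p.2 (by omega)]; simp)
    simp only [Finset.coe_product, Finset.coe_range, Set.mem_prod, Set.mem_Iio]
    omega
  · exact absurd rfl hp

/-- The normally ordered product `:Λ_{k₁}(c₁ z) ⋯ Λ_{k_s}(c_s z): = ∑ nop n * z ^ (-n)` as a
formal series of operators on the Fock space. -/
def nop (C : RealizationCase) (r : ℝ) (ℓ : ℂ) (μ : Fin 2 → ℂ) (W : List (Fin 3 × ℂ)) (n : ℤ) :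
    Module.End ℂ Fock where
  toFun v := ∑ᶠ p : ℕ × ℕ, nopTerm C r ℓ μ W n v p
  map_add' u v := by
    rw [← finsum_add_distrib (nopTerm_support_finite C r ℓ μ W n u)
      (nopTerm_support_finite C r ℓ μ W n v)]
    refine finsum_congr fun p => ?_
    unfold nopTerm
    split_ifs <;> simp
  map_smul' a v := by
    rw [RingHom.id_apply, smul_finsum]
    refine finsum_congr fun p => ?_
    unfold nopTerm
    split_ifs
    · rw [map_smul, map_smul, smul_comm]
    · simp

lemma nop_truncated (C : RealizationCase) (r : ℝ) (ℓ : ℂ) (μ : Fin 2 → ℂ)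
    (W : List (Fin 3 × ℂ)) (v : Fock) : ∃ N : ℤ, ∀ n ≥ N, nop C r ℓ μ W n v = 0 := by
  obtain ⟨N, hN⟩ := annPart_eventually_zero C r ℓ μ W v
  refine ⟨N, fun n hn => ?_⟩
  refine finsum_eq_zero_of_forall_eq_zero fun p => ?_
  unfold nopTerm
  split_ifs with h
  · rw [hN p.2 (by omega)]; simp
  · rfl

/-! ### The W-currents -/

/-- The coefficients `d_j(r, x) = ∏_{l=1}^{j} [r - l]_x / [l]_x`. -/
def dcoef (r : ℝ) (ℓ : ℂ) (j : ℕ) : ℂ :=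
  ∏ l ∈ Finset.Icc 1 j, qnum ℓ (r - l) / qnum ℓ l

/-- The arguments of the factors of a word `k_0 ⋯ k_{i-1}`: it is turned into the data of
`:Λ_{k_0}(x^{-i+1} z) Λ_{k_1}(x^{-i+3} z) ⋯ Λ_{k_{i-1}}(x^{i-1} z):`. -/
def spread (x : ℂ) (w : List (Fin 3)) : List (Fin 3 × ℂ) :=
  w.zipIdx.map fun kp => (kp.1, x ^ (2 * (kp.2 : ℤ) - w.length + 1))

/-- The words, with their coefficients, whose normally ordered products add up to `T_i(z)`. In a
word the indices are weakly increasing, and only the index with nontrivial coefficient `g`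
(`3` in Case 2, and `2` in Case 3) may be repeated. -/
def currentTerms (C : RealizationCase) (r : ℝ) (ℓ : ℂ) : ℕ → List (ℂ × List (Fin 3))
  | 0 => [(1, [])]
  | 1 =>
      match C with
      | .two => [(1, [0]), (1, [1]), (dcoef r ℓ 1, [2])]
      | .three => [(1, [0]), (dcoef r ℓ 1, [1]), (1, [2])]
  | i + 2 =>
      match C with
      | .two =>
          [(dcoef r ℓ i, [0, 1] ++ List.replicate i 2),
           (dcoef r ℓ (i + 1), [0] ++ List.replicate (i + 1) 2),
           (dcoef r ℓ (i + 1), [1] ++ List.replicate (i + 1) 2),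
           (dcoef r ℓ (i + 2), List.replicate (i + 2) 2)]
      | .three =>
          [(dcoef r ℓ i, [0] ++ List.replicate i 1 ++ [2]),
           (dcoef r ℓ (i + 1), [0] ++ List.replicate (i + 1) 1),
           (dcoef r ℓ (i + 1), List.replicate (i + 1) 1 ++ [2]),
           (dcoef r ℓ (i + 2), List.replicate (i + 2) 1)]

/-- The mode `T_i[n]` of the W-current `T_i(z) = ∑ T_i[n] z ^ (-n)` on the Fock space over `|μ⟩`,
with `T_0(z) = 1`. -/
def T (C : RealizationCase) (r : ℝ) (ℓ : ℂ) (μ : Fin 2 → ℂ) (i : ℕ) (n : ℤ) :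
    Module.End ℂ Fock :=
  if i = 0 then (if n = 0 then LinearMap.id else 0)
  else ((currentTerms C r ℓ i).map fun t =>
    t.1 • nop C r ℓ μ (spread (xpow ℓ 1) t.2) n).sum

lemma T_truncated (C : RealizationCase) (r : ℝ) (ℓ : ℂ) (μ : Fin 2 → ℂ) (i : ℕ) (v : Fock) :
    ∃ N : ℤ, ∀ n ≥ N, T C r ℓ μ i n v = 0 := by
  unfold T
  split_ifs with hi
  · refine ⟨1, fun n hn => ?_⟩
    rw [if_neg (by omega), LinearMap.zero_apply]
  · induction currentTerms C r ℓ i with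
    | nil => exact ⟨0, fun n _ => by simp⟩
    | cons t L ih =>
      obtain ⟨N, hN⟩ := ih
      obtain ⟨M, hM⟩ := nop_truncated C r ℓ μ (spread (xpow ℓ 1) t.2) v
      refine ⟨max N M, fun n hn => ?_⟩
      rw [List.map_cons, List.sum_cons, LinearMap.add_apply, LinearMap.smul_apply,
        hN n (le_trans (le_max_left _ _) hn), hM n (le_trans (le_max_right _ _) hn)]
      simp

/-! ### Structure functions -/

/-- `Δ_i(z)`. -/
def Delta (r : ℝ) (ℓ : ℂ) (i : ℕ) (z : ℂ) : ℂ :=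
  ((1 - xpow ℓ (2 * r - i) * z) * (1 - xpow ℓ (-(2 * r) + i) * z)) /
    ((1 - xpow ℓ i * z) * (1 - xpow ℓ (-i) * z))

/-- The structure function `f_{i,j}(z)`, as a power series in `z`. -/
def fser (r : ℝ) (ℓ : ℂ) (i j : ℕ) : PowerSeries ℂ :=
  expSeries (PowerSeries.mk fun m : ℕ => if m = 0 then 0 else
    -(1 / (m : ℂ) *
      (qnum ℓ ((r - 1) * m) * qnum ℓ (r * m) * qnum ℓ ((min i j : ℕ) * m) *
        qnum ℓ ((r + 1 - (max i j : ℕ)) * m) / (qnum ℓ m * qnum ℓ ((r + 1) * m))) *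
      xdiff ℓ ^ 2))

/-- `c(r, x) = [r]_x [r - 1]_x (x - x⁻¹)`. -/
def cconst (r : ℝ) (ℓ : ℂ) : ℂ := qnum ℓ r * qnum ℓ (r - 1) * xdiff ℓ

/-! ### Formal series of operators -/

/-- The coefficient of `z ^ (-m) * w ^ (-n)` in `f(w / z) a(z) b(w) v`, where
`a(z) = ∑ a m * z ^ (-m)` and `b(w) = ∑ b n * w ^ (-n)`. The sum is finite as soon as `b n u = 0`
for all large `n`, for each `u`. -/
def prodCoeff (f : PowerSeries ℂ) (a b : ℤ → Module.End ℂ Fock) (m n : ℤ) (v : Fock) : Fock :=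
  ∑ᶠ l : ℕ, PowerSeries.coeff l f • a (m - l) (b (n + l) v)

lemma prodCoeff_T_support_finite (C : RealizationCase) (r : ℝ) (ℓ : ℂ) (μ : Fin 2 → ℂ) (i j : ℕ)
    (f : PowerSeries ℂ) (m n : ℤ) (v : Fock) :
    (Function.support fun l : ℕ =>
      PowerSeries.coeff l f • T C r ℓ μ i (m - l) (T C r ℓ μ j (n + l) v)).Finite := by
  obtain ⟨N, hN⟩ := T_truncated C r ℓ μ j v
  refine ((Finset.range (N - n).toNat).finite_toSet).subset ?_
  intro l hl
  rw [Function.mem_support] at hl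
  simp only [Finset.coe_range, Set.mem_Iio]
  by_contra hc
  exact hl (by rw [hN (n + l) (by omega)]; simp)

/-- The formal Laurent series `∑ c p * ζ ^ p` with coefficients in the Fock space is the expansion
at `ζ = 0` of a rational function `Q(ζ) / P(ζ)` (`P` a polynomial, `Q` a Laurent polynomial with
coefficients in the Fock space) which is regular at the point `ζ₀` and has the value `g` there. -/
def HasValueAt (c : ℤ → Fock) (ζ₀ : ℂ) (g : Fock) : Prop :=
  (∃ N : ℤ, ∀ p < N, c p = 0) ∧
  ∃ (P : Polynomial ℂ) (Q : ℤ →₀ Fock), P.eval ζ₀ ≠ 0 ∧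
    (∀ p : ℤ, ∑ k ∈ Finset.range (P.natDegree + 1), P.coeff k • c (p - k) = Q p) ∧
    Q.sum (fun p u => ζ₀ ^ p • u) = P.eval ζ₀ • g

lemma laurent_mul_value (P : Polynomial ℂ) (Q : ℤ →₀ Fock) {ζ₀ : ℂ} (hζ : ζ₀ ≠ 0) :
    ∑ᶠ p : ℤ, ζ₀ ^ p • ∑ k ∈ Finset.range (P.natDegree + 1), P.coeff k • Q (p - k) =
      P.eval ζ₀ • Q.sum (fun p u => ζ₀ ^ p • u) := by
  have hfin : ∀ k : ℕ, (Function.support fun p : ℤ => ζ₀ ^ p • P.coeff k • Q (p - k)).Finite := by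
    intro k
    refine ((Q.hasFiniteSupport).image fun p => p + (k : ℤ)).subset ?_
    intro p hp
    refine ⟨p - k, ?_, by simp⟩
    rw [Function.mem_support] at hp ⊢
    intro h0
    exact hp (by rw [h0, smul_zero, smul_zero])
  have hQ : Q.sum (fun p u => ζ₀ ^ p • u) = ∑ᶠ p : ℤ, ζ₀ ^ p • Q p := by
    rw [Finsupp.sum, finsum_eq_sum_of_support_subset]
    intro p hp
    rw [Function.mem_support] at hp
    rw [Finset.mem_coe, Finsupp.mem_support_iff]
    intro h0
    exact hp (by rw [h0, smul_zero])
  simp_rw [Finset.smul_sum]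
  rw [finsum_sum_comm _ _ fun k _ => hfin k, Polynomial.eval_eq_sum_range, Finset.sum_smul]
  refine Finset.sum_congr rfl fun k _ => ?_
  rw [hQ, smul_finsum,
    ← finsum_comp_equiv (Equiv.subRight (k : ℤ)) (f := fun p : ℤ =>
      (P.coeff k * ζ₀ ^ k) • ζ₀ ^ p • Q p)]
  refine finsum_congr fun p => ?_
  simp only [Equiv.subRight_apply]
  rw [smul_smul, smul_smul, zpow_sub₀ hζ, zpow_natCast]
  congr 1
  field_simp

/-- The value is unique. -/
lemma HasValueAt.unique {c : ℤ → Fock} {ζ₀ : ℂ} {g g' : Fock} (hζ : ζ₀ ≠ 0)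
    (h : HasValueAt c ζ₀ g) (h' : HasValueAt c ζ₀ g') : g = g' := by
  obtain ⟨-, P, Q, hP, hQ, hg⟩ := h
  obtain ⟨-, P', Q', hP', hQ', hg'⟩ := h'
  have h1 := laurent_mul_value P' Q hζ
  have h2 := laurent_mul_value P Q' hζ
  have h3 : ∀ p : ℤ, ∑ k ∈ Finset.range (P'.natDegree + 1), P'.coeff k • Q (p - k) =
      ∑ k ∈ Finset.range (P.natDegree + 1), P.coeff k • Q' (p - k) := by
    intro p
    simp_rw [← hQ, ← hQ', Finset.smul_sum]
    rw [Finset.sum_comm]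
    refine Finset.sum_congr rfl fun k _ => Finset.sum_congr rfl fun l _ => ?_
    rw [smul_comm, sub_right_comm]
  simp_rw [h3] at h1
  rw [h2, hg, hg', smul_comm] at h1
  exact ((smul_right_injective Fock hP) ((smul_right_injective Fock hP') h1)).symm

/-- The value at `ζ₀`, by analytic continuation, of a Laurent series that represents a rational
function regular at `ζ₀`. -/
def valueAt (c : ℤ → Fock) (ζ₀ : ℂ) : Fock :=
  open Classical in if h : ∃ g, HasValueAt c ζ₀ g then h.choose else 0

/-- The coefficient of `z ^ (-N)` in `f(ζ) a(z) b(ζ z) v`, as a Laurent series in `ζ`: the `p`-th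
entry is the coefficient of `ζ ^ p`. -/
def diagSeries (f : PowerSeries ℂ) (a b : ℤ → Module.End ℂ Fock) (N : ℤ) (v : Fock) (p : ℤ) :
    Fock :=
  prodCoeff f a b (N + p) (-p) v

/-- The analytic continuation of `f(w / z) a(z) b(w)`, which is an operator-valued rational
function of `ζ = w / z`, is regular at `ζ = ζ₀`. -/
def RegularAt (f : PowerSeries ℂ) (a b : ℤ → Module.End ℂ Fock) (ζ₀ : ℂ) : Prop :=
  ∀ (N : ℤ) (v : Fock), ∃ g, HasValueAt (diagSeries f a b N v) ζ₀ g

/-- The coefficients of the series `f(ζ₀) a(z) b(ζ₀ z) = ∑ fused N * z ^ (-N)`, the product being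
defined by analytic continuation in `ζ = w / z` of `f(w / z) a(z) b(w)`. -/
def fused (f : PowerSeries ℂ) (a b : ℤ → Module.End ℂ Fock) (ζ₀ : ℂ) (N : ℤ) (v : Fock) : Fock :=
  valueAt (diagSeries f a b N v) ζ₀

/-- The coefficients of `G(c z)`, where `G(z) = ∑ G N * z ^ (-N)`. -/
def dilate (c : ℂ) (G : ℤ → Fock → Fock) (N : ℤ) (v : Fock) : Fock := c ^ (-N) • G N v

/-- The coefficient of `z₁ ^ (-m) * z₂ ^ (-n)` in `δ(c z₂ / z₁) G(z₁)`, where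
`δ(z) = ∑_{k ∈ ℤ} z ^ k` and `G(z) = ∑ G N * z ^ (-N)`. -/
def deltaTerm (c : ℂ) (G : ℤ → Fock → Fock) (m n : ℤ) (v : Fock) : Fock :=
  c ^ (-n) • G (m + n) v

end DeformedW

end

/-! Everything is read as a statement about operator-valued functions of ζ = z₂/z₁. By Wick's
theorem (`nop_nop`) the product of two normally ordered words is a jointly normally ordered product
times the exponential of their contractions. By `contr_eq` the contraction of two letters is a part
common to all pairs of letters plus a short character that depends only on the order of the letters
and on whether a repeated letter is the special one (the letter that words of the currents may
repeat). The series f_{i,j} is made to cancel what does not depend on the letters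
(`fexp_add_eq_zero`). Hence f_{i,j}T_iT_j and f_{j,i}T_jT_i are the expansions at ζ = 0 and at ζ = ∞
of one rational function (`isExpansion_T`). Once this function is known to have only simple poles,
the difference of the expansions is a sum of delta functions weighted by residues (`sub_eq_sum`). It
remains to find the poles and the residues.

The separate terms have more poles than their sum. To see the cancellation, write the contraction of
Λ_k(y) and Λ_l(y'), up to the common part, as a cubic numerator over (y - y')(y - x²y')(y - x⁻²y'),
a denominator independent of the letters. The numerator changes sign when the two letters are
exchanged together with their points (`numer_swap`). So the sum over all ways to put letters on n
points (`wordSum`) is an antisymmetric Laurent polynomial, that is, the Vandermonde product times a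
symmetric Laurent polynomial G (`exists_isSymm`, `IsSymm.perm`). On a string of points y, x²y, x⁴y,
… the numerators kill every word that does not occur in the current, and the surviving words appear
with the coefficients d_j (`wordSum_pts`). In this way the currents are values of symmetric
functions, and G at the union of two strings is, up to explicit factors, the product of two currents
with the poles in `poleList` removed (`exists_factor`). Only the poles ζ = x^{±(j-i+2k)}, 1 ≤ k ≤ i,
can therefore remain, and they are at most simple (`exists_continuation`).

At such a pole the union of the strings of lengths i and j is also the union of strings of lengths
i-k and j+k (`pts_perm_pos`, `pts_perm_neg`). Since G does not see how its points are grouped, the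
residue is a scalar times the regular value of the product of T_{i-k} and T_{j+k}
(`relation_of_perm`). The scalar does not depend on the operators. It is computed by replacing the
operators with the indicator of the words made of special letters only (`specialFamily`), for which
each product of currents has a single term, and `mfun_pos` brings it to the form c ∏ Δ₁. The poles
on the other side follow from the substitution x ↦ x⁻¹, τ ↦ τ⁻¹, which changes the sign of c.

The factors used in the comparison may vanish when x^{2r} is an integral power of x. For this reason
τ = x^r is treated as an independent variable. The identities are proved for τ² outside the integral
powers of x, and they extend to every nonzero τ because both sides are Laurent polynomials in τ. -/

noncomputable section

namespace DeformedW

/-! ### Exponentials of formal power series -/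

section ExpSeries

open Finset.HasAntidiagonal

variable {R : Type*} [Ring R] [Algebra ℂ R]

/-- The Euler derivative `z d/dz` of a power series. -/
def eulerD (P : PowerSeries R) : PowerSeries R :=
  PowerSeries.mk fun n => (n : ℂ) • PowerSeries.coeff n P

lemma eulerD_mul (P Q : PowerSeries R) : eulerD (P * Q) = eulerD P * Q + P * eulerD Q := by
  ext n
  simp only [eulerD, PowerSeries.coeff_mk, PowerSeries.coeff_mul, map_add, Finset.smul_sum,
    ← Finset.sum_add_distrib]
  refine Finset.sum_congr rfl fun p hp => ?_
  rw [mem_antidiagonal] at hp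
  rw [← hp]
  push_cast
  rw [add_smul, smul_mul_assoc, mul_smul_comm]

lemma eulerD_one : eulerD (1 : PowerSeries R) = 0 := by
  ext n
  rw [eulerD, PowerSeries.coeff_mk, PowerSeries.coeff_one]
  split_ifs with h <;> simp [h]

/-- The coefficients are operators, so the power rule needs `P` to commute with its own derivative.
This holds for the exponents below, whose coefficients commute with each other. -/
lemma eulerD_pow {P : PowerSeries R} (h : Commute P (eulerD P)) (k : ℕ) :
    eulerD (P ^ (k + 1)) = ((k : ℂ) + 1) • (eulerD P * P ^ k) := by
  induction k with
  | zero => simp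
  | succ k ih =>
    rw [pow_succ, eulerD_mul, ih, smul_mul_assoc, mul_assoc, ← pow_succ,
      (h.pow_left (k + 1)).eq]
    push_cast
    rw [add_smul ((k : ℂ) + 1) 1, one_smul]

lemma coeff_pow_eq_zero {P : PowerSeries R} (h0 : PowerSeries.coeff 0 P = 0) {n k : ℕ}
    (h : n < k) : PowerSeries.coeff n (P ^ k) = 0 := by
  induction k generalizing n with
  | zero => omega
  | succ k ih =>
    rw [pow_succ, PowerSeries.coeff_mul]
    refine Finset.sum_eq_zero fun p hp => ?_
    rw [mem_antidiagonal] at hp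
    rcases Nat.eq_zero_or_pos p.2 with h2 | h2
    · rw [h2, h0, mul_zero]
    · rw [ih (by omega), zero_mul]

/-- Powers of `P` above the degree contribute nothing, so every sufficiently long truncation gives
the same coefficient. -/
lemma coeff_expSeries {P : PowerSeries R} (h0 : PowerSeries.coeff 0 P = 0) {n K : ℕ} (h : n < K) :
    PowerSeries.coeff n (expSeries P) =
      ∑ k ∈ Finset.range K, ((k.factorial : ℂ)⁻¹) • PowerSeries.coeff n (P ^ k) := by
  rw [expSeries, PowerSeries.coeff_mk]
  refine Finset.sum_subset (Finset.range_mono (by omega)) fun k _ hk => ?_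
  rw [Finset.mem_range] at hk
  rw [coeff_pow_eq_zero h0 (by omega), smul_zero]

lemma coeff_zero_expSeries (P : PowerSeries R) : PowerSeries.coeff 0 (expSeries P) = 1 := by
  simp [expSeries]

/-- The differential equation `E' = P' E` of the exponential. -/
lemma eulerD_expSeries {P : PowerSeries R} (h0 : PowerSeries.coeff 0 P = 0)
    (h : Commute P (eulerD P)) : eulerD (expSeries P) = eulerD P * expSeries P := by
  ext n
  -- The range is `n + 2` because differentiation lowers the power of `P` by one: after the constant
  -- term drops out, `n + 1` terms are left to match the other side.
  have h1 : PowerSeries.coeff n (eulerD (expSeries P)) =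
      ∑ k ∈ Finset.range (n + 2), ((k.factorial : ℂ)⁻¹) • PowerSeries.coeff n (eulerD (P ^ k)) := by
    rw [eulerD, PowerSeries.coeff_mk, coeff_expSeries h0 (show n < n + 2 by omega),
      Finset.smul_sum]
    refine Finset.sum_congr rfl fun k _ => ?_
    rw [eulerD, PowerSeries.coeff_mk, smul_comm]
  have h2 : PowerSeries.coeff n (eulerD P * expSeries P) =
      ∑ k ∈ Finset.range (n + 1), ((k.factorial : ℂ)⁻¹) •
        PowerSeries.coeff n (eulerD P * P ^ k) := by
    simp only [PowerSeries.coeff_mul, Finset.smul_sum]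
    rw [Finset.sum_comm]
    refine Finset.sum_congr rfl fun p hp => ?_
    rw [mem_antidiagonal] at hp
    rw [coeff_expSeries h0 (show p.2 < n + 1 by omega), Finset.mul_sum]
    exact Finset.sum_congr rfl fun k _ => by rw [mul_smul_comm]
  rw [h1, h2, Finset.sum_range_succ', pow_zero, eulerD_one, map_zero, smul_zero, add_zero]
  refine Finset.sum_congr rfl fun k _ => ?_
  rw [eulerD_pow h, PowerSeries.coeff_smul, smul_smul, Nat.factorial_succ]
  congr 1
  push_cast
  have : (k : ℂ) + 1 ≠ 0 := by exact_mod_cast Nat.succ_ne_zero k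
  have : (k.factorial : ℂ) ≠ 0 := by exact_mod_cast Nat.factorial_ne_zero k
  field_simp

lemma coeff_mul_swap (P Q : PowerSeries R) (n : ℕ) : PowerSeries.coeff n (P * Q) =
    ∑ p ∈ antidiagonal n, PowerSeries.coeff p.2 P * PowerSeries.coeff p.1 Q := by
  rw [PowerSeries.coeff_mul, ← Finset.Nat.sum_antidiagonal_swap]
  rfl

lemma commute_mk {a b : ℕ → R} (h : ∀ m n, Commute (a m) (b n)) :
    Commute (PowerSeries.mk a) (PowerSeries.mk b) := by
  ext n
  rw [coeff_mul_swap, PowerSeries.coeff_mul]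
  refine Finset.sum_congr rfl fun p _ => ?_
  simpa using (h p.2 p.1).eq

/-- The coefficients of the exponential of `∑ a m * z ^ m`, `m ≥ 1`. -/
def expC (a : ℕ → R) (n : ℕ) : R :=
  PowerSeries.coeff n (expSeries (PowerSeries.mk fun m => if m = 0 then 0 else a m))

lemma expC_zero (a : ℕ → R) : expC a 0 = 1 := coeff_zero_expSeries _

/-- The recursion for the coefficients of an exponential. -/
lemma expC_rec {a : ℕ → R} (h : ∀ m n, Commute (a m) (a n)) (n : ℕ) :
    (n : ℂ) • expC a n =
      ∑ p ∈ antidiagonal n, (p.1 : ℂ) • (a p.1 * expC a p.2) := by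
  have hP : Commute (PowerSeries.mk fun m => if m = 0 then 0 else a m)
      (eulerD (PowerSeries.mk fun m => if m = 0 then 0 else a m)) := by
    refine commute_mk fun m n => ?_
    rw [PowerSeries.coeff_mk]
    refine Commute.smul_right ?_ _
    split_ifs <;> simp [h]
  have := congrArg (PowerSeries.coeff n) (eulerD_expSeries (by simp) hP)
  rw [PowerSeries.coeff_mul] at this
  simp only [eulerD, PowerSeries.coeff_mk] at this
  rw [expC, this]
  refine Finset.sum_congr rfl fun p _ => ?_
  split_ifs with h1
  · simp [h1]
  · rw [smul_mul_assoc]; rfl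

/-- For positive `n` the scalar `n` is invertible and the term containing `e n` on the right has
coefficient zero, so the recursion determines `e`. Identities between exponentials are reduced to
this recursion. -/
lemma expC_unique {a e : ℕ → R} (h : ∀ m n, Commute (a m) (a n)) (h0 : e 0 = 1)
    (he : ∀ n : ℕ, (n : ℂ) • e n = ∑ p ∈ antidiagonal n, (p.1 : ℂ) • (a p.1 * e p.2)) :
    e = expC a := by
  funext n
  induction n using Nat.strong_induction_on with
  | _ n ih =>
    rcases Nat.eq_zero_or_pos n with rfl | hn
    · rw [h0, expC_zero]
    · have h1 : (n : ℂ) • e n = (n : ℂ) • expC a n := by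
        rw [he, expC_rec h]
        refine Finset.sum_congr rfl fun p hp => ?_
        rw [mem_antidiagonal] at hp
        rcases Nat.eq_zero_or_pos p.1 with h2 | h2
        · simp [h2]
        · rw [ih p.2 (by omega)]
      have hn' : (n : ℂ) ≠ 0 := by exact_mod_cast hn.ne'
      exact smul_right_injective R hn' h1

lemma expC_commute {a : ℕ → R} {u : R} (h : ∀ m n, Commute (a m) (a n))
    (hu : ∀ m, Commute u (a m)) (n : ℕ) : Commute u (expC a n) := by
  induction n using Nat.strong_induction_on with
  | _ n ih =>
    rcases Nat.eq_zero_or_pos n with rfl | hn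
    · rw [expC_zero]; exact Commute.one_right u
    · have hn' : (n : ℂ) ≠ 0 := by exact_mod_cast hn.ne'
      have h1 : expC a n = (n : ℂ)⁻¹ • ((n : ℂ) • expC a n) := by
        rw [smul_smul, inv_mul_cancel₀ hn', one_smul]
      rw [h1, expC_rec h]
      refine Commute.smul_right (Commute.sum_right _ _ _ fun p hp => ?_) _
      rw [mem_antidiagonal] at hp
      rcases Nat.eq_zero_or_pos p.1 with h2 | h2
      · simp [h2]
      · exact Commute.smul_right ((hu p.1).mul_right (ih p.2 (by omega))) _

lemma expC_add {a b : ℕ → R} (ha : ∀ m n, Commute (a m) (a n)) (hb : ∀ m n, Commute (b m) (b n))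
    (hab : ∀ m n, Commute (a m) (b n)) (n : ℕ) :
    expC (fun m => a m + b m) n = ∑ p ∈ antidiagonal n, expC a p.1 * expC b p.2 := by
  have hc : ∀ m n, Commute (a m + b m) (a n + b n) := fun m n =>
    ((ha m n).add_left (hab n m).symm).add_right ((hab m n).add_left (hb m n))
  refine (congrFun (expC_unique hc (e := fun n => ∑ p ∈ antidiagonal n,
    expC a p.1 * expC b p.2) (by simp [expC_zero]) ?_) n).symm
  intro k
  -- The product of the two exponentials satisfies the differential equation of the exponential of
  -- the sum. The commutation of the two families is needed to move the derivative of the second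
  -- exponent past the first exponential.
  have key : eulerD (PowerSeries.mk (expC a) * PowerSeries.mk (expC b)) =
      (PowerSeries.mk fun m => (m : ℂ) • (a m + b m)) *
        (PowerSeries.mk (expC a) * PowerSeries.mk (expC b)) := by
    have h1 : eulerD (PowerSeries.mk (expC a)) =
        (PowerSeries.mk fun m => (m : ℂ) • a m) * PowerSeries.mk (expC a) := by
      ext n
      rw [PowerSeries.coeff_mul, eulerD, PowerSeries.coeff_mk, PowerSeries.coeff_mk, expC_rec ha]
      simp
    have h2 : eulerD (PowerSeries.mk (expC b)) =
        (PowerSeries.mk fun m => (m : ℂ) • b m) * PowerSeries.mk (expC b) := by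
      ext n
      rw [PowerSeries.coeff_mul, eulerD, PowerSeries.coeff_mk, PowerSeries.coeff_mk, expC_rec hb]
      simp
    have h3 : Commute (PowerSeries.mk (expC a)) (PowerSeries.mk fun m => (m : ℂ) • b m) :=
      commute_mk fun m n =>
        (expC_commute ha (fun k => ((hab k n).symm.smul_left _)) m).symm
    have h4 : (PowerSeries.mk fun m => (m : ℂ) • (a m + b m)) =
        (PowerSeries.mk fun m => (m : ℂ) • a m) + PowerSeries.mk fun m => (m : ℂ) • b m := by
      ext n; simp [smul_add]
    rw [eulerD_mul, h1, h2, h4, add_mul, mul_assoc,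
      ← mul_assoc (PowerSeries.mk (expC a)) (PowerSeries.mk _), h3.eq, mul_assoc]
  have := congrArg (PowerSeries.coeff k) key
  rw [PowerSeries.coeff_mul] at this
  simp only [eulerD, PowerSeries.coeff_mk, PowerSeries.coeff_mul] at this
  rw [this]
  refine Finset.sum_congr rfl fun p _ => ?_
  rw [smul_mul_assoc]

lemma expC_scale {a : ℕ → R} (h : ∀ m n, Commute (a m) (a n)) (c : ℂ) (n : ℕ) :
    expC (fun m => c ^ m • a m) n = c ^ n • expC a n := by
  have hc : ∀ m n, Commute (c ^ m • a m) (c ^ n • a n) := fun m n =>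
    ((h m n).smul_left _).smul_right _
  refine (congrFun (expC_unique hc (e := fun n => c ^ n • expC a n) (by simp [expC_zero]) ?_)
    n).symm
  intro n
  rw [smul_comm, expC_rec h, Finset.smul_sum]
  refine Finset.sum_congr rfl fun p hp => ?_
  rw [mem_antidiagonal] at hp
  rw [← hp, pow_add, smul_mul_smul_comm, smul_comm]

lemma expC_zero_fun (n : ℕ) : expC (fun _ => (0 : R)) n = if n = 0 then 1 else 0 := by
  refine (congrFun (expC_unique (a := fun _ => (0 : R)) (by simp)
    (e := fun n => if n = 0 then 1 else 0) (by simp) ?_) n).symm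
  intro n
  split_ifs with h <;> simp [h]

/-- Moving one annihilation operator through an exponential of creation operators. -/
lemma expC_commutator {b : ℕ → R} {u : R} {m : ℕ} {κ : ℂ} (hm : 0 < m)
    (hb : ∀ m n, Commute (b m) (b n))
    (hu : ∀ n, u * b n - b n * u = if n = m then algebraMap ℂ R κ else 0) (n : ℕ) :
    u * expC b n = expC b n * u + if m ≤ n then κ • expC b (n - m) else 0 := by
  induction n using Nat.strong_induction_on with
  | _ n ih =>
    rcases Nat.eq_zero_or_pos n with rfl | hn
    · rw [expC_zero, if_neg (by omega)]; simp
    have hn' : (n : ℂ) ≠ 0 := by exact_mod_cast hn.ne'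
    suffices hs : (n : ℂ) • (u * expC b n) =
        (n : ℂ) • (expC b n * u + if m ≤ n then κ • expC b (n - m) else 0) by
      exact smul_right_injective R hn' hs
    have h1 : ∀ p ∈ antidiagonal n, (p.1 : ℂ) • (u * (b p.1 * expC b p.2)) =
        (p.1 : ℂ) • (b p.1 * expC b p.2 * u) +
        ((if m ≤ p.2 then κ • ((p.1 : ℂ) • (b p.1 * expC b (p.2 - m))) else 0) +
        if p.1 = m then ((m : ℂ) * κ) • expC b p.2 else 0) := by
      intro p hp
      rw [mem_antidiagonal] at hp
      rcases Nat.eq_zero_or_pos p.1 with h2 | h2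
      · rw [h2, if_neg (by omega : ¬ 0 = m)]; simp
      · have e1 : u * b p.1 = b p.1 * u + if p.1 = m then algebraMap ℂ R κ else 0 := by
          rw [← hu]; abel
        rw [← mul_assoc, e1, add_mul, mul_assoc, ih p.2 (by omega), mul_add, smul_add, smul_add,
          mul_assoc, add_assoc]
        congr 2
        · split_ifs
          · rw [mul_smul_comm, smul_comm]
          · simp
        · split_ifs with h3
          · rw [h3, ← Algebra.smul_def, smul_smul]
          · simp
    rw [← mul_smul_comm, expC_rec hb, Finset.mul_sum]
    simp_rw [mul_smul_comm]
    rw [Finset.sum_congr rfl h1, Finset.sum_add_distrib, Finset.sum_add_distrib, smul_add]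
    congr 1
    · rw [← smul_mul_assoc, expC_rec hb, Finset.sum_mul]
      simp_rw [smul_mul_assoc]
    -- The two correction sums contribute `n - m` and `m` times the same term, which together give
    -- the factor `n` on the left.
    · by_cases hmn : m ≤ n
      · rw [if_pos hmn]
        have e2 : ∑ p ∈ antidiagonal n, (if p.1 = m then ((m : ℂ) * κ) • expC b p.2 else 0) =
            ((m : ℂ) * κ) • expC b (n - m) := by
          rw [Finset.sum_eq_single (m, n - m)]
          · simp
          · rintro ⟨p, q⟩ hp hne
            rw [mem_antidiagonal] at hp
            rw [if_neg]
            rintro rfl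
            exact hne (by ext <;> simp <;> omega)
          · intro h; exact absurd (by simp; omega) h
        have e3 : ∑ p ∈ antidiagonal n,
            (if m ≤ p.2 then κ • ((p.1 : ℂ) • (b p.1 * expC b (p.2 - m))) else 0) =
            κ • ((n - m : ℕ) : ℂ) • expC b (n - m) := by
          rw [expC_rec hb, Finset.smul_sum, ← Finset.sum_filter]
          refine Finset.sum_nbij' (fun p => (p.1, p.2 - m)) (fun p => (p.1, p.2 + m))
            ?_ ?_ ?_ ?_ ?_
          · simp; intros; omega
          · simp; intros; omega
          · rintro ⟨p, q⟩; simp; omega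
          · rintro ⟨p, q⟩; simp
          · simp
        rw [e2, e3, smul_smul, ← add_smul, smul_smul]
        congr 1
        push_cast [hmn]
        ring
      · rw [if_neg hmn, smul_zero, ← Finset.sum_add_distrib]
        refine Finset.sum_eq_zero fun p hp => ?_
        rw [mem_antidiagonal] at hp
        rw [if_neg (by omega), if_neg (by omega), add_zero]

/-- Wick's theorem for one pair of exponentials. -/
lemma expC_wick {a b : ℕ → R} {κ : ℕ → ℂ} (ha : ∀ m n, Commute (a m) (a n))
    (hb : ∀ m n, Commute (b m) (b n))
    (hab : ∀ m n, 0 < m → a m * b n - b n * a m = if n = m then algebraMap ℂ R (κ m) else 0)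
    (p n : ℕ) :
    expC a p * expC b n = ∑ q ∈ antidiagonal p,
      if q.1 ≤ n then expC κ q.1 • (expC b (n - q.1) * expC a q.2) else 0 := by
  -- Commuting `a m` with `Bx q` shifts `q` by `m`. Hence the generating series `G` satisfies G' =
  -- [a', G], and G·exp(a) solves the same differential equation as exp(a) times the fixed
  -- coefficient `expC b n`, with the same initial value.
  set Bx : ℕ → R := fun q => if q ≤ n then expC b (n - q) else 0 with hBx
  set G : PowerSeries R := PowerSeries.mk fun q => expC κ q • Bx q with hG
  have hκ : ∀ m n, Commute (κ m) (κ n) := fun m n => Commute.all _ _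
  have hA : eulerD (PowerSeries.mk (expC a)) =
      (PowerSeries.mk fun m => (m : ℂ) • a m) * PowerSeries.mk (expC a) := by
    ext n
    rw [PowerSeries.coeff_mul, eulerD, PowerSeries.coeff_mk, PowerSeries.coeff_mk, expC_rec ha]
    simp
  have hc : ∀ m q, 0 < m → a m * Bx q - Bx q * a m = κ m • Bx (m + q) := by
    intro m q hm
    simp only [hBx]
    by_cases hq : q ≤ n
    · rw [if_pos hq, expC_commutator hm hb (fun k => hab m k hm), add_sub_cancel_left]
      by_cases h2 : m + q ≤ n
      · rw [if_pos h2, if_pos (by omega)]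
        congr 2
        omega
      · rw [if_neg h2, if_neg (by omega), smul_zero]
    · rw [if_neg hq, if_neg (by omega)]; simp
  have hGe : eulerD G + G * (PowerSeries.mk fun m => (m : ℂ) • a m) =
      (PowerSeries.mk fun m => (m : ℂ) • a m) * G := by
    ext p
    rw [map_add, ← eq_sub_iff_add_eq, PowerSeries.coeff_mul, coeff_mul_swap,
      ← Finset.sum_sub_distrib]
    simp only [eulerD, hG, PowerSeries.coeff_mk]
    rw [← smul_assoc, expC_rec hκ, Finset.sum_smul]
    refine Finset.sum_congr rfl fun q hq => ?_
    rw [mem_antidiagonal] at hq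
    rcases Nat.eq_zero_or_pos q.1 with h1 | h1
    · simp [h1]
    · rw [smul_mul_smul_comm, smul_mul_smul_comm, mul_comm (expC κ q.2), ← smul_sub, hc _ _ h1, hq,
        smul_smul]
      congr 1
      simp only [smul_eq_mul]
      ring
  have key : eulerD (G * PowerSeries.mk (expC a)) =
      (PowerSeries.mk fun m => (m : ℂ) • a m) * (G * PowerSeries.mk (expC a)) := by
    rw [eulerD_mul, hA, ← mul_assoc, ← mul_assoc, ← add_mul, hGe]
  have hgoal : expC a p * expC b n = PowerSeries.coeff p (G * PowerSeries.mk (expC a)) := by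
    induction p using Nat.strong_induction_on with
    | _ p ih =>
      rcases Nat.eq_zero_or_pos p with rfl | hp
      · simp [PowerSeries.coeff_mul, hG, hBx, expC_zero]
      have hp' : (p : ℂ) ≠ 0 := by exact_mod_cast hp.ne'
      refine smul_right_injective R hp' ?_
      have h1 := congrArg (PowerSeries.coeff p) key
      rw [eulerD, PowerSeries.coeff_mk, PowerSeries.coeff_mul (n := p)
        (φ := PowerSeries.mk fun m => (m : ℂ) • a m)] at h1
      simp only
      rw [h1, ← smul_mul_assoc, expC_rec ha, Finset.sum_mul]
      refine Finset.sum_congr rfl fun q hq => ?_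
      rw [mem_antidiagonal] at hq
      rcases Nat.eq_zero_or_pos q.1 with h2 | h2
      · simp [h2]
      · rw [← ih q.2 (by omega), PowerSeries.coeff_mk, smul_mul_assoc, smul_mul_assoc, mul_assoc]
  rw [hgoal, PowerSeries.coeff_mul]
  refine Finset.sum_congr rfl fun q _ => ?_
  simp only [hG, PowerSeries.coeff_mk, hBx]
  split_ifs <;> simp

end ExpSeries

/-! ### Normally ordered products -/

section FreeField

open Finset.HasAntidiagonal

variable (C : RealizationCase) (r : ℝ) (ℓ : ℂ) (μ : Fin 2 → ℂ)

/-- The commutator of two derivations is a derivation, and this one vanishes on the variables. -/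
lemma pderiv_comm (a b : Fin 2 × ℕ+) (v : Fock) :
    MvPolynomial.pderiv a (MvPolynomial.pderiv b v) =
      MvPolynomial.pderiv b (MvPolynomial.pderiv a v) := by
  have h : ⁅(MvPolynomial.pderiv a : Derivation ℂ Fock Fock),
      (MvPolynomial.pderiv b : Derivation ℂ Fock Fock)⁆ = 0 := by
    refine MvPolynomial.derivation_ext fun i => ?_
    rw [Derivation.commutator_apply]
    simp only [MvPolynomial.pderiv_X, Derivation.zero_apply]
    rw [Pi.single_apply, Pi.single_apply]
    split_ifs <;> simp
  have := congrArg (fun D : Derivation ℂ Fock Fock => D v) h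
  simpa [Derivation.commutator_apply, sub_eq_zero] using this

lemma osc_zero (i : Fin 2) :
    osc C r ℓ μ i 0 = algebraMap ℂ (Module.End ℂ Fock) (∑ k, A C r ℓ i k 0 * μ k) := by
  refine LinearMap.ext fun v => ?_
  rfl

lemma osc_succ (i : Fin 2) (m : ℕ) : osc C r ℓ μ i ((m + 1 : ℕ) : ℤ) =
    ∑ j, (A C r ℓ i j (m + 1 : ℕ) / (m + 1 : ℕ)) •
      (MvPolynomial.pderiv (R := ℂ) (j, m.succPNat)).toLinearMap := rfl

lemma osc_neg_succ (i : Fin 2) (m : ℕ) : osc C r ℓ μ i (-((m + 1 : ℕ) : ℤ)) =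
    LinearMap.mulLeft ℂ (MvPolynomial.X (i, m.succPNat)) := rfl

lemma osc_comm_nonneg (i j : Fin 2) (m n : ℕ) :
    Commute (osc C r ℓ μ i m) (osc C r ℓ μ j n) := by
  rcases m with _ | m
  · rw [Nat.cast_zero, osc_zero]; exact Algebra.commutes _ _
  rcases n with _ | n
  · rw [Nat.cast_zero, osc_zero]; exact (Algebra.commutes _ _).symm
  rw [osc_succ, osc_succ]
  refine Commute.sum_left _ _ _ fun a _ => Commute.sum_right _ _ _ fun b _ => ?_
  refine Commute.smul_left (Commute.smul_right ?_ _) _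
  refine LinearMap.ext fun v => ?_
  exact pderiv_comm _ _ v

lemma osc_comm_nonpos (i j : Fin 2) (m n : ℕ) :
    Commute (osc C r ℓ μ i (-m)) (osc C r ℓ μ j (-n)) := by
  rcases m with _ | m
  · rw [Nat.cast_zero, neg_zero, osc_zero]; exact Algebra.commutes _ _
  rcases n with _ | n
  · rw [Nat.cast_zero, neg_zero, osc_zero]; exact (Algebra.commutes _ _).symm
  rw [osc_neg_succ, osc_neg_succ]
  refine LinearMap.ext fun v => ?_
  simp only [Module.End.mul_apply, LinearMap.mulLeft_apply]
  ring

/-- By the Leibniz rule, only the derivative of the variable by which `osc` multiplies survives. -/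
lemma osc_commutator (i j : Fin 2) (m n : ℕ) (hm : 0 < m) :
    osc C r ℓ μ i m * osc C r ℓ μ j (-n) - osc C r ℓ μ j (-n) * osc C r ℓ μ i m =
      if n = m then algebraMap ℂ (Module.End ℂ Fock) (A C r ℓ i j m / m) else 0 := by
  obtain ⟨m, rfl⟩ : ∃ k, m = k + 1 := ⟨m - 1, by omega⟩
  rcases n with _ | n
  · rw [if_neg (by omega), Nat.cast_zero, neg_zero, osc_zero, sub_eq_zero]
    exact (Algebra.commutes _ _).symm
  rw [osc_succ, osc_neg_succ]
  refine LinearMap.ext fun v => ?_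
  simp only [LinearMap.sub_apply, Module.End.mul_apply, LinearMap.mulLeft_apply,
    LinearMap.sum_apply, LinearMap.smul_apply, Derivation.coeFn_coe, Derivation.leibniz,
    Finset.mul_sum, smul_add, Finset.sum_add_distrib, smul_eq_mul, MvPolynomial.pderiv_X]
  have h1 : ∀ x : Fin 2, (A C r ℓ i x (m + 1 : ℕ) / (m + 1 : ℕ)) •
      (MvPolynomial.X (j, n.succPNat) * (MvPolynomial.pderiv (x, m.succPNat)) v) =
      MvPolynomial.X (j, n.succPNat) * (A C r ℓ i x (m + 1 : ℕ) / (m + 1 : ℕ)) •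
        (MvPolynomial.pderiv (x, m.succPNat)) v := fun x => by rw [mul_smul_comm]
  simp_rw [h1]
  rw [add_sub_cancel_left]
  by_cases h : n = m
  · subst h
    rw [if_pos rfl, Finset.sum_eq_single j]
    · simp [Algebra.smul_def]
    · intro b _ hb
      rw [Pi.single_apply, if_neg (by simpa using hb.symm)]
      simp
    · simp
  · rw [if_neg (by omega)]
    refine Finset.sum_eq_zero fun x _ => ?_
    rw [Pi.single_apply, if_neg (by simp [h])]
    simp

/-- The coefficients of the exponent of the annihilation part. -/
def annC (W : List (Fin 3 × ℂ)) (m : ℕ) : Module.End ℂ Fock :=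
  (W.map fun kc => ∑ j, (lam C r ℓ kc.1 j m * kc.2 ^ (-(m : ℤ))) • osc C r ℓ μ j m).sum

/-- The coefficients of the exponent of the creation part. -/
def creC (W : List (Fin 3 × ℂ)) (m : ℕ) : Module.End ℂ Fock :=
  (W.map fun kc => ∑ j, (lam C r ℓ kc.1 j (-m) * kc.2 ^ (m : ℤ)) • osc C r ℓ μ j (-m)).sum

lemma coeff_annPart (W : List (Fin 3 × ℂ)) (n : ℕ) :
    PowerSeries.coeff n (annPart C r ℓ μ W) = expC (annC C r ℓ μ W) n := rfl

lemma commute_list_sum {α β R : Type*} [Ring R] (L : List α) (L' : List β) (f : α → R) (g : β → R)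
    (h : ∀ a b, Commute (f a) (g b)) : Commute (L.map f).sum (L'.map g).sum := by
  refine Commute.list_sum_left _ _ fun a ha => Commute.list_sum_right _ _ fun b hb => ?_
  rw [List.mem_map] at ha hb
  obtain ⟨a, -, rfl⟩ := ha
  obtain ⟨b, -, rfl⟩ := hb
  exact h a b

lemma annC_comm (W W' : List (Fin 3 × ℂ)) (m n : ℕ) :
    Commute (annC C r ℓ μ W m) (annC C r ℓ μ W' n) :=
  commute_list_sum _ _ _ _ fun _ _ => Commute.sum_left _ _ _ fun _ _ => Commute.sum_right _ _ _
    fun _ _ => ((osc_comm_nonneg C r ℓ μ _ _ m n).smul_left _).smul_right _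

lemma creC_comm (W W' : List (Fin 3 × ℂ)) (m n : ℕ) :
    Commute (creC C r ℓ μ W m) (creC C r ℓ μ W' n) :=
  commute_list_sum _ _ _ _ fun _ _ => Commute.sum_left _ _ _ fun _ _ => Commute.sum_right _ _ _
    fun _ _ => ((osc_comm_nonpos C r ℓ μ _ _ m n).smul_left _).smul_right _

/-- `m` times the coefficient of `(w / z) ^ m` in the contraction of `Λ_k(z)` and `Λ_l(w)`. -/
def contr (k l : Fin 3) (m : ℕ) : ℂ :=
  ∑ j, ∑ j', lam C r ℓ k j m * lam C r ℓ l j' (-m) * A C r ℓ j j' m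

/-- The exponent of the contraction of two normally ordered products. -/
def contrW (W W' : List (Fin 3 × ℂ)) (m : ℕ) : ℂ :=
  (W.map fun kc => (W'.map fun lc =>
    contr C r ℓ kc.1 lc.1 m * (kc.2 ^ (-(m : ℤ)) * lc.2 ^ (m : ℤ)) / m).sum).sum

lemma commutator_list_sum {α β R : Type*} [Ring R] (L : List α) (L' : List β) (f : α → R)
    (g : β → R) : (L.map f).sum * (L'.map g).sum - (L'.map g).sum * (L.map f).sum =
      (L.map fun a => (L'.map fun b => f a * g b - g b * f a).sum).sum := by
  induction L with
  | nil => simp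
  | cons a L ih =>
    have h1 : f a * (L'.map g).sum - (L'.map g).sum * f a =
        (L'.map fun b => f a * g b - g b * f a).sum := by
      clear ih
      induction L' with
      | nil => simp
      | cons b L' ih => simp only [List.map_cons, List.sum_cons, ← ih]; noncomm_ring
    simp only [List.map_cons, List.sum_cons, ← ih, ← h1]
    noncomm_ring

/-- The commutators of the exponents are scalars by the Heisenberg relations; this is the hypothesis
of `expC_wick`. -/
lemma annC_creC (W W' : List (Fin 3 × ℂ)) (m n : ℕ) (hm : 0 < m) :
    annC C r ℓ μ W m * creC C r ℓ μ W' n - creC C r ℓ μ W' n * annC C r ℓ μ W m =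
      if n = m then algebraMap ℂ (Module.End ℂ Fock) (contrW C r ℓ W W' m) else 0 := by
  unfold annC creC
  rw [commutator_list_sum]
  have h1 : ∀ kc lc : Fin 3 × ℂ,
      (∑ j, (lam C r ℓ kc.1 j m * kc.2 ^ (-(m : ℤ))) • osc C r ℓ μ j m) *
        (∑ j, (lam C r ℓ lc.1 j (-n) * lc.2 ^ (n : ℤ)) • osc C r ℓ μ j (-n)) -
      (∑ j, (lam C r ℓ lc.1 j (-n) * lc.2 ^ (n : ℤ)) • osc C r ℓ μ j (-n)) *
        (∑ j, (lam C r ℓ kc.1 j m * kc.2 ^ (-(m : ℤ))) • osc C r ℓ μ j m) =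
      if n = m then algebraMap ℂ (Module.End ℂ Fock)
        (contr C r ℓ kc.1 lc.1 m * (kc.2 ^ (-(m : ℤ)) * lc.2 ^ (m : ℤ)) / m) else 0 := by
    intro kc lc
    rw [Finset.sum_mul_sum, Finset.sum_mul_sum, Finset.sum_comm (γ := Fin 2) (s := Finset.univ)
      (f := fun i j => (lam C r ℓ lc.1 i (-n) * lc.2 ^ (n : ℤ)) • osc C r ℓ μ i (-n) *
        (lam C r ℓ kc.1 j m * kc.2 ^ (-(m : ℤ))) • osc C r ℓ μ j m), ← Finset.sum_sub_distrib]
    simp_rw [← Finset.sum_sub_distrib, smul_mul_smul_comm]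
    have h2 : ∀ i j, (lam C r ℓ kc.1 i m * kc.2 ^ (-(m : ℤ)) *
        (lam C r ℓ lc.1 j (-n) * lc.2 ^ (n : ℤ))) • (osc C r ℓ μ i m * osc C r ℓ μ j (-n)) -
        (lam C r ℓ lc.1 j (-n) * lc.2 ^ (n : ℤ) *
        (lam C r ℓ kc.1 i m * kc.2 ^ (-(m : ℤ)))) • (osc C r ℓ μ j (-n) * osc C r ℓ μ i m) =
        if n = m then algebraMap ℂ (Module.End ℂ Fock)
          ((lam C r ℓ kc.1 i m * lam C r ℓ lc.1 j (-m) * A C r ℓ i j m) *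
            ((kc.2 ^ (-(m : ℤ)) * lc.2 ^ (m : ℤ)) / m)) else 0 := by
      intro i j
      rw [mul_comm (lam C r ℓ lc.1 j (-n) * _)]
      refine (smul_sub _ _ _).symm.trans ?_
      rw [osc_commutator C r ℓ μ i j m n hm]
      split_ifs with h
      · subst h
        rw [Algebra.smul_def, ← map_mul]
        congr 1
        ring
      · simp
    simp_rw [h2]
    split_ifs with h
    · simp_rw [← map_sum, ← Finset.sum_mul]
      congr 1
      rw [contr]
      ring
    · simp
  simp_rw [h1]
  split_ifs with h
  · rw [contrW]
    simp only [map_list_sum, List.map_map, Function.comp_def]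
  · simp

end FreeField

/-! ### Wick's theorem for normally ordered products -/

section NormalOrder

open Finset.HasAntidiagonal

variable (C : RealizationCase) (r : ℝ) (ℓ : ℂ) (μ : Fin 2 → ℂ)

/-- Wick's theorem produces sums graded by total degree, while truncation bounds each index
separately. When the terms vanish outside a box and the degrees cover the box, the two finite sums
agree. -/
lemma sum_antidiagonal_box {M : Type*} [AddCommMonoid M] (g : ℕ × ℕ → M) {L H K : ℕ}
    (hK : L + H ≤ K) (h1 : ∀ q : ℕ × ℕ, L ≤ q.1 → g q = 0) (h2 : ∀ q : ℕ × ℕ, H ≤ q.2 → g q = 0) :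
    ∑ k ∈ Finset.range K, ∑ q ∈ antidiagonal k, g q =
      ∑ l ∈ Finset.range L, ∑ h ∈ Finset.range H, g (l, h) := by
  rw [← Finset.sum_product', ← Finset.sum_fiberwise_of_maps_to (t := Finset.range K)
    (g := fun q : ℕ × ℕ => q.1 + q.2)]
  · refine Finset.sum_congr rfl fun k _ => ?_
    symm
    refine Finset.sum_subset ?_ ?_
    · intro q hq
      rw [Finset.mem_filter] at hq
      rw [mem_antidiagonal, hq.2]
    · intro q hq hq'
      rw [mem_antidiagonal] at hq
      by_contra hne
      refine hq' ?_
      rw [Finset.mem_filter, Finset.mem_product, Finset.mem_range, Finset.mem_range]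
      refine ⟨⟨?_, ?_⟩, hq⟩ <;> by_contra hlt
      · exact hne (h1 q (by omega))
      · exact hne (h2 q (by omega))
  · intro q hq
    rw [Finset.mem_product, Finset.mem_range, Finset.mem_range] at hq
    rw [Finset.mem_range]
    omega

/-- Extension by zero of a sequence to negative indices. -/
def extZ (e : ℕ → Module.End ℂ Fock) (k : ℤ) : Module.End ℂ Fock :=
  if 0 ≤ k then e k.toNat else 0

lemma extZ_neg (e : ℕ → Module.End ℂ Fock) {k : ℤ} (h : k < 0) : extZ e k = 0 := by
  rw [extZ, if_neg (by omega)]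

lemma extZ_coe (e : ℕ → Module.End ℂ Fock) (k : ℕ) : extZ e k = e k := by
  rw [extZ, if_pos (by omega), Int.toNat_natCast]

lemma nop_eq_sum (W : List (Fin 3 × ℂ)) (n : ℤ) (v : Fock) {K : ℕ}
    (hK : ∀ k ≥ K, expC (annC C r ℓ μ W) k v = 0) :
    nop C r ℓ μ W n v = zeroPart C r ℓ μ W • ∑ k ∈ Finset.range K,
      extZ (expC (creC C r ℓ μ W)) (k - n) (expC (annC C r ℓ μ W) k v) := by
  change ∑ᶠ p : ℕ × ℕ, nopTerm C r ℓ μ W n v p = _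
  rw [finsum_eq_sum_of_support_subset (s := Finset.range (K + n.natAbs + 1) ×ˢ Finset.range K)]
  · rw [Finset.sum_product_right, Finset.smul_sum]
    refine Finset.sum_congr rfl fun k hk => ?_
    rw [Finset.mem_range] at hk
    by_cases h : 0 ≤ (k : ℤ) - n
    · rw [Finset.sum_eq_single ((k : ℤ) - n).toNat]
      · rw [nopTerm, if_pos (by simp only; omega), extZ, if_pos h]
        rfl
      · intro b _ hb
        rw [nopTerm, if_neg (by simp only; omega)]
      · intro hn
        exact absurd (Finset.mem_range.2 (by omega)) hn
    · rw [extZ_neg _ (by omega), LinearMap.zero_apply, smul_zero]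
      refine Finset.sum_eq_zero fun p _ => ?_
      rw [nopTerm, if_neg (by simp only; omega)]
  · intro p hp
    rw [Function.mem_support, nopTerm] at hp
    split_ifs at hp with h
    · have h2 : p.2 < K := by
        by_contra hc
        refine hp ?_
        rw [coeff_annPart, hK p.2 (by omega)]; simp
      simp only [Finset.coe_product, Finset.coe_range, Set.mem_prod, Set.mem_Iio]
      omega
    · exact absurd rfl hp

lemma annC_bound (W : List (Fin 3 × ℂ)) (v : Fock) :
    ∃ K, ∀ k ≥ K, expC (annC C r ℓ μ W) k v = 0 :=
  annPart_eventually_zero C r ℓ μ W v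

/-- Only finitely many `k'` matter, and each of the resulting vectors has its own bound in `k`; the
largest of these bounds works for all. -/
lemma annC_bound₂ (W W' : List (Fin 3 × ℂ)) (v : Fock) :
    ∃ K : ℕ, ∀ k k' : ℕ, K ≤ k ∨ K ≤ k' →
      expC (annC C r ℓ μ W) k (expC (annC C r ℓ μ W') k' v) = 0 := by
  obtain ⟨K', hK'⟩ := annC_bound C r ℓ μ W' v
  choose B hB using fun k' : ℕ => annC_bound C r ℓ μ W (expC (annC C r ℓ μ W') k' v)
  refine ⟨max K' ((Finset.range K').sup B), fun k k' h => ?_⟩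
  by_cases hk' : K' ≤ k'
  · rw [hK' k' hk', map_zero]
  · have := Finset.le_sup (f := B) (Finset.mem_range.2 (not_le.1 hk'))
    refine hB k' k ?_
    omega

/-- The terms of `nop₂`. -/
def nopTerm₂ (W W' : List (Fin 3 × ℂ)) (m n : ℤ) (v : Fock) (q : ℕ × ℕ) : Fock :=
  extZ (expC (creC C r ℓ μ W)) (q.1 - m) (extZ (expC (creC C r ℓ μ W')) (q.2 - n)
    (expC (annC C r ℓ μ W) q.1 (expC (annC C r ℓ μ W') q.2 v)))

/-- The coefficient of `z ^ (-m) * w ^ (-n)` in the normally ordered product of `W(z)` and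
`W'(w)`. -/
def nop₂ (W W' : List (Fin 3 × ℂ)) (m n : ℤ) (v : Fock) : Fock :=
  (zeroPart C r ℓ μ W * zeroPart C r ℓ μ W') • ∑ᶠ q : ℕ × ℕ, nopTerm₂ C r ℓ μ W W' m n v q

lemma nop₂_eq_sum (W W' : List (Fin 3 × ℂ)) (m n : ℤ) (v : Fock) {K : ℕ}
    (hK : ∀ k k' : ℕ, K ≤ k ∨ K ≤ k' →
      expC (annC C r ℓ μ W) k (expC (annC C r ℓ μ W') k' v) = 0) :
    nop₂ C r ℓ μ W W' m n v = (zeroPart C r ℓ μ W * zeroPart C r ℓ μ W') •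
      ∑ k ∈ Finset.range K, ∑ k' ∈ Finset.range K, nopTerm₂ C r ℓ μ W W' m n v (k, k') := by
  rw [nop₂, ← Finset.sum_product', finsum_eq_sum_of_support_subset]
  intro q hq
  rw [Function.mem_support, nopTerm₂] at hq
  simp only [Finset.coe_product, Finset.coe_range, Set.mem_prod, Set.mem_Iio]
  by_contra hc
  exact hq (by rw [hK q.1 q.2 (by omega)]; simp)

lemma nop₂_truncated (W W' : List (Fin 3 × ℂ)) (v : Fock) :
    ∃ N : ℕ, ∀ m n : ℤ, N ≤ m ∨ N ≤ n → nop₂ C r ℓ μ W W' m n v = 0 := by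
  obtain ⟨K, hK⟩ := annC_bound₂ C r ℓ μ W W' v
  refine ⟨K, fun m n h => ?_⟩
  rw [nop₂_eq_sum C r ℓ μ W W' m n v hK]
  refine smul_eq_zero_of_right _ (Finset.sum_eq_zero fun k hk =>
    Finset.sum_eq_zero fun k' hk' => ?_)
  rw [Finset.mem_range] at hk hk'
  rw [nopTerm₂]
  rcases h with h | h
  · rw [extZ_neg _ (by simp only; omega), LinearMap.zero_apply]
  · rw [extZ_neg (k := _ - n) _ (by simp only; omega), LinearMap.zero_apply, map_zero]

/-- This is `expC_wick` with the creation index extended by zero to all integers, which absorbs the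
condition `q.1 ≤ n`. -/
lemma annC_extZ_creC (W W' : List (Fin 3 × ℂ)) (k : ℕ) (p : ℤ) (v : Fock) :
    expC (annC C r ℓ μ W) k (extZ (expC (creC C r ℓ μ W')) p v) =
      ∑ q ∈ antidiagonal k, expC (contrW C r ℓ W W') q.1 •
        extZ (expC (creC C r ℓ μ W')) (p - q.1) (expC (annC C r ℓ μ W) q.2 v) := by
  by_cases hp : 0 ≤ p
  · obtain ⟨n, rfl⟩ : ∃ n : ℕ, p = n := ⟨p.toNat, by omega⟩
    rw [extZ_coe, ← Module.End.mul_apply, expC_wick (annC_comm C r ℓ μ W W)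
      (creC_comm C r ℓ μ W' W') (annC_creC C r ℓ μ W W'), LinearMap.sum_apply]
    refine Finset.sum_congr rfl fun q _ => ?_
    split_ifs with h
    · rw [show (n : ℤ) - q.1 = ((n - q.1 : ℕ) : ℤ) by omega, extZ_coe]
      rfl
    · rw [extZ_neg _ (by omega)]
      simp
  · rw [extZ_neg _ (by omega), LinearMap.zero_apply, map_zero]
    symm
    refine Finset.sum_eq_zero fun q _ => ?_
    rw [extZ_neg _ (by omega), LinearMap.zero_apply, smul_zero]

/-- Wick's theorem for two normally ordered products. -/
lemma nop_nop (W W' : List (Fin 3 × ℂ)) (m n : ℤ) (v : Fock) {L : ℕ}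
    (hL : ∀ m' n' : ℤ, n + L ≤ n' → nop₂ C r ℓ μ W W' m' n' v = 0) :
    nop C r ℓ μ W m (nop C r ℓ μ W' n v) = ∑ l ∈ Finset.range L,
      expC (contrW C r ℓ W W') l • nop₂ C r ℓ μ W W' (m - l) (n + l) v := by
  obtain ⟨H, hH⟩ := annC_bound₂ C r ℓ μ W W' v
  obtain ⟨K', hK'⟩ := annC_bound C r ℓ μ W' v
  obtain ⟨K'', hK''⟩ := annC_bound C r ℓ μ W (nop C r ℓ μ W' n v)
  have hsub : ∀ L₁ : ℕ, L ≤ L₁ → ∑ l ∈ Finset.range L,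
      expC (contrW C r ℓ W W') l • nop₂ C r ℓ μ W W' (m - l) (n + l) v =
      ∑ l ∈ Finset.range L₁,
      expC (contrW C r ℓ W W') l • nop₂ C r ℓ μ W W' (m - l) (n + l) v := by
    intro L₁ hL₁
    refine Finset.sum_subset (Finset.range_mono hL₁) fun l _ hl => ?_
    rw [Finset.mem_range] at hl
    rw [hL _ _ (by omega), smul_zero]
  set H₁ := max H K'
  -- For a contraction degree of at least `L₁` the creation index of `W'` is negative for every
  -- annihilation index below `H₁`. Enlarging `L` to `L₁` thus confines the double sum to a box.
  set L₁ := max L (H₁ + n.natAbs)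
  have hH₁ : ∀ k k' : ℕ, H₁ ≤ k ∨ H₁ ≤ k' →
      expC (annC C r ℓ μ W) k (expC (annC C r ℓ μ W') k' v) = 0 :=
    fun k k' h => hH k k' (by omega)
  rw [hsub L₁ (by omega), nop_eq_sum C r ℓ μ W m _ (K := max K'' (L₁ + H₁))
    (fun k hk => hK'' k (by omega)), nop_eq_sum C r ℓ μ W' n v (K := H₁)
    (fun k hk => hK' k (by omega))]
  have e1 : ∀ k : ℕ, extZ (expC (creC C r ℓ μ W)) (k - m) (expC (annC C r ℓ μ W) k
      (zeroPart C r ℓ μ W' • ∑ k' ∈ Finset.range H₁,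
        extZ (expC (creC C r ℓ μ W')) (k' - n) (expC (annC C r ℓ μ W') k' v))) =
      zeroPart C r ℓ μ W' • ∑ q ∈ antidiagonal k, ∑ k' ∈ Finset.range H₁,
        expC (contrW C r ℓ W W') q.1 •
          nopTerm₂ C r ℓ μ W W' (m - q.1) (n + q.1) v (q.2, k') := by
    intro k
    rw [map_smul, map_smul, map_sum, map_sum, Finset.sum_comm]
    congr 1
    refine Finset.sum_congr rfl fun k' _ => ?_
    rw [annC_extZ_creC, map_sum]
    refine Finset.sum_congr rfl fun q hq => ?_
    rw [mem_antidiagonal] at hq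
    rw [map_smul, nopTerm₂]
    rw [show (k : ℤ) - m = q.2 - (m - q.1) by omega,
      show (k' : ℤ) - n - q.1 = k' - (n + q.1) by omega]
  simp_rw [e1]
  rw [← Finset.smul_sum, smul_smul, sum_antidiagonal_box (L := L₁) (H := H₁) _ (by omega)]
  · rw [Finset.smul_sum]
    refine Finset.sum_congr rfl fun l _ => ?_
    rw [nop₂_eq_sum C r ℓ μ W W' _ _ v hH₁, smul_comm, Finset.smul_sum (r := expC _ l)]
    simp_rw [Finset.smul_sum]
  · intro q hq
    refine Finset.sum_eq_zero fun k' hk' => ?_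
    rw [Finset.mem_range] at hk'
    rw [nopTerm₂, extZ_neg (k := _ - (n + (q.1 : ℤ))) _ (by simp only; omega)]
    simp
  · intro q hq
    refine Finset.sum_eq_zero fun k' hk' => ?_
    rw [nopTerm₂]
    simp only
    rw [hH₁ q.2 k' (Or.inl hq)]
    simp

/-- The coefficients of `f(w / z) W(z) W'(w)`. -/
lemma prodCoeff_nop (f : PowerSeries ℂ) (W W' : List (Fin 3 × ℂ)) (m n : ℤ) (v : Fock) :
    prodCoeff f (nop C r ℓ μ W) (nop C r ℓ μ W') m n v =
      ∑ᶠ l : ℕ, PowerSeries.coeff l (f * PowerSeries.mk (expC (contrW C r ℓ W W'))) •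
        nop₂ C r ℓ μ W W' (m - l) (n + l) v := by
  obtain ⟨N, hN⟩ := nop₂_truncated C r ℓ μ W W' v
  obtain ⟨N', hN'⟩ := nop_truncated C r ℓ μ W' v
  set L := max (N - n).toNat (N' - n).toNat
  have hL : ∀ l : ℕ, L ≤ l → ∀ m', nop₂ C r ℓ μ W W' m' (n + l) v = 0 :=
    fun l hl m' => hN _ _ (Or.inr (by omega))
  rw [prodCoeff, finsum_eq_sum_of_support_subset (s := Finset.range L),
    finsum_eq_sum_of_support_subset (s := Finset.range (L + L))]
  · symm
    have e1 : ∀ k : ℕ, PowerSeries.coeff k (f * PowerSeries.mk (expC (contrW C r ℓ W W'))) •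
        nop₂ C r ℓ μ W W' (m - k) (n + k) v = ∑ q ∈ antidiagonal k,
        PowerSeries.coeff q.1 f • expC (contrW C r ℓ W W') q.2 •
          nop₂ C r ℓ μ W W' (m - q.1 - q.2) (n + q.1 + q.2) v := by
      intro k
      rw [PowerSeries.coeff_mul, Finset.sum_smul]
      refine Finset.sum_congr rfl fun q hq => ?_
      rw [mem_antidiagonal] at hq
      rw [smul_smul, PowerSeries.coeff_mk, ← hq]
      congr 2 <;> push_cast <;> ring
    simp_rw [e1]
    rw [sum_antidiagonal_box (L := L) (H := L) _ le_rfl]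
    · refine Finset.sum_congr rfl fun l _ => ?_
      rw [nop_nop C r ℓ μ W W' (m - l) (n + l) v (L := L) (fun m' n' h => ?_), Finset.smul_sum]
      exact hN _ _ (Or.inr (by omega))
    · intro q hq
      rw [hN _ _ (Or.inr (by omega)), smul_zero, smul_zero]
    · intro q hq
      rw [hN _ _ (Or.inr (by omega)), smul_zero, smul_zero]
  · intro l hl
    rw [Function.mem_support] at hl
    simp only [Finset.coe_range, Set.mem_Iio]
    by_contra hc
    exact hl (by rw [hL l (by omega), smul_zero])
  · intro l hl
    rw [Function.mem_support] at hl
    simp only [Finset.coe_range, Set.mem_Iio]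
    by_contra hc
    exact hl (by rw [hN' (n + l) (by omega), map_zero, smul_zero])

lemma creC_extZ_comm (W W' : List (Fin 3 × ℂ)) (m n : ℤ) :
    Commute (extZ (expC (creC C r ℓ μ W)) m) (extZ (expC (creC C r ℓ μ W')) n) := by
  unfold extZ
  split_ifs
  · exact expC_commute (creC_comm C r ℓ μ W' W') (fun k => (expC_commute (creC_comm C r ℓ μ W W)
      (fun k' => creC_comm C r ℓ μ W' W k k') _).symm) _
  all_goals simp

lemma expC_annC_comm (W W' : List (Fin 3 × ℂ)) (m n : ℕ) :
    Commute (expC (annC C r ℓ μ W) m) (expC (annC C r ℓ μ W') n) :=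
  expC_commute (annC_comm C r ℓ μ W' W') (fun k => (expC_commute (annC_comm C r ℓ μ W W)
      (fun k' => annC_comm C r ℓ μ W' W k k') _).symm) _

/-- Annihilation operators commute with each other, and so do creation operators. The two orders of
a product therefore differ only in their scalar contraction factors. -/
lemma nop₂_comm (W W' : List (Fin 3 × ℂ)) (m n : ℤ) (v : Fock) :
    nop₂ C r ℓ μ W' W n m v = nop₂ C r ℓ μ W W' m n v := by
  rw [nop₂, nop₂, mul_comm]
  congr 1
  rw [← finsum_comp_equiv (Equiv.prodComm ℕ ℕ)]
  refine finsum_congr fun q => ?_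
  simp only [nopTerm₂, Equiv.prodComm_apply, Prod.fst_swap, Prod.snd_swap]
  rw [← Module.End.mul_apply (expC (annC C r ℓ μ W') q.2), (expC_annC_comm C r ℓ μ W' W _ _).eq,
    ← Module.End.mul_apply (extZ _ _) (extZ _ _), (creC_extZ_comm C r ℓ μ W' W _ _).eq]
  rfl

end NormalOrder

/-! ### Laurent polynomial functions -/

section Laurent

variable {ι κ : Type*} [Fintype ι] [Fintype κ] {E F : Type*} [AddCommGroup E] [Module ℂ E]
  [AddCommGroup F] [Module ℂ F]

/-- The function is a Laurent polynomial on the torus of all points with nonzero coordinates. -/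
def IsLaurent (f : (ι → ℂ) → E) : Prop :=
  ∃ s : (ι → ℤ) →₀ E, ∀ Y, (∀ a, Y a ≠ 0) → f Y = s.sum fun e u => (∏ a, Y a ^ e a) • u

lemma IsLaurent.congr {f g : (ι → ℂ) → E} (hf : IsLaurent f)
    (h : ∀ Y, (∀ a, Y a ≠ 0) → f Y = g Y) : IsLaurent g := by
  obtain ⟨s, hs⟩ := hf
  exact ⟨s, fun Y hY => by rw [← h Y hY, hs Y hY]⟩

lemma IsLaurent.zero : IsLaurent (fun _ : ι → ℂ => (0 : E)) := ⟨0, fun Y _ => by simp⟩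

lemma IsLaurent.monomial (e : ι → ℤ) (u : E) : IsLaurent fun Y : ι → ℂ => (∏ a, Y a ^ e a) • u :=
  ⟨Finsupp.single e u, fun Y _ => by rw [Finsupp.sum_single_index]; simp⟩

lemma IsLaurent.const (u : E) : IsLaurent fun _ : ι → ℂ => u :=
  (IsLaurent.monomial (fun _ => 0) u).congr fun Y _ => by simp

lemma IsLaurent.add {f g : (ι → ℂ) → E} (hf : IsLaurent f) (hg : IsLaurent g) :
    IsLaurent fun Y => f Y + g Y := by
  classical
  obtain ⟨s, hs⟩ := hf
  obtain ⟨t, ht⟩ := hg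
  refine ⟨s + t, fun Y hY => ?_⟩
  simp only
  rw [Finsupp.sum_add_index (by simp) (by simp [smul_add]), hs Y hY, ht Y hY]

lemma IsLaurent.sum {α : Type*} (S : Finset α) {f : α → (ι → ℂ) → E}
    (hf : ∀ i ∈ S, IsLaurent (f i)) : IsLaurent fun Y => ∑ i ∈ S, f i Y := by
  classical
  induction S using Finset.induction_on with
  | empty => simpa using IsLaurent.zero
  | insert a S ha ih =>
    simp_rw [Finset.sum_insert ha]
    exact (hf a (by simp)).add (ih fun i hi => hf i (by simp [hi]))

/-- Properties of Laurent polynomials are checked on monomials. The clause `congr` is needed because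
`IsLaurent` restricts a function only on the torus, not where a coordinate is zero. -/
lemma IsLaurent.induct {p : ((ι → ℂ) → E) → Prop}
    (congr : ∀ f g : (ι → ℂ) → E, (∀ Y, (∀ a, Y a ≠ 0) → f Y = g Y) → p f → p g)
    (zero : p fun _ => 0) (add : ∀ f g, p f → p g → p fun Y => f Y + g Y)
    (mono : ∀ (e : ι → ℤ) (u : E), p fun Y => (∏ a, Y a ^ e a) • u) {f : (ι → ℂ) → E} (hf : IsLaurent f) : p f := by
  classical
  obtain ⟨s, hs⟩ := hf
  refine congr (fun Y => s.sum fun e u => (∏ a, Y a ^ e a) • u) f (fun Y hY => (hs Y hY).symm) ?_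
  clear hs
  induction s using Finsupp.induction with
  | zero => simpa using zero
  | single_add e u s _ _ ih =>
    refine congr _ _ (fun Y _ => ?_) (add _ _ (mono e u) ih)
    rw [Finsupp.sum_add_index (by simp) (by simp [smul_add]), Finsupp.sum_single_index (by simp)]

lemma IsLaurent.map (L : E →ₗ[ℂ] F) {f : (ι → ℂ) → E} (hf : IsLaurent f) :
    IsLaurent fun Y => L (f Y) := by
  refine IsLaurent.induct (p := fun f => IsLaurent fun Y => L (f Y)) ?_ ?_ ?_ ?_ hf
  · intro f g h hf
    exact hf.congr fun Y hY => by rw [h Y hY]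
  · simpa using IsLaurent.zero
  · intro f g hf hg
    simpa using hf.add hg
  · intro e u
    simpa using IsLaurent.monomial e (L u)

lemma IsLaurent.smul {s : (ι → ℂ) → ℂ} {f : (ι → ℂ) → E} (hs : IsLaurent s) (hf : IsLaurent f) :
    IsLaurent fun Y => s Y • f Y := by
  refine IsLaurent.induct (p := fun f => IsLaurent fun Y => s Y • f Y) ?_ ?_ ?_ ?_ hf
  · intro f g h hf
    exact hf.congr fun Y hY => by rw [h Y hY]
  · simpa using IsLaurent.zero
  · intro f g hf hg
    simpa [smul_add] using hf.add hg
  · intro e u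
    refine IsLaurent.induct (p := fun s => IsLaurent fun Y => s Y • (∏ a, Y a ^ e a) • u)
      ?_ ?_ ?_ ?_ hs
    · intro f g h hf
      exact hf.congr fun Y hY => by rw [h Y hY]
    · simpa using IsLaurent.zero
    · intro f g hf hg
      simpa [add_smul] using hf.add hg
    · intro e' c
      refine (IsLaurent.monomial (e + e') (c • u)).congr fun Y hY => ?_
      simp only [Pi.add_apply, zpow_add₀ (hY _), Finset.prod_mul_distrib, smul_smul, smul_eq_mul]
      congr 1
      ring

lemma IsLaurent.mul {s f : (ι → ℂ) → ℂ} (hs : IsLaurent s) (hf : IsLaurent f) :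
    IsLaurent fun Y => s Y * f Y := hs.smul hf

lemma IsLaurent.const_smul (c : ℂ) {f : (ι → ℂ) → E} (hf : IsLaurent f) :
    IsLaurent fun Y => c • f Y := (IsLaurent.const c).smul hf

lemma IsLaurent.sub {f g : (ι → ℂ) → E} (hf : IsLaurent f) (hg : IsLaurent g) :
    IsLaurent fun Y => f Y - g Y :=
  (hf.add (hg.const_smul (-1))).congr fun Y _ => by rw [neg_one_smul, sub_eq_add_neg]

lemma IsLaurent.coord_zpow (a : ι) (k : ℤ) : IsLaurent fun Y : ι → ℂ => Y a ^ k := by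
  classical
  refine (IsLaurent.monomial (Pi.single a k) (1 : ℂ)).congr fun Y _ => ?_
  rw [smul_eq_mul, mul_one, Finset.prod_eq_single a]
  · simp
  · intro b _ hb
    rw [Pi.single_eq_of_ne hb, zpow_zero]
  · simp

lemma IsLaurent.coord (a : ι) : IsLaurent fun Y : ι → ℂ => Y a :=
  (IsLaurent.coord_zpow a 1).congr fun Y _ => by rw [zpow_one]

lemma IsLaurent.prod {α : Type*} (S : Finset α) {f : α → (ι → ℂ) → ℂ}
    (hf : ∀ i ∈ S, IsLaurent (f i)) : IsLaurent fun Y => ∏ i ∈ S, f i Y := by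
  classical
  induction S using Finset.induction_on with
  | empty => simpa using IsLaurent.const (1 : ℂ)
  | insert a S ha ih =>
    simp_rw [Finset.prod_insert ha]
    exact (hf a (by simp)).mul (ih fun i hi => hf i (by simp [hi]))

lemma IsLaurent.list_prod {α : Type*} (S : List α) {f : α → (ι → ℂ) → ℂ}
    (hf : ∀ i ∈ S, IsLaurent (f i)) : IsLaurent fun Y => (S.map fun i => f i Y).prod := by
  induction S with
  | nil => simpa using IsLaurent.const (1 : ℂ)
  | cons a S ih =>
    simp only [List.map_cons, List.prod_cons]
    exact (hf a (by simp)).mul (ih fun i hi => hf i (by simp [hi]))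

lemma prod_zpow_eq {α : Type*} {z : ℂ} (hz : z ≠ 0) (S : Finset α) (m : α → ℤ) :
    ∏ a ∈ S, z ^ m a = z ^ ∑ a ∈ S, m a := by
  classical
  induction S using Finset.induction_on with
  | empty => simp
  | insert a S ha ih => rw [Finset.prod_insert ha, Finset.sum_insert ha, zpow_add₀ hz, ih]

/-- Substitution of monomials. -/
lemma IsLaurent.comp_monomial {f : (ι → ℂ) → E} (hf : IsLaurent f) (c : ι → ℂ) (hc : ∀ a, c a ≠ 0)
    (m : ι → κ → ℤ) : IsLaurent fun Z : κ → ℂ => f fun a => c a * ∏ b, Z b ^ m a b := by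
  refine IsLaurent.induct (p := fun f => IsLaurent fun Z : κ → ℂ =>
    f fun a => c a * ∏ b, Z b ^ m a b) ?_ ?_ ?_ ?_ hf
  · intro f g h hf
    exact hf.congr fun Z hZ => h _ fun a => mul_ne_zero (hc a)
      (Finset.prod_ne_zero_iff.2 fun b _ => zpow_ne_zero _ (hZ b))
  · exact IsLaurent.zero
  · intro f g hf hg
    exact hf.add hg
  · intro e u
    refine (IsLaurent.monomial (fun b => ∑ a, m a b * e a) ((∏ a, c a ^ e a) • u)).congr
      fun Z hZ => ?_
    rw [smul_smul]
    congr 1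
    simp only [mul_zpow, Finset.prod_mul_distrib, ← Finset.prod_zpow, ← zpow_mul]
    rw [mul_comm]
    congr 1
    rw [Finset.prod_comm]
    refine Finset.prod_congr rfl fun b _ => ?_
    exact (prod_zpow_eq (hZ b) _ _).symm

/-- The identity theorem in one variable. -/
lemma IsLaurent.eq_zero_of_infinite {f : ℂ → E} (hf : IsLaurent fun Y : Unit → ℂ => f (Y ()))
    {S : Set ℂ} (hS : S.Infinite) (h0 : ∀ z ∈ S, z ≠ 0 → f z = 0) {z : ℂ} (hz : z ≠ 0) :
    f z = 0 := by
  classical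
  rw [← Module.forall_dual_apply_eq_zero_iff ℂ]
  intro φ
  obtain ⟨s, hs⟩ := hf.map φ
  -- After applying a linear functional, multiplication by `y ^ K` clears the negative exponents and
  -- leaves a scalar polynomial with infinitely many roots.
  obtain ⟨K, hK⟩ : ∃ K : ℕ, ∀ e ∈ s.support, 0 ≤ e () + K := by
    refine ⟨s.support.sup fun e => (e ()).natAbs, fun e he => ?_⟩
    have := Finset.le_sup (f := fun e : Unit → ℤ => (e ()).natAbs) he
    omega
  set P : Polynomial ℂ := ∑ e ∈ s.support, Polynomial.C (s e) * Polynomial.X ^ (e () + K).toNat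
  have hP : ∀ y : ℂ, y ≠ 0 → P.eval y = y ^ K * φ (f y) := by
    intro y hy
    have := hs (fun _ => y) (fun _ => hy)
    simp only at this
    rw [this, Finsupp.sum, Finset.mul_sum, Polynomial.eval_finsetSum]
    refine Finset.sum_congr rfl fun e he => ?_
    simp only [Polynomial.eval_mul, Polynomial.eval_C, Polynomial.eval_pow, Polynomial.eval_X,
      Finset.univ_unique, Finset.prod_singleton, smul_eq_mul]
    have h1 : y ^ (e () + K).toNat = y ^ (e () : ℤ) * y ^ K := by
      rw [← zpow_natCast, Int.toNat_of_nonneg (hK e he), zpow_add₀ hy, zpow_natCast]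
    rw [h1]
    simp only [PUnit.default_eq_unit]
    ring
  have hP0 : P = 0 := by
    refine Polynomial.eq_zero_of_infinite_isRoot P ((hS.sdiff (Set.finite_singleton 0)).mono ?_)
    rintro y ⟨hy, hy0⟩
    have hy0' : y ≠ 0 := hy0
    simp [hP y hy0', h0 y hy hy0']
  have := hP z hz
  rw [hP0, Polynomial.eval_zero] at this
  exact (mul_eq_zero.1 this.symm).resolve_left (pow_ne_zero _ hz)

/-- The quotient is a geometric sum. For a negative exponent one uses y⁻ⁿ - g⁻ⁿ = -(yⁿ - gⁿ)y⁻ⁿg⁻ⁿ,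
and the Laurent polynomials `y'` and `g'` supply the inverses. -/
lemma zpow_sub_zpow_dvd {y y' g g' : (ι → ℂ) → ℂ} (hy : IsLaurent y) (hy' : IsLaurent y')
    (hg : IsLaurent g) (hg' : IsLaurent g') (h1 : ∀ Y, (∀ a, Y a ≠ 0) → y Y * y' Y = 1)
    (h2 : ∀ Y, (∀ a, Y a ≠ 0) → g Y * g' Y = 1) (k : ℤ) :
    ∃ q : (ι → ℂ) → ℂ, IsLaurent q ∧
      ∀ Y, (∀ a, Y a ≠ 0) → y Y ^ k - g Y ^ k = (y Y - g Y) * q Y := by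
  have hpow : ∀ {u : (ι → ℂ) → ℂ}, IsLaurent u → ∀ n : ℕ, IsLaurent fun Y => u Y ^ n := by
    intro u hu n
    simpa using IsLaurent.prod (Finset.range n) (f := fun _ => u) fun _ _ => hu
  have hgeom : ∀ n : ℕ, IsLaurent fun Y =>
      ∑ i ∈ Finset.range n, y Y ^ i * g Y ^ (n - 1 - i) := fun n =>
    IsLaurent.sum _ fun i _ => (hpow hy i).mul (hpow hg _)
  obtain ⟨n, rfl | rfl⟩ := k.eq_nat_or_neg
  · refine ⟨_, hgeom n, fun Y _ => ?_⟩
    rw [zpow_natCast, zpow_natCast, mul_comm, (Commute.all (y Y) (g Y)).geom_sum₂_mul]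
  · refine ⟨_, ((hgeom n).mul ((hpow hy' n).mul (hpow hg' n))).const_smul (-1), fun Y hY => ?_⟩
    have e1 : y' Y = (y Y)⁻¹ := eq_inv_of_mul_eq_one_right (h1 Y hY)
    have e2 : g' Y = (g Y)⁻¹ := eq_inv_of_mul_eq_one_right (h2 Y hY)
    have n1 : y Y ≠ 0 := left_ne_zero_of_mul_eq_one (h1 Y hY)
    have n2 : g Y ≠ 0 := left_ne_zero_of_mul_eq_one (h2 Y hY)
    have e3 := (Commute.all (y Y) (g Y)).geom_sum₂_mul n
    rw [zpow_neg, zpow_neg, zpow_natCast, zpow_natCast, e1, e2, smul_eq_mul]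
    have : (y Y - g Y) * (-1 * ((∑ i ∈ Finset.range n, y Y ^ i * g Y ^ (n - 1 - i)) *
      ((y Y)⁻¹ ^ n * (g Y)⁻¹ ^ n))) = - (y Y ^ n - g Y ^ n) * ((y Y)⁻¹ ^ n * (g Y)⁻¹ ^ n) := by
      rw [← e3]; ring
    rw [this, inv_pow, inv_pow]
    have := pow_ne_zero n n1
    have := pow_ne_zero n n2
    field_simp
    ring

/-- The difference of the values at two points that differ in one coordinate is divisible by the
difference of these coordinates. -/
lemma IsLaurent.sub_update_dvd [DecidableEq ι] {f : (ι → ℂ) → E} (hf : IsLaurent f) (a : ι)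
    {g g' : (ι → ℂ) → ℂ} (hg : IsLaurent g) (hg' : IsLaurent g')
    (h2 : ∀ Y, (∀ a, Y a ≠ 0) → g Y * g' Y = 1) :
    ∃ q : (ι → ℂ) → E, IsLaurent q ∧ ∀ Y, (∀ a, Y a ≠ 0) →
      f Y - f (Function.update Y a (g Y)) = (Y a - g Y) • q Y := by
  have hne : ∀ Y, (∀ a, Y a ≠ 0) → ∀ b, Function.update Y a (g Y) b ≠ 0 := by
    intro Y hY b
    rw [Function.update_apply]
    split_ifs
    · exact left_ne_zero_of_mul_eq_one (h2 Y hY)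
    · exact hY b
  refine IsLaurent.induct (p := fun f => ∃ q : (ι → ℂ) → E, IsLaurent q ∧
    ∀ Y, (∀ a, Y a ≠ 0) → f Y - f (Function.update Y a (g Y)) = (Y a - g Y) • q Y) ?_ ?_ ?_ ?_ hf
  · rintro f f' h ⟨q, hq, hq'⟩
    refine ⟨q, hq, fun Y hY => ?_⟩
    rw [← h Y hY, ← h _ (hne Y hY), hq' Y hY]
  · exact ⟨fun _ => 0, IsLaurent.zero, by simp⟩
  · rintro f f' ⟨q, hq, h⟩ ⟨q', hq', h'⟩
    refine ⟨_, hq.add hq', fun Y hY => ?_⟩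
    simp only
    rw [smul_add, ← h Y hY, ← h' Y hY, add_sub_add_comm]
  · intro e u
    obtain ⟨q, hq, h⟩ := zpow_sub_zpow_dvd (IsLaurent.coord a) (IsLaurent.coord_zpow a (-1)) hg hg'
      (fun Y hY => by rw [zpow_neg_one, mul_inv_cancel₀ (hY a)]) h2 (e a)
    refine ⟨fun Y => q Y • (∏ b, Y b ^ (Function.update e a 0) b) • u,
      hq.smul (IsLaurent.monomial _ u), fun Y hY => ?_⟩
    have e1 : ∏ b, Y b ^ e b = Y a ^ e a * ∏ b, Y b ^ (Function.update e a 0) b := by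
      rw [← Finset.mul_prod_erase _ _ (Finset.mem_univ a),
        ← Finset.mul_prod_erase Finset.univ (fun b => Y b ^ (Function.update e a 0) b)
          (Finset.mem_univ a), Function.update_self, zpow_zero, one_mul]
      congr 1
      refine Finset.prod_congr rfl fun b hb => ?_
      rw [Function.update_of_ne (Finset.ne_of_mem_erase hb)]
    have e2 : ∏ b, Function.update Y a (g Y) b ^ e b =
        g Y ^ e a * ∏ b, Y b ^ (Function.update e a 0) b := by
      rw [← Finset.mul_prod_erase _ _ (Finset.mem_univ a),
        ← Finset.mul_prod_erase Finset.univ (fun b => Y b ^ (Function.update e a 0) b)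
          (Finset.mem_univ a), Function.update_self, Function.update_self, zpow_zero, one_mul]
      congr 1
      refine Finset.prod_congr rfl fun b hb => ?_
      rw [Function.update_of_ne (Finset.ne_of_mem_erase hb),
        Function.update_of_ne (Finset.ne_of_mem_erase hb)]
    simp only
    rw [e1, e2, ← sub_smul, smul_smul, smul_smul, ← sub_mul, h Y hY, mul_assoc]

end Laurent

/-! ### Normally ordered products as functions of their arguments -/

section Points

open Finset.HasAntidiagonal

/-- Multiplication of all arguments by `κ`. -/
def scaleW (κ : ℂ) (W : List (Fin 3 × ℂ)) : List (Fin 3 × ℂ) := W.map fun kc => (kc.1, κ * kc.2)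

/-- A symmetric homogeneous family of Laurent polynomials, indexed by words. -/
structure IsFamily (N : ℤ) (F : List (Fin 3 × ℂ) → Fock) : Prop where
  perm : ∀ {W W' : List (Fin 3 × ℂ)}, W.Perm W' → F W = F W'
  scale : ∀ {κ : ℂ} (W : List (Fin 3 × ℂ)), κ ≠ 0 → F (scaleW κ W) = κ ^ (-N) • F W
  laurent : ∀ (n : ℕ) (w : Fin n → Fin 3), IsLaurent fun Y => F (List.ofFn fun a => (w a, Y a))

lemma IsFamily.laurent_list {N : ℤ} {F : List (Fin 3 × ℂ) → Fock} (hF : IsFamily N F)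
    (L : List (Fin 3 × ℂ × ℤ)) (hL : ∀ t ∈ L, t.2.1 ≠ 0) :
    IsLaurent fun Y : Unit → ℂ => F (L.map fun t => (t.1, t.2.1 * Y () ^ t.2.2)) := by
  have h := (hF.laurent L.length fun a => (L.get a).1).comp_monomial (κ := Unit)
    (fun a => (L.get a).2.1) (fun a => hL _ (List.get_mem L a)) fun a _ => (L.get a).2.2
  refine h.congr fun Y _ => ?_
  congr 1
  conv_rhs => rw [← List.ofFn_get L, List.map_ofFn]
  simp [Function.comp_def]

variable (C : RealizationCase) (r : ℝ) (ℓ : ℂ) (μ : Fin 2 → ℂ)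

/-- The bound comes from the degrees of the monomials of `v` and not from `W`. One finite sum
therefore represents the coefficient for all words and all positions of the points, which is what
makes it a Laurent polynomial in the points. -/
lemma annC_bound_uniform (v : Fock) :
    ∃ K, ∀ W, ∀ k ≥ K, expC (annC C r ℓ μ W) k v = 0 := by
  induction v using MvPolynomial.induction_on' with
  | monomial e a =>
    obtain ⟨N, hN⟩ : ∃ N : ℕ, Finsupp.weight fockWeight e < N :=
      ⟨(Finsupp.weight fockWeight e).toNat + 1, by omega⟩
    refine ⟨N, fun W n hn => ?_⟩
    refine fock_homogeneous_neg (annPart_homogeneous C r ℓ μ W n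
      (MvPolynomial.isWeightedHomogeneous_monomial fockWeight e a rfl)) ?_
    omega
  | add p q hp hq =>
    obtain ⟨N, hN⟩ := hp
    obtain ⟨M, hM⟩ := hq
    refine ⟨max N M, fun W n hn => ?_⟩
    rw [map_add, hN W n (le_trans (le_max_left _ _) hn), hM W n (le_trans (le_max_right _ _) hn),
      add_zero]

lemma annC_perm {W W' : List (Fin 3 × ℂ)} (h : W.Perm W') : annC C r ℓ μ W = annC C r ℓ μ W' :=
  funext fun _ => (h.map _).sum_eq

lemma creC_perm {W W' : List (Fin 3 × ℂ)} (h : W.Perm W') : creC C r ℓ μ W = creC C r ℓ μ W' :=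
  funext fun _ => (h.map _).sum_eq

lemma zeroPart_perm {W W' : List (Fin 3 × ℂ)} (h : W.Perm W') :
    zeroPart C r ℓ μ W = zeroPart C r ℓ μ W' := (h.map _).prod_eq

lemma annC_scale {κ : ℂ} (W : List (Fin 3 × ℂ)) :
    annC C r ℓ μ (scaleW κ W) = fun m => κ⁻¹ ^ m • annC C r ℓ μ W m := by
  funext m
  rw [annC, annC, scaleW, List.map_map, List.smul_sum, List.map_map]
  congr 2
  funext kc
  simp only [Function.comp_apply, Finset.smul_sum, smul_smul, mul_zpow]
  refine Finset.sum_congr rfl fun j _ => ?_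
  congr 1
  rw [zpow_neg, zpow_natCast, inv_pow]
  ring

lemma creC_scale {κ : ℂ} (W : List (Fin 3 × ℂ)) :
    creC C r ℓ μ (scaleW κ W) = fun m => κ ^ m • creC C r ℓ μ W m := by
  funext m
  rw [creC, creC, scaleW, List.map_map, List.smul_sum, List.map_map]
  congr 2
  funext kc
  simp only [Function.comp_apply, Finset.smul_sum, smul_smul, mul_zpow]
  refine Finset.sum_congr rfl fun j _ => ?_
  congr 1
  rw [zpow_natCast]
  ring

lemma zeroPart_scale {κ : ℂ} (W : List (Fin 3 × ℂ)) :
    zeroPart C r ℓ μ (scaleW κ W) = zeroPart C r ℓ μ W := by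
  rw [zeroPart, scaleW, List.map_map]
  rfl

lemma annC_append (W W' : List (Fin 3 × ℂ)) :
    annC C r ℓ μ (W ++ W') = fun m => annC C r ℓ μ W m + annC C r ℓ μ W' m := by
  funext m
  rw [annC, List.map_append, List.sum_append]; rfl

lemma creC_append (W W' : List (Fin 3 × ℂ)) :
    creC C r ℓ μ (W ++ W') = fun m => creC C r ℓ μ W m + creC C r ℓ μ W' m := by
  funext m
  rw [creC, List.map_append, List.sum_append]; rfl

lemma zeroPart_append (W W' : List (Fin 3 × ℂ)) :
    zeroPart C r ℓ μ (W ++ W') = zeroPart C r ℓ μ W * zeroPart C r ℓ μ W' := by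
  rw [zeroPart, List.map_append, List.prod_append]; rfl

lemma isLaurent_annC {n : ℕ} (w : Fin n → Fin 3) (m : ℕ) {u : (Fin n → ℂ) → Fock}
    (hu : IsLaurent u) :
    IsLaurent fun Y => annC C r ℓ μ (List.ofFn fun a => (w a, Y a)) m (u Y) := by
  have h : IsLaurent fun Y => ∑ a, ∑ j, (lam C r ℓ (w a) j m * Y a ^ (-(m : ℤ))) •
      osc C r ℓ μ j m (u Y) :=
    IsLaurent.sum _ fun a _ => IsLaurent.sum _ fun j _ =>
      (((IsLaurent.const _).mul (IsLaurent.coord_zpow a _))).smul (hu.map _)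
  refine h.congr fun Y _ => ?_
  rw [annC, List.map_ofFn, List.sum_ofFn, LinearMap.sum_apply]
  refine Finset.sum_congr rfl fun a _ => ?_
  simp only [Function.comp_apply, LinearMap.sum_apply, LinearMap.smul_apply]

lemma isLaurent_creC {n : ℕ} (w : Fin n → Fin 3) (m : ℕ) {u : (Fin n → ℂ) → Fock}
    (hu : IsLaurent u) :
    IsLaurent fun Y => creC C r ℓ μ (List.ofFn fun a => (w a, Y a)) m (u Y) := by
  have h : IsLaurent fun Y => ∑ a, ∑ j, (lam C r ℓ (w a) j (-m) * Y a ^ (m : ℤ)) •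
      osc C r ℓ μ j (-m) (u Y) :=
    IsLaurent.sum _ fun a _ => IsLaurent.sum _ fun j _ =>
      (((IsLaurent.const _).mul (IsLaurent.coord_zpow a _))).smul (hu.map _)
  refine h.congr fun Y _ => ?_
  rw [creC, List.map_ofFn, List.sum_ofFn, LinearMap.sum_apply]
  refine Finset.sum_congr rfl fun a _ => ?_
  simp only [Function.comp_apply, LinearMap.sum_apply, LinearMap.smul_apply]

lemma isLaurent_expC {n : ℕ} {a : (Fin n → ℂ) → ℕ → Module.End ℂ Fock}
    (hc : ∀ Y m n, Commute (a Y m) (a Y n))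
    (ha : ∀ m (u : (Fin n → ℂ) → Fock), IsLaurent u → IsLaurent fun Y => a Y m (u Y)) (m : ℕ)
    {u : (Fin n → ℂ) → Fock} (hu : IsLaurent u) : IsLaurent fun Y => expC (a Y) m (u Y) := by
  induction m using Nat.strong_induction_on generalizing u with
  | _ m ih =>
    rcases Nat.eq_zero_or_pos m with rfl | hm
    · exact hu.congr fun Y _ => by rw [expC_zero]; rfl
    have hm' : (m : ℂ) ≠ 0 := by exact_mod_cast hm.ne'
    -- The guard `p.2 < m` restricts the recursion to smaller indices. It only discards the term
    -- with `p.1 = 0`, whose coefficient is zero.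
    have h : IsLaurent fun Y => (m : ℂ)⁻¹ • ∑ p ∈ antidiagonal m,
        (p.1 : ℂ) • a Y p.1 (if p.2 < m then expC (a Y) p.2 (u Y) else 0) := by
      refine (IsLaurent.sum _ fun p _ => (ha _ _ ?_).const_smul _).const_smul _
      split_ifs with hp
      · exact ih p.2 hp hu
      · exact IsLaurent.zero
    refine h.congr fun Y _ => ?_
    have h1 : expC (a Y) m = (m : ℂ)⁻¹ • ((m : ℂ) • expC (a Y) m) := by
      rw [smul_smul, inv_mul_cancel₀ hm', one_smul]
    rw [h1, expC_rec (hc Y), LinearMap.smul_apply, LinearMap.sum_apply]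
    congr 1
    refine Finset.sum_congr rfl fun p hp => ?_
    rw [mem_antidiagonal] at hp
    rw [LinearMap.smul_apply, Module.End.mul_apply]
    rcases Nat.eq_zero_or_pos p.1 with h2 | h2
    · simp [h2]
    · rw [if_pos (by omega)]

/-- The coefficients of normally ordered products form a symmetric homogeneous family. -/
lemma isFamily_nop (N : ℤ) (v : Fock) : IsFamily N fun W => nop C r ℓ μ W N v := by
  obtain ⟨K, hK⟩ := annC_bound_uniform C r ℓ μ v
  refine ⟨?_, ?_, ?_⟩
  · intro W W' h
    rw [nop_eq_sum C r ℓ μ W N v (hK W), nop_eq_sum C r ℓ μ W' N v (hK W'),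
      annC_perm C r ℓ μ h, creC_perm C r ℓ μ h, zeroPart_perm C r ℓ μ h]
  · intro κ W hκ
    rw [nop_eq_sum C r ℓ μ W N v (hK W), nop_eq_sum C r ℓ μ _ N v (hK _), zeroPart_scale,
      smul_comm]
    congr 1
    rw [Finset.smul_sum]
    refine Finset.sum_congr rfl fun k _ => ?_
    rw [annC_scale, creC_scale, expC_scale (annC_comm C r ℓ μ W W), LinearMap.smul_apply, map_smul]
    rw [extZ, extZ]
    split_ifs with h
    · rw [expC_scale (creC_comm C r ℓ μ W W), LinearMap.smul_apply, smul_smul]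
      congr 1
      rw [← zpow_natCast κ, Int.toNat_of_nonneg h, inv_pow, ← zpow_natCast κ, ← zpow_neg,
        ← zpow_add₀ hκ]
      congr 1
      ring
    · simp
  · intro n w
    have h : IsLaurent fun Y : Fin n → ℂ => (List.ofFn fun a => Complex.exp
        (∑ j, lam C r ℓ (w a) j 0 * ∑ k, A C r ℓ j k 0 * μ k)).prod • ∑ k ∈ Finset.range K,
        extZ (expC (creC C r ℓ μ (List.ofFn fun a => (w a, Y a)))) (k - N)
          (expC (annC C r ℓ μ (List.ofFn fun a => (w a, Y a))) k v) := by
      refine (IsLaurent.sum _ fun k _ => ?_).const_smul _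
      have h1 : IsLaurent fun Y : Fin n → ℂ =>
          expC (annC C r ℓ μ (List.ofFn fun a => (w a, Y a))) k v :=
        isLaurent_expC (fun Y => annC_comm C r ℓ μ _ _)
          (fun m u hu => isLaurent_annC C r ℓ μ w m hu) k (IsLaurent.const v)
      unfold extZ
      split_ifs
      · exact isLaurent_expC (fun Y => creC_comm C r ℓ μ _ _)
          (fun m u hu => isLaurent_creC C r ℓ μ w m hu) _ h1
      · simpa using IsLaurent.zero
    refine h.congr fun Y _ => ?_
    rw [nop_eq_sum C r ℓ μ _ N v (hK _), zeroPart, List.map_ofFn]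
    rfl

lemma extZ_creC_append_support (W W' : List (Fin 3 × ℂ)) (ζ : ℂ) (p c : ℤ) (u : Fock) :
    (Function.support fun b : ℤ => ζ ^ (b - c) • extZ (expC (creC C r ℓ μ W)) (p - b)
      (extZ (expC (creC C r ℓ μ W')) b u)).Finite := by
  refine (Set.finite_Icc (0 : ℤ) p).subset fun b hb => ?_
  rw [Function.mem_support] at hb
  rw [Set.mem_Icc]
  by_contra hc
  refine hb ?_
  rcases lt_or_ge b 0 with h | h
  · rw [extZ_neg (k := b) _ h]; simp
  · rw [extZ_neg (k := p - b) _ (by omega)]; simp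

lemma extZ_creC_append (W W' : List (Fin 3 × ℂ)) {ζ : ℂ} (p : ℤ) (u : Fock) :
    extZ (expC (creC C r ℓ μ (W ++ scaleW ζ W'))) p u =
      ∑ᶠ b : ℤ, ζ ^ b • extZ (expC (creC C r ℓ μ W)) (p - b)
        (extZ (expC (creC C r ℓ μ W')) b u) := by
  have hs := extZ_creC_append_support C r ℓ μ W W' ζ p 0 u
  simp only [sub_zero] at hs
  by_cases hp : 0 ≤ p
  · obtain ⟨n, rfl⟩ : ∃ n : ℕ, p = n := ⟨p.toNat, by omega⟩
    rw [extZ_coe, creC_append, expC_add (creC_comm C r ℓ μ W W) (creC_comm C r ℓ μ _ _)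
      (creC_comm C r ℓ μ W _), LinearMap.sum_apply, creC_scale,
      finsum_eq_sum_of_support_subset (s := (Finset.range (n + 1)).map Nat.castEmbedding),
      Finset.sum_map, Finset.Nat.sum_antidiagonal_eq_sum_range_succ (n := n)
        (f := fun a b => (expC (creC C r ℓ μ W) a *
          expC (fun m => ζ ^ m • creC C r ℓ μ W' m) b) u),
      ← Finset.sum_range_reflect]
    · refine Finset.sum_congr rfl fun b hb => ?_
      rw [Finset.mem_range] at hb
      have h1 : n - (n + 1 - 1 - b) = b := by omega
      have h2 : (n : ℤ) - b = ((n + 1 - 1 - b : ℕ) : ℤ) := by omega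
      rw [h1, Nat.castEmbedding_apply, h2, extZ_coe, extZ_coe,
        expC_scale (creC_comm C r ℓ μ W' W'), zpow_natCast, Module.End.mul_apply,
        LinearMap.smul_apply, map_smul]
    · intro b hb
      rw [Function.mem_support] at hb
      rw [Finset.mem_coe, Finset.mem_map]
      have hb0 : 0 ≤ b ∧ b ≤ n := by
        by_contra hc
        refine hb ?_
        rcases lt_or_ge b 0 with h | h
        · rw [extZ_neg (k := b) _ h]; simp
        · rw [extZ_neg (k := n - b) _ (by omega)]; simp
      exact ⟨b.toNat, Finset.mem_range.2 (by omega), by simp [hb0.1]⟩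
  · rw [extZ_neg _ (by omega), LinearMap.zero_apply]
    symm
    refine finsum_eq_zero_of_forall_eq_zero fun b => ?_
    rcases lt_or_ge b 0 with h | h
    · rw [extZ_neg (k := b) _ h]; simp
    · rw [extZ_neg (k := p - b) _ (by omega)]; simp

/-- The normally ordered product of `W(z)` and `W'(ζ z)`. -/
lemma nop_append_scale (W W' : List (Fin 3 × ℂ)) {ζ : ℂ} (hζ : ζ ≠ 0) (N : ℤ) (v : Fock) :
    nop C r ℓ μ (W ++ scaleW ζ W') N v =
      ∑ᶠ p : ℤ, ζ ^ p • nop₂ C r ℓ μ W W' (N + p) (-p) v := by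
  obtain ⟨H, hH⟩ := annC_bound₂ C r ℓ μ W W' v
  obtain ⟨K, hK⟩ := annC_bound_uniform C r ℓ μ v
  have hann : ∀ k : ℕ, expC (annC C r ℓ μ (W ++ scaleW ζ W')) k v = ∑ q ∈ antidiagonal k,
      ζ ^ (-(q.2 : ℤ)) • expC (annC C r ℓ μ W) q.1 (expC (annC C r ℓ μ W') q.2 v) := by
    intro k
    rw [annC_append, expC_add (annC_comm C r ℓ μ W W) (annC_comm C r ℓ μ _ _)
      (annC_comm C r ℓ μ W _), LinearMap.sum_apply]
    refine Finset.sum_congr rfl fun q _ => ?_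
    rw [annC_scale, expC_scale (annC_comm C r ℓ μ W' W'), Module.End.mul_apply,
      LinearMap.smul_apply, map_smul, zpow_neg, zpow_natCast, inv_pow]
  have key : ∀ q : ℕ × ℕ, extZ (expC (creC C r ℓ μ (W ++ scaleW ζ W'))) (q.1 + q.2 - N)
      (ζ ^ (-(q.2 : ℤ)) • expC (annC C r ℓ μ W) q.1 (expC (annC C r ℓ μ W') q.2 v)) =
      ∑ᶠ p : ℤ, ζ ^ p • nopTerm₂ C r ℓ μ W W' (N + p) (-p) v q := by
    intro q
    rw [map_smul, extZ_creC_append, smul_finsum, ← finsum_comp_equiv (Equiv.addRight (q.2 : ℤ))]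
    refine finsum_congr fun p => ?_
    simp only [Equiv.coe_addRight]
    rw [smul_smul, ← zpow_add₀ hζ, nopTerm₂, show -(q.2 : ℤ) + (p + q.2) = p by ring,
      show (q.1 : ℤ) + q.2 - N - (p + q.2) = q.1 - (N + p) by ring,
      show (q.2 : ℤ) - -p = p + q.2 by ring]
  have hsupp : ∀ q : ℕ × ℕ, (Function.support fun p : ℤ =>
      ζ ^ p • nopTerm₂ C r ℓ μ W W' (N + p) (-p) v q).Finite := by
    intro q
    refine (Set.finite_Icc (-(q.2 : ℤ)) (q.1 - N)).subset fun p hp => ?_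
    rw [Function.mem_support, nopTerm₂] at hp
    rw [Set.mem_Icc]
    by_contra hc
    refine hp ?_
    rcases lt_or_ge p (-(q.2 : ℤ)) with h | h
    · rw [extZ_neg (k := q.2 - -p) _ (by omega)]; simp
    · rw [extZ_neg (k := q.1 - (N + p)) _ (by omega)]; simp
  rw [nop_eq_sum C r ℓ μ _ N v (K := max K (H + H)) (fun k hk => hK _ k (by omega)),
    zeroPart_append, zeroPart_scale]
  have e1 : ∀ k : ℕ, extZ (expC (creC C r ℓ μ (W ++ scaleW ζ W'))) (k - N)
      (expC (annC C r ℓ μ (W ++ scaleW ζ W')) k v) = ∑ q ∈ antidiagonal k,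
      ∑ᶠ p : ℤ, ζ ^ p • nopTerm₂ C r ℓ μ W W' (N + p) (-p) v q := by
    intro k
    rw [hann, map_sum]
    refine Finset.sum_congr rfl fun q hq => ?_
    rw [mem_antidiagonal] at hq
    rw [← key, ← hq]
    push_cast
    rfl
  simp_rw [e1]
  rw [sum_antidiagonal_box (L := H) (H := H) _ (by omega)]
  · have e2 : ∀ p : ℤ, nop₂ C r ℓ μ W W' (N + p) (-p) v =
        (zeroPart C r ℓ μ W * zeroPart C r ℓ μ W') • ∑ q ∈ Finset.range H ×ˢ Finset.range H,
          nopTerm₂ C r ℓ μ W W' (N + p) (-p) v q := by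
      intro p
      rw [nop₂_eq_sum C r ℓ μ W W' _ _ v hH, ← Finset.sum_product']
    simp_rw [e2]
    rw [← Finset.sum_product' (f := fun k k' => ∑ᶠ p : ℤ, ζ ^ p •
      nopTerm₂ C r ℓ μ W W' (N + p) (-p) v (k, k')),
      ← finsum_sum_comm _ _ fun q _ => hsupp q, smul_finsum]
    refine finsum_congr fun p => ?_
    rw [smul_comm, Finset.smul_sum (r := ζ ^ p)]
  all_goals
    intro q hq
    refine finsum_eq_zero_of_forall_eq_zero fun p => ?_
    rw [nopTerm₂, hH q.1 q.2 (by omega)]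
    simp

/-- Both modes are bounded above and their sum is fixed, so the normally ordered product is a
Laurent polynomial in ζ. All denominators come from the contractions. -/
lemma nop₂_support_finite (W W' : List (Fin 3 × ℂ)) (N : ℤ) (v : Fock) :
    (Function.support fun p : ℤ => nop₂ C r ℓ μ W W' (N + p) (-p) v).Finite := by
  obtain ⟨K, hK⟩ := nop₂_truncated C r ℓ μ W W' v
  refine (Set.finite_Icc (-(K : ℤ)) (K - N)).subset fun p hp => ?_
  rw [Function.mem_support] at hp
  rw [Set.mem_Icc]
  by_contra hc
  exact hp (hK _ _ (by omega))

end Points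

/-! ### The combinatorics of the structure functions -/

/-- The index that may be repeated in a word. -/
def special : RealizationCase → Fin 3
  | .two => 2
  | .three => 1

/-- The words that occur in the currents are those in which every pair of letters is related in this
way. -/
def rel (C : RealizationCase) (k l : Fin 3) : Prop := k < l ∨ (k = l ∧ k = special C)

instance (C : RealizationCase) (k l : Fin 3) : Decidable (rel C k l) := by
  unfold rel; infer_instance

section Words

variable (C : RealizationCase)

/-- The letters of `w` placed at `y, x² y, x⁴ y, …`. -/
def place (x : ℂ) : ℂ → List (Fin 3) → List (Fin 3 × ℂ)
  | _, [] => []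
  | y, k :: w => (k, y) :: place x (x ^ 2 * y) w

lemma spread_eq_place {x : ℂ} (hx : x ≠ 0) (w : List (Fin 3)) :
    spread x w = place x (x ^ (1 - (w.length : ℤ))) w := by
  have h : ∀ (w : List (Fin 3)) (s : ℕ) (n : ℤ),
      (w.zipIdx s).map (fun kp => (kp.1, x ^ (2 * (kp.2 : ℤ) - n + 1))) =
        place x (x ^ (2 * (s : ℤ) - n + 1)) w := by
    intro w
    induction w with
    | nil => intros; rfl
    | cons k w ih =>
      intro s n
      rw [List.zipIdx_cons, List.map_cons, ih, place]
      congr 2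
      rw [← zpow_natCast x 2, ← zpow_add₀ hx]
      congr 1
      push_cast
      ring
  rw [spread, h w 0]
  congr 2
  simp
  ring

lemma scaleW_place (x κ y : ℂ) (w : List (Fin 3)) :
    scaleW κ (place x y w) = place x (κ * y) w := by
  induction w generalizing y with
  | nil => rfl
  | cons k w ih =>
    rw [place, place, scaleW, List.map_cons, ← scaleW, ih]
    congr 2
    ring

/-- The character of the normalized contraction of `Λ_k(z)` and `Λ_l(w)`. -/
def chr (k l : Fin 3) (X T : ℂ) : ℂ :=
  if k = l then (if k = special C then -(T * X⁻¹ ^ 2 + T⁻¹ * X ^ 2) + X ^ 2 + X⁻¹ ^ 2 else 0)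
  else if k < l then -(T * X⁻¹ ^ 2 + T⁻¹) + 1 + X⁻¹ ^ 2
  else -(T + T⁻¹ * X ^ 2) + X ^ 2 + 1

/-- Exchanging the two letters amounts to inverting the variables. Thus the contractions in the two
orders are expansions of one rational function. -/
lemma chr_inv (k l : Fin 3) (X T : ℂ) : chr C l k X⁻¹ T⁻¹ = chr C k l X T := by
  unfold chr
  rcases lt_trichotomy k l with h | rfl | h
  · rw [if_neg h.ne', if_neg h.not_gt, if_neg h.ne, if_pos h]
    simp only [inv_inv]
    ring
  · rw [if_pos rfl, if_pos rfl]
    split_ifs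
    · simp only [inv_inv]
      ring
    · rfl
  · rw [if_neg h.ne, if_pos h, if_neg h.ne', if_neg h.not_gt]
    simp only [inv_inv]
    ring

/-- The number of letters of `w` before `k`. -/
def before (k : Fin 3) (w : List (Fin 3)) : ℕ := w.countP (· < k)

/-- The inverse zeros of the factor of a letter in the structure function of two words. -/
def rowNum (x t u : ℂ) (k : Fin 3) (w : List (Fin 3)) : List ℂ :=
  if k ≠ special C ∧ k ∈ w then []
  else [t * x ^ (2 * (before k w : ℤ) - 2) * u,
    t⁻¹ * x ^ (2 * (before k w : ℤ) + 2 * w.count k) * u]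

/-- The inverse poles of the factor of a letter in the structure function of two words. -/
def rowDen (x u : ℂ) (k : Fin 3) (w : List (Fin 3)) : List ℂ :=
  if k ≠ special C ∧ k ∈ w then []
  else [x ^ (2 * (before k w : ℤ) + 2 * w.count k) * u, x ^ (2 * (before k w : ℤ) - 2) * u]

/-- The inverse zeros of the structure function of two words. -/
def phiNum (x t : ℂ) (w' : List (Fin 3)) : ℂ → List (Fin 3) → List ℂ
  | _, [] => []
  | u, k :: w => rowNum C x t u k w' ++ phiNum x t w' (x⁻¹ ^ 2 * u) w

/-- The inverse poles of the structure function of two words. -/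
def phiDen (x : ℂ) (w' : List (Fin 3)) : ℂ → List (Fin 3) → List ℂ
  | _, [] => []
  | u, k :: w => rowDen C x u k w' ++ phiDen x w' (x⁻¹ ^ 2 * u) w

/-- Power sums. -/
def psum (L : List ℂ) (e : ℤ) : ℂ := (L.map fun a => a ^ e).sum

lemma psum_append (L L' : List ℂ) (e : ℤ) : psum (L ++ L') e = psum L e + psum L' e := by
  simp [psum]

lemma rowNum_length (x t u : ℂ) (k : Fin 3) (w : List (Fin 3)) :
    (rowNum C x t u k w).length = (rowDen C x u k w).length := by
  unfold rowNum rowDen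
  split_ifs <;> rfl

/-- With the equality of lengths, this makes the ratio of the two products tend to 1 at infinity as
it does at zero. The expansion at infinity then needs no monomial prefactor. -/
lemma rowNum_prod {x t : ℂ} (ht : t ≠ 0) (u : ℂ) (k : Fin 3) (w : List (Fin 3)) :
    (rowNum C x t u k w).prod = (rowDen C x u k w).prod := by
  unfold rowNum rowDen
  split_ifs
  · rfl
  · simp only [List.prod_cons, List.prod_nil]
    field_simp

lemma phiNum_length (x t : ℂ) (w' : List (Fin 3)) (u : ℂ) (w : List (Fin 3)) :
    (phiNum C x t w' u w).length = (phiDen C x w' u w).length := by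
  induction w generalizing u with
  | nil => rfl
  | cons k w ih =>
    rw [phiNum, phiDen, List.length_append, List.length_append, ih, rowNum_length]

lemma phiNum_prod {x t : ℂ} (ht : t ≠ 0) (w' : List (Fin 3)) (u : ℂ) (w : List (Fin 3)) :
    (phiNum C x t w' u w).prod = (phiDen C x w' u w).prod := by
  induction w generalizing u with
  | nil => rfl
  | cons k w ih => rw [phiNum, phiDen, List.prod_append, List.prod_append, ih, rowNum_prod C ht]

/-- The apparent poles do not involve `t`. They stay at integral powers of `x` when τ is varied. -/
lemma phiDen_zpow {x : ℂ} (hx : x ≠ 0) (w' : List (Fin 3)) (s : ℤ) (w : List (Fin 3)) :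
    ∀ e ∈ phiDen C x w' (x ^ s) w, ∃ n : ℤ, e = x ^ n := by
  induction w generalizing s with
  | nil => simp [phiDen]
  | cons k w ih =>
    intro e he
    rw [phiDen, List.mem_append] at he
    rcases he with he | he
    · unfold rowDen at he
      split_ifs at he
      · simp at he
      · simp only [List.mem_cons, List.not_mem_nil, or_false, ← zpow_add₀ hx] at he
        rcases he with rfl | rfl
        · exact ⟨_, rfl⟩
        · exact ⟨_, rfl⟩
    · refine ih (s - 2) e ?_
      rwa [zpow_sub₀ hx, zpow_ofNat, div_eq_inv_mul, ← inv_pow]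

/-- The row sums of the characters. -/
def rowChr (X T : ℂ) (k : Fin 3) : List (Fin 3) → ℂ
  | [] => 0
  | l :: w => chr C k l X T + X ^ 2 * rowChr X T k w

/-- Geometric sums. -/
def geoS (Z : ℂ) (n : ℕ) : ℂ := ∑ b ∈ Finset.range n, Z ^ b

lemma geoS_succ (Z : ℂ) (n : ℕ) : geoS Z (n + 1) = 1 + Z * geoS Z n := by
  rw [geoS, Finset.sum_range_succ', geoS, Finset.mul_sum, pow_zero, add_comm]
  congr 1
  exact Finset.sum_congr rfl fun b _ => by rw [pow_succ']

/-- A row of the character table of two words. -/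
def rowVal (X T : ℂ) (k : Fin 3) (w : List (Fin 3)) : ℂ :=
  if k ≠ special C ∧ k ∈ w then 0
  else -(T * X ^ (2 * (before k w : ℤ) - 2) + T⁻¹ * X ^ (2 * (before k w : ℤ) + 2 * w.count k)) +
    X ^ (2 * (before k w : ℤ) + 2 * w.count k) + X ^ (2 * (before k w : ℤ) - 2)

/-- Minus the character of `Δ_1(x⁻¹ z)`. -/
def chr1 (X T : ℂ) : ℂ := T * X⁻¹ ^ 2 + T⁻¹ - 1 - X⁻¹ ^ 2

lemma before_eq_zero {k : Fin 3} {w : List (Fin 3)} (h : ∀ l ∈ w, k ≤ l) : before k w = 0 := by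
  rw [before, List.countP_eq_zero]
  intro l hl
  simpa using h l hl

lemma count_eq_zero_of_lt {k : Fin 3} {w : List (Fin 3)} (h : ∀ l ∈ w, k < l) :
    w.count k = 0 :=
  List.count_eq_zero.2 fun hk => lt_irrefl _ (h k hk)

lemma rel_le {k l : Fin 3} (h : rel C k l) : k ≤ l := by
  rcases h with h | h
  · exact h.le
  · exact h.1.le

/-- Induction from the left. Once `chr1` is added for every letter, a letter after `k` contributes
nothing, since `chr` is then `-chr1`. A letter before `k` adds (1 - X²)`chr1`, which turns the rest
of the row into itself multiplied by X². A further special `k` raises the count by one, and a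
non-special `k` makes the row trivial. Hence the row depends only on how many letters are before `k`
and how many equal it. -/
lemma rowChr_eq {X : ℂ} (hX : X ≠ 0) (T : ℂ) (k : Fin 3) {w : List (Fin 3)}
    (hw : w.Pairwise (rel C)) :
    rowChr C X T k w + chr1 X T * geoS (X ^ 2) w.length = chr1 X T + rowVal C X T k w := by
  have e1 : ∀ n : ℤ, X ^ (n + 2) = X ^ n * X ^ 2 := fun n => by rw [zpow_add₀ hX]; rfl
  have e2 : ∀ n : ℤ, X ^ (n - 2) = X ^ n * X⁻¹ ^ 2 := fun n => by
    rw [zpow_sub₀ hX, div_eq_mul_inv, zpow_ofNat, inv_pow]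
  induction w with
  | nil =>
    simp only [rowChr, geoS, rowVal, before, chr1, List.length_nil, Finset.range_zero,
      Finset.sum_empty, List.countP_nil, List.count_nil, List.not_mem_nil, and_false, if_false,
      Nat.cast_zero, mul_zero, add_zero, zpow_zero, e2]
    ring
  | cons l w ih =>
    rw [List.pairwise_cons] at hw
    have ih := ih hw.2
    rw [rowChr, List.length_cons, geoS_succ]
    have h1 : chr C k l X T + X ^ 2 * rowChr C X T k w +
        chr1 X T * (1 + X ^ 2 * geoS (X ^ 2) w.length) =
        chr C k l X T + chr1 X T + X ^ 2 * (chr1 X T + rowVal C X T k w) := by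
      rw [← ih]; ring
    rw [h1]
    have hXX : X * X⁻¹ = 1 := mul_inv_cancel₀ hX
    have hXX2 : X ^ 2 * X⁻¹ ^ 2 = 1 := by rw [← mul_pow, hXX, one_pow]
    rcases lt_trichotomy k l with h | rfl | h
    · have hlt : ∀ l' ∈ w, k < l' := fun l' hl' => lt_of_lt_of_le h (rel_le C (hw.1 l' hl'))
      have hlt' : ∀ l' ∈ l :: w, k < l' := by
        intro l' hl'
        rcases List.mem_cons.1 hl' with rfl | hl'
        · exact h
        · exact hlt l' hl'
      have hn : k ∉ w := fun hk => lt_irrefl _ (hlt k hk)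
      have hn' : k ∉ l :: w := fun hk => lt_irrefl _ (hlt' k hk)
      rw [rowVal, rowVal, if_neg (fun hh => hn hh.2), if_neg (fun hh => hn' hh.2),
        before_eq_zero fun l' hl' => (hlt l' hl').le, before_eq_zero fun l' hl' => (hlt' l' hl').le,
        count_eq_zero_of_lt hlt, count_eq_zero_of_lt hlt', chr, if_neg h.ne, if_pos h, e2, chr1]
      simp only [Nat.cast_zero, mul_zero, add_zero, zpow_zero, one_mul, mul_one]
      linear_combination (0 : ℂ) * hXX
    · have hle : ∀ l' ∈ w, k ≤ l' := fun l' hl' => rel_le C (hw.1 l' hl')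
      have hle' : ∀ l' ∈ k :: w, k ≤ l' := by
        intro l' hl'
        rcases List.mem_cons.1 hl' with rfl | hl'
        · exact le_rfl
        · exact hle l' hl'
      by_cases hk : k = special C
      · rw [rowVal, rowVal, if_neg (fun hh => hh.1 hk), if_neg (fun hh => hh.1 hk),
          before_eq_zero hle, before_eq_zero hle', List.count_cons_self, chr, if_pos rfl, if_pos hk,
          chr1]
        push_cast
        have e3 : (2 * ((0 : ℕ) : ℤ) + 2 * ((w.count k : ℤ) + 1)) = 2 * (w.count k : ℤ) + 2 := by
          push_cast; ring
        have e4 : (2 * ((0 : ℕ) : ℤ) + 2 * (w.count k : ℤ)) = 2 * (w.count k : ℤ) := by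
          push_cast; ring
        push_cast at e3 e4
        have e5 : X ^ (-2 : ℤ) = X⁻¹ ^ 2 := by rw [zpow_neg, inv_pow]; rfl
        rw [e3, e4, e1, e5]
        ring
      · have hlt : ∀ l' ∈ w, k < l' := by
          intro l' hl'
          rcases hw.1 l' hl' with h | h
          · exact h
          · exact absurd h.2 hk
        have hn : k ∉ w := fun hk => lt_irrefl _ (hlt k hk)
        rw [rowVal, rowVal, if_neg (fun hh => hn hh.2), if_pos ⟨hk, by simp⟩, before_eq_zero hle,
          count_eq_zero_of_lt hlt, chr, if_pos rfl, if_neg hk, chr1, e2]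
        simp only [Nat.cast_zero, mul_zero, add_zero, zpow_zero, one_mul, mul_one]
        linear_combination (0 : ℂ) * hXX2
    · have hb : before k (l :: w) = before k w + 1 := by
        rw [before, List.countP_cons_of_pos (by simpa using h)]; rfl
      have hc : (l :: w).count k = w.count k := List.count_cons_of_ne h.ne
      have hm : k ∈ l :: w ↔ k ∈ w := by simp [h.ne']
      rw [rowVal, rowVal, hb, hc, chr, if_neg h.ne', if_neg h.not_gt]
      simp only [hm]
      split_ifs with hh
      · rw [chr1]
        linear_combination (T - 1) * hXX2
      · push_cast
        rw [show 2 * ((before k w : ℤ) + 1) - 2 = 2 * (before k w : ℤ) - 2 + 2 by ring,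
          show 2 * ((before k w : ℤ) + 1) + 2 * (w.count k : ℤ) =
            2 * (before k w : ℤ) + 2 * (w.count k : ℤ) + 2 by ring, e1, e1, chr1]
        linear_combination (T - 1) * hXX2

end Words

/-! ### The contractions of the free fields -/

lemma xpow_add (ℓ a b : ℂ) : xpow ℓ (a + b) = xpow ℓ a * xpow ℓ b := by
  rw [xpow, add_mul, Complex.exp_add]; rfl

lemma xpow_neg (ℓ a : ℂ) : xpow ℓ (-a) = (xpow ℓ a)⁻¹ := by
  rw [xpow, neg_mul, Complex.exp_neg]; rfl

lemma xpow_ne_zero (ℓ a : ℂ) : xpow ℓ a ≠ 0 := Complex.exp_ne_zero _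

lemma xpow_int_mul (ℓ : ℂ) (n : ℤ) (a : ℂ) : xpow ℓ (n * a) = xpow ℓ a ^ n := by
  rw [xpow, xpow, ← Complex.exp_int_mul, mul_assoc]

lemma xpow_nat_mul (ℓ : ℂ) (n : ℕ) (a : ℂ) : xpow ℓ (n * a) = xpow ℓ a ^ n := by
  rw [xpow, xpow, ← Complex.exp_nat_mul, mul_assoc]

lemma xpow_one (ℓ : ℂ) : xpow ℓ 1 = Complex.exp ℓ := by rw [xpow, one_mul]

lemma norm_xpow (ℓ : ℂ) (a : ℝ) : ‖xpow ℓ a‖ = ‖Complex.exp ℓ‖ ^ a := by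
  rw [xpow, Complex.norm_exp, Complex.norm_exp, ← Real.exp_mul, Complex.re_ofReal_mul, mul_comm]

lemma xpow_real_ne_one {ℓ : ℂ} (h1 : ‖Complex.exp ℓ‖ < 1) {a : ℝ} (ha : a ≠ 0) :
    xpow ℓ a ≠ 1 := by
  intro h
  have h2 := norm_xpow ℓ a
  have h0 : 0 < ‖Complex.exp ℓ‖ := norm_pos_iff.2 (Complex.exp_ne_zero _)
  rw [h, norm_one] at h2
  rcases lt_or_gt_of_ne ha with h | h
  · exact absurd h2 (Real.one_lt_rpow_of_pos_of_lt_one_of_neg h0 h1 h).ne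
  · exact absurd h2.symm (Real.rpow_lt_one h0.le h1 h).ne

lemma qnum_eq (ℓ a : ℂ) : qnum ℓ a = (xpow ℓ a - (xpow ℓ a)⁻¹) / xdiff ℓ := by
  rw [qnum, xpow_neg]; rfl

lemma qnum_neg (ℓ a : ℂ) : qnum ℓ (-a) = -qnum ℓ a := by
  rw [qnum, qnum, neg_neg, ← neg_div, neg_sub]

lemma sub_inv_ne_zero {X : ℂ} (hX : X ≠ 0) (h : X ^ 2 ≠ 1) : X - X⁻¹ ≠ 0 := by
  intro h0
  refine h ?_
  rw [sub_eq_zero] at h0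
  rw [pow_two]
  nth_rewrite 2 [h0]
  exact mul_inv_cancel₀ hX

lemma xpow_sq_ne_one {ℓ : ℂ} (h1 : ‖Complex.exp ℓ‖ < 1) {a : ℝ} (ha : a ≠ 0) :
    xpow ℓ a ^ 2 ≠ 1 := by
  rw [← xpow_nat_mul]
  have := xpow_real_ne_one h1 (a := 2 * a) (by simpa using ha)
  push_cast at this ⊢
  exact this

lemma xdiff_ne_zero {ℓ : ℂ} (h1 : ‖Complex.exp ℓ‖ < 1) : xdiff ℓ ≠ 0 := by
  rw [xdiff, xpow_neg]
  refine sub_inv_ne_zero (xpow_ne_zero _ _) ?_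
  simpa using xpow_sq_ne_one h1 (a := 1) one_ne_zero

/-- The common part of the contractions. -/
def ffun (X R : ℂ) : ℂ :=
  (R * X⁻¹ - R⁻¹ * X) * (R - R⁻¹) ^ 2 / (R * X - R⁻¹ * X⁻¹)

section

variable (C : RealizationCase) (r : ℝ) (ℓ : ℂ)

/-- After the parameters are expressed through X = x^m and R = x^{rm}, this is a rational identity,
checked for each pair of letters in each case. The condition |x| < 1 keeps the denominators away
from zero. The summand `ffun` is the same for all letters and for both realizations. -/
lemma contr_eq (hr : 1 < r) (h1 : ‖Complex.exp ℓ‖ < 1) (k l : Fin 3) {m : ℕ} (hm : 0 < m) :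
    contr C r ℓ k l m = chr C k l (xpow ℓ m) (xpow ℓ (r * m) ^ 2) +
      ffun (xpow ℓ m) (xpow ℓ (r * m)) := by
  set X := xpow ℓ m with hXdef
  set R := xpow ℓ (r * m) with hRdef
  have hm0 : (m : ℝ) ≠ 0 := by exact_mod_cast hm.ne'
  have hr1 : r ≠ 0 := by linarith
  have hX : X ≠ 0 := xpow_ne_zero _ _
  have hR : R ≠ 0 := xpow_ne_zero _ _
  have hx := xdiff_ne_zero h1
  have hX2 : X ^ 2 - 1 ≠ 0 := by
    have := xpow_sq_ne_one h1 hm0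
    rw [sub_ne_zero]; simpa using this
  have hX4 : X ^ 4 - 1 ≠ 0 := by
    have := xpow_sq_ne_one h1 (a := 2 * m) (by simpa using hm0)
    push_cast at this
    have h2 := xpow_nat_mul ℓ 2 m
    push_cast at h2
    rw [h2, ← hXdef] at this
    rw [sub_ne_zero]
    intro h0
    exact this (by linear_combination h0)
  have hR2 : R ^ 2 - 1 ≠ 0 := by
    have := xpow_sq_ne_one h1 (a := r * m) (by simp [hm0, hr1])
    push_cast at this
    rwa [sub_ne_zero]
  have hRX : R ^ 2 * X ^ 2 - 1 ≠ 0 := by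
    have := xpow_sq_ne_one h1 (a := (r + 1) * m) (mul_ne_zero (by linarith) hm0)
    push_cast at this
    rw [add_mul, one_mul, xpow_add, mul_pow] at this
    rwa [sub_ne_zero]
  have q1 : qnum ℓ m = (X - X⁻¹) / xdiff ℓ := qnum_eq _ _
  have q2 : qnum ℓ (2 * m) = (X ^ 2 - X⁻¹ ^ 2) / xdiff ℓ := by
    have h2 := xpow_nat_mul ℓ 2 m
    push_cast at h2
    rw [qnum_eq, h2, inv_pow]
  have u1 : xpow ℓ ((r - 1) * m) = R * X⁻¹ := by
    rw [sub_mul, one_mul, sub_eq_add_neg, xpow_add, xpow_neg]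
  have u2 : xpow ℓ (2 * r * m) = R ^ 2 := by
    have h2 := xpow_nat_mul ℓ 2 (r * m)
    push_cast at h2
    rw [mul_assoc, h2]
  have qr : qnum ℓ (r * m) = (R - R⁻¹) / xdiff ℓ := qnum_eq _ _
  have qr1 : qnum ℓ ((r - 1) * m) = (R * X⁻¹ - R⁻¹ * X) / xdiff ℓ := by
    rw [qnum_eq, u1, mul_inv, inv_inv]
  have qrp : qnum ℓ ((r + 1) * m) = (R * X - R⁻¹ * X⁻¹) / xdiff ℓ := by
    rw [qnum_eq, add_mul, one_mul, xpow_add, mul_inv]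
  have hp : (0 : ℤ) < m := by exact_mod_cast hm
  have hlp : ∀ k j, lam C r ℓ k j m = (R - R⁻¹) / (R * X - R⁻¹ * X⁻¹) * xdiff ℓ *
      lamTable C r ℓ m k j := by
    intro k j
    rw [lam, if_neg hp.ne', show s C r ℓ j m = 1 from if_pos hp]
    push_cast
    rw [qr, qrp, one_mul]
    congr 2
    rw [div_div_div_cancel_right₀ hx]
  have hln : ∀ k j, lam C r ℓ k j (-m) = s C r ℓ j (-m) * ((R - R⁻¹) / (R * X - R⁻¹ * X⁻¹) *
      xdiff ℓ * lamTable C r ℓ (-m) k j) := by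
    intro k j
    rw [lam, if_neg (by omega)]
    push_cast
    rw [mul_neg, mul_neg, qnum_neg, qnum_neg, qr, qrp, neg_div_neg_eq]
    congr 3
    rw [div_div_div_cancel_right₀ hx]
  have hRX' : R * X - R⁻¹ * X⁻¹ ≠ 0 := by
    have := sub_inv_ne_zero (mul_ne_zero hR hX) (by rw [mul_pow]; exact sub_ne_zero.1 hRX)
    rwa [mul_inv] at this
  have hR' : R - R⁻¹ ≠ 0 := sub_inv_ne_zero hR (sub_ne_zero.1 hR2)
  have hX' : X - X⁻¹ ≠ 0 := sub_inv_ne_zero hX (sub_ne_zero.1 hX2)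
  have hneg : ¬ (0 : ℤ) < -m := by omega
  have hn0 : ¬ (-(m : ℤ)) = 0 := by omega
  have hm0' : ¬ m = 0 := hm.ne'
  rw [contr, ffun, chr]
  simp only [hlp, hln, Fin.sum_univ_two, A, A12, s, lamTable, hneg, hn0, hm0', if_false, if_true,
    Int.cast_neg, Int.cast_natCast, mul_neg, qnum_neg, xpow_neg, q1, q2, u1, u2, qr, qr1,
    hp, hp.ne', neg_neg, Fin.isValue, one_ne_zero, zero_ne_one, Nat.cast_eq_zero]
  set x0 := xdiff ℓ
  cases C
  · fin_cases k <;> fin_cases l <;>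
    · simp [special, hm0']
      field_simp
      ring
  · fin_cases k <;> fin_cases l <;>
    · simp [special, hm0']
      field_simp
      ring

end

/-! ### Cancellation of the letter-independent part of the contractions -/

lemma expC_congr {R : Type*} [Ring R] [Algebra ℂ R] {a b : ℕ → R} (h : ∀ m, 0 < m → a m = b m) :
    expC a = expC b := by
  funext n
  rw [expC, expC]
  congr 3
  funext m
  split_ifs with hm
  · rfl
  · exact h m (Nat.pos_of_ne_zero hm)

/-- The coefficients of the logarithm of `∏ (1 - b z) / ∏ (1 - a z)`, or of the same function of
the inverse variables. -/
def ratC (D N : List ℂ) (e : ℤ) (m : ℕ) : ℂ := (psum D (e * m) - psum N (e * m)) / m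

/-- The exponent of the structure functions. -/
def fexp (X R : ℂ) (i j : ℕ) : ℂ :=
  -((R * X⁻¹ - R⁻¹ * X) * (R - R⁻¹) * (X ^ i - X⁻¹ ^ i) * (R * X * X⁻¹ ^ j - R⁻¹ * X⁻¹ * X ^ j) /
    ((X - X⁻¹) * (R * X - R⁻¹ * X⁻¹)))

/-- This invariance and `ffun_inv` let one computation serve both orders of the product. -/
lemma fexp_inv (X R : ℂ) (i j : ℕ) : fexp X⁻¹ R⁻¹ i j = fexp X R i j := by
  unfold fexp
  simp only [inv_inv]
  rw [show (X⁻¹ - X) * (R⁻¹ * X⁻¹ - R * X) = (X - X⁻¹) * (R * X - R⁻¹ * X⁻¹) by ring]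
  congr 2
  ring

lemma ffun_inv (X R : ℂ) : ffun X⁻¹ R⁻¹ = ffun X R := by
  unfold ffun
  simp only [inv_inv]
  rw [show R⁻¹ * X⁻¹ - R * X = -(R * X - R⁻¹ * X⁻¹) by ring, div_neg]
  rw [← neg_div]
  congr 1
  ring

lemma geoS_eq {Z : ℂ} (hZ : Z ≠ 1) (n : ℕ) : geoS Z n = (Z ^ n - 1) / (Z - 1) :=
  geom_sum_eq hZ n

/-- The second summand is the part of the contraction of words of lengths `i` and `j` that does not
depend on the letters, as it appears in `doubleChr_eq`. The identity explains the shape of f_{i,j}: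
only finitely many zeros and poles remain after the cancellation. With the geometric sums in closed
form it is a rational identity. -/
lemma fexp_add_eq_zero {X R : ℂ} (hX : X ≠ 0) (hR : R ≠ 0) (hX2 : X ^ 2 ≠ 1)
    (hRX : R ^ 2 * X ^ 2 ≠ 1) (i j : ℕ) :
    fexp X R i j + X ^ ((i : ℤ) - j) * geoS (X⁻¹ ^ 2) i * (chr1 X (R ^ 2) *
      (1 - geoS (X ^ 2) j) + ffun X R * geoS (X ^ 2) j) = 0 := by
  have hX2' : X⁻¹ ^ 2 ≠ 1 := by rwa [inv_pow, Ne, inv_eq_one]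
  have h1 : X ^ 2 - 1 ≠ 0 := sub_ne_zero.2 hX2
  have h1' : 1 - X ^ 2 ≠ 0 := sub_ne_zero.2 hX2.symm
  have h2 : R ^ 2 * X ^ 2 - 1 ≠ 0 := sub_ne_zero.2 hRX
  rw [geoS_eq hX2, geoS_eq hX2', fexp, ffun, chr1, zpow_sub₀ hX, zpow_natCast, zpow_natCast,
    ← pow_mul, ← pow_mul, mul_comm 2 i, mul_comm 2 j, pow_mul, pow_mul, inv_pow X i, inv_pow X j]
  have hxi : X ^ i ≠ 0 := pow_ne_zero _ hX
  have hxj : X ^ j ≠ 0 := pow_ne_zero _ hX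
  generalize X ^ i = I at *
  generalize X ^ j = J at *
  field_simp
  ring

section

variable (C : RealizationCase)

/-- The sum of the characters over all pairs of letters of two words. -/
def doubleChr (X T f : ℂ) (w' : List (Fin 3)) : ℂ → List (Fin 3) → ℂ
  | _, [] => 0
  | U, k :: w => U * (rowChr C X T k w' + f * geoS (X ^ 2) w'.length) +
      doubleChr X T f w' (X⁻¹ ^ 2 * U) w

lemma rowVal_eq {x t : ℂ} (e : ℤ) (u : ℂ) (k : Fin 3) (w : List (Fin 3)) :
    u ^ e * rowVal C (x ^ e) (t ^ e) k w =
      psum (rowDen C x u k w) e - psum (rowNum C x t u k w) e := by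
  unfold rowVal rowDen rowNum
  split_ifs
  · simp [psum]
  · simp only [psum, List.map_cons, List.map_nil, List.sum_cons, List.sum_nil, mul_zpow, inv_zpow]
    simp only [← zpow_mul, mul_comm e]
    ring

lemma doubleChr_eq {x t : ℂ} (hx : x ≠ 0) (f : ℂ) (e : ℤ) {w' : List (Fin 3)}
    (hw' : w'.Pairwise (rel C)) (u : ℂ) (w : List (Fin 3)) :
    doubleChr C (x ^ e) (t ^ e) f w' (u ^ e) w =
      psum (phiDen C x w' u w) e - psum (phiNum C x t w' u w) e +
        u ^ e * geoS ((x ^ e)⁻¹ ^ 2) w.length * (chr1 (x ^ e) (t ^ e) *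
          (1 - geoS ((x ^ e) ^ 2) w'.length) + f * geoS ((x ^ e) ^ 2) w'.length) := by
  induction w generalizing u with
  | nil => simp [doubleChr, phiDen, phiNum, psum, geoS]
  | cons k w ih =>
    have h := rowChr_eq C (zpow_ne_zero e hx) (t ^ e) k hw'
    have h2 := rowVal_eq C (x := x) (t := t) e u k w'
    have h3 : (x ^ e)⁻¹ ^ 2 * u ^ e = (x⁻¹ ^ 2 * u) ^ e := by
      rw [mul_zpow, ← inv_zpow, ← zpow_natCast, ← zpow_natCast, ← zpow_mul, ← zpow_mul, mul_comm e]
    rw [doubleChr, h3, ih, phiDen, phiNum, psum_append, psum_append, List.length_cons, geoS_succ,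
      ← h3]
    linear_combination u ^ e * h + h2

lemma sum_place_row {x : ℂ} (e : ℤ) (G : Fin 3 → ℂ) (g : ℂ) (k : Fin 3) (f T : ℂ)
    (hG : ∀ l, G l = chr C k l (x ^ e) T + f) (w : List (Fin 3)) (y : ℂ) :
    ((place x y w).map fun lc => G lc.1 * (g * lc.2 ^ e)).sum =
      g * y ^ e * (rowChr C (x ^ e) T k w + f * geoS ((x ^ e) ^ 2) w.length) := by
  induction w generalizing y with
  | nil => simp [place, rowChr, geoS]
  | cons l w ih =>
    rw [place, List.map_cons, List.sum_cons, ih, rowChr, List.length_cons, geoS_succ, hG]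
    simp only
    rw [mul_zpow, show (x ^ 2) ^ e = (x ^ e) ^ 2 by
      rw [← zpow_natCast, ← zpow_natCast, ← zpow_mul, ← zpow_mul, mul_comm]]
    ring

lemma sum_place_place {x : ℂ} (e : ℤ) (G : Fin 3 → Fin 3 → ℂ) (f T : ℂ)
    (hG : ∀ k l, G k l = chr C k l (x ^ e) T + f) (w w' : List (Fin 3)) (y y' : ℂ) :
    ((place x y w).map fun kc => ((place x y' w').map fun lc =>
        G kc.1 lc.1 * (kc.2 ^ (-e) * lc.2 ^ e)).sum).sum =
      doubleChr C (x ^ e) T f w' ((y⁻¹ * y') ^ e) w := by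
  induction w generalizing y with
  | nil => simp [place, doubleChr]
  | cons k w ih =>
    rw [place, List.map_cons, List.sum_cons, ih, doubleChr]
    simp only
    rw [sum_place_row C e (G k) _ k f T (hG k), mul_zpow y⁻¹, inv_zpow, zpow_neg]
    congr 2
    rw [mul_zpow, mul_inv, mul_zpow, inv_zpow y, inv_zpow (x ^ 2), inv_pow,
      show (x ^ 2) ^ e = (x ^ e) ^ 2 by
        rw [← zpow_natCast, ← zpow_natCast, ← zpow_mul, ← zpow_mul, mul_comm]]
    ring

end

lemma list_sum_comm {α β M : Type*} [AddCommMonoid M] (L : List α) (L' : List β)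
    (f : α → β → M) :
    (L.map fun a => (L'.map fun b => f a b).sum).sum =
      (L'.map fun b => (L.map fun a => f a b).sum).sum := by
  induction L with
  | nil => simp
  | cons a L ih => simp [ih, List.sum_map_add]

/-! ### Operator product expansions of two words -/

section

variable (C : RealizationCase) (r : ℝ) (ℓ : ℂ)

lemma fser_eq (hr : 1 < r) (h1 : ‖Complex.exp ℓ‖ < 1) (i j : ℕ) (hij : i ≤ j) :
    fser r ℓ i j = PowerSeries.mk (expC fun m : ℕ =>
      fexp (xpow ℓ m) (xpow ℓ (r * m)) i j / m) := by
  have hx := xdiff_ne_zero h1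
  have h : PowerSeries.mk (expC fun m : ℕ => fexp (xpow ℓ m) (xpow ℓ (r * m)) i j / m) =
      expSeries (PowerSeries.mk fun m : ℕ => if m = 0 then 0 else
        fexp (xpow ℓ m) (xpow ℓ (r * m)) i j / (m : ℂ)) := by
    ext n; rw [PowerSeries.coeff_mk]; rfl
  rw [h, fser]
  congr 2
  funext m
  split_ifs with hm
  · rfl
  rw [min_eq_left hij, max_eq_right hij, fexp]
  have hm0 : (m : ℝ) ≠ 0 := by exact_mod_cast hm
  have u1 : xpow ℓ ((r - 1) * m) = xpow ℓ (r * m) * (xpow ℓ m)⁻¹ := by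
    rw [sub_mul, one_mul, sub_eq_add_neg, xpow_add, xpow_neg]
  have u2 : xpow ℓ ((r + 1) * m) = xpow ℓ (r * m) * xpow ℓ m := by
    rw [add_mul, one_mul, xpow_add]
  have u3 : xpow ℓ ((r + 1 - j) * m) = xpow ℓ (r * m) * xpow ℓ m * (xpow ℓ m ^ j)⁻¹ := by
    rw [sub_mul, add_mul, one_mul, sub_eq_add_neg, xpow_add, xpow_add, xpow_neg, xpow_nat_mul]
  rw [qnum_eq _ ((r - 1) * m), qnum_eq _ (r * m), qnum_eq _ (i * m), qnum_eq _ ((r + 1 - j) * m),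
    qnum_eq _ (m : ℂ), qnum_eq _ ((r + 1) * m), u1, u2, u3, xpow_nat_mul ℓ i]
  have hX := xpow_sq_ne_one h1 hm0
  have hR := xpow_sq_ne_one h1 (a := (r + 1) * m) (mul_ne_zero (by linarith) hm0)
  push_cast at hX hR
  rw [u2] at hR
  have hX0 := xpow_ne_zero ℓ m
  have hR0 := xpow_ne_zero ℓ (r * m)
  have e1 := sub_inv_ne_zero hX0 hX
  have e2 := sub_inv_ne_zero (mul_ne_zero hR0 hX0) hR
  rw [mul_inv] at e2
  simp only [mul_inv, inv_inv, inv_pow]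
  generalize xpow ℓ m - (xpow ℓ m)⁻¹ = A at *
  generalize xpow ℓ (r * m) * xpow ℓ m - (xpow ℓ (r * m))⁻¹ * (xpow ℓ m)⁻¹ = B at *
  have hmc : (m : ℂ) ≠ 0 := by exact_mod_cast hm
  field_simp

lemma mk_expC_mul (a b : ℕ → ℂ) : PowerSeries.mk (expC a) * PowerSeries.mk (expC b) =
    PowerSeries.mk (expC fun m => a m + b m) := by
  ext n
  rw [PowerSeries.coeff_mk, expC_add (fun _ _ => Commute.all _ _) (fun _ _ => Commute.all _ _)
    (fun _ _ => Commute.all _ _), PowerSeries.coeff_mul]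
  simp only [PowerSeries.coeff_mk]

/-- The exponents of the operator product expansions. -/
lemma ope_exponent (hr : 1 < r) (h1 : ‖Complex.exp ℓ‖ < 1) {w w' : List (Fin 3)}
    (hw' : w'.Pairwise (rel C)) {m : ℕ} (hm : 0 < m) (ε : ℤ) (hε : ε = 1 ∨ ε = -1)
    (G : Fin 3 → Fin 3 → ℂ)
    (hG : ∀ k l, G k l = chr C k l (xpow ℓ m ^ ε) ((xpow ℓ (r * m) ^ 2) ^ ε) +
      ffun (xpow ℓ m) (xpow ℓ (r * m))) :
    fexp (xpow ℓ m) (xpow ℓ (r * m)) w.length w'.length +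
      ((spread (xpow ℓ 1) w).map fun kc => ((spread (xpow ℓ 1) w').map fun lc =>
        G kc.1 lc.1 * (kc.2 ^ (-(ε * m : ℤ)) * lc.2 ^ (ε * m : ℤ))).sum).sum =
    psum (phiDen C (xpow ℓ 1) w' (xpow ℓ 1 ^ ((w.length : ℤ) - w'.length)) w) (ε * m) -
      psum (phiNum C (xpow ℓ 1) (xpow ℓ (2 * r)) w'
        (xpow ℓ 1 ^ ((w.length : ℤ) - w'.length)) w) (ε * m) := by
  have hx := xpow_ne_zero ℓ 1
  have hm0 : (m : ℝ) ≠ 0 := by exact_mod_cast hm.ne'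
  have hXm : xpow ℓ m = xpow ℓ 1 ^ (m : ℤ) := by rw [zpow_natCast, ← xpow_nat_mul, mul_one]
  have hTm : xpow ℓ (r * m) ^ 2 = xpow ℓ (2 * r) ^ (m : ℤ) := by
    rw [zpow_natCast, ← xpow_nat_mul, ← xpow_nat_mul]
    congr 1
    push_cast
    ring
  have hX : xpow ℓ m ^ ε = xpow ℓ 1 ^ (ε * m : ℤ) := by rw [hXm, ← zpow_mul, mul_comm]
  have hT : (xpow ℓ (r * m) ^ 2) ^ ε = xpow ℓ (2 * r) ^ (ε * m : ℤ) := by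
    rw [hTm, ← zpow_mul, mul_comm (m : ℤ)]
  have hX0 := xpow_ne_zero ℓ m
  have hR0 := xpow_ne_zero ℓ (r * m)
  have hX2 := xpow_sq_ne_one h1 hm0
  have hRX := xpow_sq_ne_one h1 (a := (r + 1) * m) (mul_ne_zero (by linarith) hm0)
  push_cast at hX2 hRX
  rw [add_mul, one_mul, xpow_add, mul_pow] at hRX
  -- The sign `ε = -1` stands for the opposite order. The cancellation is applied to the inverted
  -- variables, and the invariance of `fexp` and `ffun` then removes `ε` from these two functions.
  have key : fexp (xpow ℓ m ^ ε) (xpow ℓ (r * m) ^ ε) w.length w'.length +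
      (xpow ℓ m ^ ε) ^ ((w.length : ℤ) - w'.length) * geoS ((xpow ℓ m ^ ε)⁻¹ ^ 2) w.length *
        (chr1 (xpow ℓ m ^ ε) ((xpow ℓ (r * m) ^ ε) ^ 2) *
      (1 - geoS ((xpow ℓ m ^ ε) ^ 2) w'.length) + ffun (xpow ℓ m ^ ε) (xpow ℓ (r * m) ^ ε) *
        geoS ((xpow ℓ m ^ ε) ^ 2) w'.length) = 0 := by
    refine fexp_add_eq_zero (zpow_ne_zero _ hX0) (zpow_ne_zero _ hR0) ?_ ?_ _ _
    · rcases hε with rfl | rfl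
      · rwa [zpow_one]
      · rwa [zpow_neg_one, inv_pow, Ne, inv_eq_one]
    · rcases hε with rfl | rfl
      · rwa [zpow_one, zpow_one]
      · rwa [zpow_neg_one, zpow_neg_one, inv_pow, inv_pow, ← mul_inv, Ne, inv_eq_one]
  have hf1 : fexp (xpow ℓ m ^ ε) (xpow ℓ (r * m) ^ ε) w.length w'.length =
      fexp (xpow ℓ m) (xpow ℓ (r * m)) w.length w'.length := by
    rcases hε with rfl | rfl
    · rw [zpow_one, zpow_one]
    · rw [zpow_neg_one, zpow_neg_one, fexp_inv]
  have hf2 : ffun (xpow ℓ m ^ ε) (xpow ℓ (r * m) ^ ε) = ffun (xpow ℓ m) (xpow ℓ (r * m)) := by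
    rcases hε with rfl | rfl
    · rw [zpow_one, zpow_one]
    · rw [zpow_neg_one, zpow_neg_one, ffun_inv]
  have hTT : (xpow ℓ (r * m) ^ ε) ^ 2 = (xpow ℓ (r * m) ^ 2) ^ ε := by
    rw [← zpow_natCast, ← zpow_natCast, ← zpow_mul, ← zpow_mul, mul_comm ε]
  rw [hf1, hf2, hTT, hT, hX] at key
  rw [hT, hX] at hG
  rw [spread_eq_place hx, spread_eq_place hx, sum_place_place C _ G _ _ hG]
  have hU : (xpow ℓ 1 ^ (1 - (w.length : ℤ)))⁻¹ * xpow ℓ 1 ^ (1 - (w'.length : ℤ)) =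
      xpow ℓ 1 ^ ((w.length : ℤ) - w'.length) := by
    rw [← zpow_neg, ← zpow_add₀ hx]
    congr 1
    ring
  rw [hU, doubleChr_eq C hx _ _ hw', ← zpow_mul, mul_comm ((w.length : ℤ) - w'.length), zpow_mul]
  linear_combination key

/-- The operator product expansion of two words. -/
lemma ope (hr : 1 < r) (h1 : ‖Complex.exp ℓ‖ < 1) {w w' : List (Fin 3)}
    (hw' : w'.Pairwise (rel C)) (hle : w.length ≤ w'.length) :
    fser r ℓ w.length w'.length *
        PowerSeries.mk (expC (contrW C r ℓ (spread (xpow ℓ 1) w) (spread (xpow ℓ 1) w'))) =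
      PowerSeries.mk (expC (ratC
        (phiDen C (xpow ℓ 1) w' (xpow ℓ 1 ^ ((w.length : ℤ) - w'.length)) w)
        (phiNum C (xpow ℓ 1) (xpow ℓ (2 * r)) w'
          (xpow ℓ 1 ^ ((w.length : ℤ) - w'.length)) w) 1)) := by
  rw [fser_eq r ℓ hr h1 _ _ hle, mk_expC_mul]
  congr 1
  refine expC_congr fun m hm => ?_
  rw [ratC, ← ope_exponent C r ℓ hr h1 hw' hm 1 (Or.inl rfl) (fun k l => contr C r ℓ k l m)
    (fun k l => by rw [zpow_one, zpow_one, contr_eq C r ℓ hr h1 k l hm]), add_div, contrW]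
  congr 1
  simp only [div_eq_mul_inv, one_mul, List.sum_map_mul_right]

/-- The operator product expansion of two words, in the opposite order. -/
lemma ope_swap (hr : 1 < r) (h1 : ‖Complex.exp ℓ‖ < 1) {w w' : List (Fin 3)}
    (hw' : w'.Pairwise (rel C)) (hle : w.length ≤ w'.length) :
    fser r ℓ w'.length w.length *
        PowerSeries.mk (expC (contrW C r ℓ (spread (xpow ℓ 1) w') (spread (xpow ℓ 1) w))) =
      PowerSeries.mk (expC (ratC
        (phiDen C (xpow ℓ 1) w' (xpow ℓ 1 ^ ((w.length : ℤ) - w'.length)) w)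
        (phiNum C (xpow ℓ 1) (xpow ℓ (2 * r)) w'
          (xpow ℓ 1 ^ ((w.length : ℤ) - w'.length)) w) (-1))) := by
  have hs : fser r ℓ w'.length w.length = fser r ℓ w.length w'.length := by
    rw [fser, fser, min_comm, max_comm]
  rw [hs, fser_eq r ℓ hr h1 _ _ hle, mk_expC_mul]
  congr 1
  refine expC_congr fun m hm => ?_
  rw [ratC, ← ope_exponent C r ℓ hr h1 hw' hm (-1) (Or.inr rfl) (fun k l => contr C r ℓ l k m)
    (fun k l => by
      rw [zpow_neg_one, zpow_neg_one, contr_eq C r ℓ hr h1 l k hm, ← chr_inv]), add_div, contrW,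
    list_sum_comm]
  congr 1
  simp only [div_eq_mul_inv, neg_mul, one_mul, neg_neg, List.sum_map_mul_right]
  congr 3
  funext kc
  congr 2
  funext lc
  ring

end

/-! ### Laurent expansions at zero and at infinity -/

section Sequences

variable {E : Type*} [AddCommGroup E] [Module ℂ E]

/-- The shift of sequences, which corresponds to the multiplication by the variable. -/
def shift : Module.End ℂ (ℤ → E) := LinearMap.funLeft ℂ E fun p => p - 1

lemma shift_apply (c : ℤ → E) (p : ℤ) : shift c p = c (p - 1) := rfl

lemma shift_pow_apply (k : ℕ) (c : ℤ → E) (p : ℤ) : (shift ^ k) c p = c (p - k) := by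
  induction k generalizing p with
  | zero => simp
  | succ k ih =>
    rw [pow_succ', Module.End.mul_apply, shift_apply, ih]
    congr 1
    push_cast
    ring

lemma aeval_shift_apply (P : Polynomial ℂ) (c : ℤ → E) (p : ℤ) :
    Polynomial.aeval shift P c p =
      ∑ k ∈ Finset.range (P.natDegree + 1), P.coeff k • c (p - k) := by
  rw [Polynomial.aeval_eq_sum_range, LinearMap.sum_apply, Finset.sum_apply]
  exact Finset.sum_congr rfl fun k _ => by
    rw [LinearMap.smul_apply, Pi.smul_apply, shift_pow_apply]

/-- The polynomial `1 - a z`. -/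
def lin (a : ℂ) : Polynomial ℂ := 1 - Polynomial.C a * Polynomial.X

lemma eval_lin (a z : ℂ) : (lin a).eval z = 1 - a * z := by simp [lin]

lemma aeval_lin (a : ℂ) (c : ℤ → E) (p : ℤ) :
    Polynomial.aeval shift (lin a) c p = c p - a • c (p - 1) := by
  rw [lin, map_sub, map_one, map_mul, Polynomial.aeval_C, Polynomial.aeval_X, LinearMap.sub_apply,
    Pi.sub_apply, Module.End.one_apply, Module.End.mul_apply, Module.algebraMap_end_apply,
    Pi.smul_apply, shift_apply]

/-- The polynomial `∏ (1 - a z)`. -/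
def polyL (D : List ℂ) : Polynomial ℂ := (D.map lin).prod

lemma polyL_cons (a : ℂ) (D : List ℂ) : polyL (a :: D) = lin a * polyL D := rfl

lemma polyL_append (D D' : List ℂ) : polyL (D ++ D') = polyL D * polyL D' := by
  rw [polyL, List.map_append, List.prod_append]; rfl

lemma aeval_polyL_cons (a : ℂ) (D : List ℂ) (c : ℤ → E) (p : ℤ) :
    Polynomial.aeval shift (polyL (a :: D)) c p =
      Polynomial.aeval shift (polyL D) c p - a • Polynomial.aeval shift (polyL D) c (p - 1) := by
  rw [polyL_cons, map_mul, Module.End.mul_apply, aeval_lin]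

/-- The value of a Laurent polynomial. -/
def ev (ζ : ℂ) : (ℤ →₀ E) →ₗ[ℂ] E := Finsupp.lsum ℂ fun p => ζ ^ p • LinearMap.id

lemma ev_apply (ζ : ℂ) (s : ℤ →₀ E) : ev ζ s = s.sum fun p u => ζ ^ p • u := by
  rw [ev, Finsupp.lsum_apply]; rfl

lemma ev_single (ζ : ℂ) (p : ℤ) (u : E) : ev ζ (Finsupp.single p u) = ζ ^ p • u := by
  rw [ev, Finsupp.lsum_single]; rfl

/-- The multiplication by a polynomial preserves Laurent polynomials. -/
lemma exists_aeval_finsupp (P : Polynomial ℂ) (s : ℤ →₀ E) : ∃ s' : ℤ →₀ E,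
    ⇑s' = Polynomial.aeval shift P ⇑s ∧ ∀ ζ, ζ ≠ 0 → ev ζ s' = P.eval ζ • ev ζ s := by
  induction P using Polynomial.induction_on generalizing s with
  | C a =>
    refine ⟨a • s, ?_, fun ζ _ => by rw [map_smul, Polynomial.eval_C]⟩
    funext p
    simp
  | add P Q hP hQ =>
    obtain ⟨s₁, h₁, h₁'⟩ := hP s
    obtain ⟨s₂, h₂, h₂'⟩ := hQ s
    refine ⟨s₁ + s₂, ?_, fun ζ hζ => by rw [map_add, h₁' ζ hζ, h₂' ζ hζ, Polynomial.eval_add,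
      add_smul]⟩
    rw [map_add, LinearMap.add_apply, ← h₁, ← h₂]
    rfl
  | monomial n a ih =>
    obtain ⟨s₁, h₁, h₁'⟩ := ih s
    refine ⟨s₁.mapDomain fun p => p + 1, ?_, fun ζ hζ => ?_⟩
    · rw [pow_succ, ← mul_assoc, mul_comm, map_mul, Polynomial.aeval_X, Module.End.mul_apply, ← h₁]
      funext p
      rw [shift_apply]
      have := Finsupp.mapDomain_apply (f := fun p : ℤ => p + 1) (add_left_injective 1) s₁ (p - 1)
      simpa using this
    · rw [pow_succ, ← mul_assoc, Polynomial.eval_mul_X, mul_comm, mul_smul, ← h₁' ζ hζ, ev_apply,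
        Finsupp.sum_mapDomain_index (fun _ => smul_zero _) (fun _ _ _ => smul_add _ _ _), ev_apply,
        Finsupp.smul_sum]
      refine Finsupp.sum_congr fun p _ => ?_
      rw [zpow_add_one₀ hζ, smul_smul, mul_comm]

/-- Laurent polynomials that agree at infinitely many points are equal. -/
lemma finsupp_eq_of_ev {s t : ℤ →₀ E} {Z : Set ℂ} (hZ : Z.Infinite)
    (h : ∀ ζ ∈ Z, ζ ≠ 0 → ev ζ s = ev ζ t) : s = t := by
  classical
  rw [← sub_eq_zero]
  have h' : ∀ ζ ∈ Z, ζ ≠ 0 → ev ζ (s - t) = 0 := fun ζ h1 h2 => by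
    rw [map_sub, h ζ h1 h2, sub_self]
  generalize s - t = s at h'
  ext q
  rw [Finsupp.zero_apply, ← Module.forall_dual_apply_eq_zero_iff ℂ]
  intro φ
  obtain ⟨B, hB⟩ : ∃ B : ℕ, ∀ p ∈ s.support, -(B : ℤ) ≤ p := by
    refine ⟨s.support.sup Int.natAbs, fun p hp => ?_⟩
    have := Finset.le_sup (f := Int.natAbs) hp
    omega
  set P : Polynomial ℂ := ∑ p ∈ s.support, Polynomial.monomial (p + B).toNat (φ (s p)) with hP
  have hPe : ∀ ζ, ζ ≠ 0 → P.eval ζ = ζ ^ (B : ℤ) * φ (ev ζ s) := by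
    intro ζ hζ
    rw [hP, Polynomial.eval_finsetSum, ev_apply, Finsupp.sum, map_sum, Finset.mul_sum]
    refine Finset.sum_congr rfl fun p hp => ?_
    have := hB p hp
    rw [Polynomial.eval_monomial, map_smul, smul_eq_mul, ← mul_assoc, ← zpow_add₀ hζ,
      ← zpow_natCast, Int.toNat_of_nonneg (by omega), mul_comm, add_comm]
  have hP0 : P = 0 := by
    refine Polynomial.eq_zero_of_infinite_isRoot P ?_
    refine (hZ.sdiff (Set.finite_singleton (0 : ℂ))).mono fun ζ hζ => ?_
    have hne : ζ ≠ 0 := hζ.2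
    rw [Set.mem_ofPred_eq, Polynomial.IsRoot.def, hPe ζ hne, h' ζ hζ.1 hne, map_zero, mul_zero]
  by_cases hq : q ∈ s.support
  · have h1 : P.coeff (q + B).toNat = φ (s q) := by
      rw [hP, Polynomial.finsetSum_coeff, Finset.sum_eq_single q]
      · rw [Polynomial.coeff_monomial, if_pos rfl]
      · intro p hp hpq
        have := hB p hp
        have := hB q hq
        rw [Polynomial.coeff_monomial, if_neg (by omega)]
      · intro h; exact absurd hq h
    rw [← h1, hP0, Polynomial.coeff_zero]
  · rw [Finsupp.notMem_support_iff.1 hq, map_zero]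

/-- Such sequences are the coefficients of expansions at ζ = 0. -/
def BddBelowSeq (c : ℤ → E) : Prop := ∃ B : ℤ, ∀ p < B, c p = 0

/-- Such sequences are the coefficients of expansions at ζ = ∞. -/
def BddAboveSeq (c : ℤ → E) : Prop := ∃ B : ℤ, ∀ p > B, c p = 0

lemma BddBelowSeq.aeval {c : ℤ → E} (h : BddBelowSeq c) (P : Polynomial ℂ) :
    BddBelowSeq (Polynomial.aeval shift P c) := by
  obtain ⟨B, hB⟩ := h
  refine ⟨B, fun p hp => ?_⟩
  rw [aeval_shift_apply]
  exact Finset.sum_eq_zero fun k _ => by rw [hB _ (by omega), smul_zero]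

lemma BddAboveSeq.aeval {c : ℤ → E} (h : BddAboveSeq c) (P : Polynomial ℂ) :
    BddAboveSeq (Polynomial.aeval shift P c) := by
  obtain ⟨B, hB⟩ := h
  refine ⟨B + P.natDegree, fun p hp => ?_⟩
  rw [aeval_shift_apply]
  refine Finset.sum_eq_zero fun k hk => ?_
  rw [Finset.mem_range] at hk
  rw [hB _ (by omega), smul_zero]

lemma BddBelowSeq.sub {c d : ℤ → E} (hc : BddBelowSeq c) (hd : BddBelowSeq d) :
    BddBelowSeq (c - d) := by
  obtain ⟨B, hB⟩ := hc
  obtain ⟨B', hB'⟩ := hd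
  exact ⟨min B B', fun p hp => by
    rw [Pi.sub_apply, hB p (lt_of_lt_of_le hp (min_le_left _ _)),
      hB' p (lt_of_lt_of_le hp (min_le_right _ _)), sub_zero]⟩

lemma BddAboveSeq.sub {c d : ℤ → E} (hc : BddAboveSeq c) (hd : BddAboveSeq d) :
    BddAboveSeq (c - d) := by
  obtain ⟨B, hB⟩ := hc
  obtain ⟨B', hB'⟩ := hd
  exact ⟨max B B', fun p hp => by
    rw [Pi.sub_apply, hB p (lt_of_le_of_lt (le_max_left _ _) hp),
      hB' p (lt_of_le_of_lt (le_max_right _ _) hp), sub_zero]⟩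

lemma bddBelowSeq_finsupp (s : ℤ →₀ E) : BddBelowSeq ⇑s := by
  refine ⟨-(s.support.sup Int.natAbs : ℕ), fun p hp => ?_⟩
  by_contra h
  have := Finset.le_sup (f := Int.natAbs) (Finsupp.mem_support_iff.2 h)
  omega

lemma bddAboveSeq_finsupp (s : ℤ →₀ E) : BddAboveSeq ⇑s := by
  refine ⟨(s.support.sup Int.natAbs : ℕ), fun p hp => ?_⟩
  by_contra h
  have := Finset.le_sup (f := Int.natAbs) (Finsupp.mem_support_iff.2 h)
  omega

/-- The factors have constant term 1, so the vanishing of the coefficients propagates upwards from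
the lower bound. Without boundedness the statement fails: a delta function is killed by a linear
factor. -/
lemma BddBelowSeq.eq_zero {c : ℤ → E} (hc : BddBelowSeq c) (D : List ℂ)
    (h : Polynomial.aeval shift (polyL D) c = 0) : c = 0 := by
  induction D with
  | nil => simpa [polyL] using h
  | cons a D ih =>
    refine ih ?_
    obtain ⟨B, hB⟩ := hc.aeval (polyL D)
    have h1 : ∀ n : ℕ, ∀ p : ℤ, p < B + n → Polynomial.aeval shift (polyL D) c p = 0 := by
      intro n
      induction n with
      | zero => intro p hp; exact hB p (by simpa using hp)
      | succ n ihn =>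
        intro p hp
        have h2 := congrFun h p
        rw [aeval_polyL_cons, ihn (p - 1) (by push_cast at hp; omega), smul_zero, sub_zero] at h2
        exact h2
    funext p
    exact h1 (p - B + 1).toNat p (by omega)

/-- The vanishing propagates downwards from the upper bound. Each step divides by the leading
coefficient of a linear factor, hence the condition on `D`. -/
lemma BddAboveSeq.eq_zero {c : ℤ → E} (hc : BddAboveSeq c) (D : List ℂ) (hD : ∀ a ∈ D, a ≠ 0)
    (h : Polynomial.aeval shift (polyL D) c = 0) : c = 0 := by
  induction D with
  | nil => simpa [polyL] using h
  | cons a D ih =>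
    refine ih (fun b hb => hD b (by simp [hb])) ?_
    obtain ⟨B, hB⟩ := hc.aeval (polyL D)
    have h1 : ∀ n : ℕ, ∀ p : ℤ, B - n < p → Polynomial.aeval shift (polyL D) c p = 0 := by
      intro n
      induction n with
      | zero => intro p hp; exact hB p (by simpa using hp)
      | succ n ihn =>
        intro p hp
        have h2 := congrFun h (p + 1)
        rw [aeval_polyL_cons, ihn (p + 1) (by push_cast at hp; omega), zero_sub, add_sub_cancel_right,
          Pi.zero_apply, neg_eq_zero, smul_eq_zero] at h2
        exact h2.resolve_left (hD a (by simp))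
    funext p
    exact h1 (B - p + 1).toNat p (by omega)

/-- The expansions of `M(ζ) / (1 - a ζ)` at zero and at infinity differ by a delta function. -/
lemma sub_eq_of_lin {a : ℂ} (ha : a ≠ 0) {c c' : ℤ → E} {M : ℤ →₀ E} (hc : BddBelowSeq c)
    (hc' : BddAboveSeq c') (h : Polynomial.aeval shift (lin a) c = M)
    (h' : Polynomial.aeval shift (lin a) c' = M) (p : ℤ) : c p - c' p = a ^ p • ev a⁻¹ M := by
  obtain ⟨B, hB⟩ := hc
  obtain ⟨B', hB'⟩ := hc'
  obtain ⟨A, hA⟩ := bddBelowSeq_finsupp M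
  obtain ⟨A', hA'⟩ := bddAboveSeq_finsupp M
  have hrec : ∀ q, c q = M q + a • c (q - 1) := fun q => by
    rw [← h, aeval_lin, sub_add_cancel]
  have hrec' : ∀ q, c' q = M q + a • c' (q - 1) := fun q => by
    rw [← h', aeval_lin, sub_add_cancel]
  -- The difference is annihilated by 1 - a·shift, so after rescaling by `a ^ (-q)` it is constant.
  -- The constant is read off at a large index, where `c'` vanishes and `c` is a partial sum that
  -- has reached the whole value of `M` at `a⁻¹`.
  have hstep : ∀ q, a ^ (-q) • (c q - c' q) = a ^ (-(q - 1)) • (c (q - 1) - c' (q - 1)) := by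
    intro q
    rw [hrec q, hrec' q, add_sub_add_left_eq_sub, ← smul_sub, smul_smul, ← zpow_add_one₀ ha]
    congr 2
    ring
  have hconst : ∀ q, a ^ (-q) • (c q - c' q) = a ^ (-(0 : ℤ)) • (c 0 - c' 0) := by
    intro q
    induction q using Int.induction_on with
    | zero => rfl
    | succ n ih => rw [hstep, add_sub_cancel_right, ih]
    | pred n ih => rw [← ih, hstep (-(n : ℤ))]
  set K : ℤ := min B A - 1
  have hsum : ∀ n : ℕ, a ^ (-(K + n)) • c (K + n) =
      ∑ q ∈ Finset.Icc (K + 1) (K + n), a ^ (-q) • M q := by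
    intro n
    induction n with
    | zero =>
      rw [hB _ (by simp only [K]; push_cast; have := min_le_left B A; omega), smul_zero,
        Finset.Icc_eq_empty (by push_cast; omega), Finset.sum_empty]
    | succ n ih =>
      have : Finset.Icc (K + 1) (K + (n + 1 : ℕ)) =
          insert (K + (n + 1 : ℕ)) (Finset.Icc (K + 1) (K + n)) := by
        ext q; simp only [Finset.mem_insert, Finset.mem_Icc]; push_cast; omega
      rw [this, Finset.sum_insert (by simp), ← ih, hrec, smul_add, smul_smul, ← zpow_add_one₀ ha]
      congr 2
      · congr 1; push_cast; ring
      · congr 1; push_cast; ring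
  obtain ⟨n, hn⟩ : ∃ n : ℕ, max A' B' < K + n := ⟨(max A' B' - K + 1).toNat, by omega⟩
  have hev : ev a⁻¹ M = ∑ q ∈ Finset.Icc (K + 1) (K + n), a ^ (-q) • M q := by
    rw [ev_apply, Finsupp.sum_of_support_subset (s := Finset.Icc (K + 1) (K + n))]
    · exact Finset.sum_congr rfl fun q _ => by rw [inv_zpow, zpow_neg]
    · intro q hq
      rw [Finsupp.mem_support_iff] at hq
      have h1 : A ≤ q := not_lt.1 fun h => hq (hA q h)
      have h2 : q ≤ A' := not_lt.1 fun h => hq (hA' q h)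
      have h3 := min_le_right B A
      have h4 := le_max_left A' B'
      rw [Finset.mem_Icc]
      constructor
      · simp only [K]; omega
      · omega
    · intro q _; rw [smul_zero]
  have hp := hconst p
  rw [← hconst (K + n), hB' (K + n) (lt_of_le_of_lt (le_max_right _ _) hn), sub_zero, hsum n, ← hev]
    at hp
  rw [← hp, smul_smul, ← zpow_add₀ ha, add_neg_cancel, zpow_zero, one_smul]

/-- The expansions of `M(ζ) / ∏ (1 - a ζ)` at zero and at infinity differ by a sum of delta
functions. -/
lemma sub_eq_sum {s : Finset ℂ} (hs : s.Nonempty) (h0 : ∀ a ∈ s, a ≠ 0) {c c' : ℤ → E}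
    {M : ℤ →₀ E} (hc : BddBelowSeq c) (hc' : BddAboveSeq c')
    (h : Polynomial.aeval shift (∏ a ∈ s, lin a) c = M)
    (h' : Polynomial.aeval shift (∏ a ∈ s, lin a) c' = M) (p : ℤ) :
    c p - c' p = ∑ a ∈ s, (a ^ p * (∏ b ∈ s.erase a, (1 - b * a⁻¹))⁻¹) • ev a⁻¹ M := by
  classical
  -- This is the partial fraction decomposition of 1 over the product, in the form of the sum of the
  -- Lagrange basis at the nodes `a⁻¹`. It reduces the claim to one pole at a time.
  have hL : ∑ a ∈ s, Polynomial.C (∏ b ∈ s.erase a, (1 - b * a⁻¹))⁻¹ *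
      ∏ b ∈ s.erase a, lin b = 1 := by
    rw [← Lagrange.sum_basis (s := s) (v := fun a => a⁻¹) (inv_injective.injOn) hs]
    refine Finset.sum_congr rfl fun a ha => ?_
    rw [Lagrange.basis, ← Finset.prod_inv_distrib, map_prod, ← Finset.prod_mul_distrib]
    refine Finset.prod_congr rfl fun b hb => ?_
    have ha0 := h0 a ha
    have hb0 := h0 b (Finset.mem_of_mem_erase hb)
    have hne : b ≠ a := Finset.ne_of_mem_erase hb
    have hne' : a - b ≠ 0 := sub_ne_zero.2 hne.symm
    have hne'' : b - a ≠ 0 := sub_ne_zero.2 hne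
    rw [Lagrange.basisDivisor, lin]
    have e1 : (1 - b * a⁻¹)⁻¹ = -((a⁻¹ - b⁻¹)⁻¹ * b⁻¹) := by
      have : a⁻¹ - b⁻¹ ≠ 0 := by
        rw [sub_ne_zero]; exact fun h => hne (inv_injective h).symm
      have h3 : 1 - b * a⁻¹ = -(b * (a⁻¹ - b⁻¹)) := by field_simp; ring
      rw [h3, inv_neg, mul_inv, mul_comm]
    rw [e1, map_neg, map_mul]
    have e2 : Polynomial.C b⁻¹ * Polynomial.C b = (1 : Polynomial ℂ) := by
      rw [← map_mul, inv_mul_cancel₀ hb0, map_one]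
    linear_combination (Polynomial.C (a⁻¹ - b⁻¹)⁻¹ * Polynomial.X) * e2
  have key : ∀ d : ℤ → E, d = ∑ a ∈ s, (∏ b ∈ s.erase a, (1 - b * a⁻¹))⁻¹ •
      Polynomial.aeval shift (∏ b ∈ s.erase a, lin b) d := by
    intro d
    have h1 := congrArg (fun P => Polynomial.aeval (shift (E := E)) P d) hL
    simp only [map_sum, map_mul, Polynomial.aeval_C, LinearMap.sum_apply, Module.End.mul_apply,
      Module.algebraMap_end_apply, map_one, Module.End.one_apply] at h1
    exact h1.symm
  rw [key c, key c', Finset.sum_apply, Finset.sum_apply, ← Finset.sum_sub_distrib]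
  refine Finset.sum_congr rfl fun a ha => ?_
  have hmul : ∀ d : ℤ → E, Polynomial.aeval shift (lin a)
      (Polynomial.aeval shift (∏ b ∈ s.erase a, lin b) d) =
        Polynomial.aeval shift (∏ a ∈ s, lin a) d := by
    intro d
    rw [← Finset.mul_prod_erase s _ ha, map_mul, Module.End.mul_apply]
  have h2 := sub_eq_of_lin (h0 a ha) (hc.aeval (∏ b ∈ s.erase a, lin b))
    (hc'.aeval (∏ b ∈ s.erase a, lin b)) ((hmul c).trans h) ((hmul c').trans h') p
  rw [Pi.smul_apply, Pi.smul_apply, ← smul_sub, h2, smul_smul, mul_comm]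

end Sequences

/-! ### The two expansions of a rational scalar function -/

section Sequences

open Finset.HasAntidiagonal

/-- The coefficients of a power series, indexed by the integers. -/
def extS (f : PowerSeries ℂ) (p : ℤ) : ℂ := if 0 ≤ p then PowerSeries.coeff p.toNat f else 0

lemma extS_natCast (f : PowerSeries ℂ) (n : ℕ) : extS f n = PowerSeries.coeff n f := by
  rw [extS, if_pos (by omega), Int.toNat_natCast]

lemma extS_neg (f : PowerSeries ℂ) {p : ℤ} (h : p < 0) : extS f p = 0 := if_neg (by omega)

lemma extS_one (p : ℤ) : extS 1 p = if p = 0 then 1 else 0 := by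
  rw [extS, PowerSeries.coeff_one]
  split_ifs <;> first | rfl | omega

lemma aeval_extS (D : List ℂ) (f : PowerSeries ℂ) :
    Polynomial.aeval shift (polyL D) (extS f) = extS ((polyL D : PowerSeries ℂ) * f) := by
  induction D with
  | nil => simp [polyL]
  | cons a D ih =>
    funext p
    rw [aeval_polyL_cons, ih, polyL_cons, Polynomial.coe_mul, mul_assoc]
    generalize (polyL D : PowerSeries ℂ) * f = g
    rw [lin, Polynomial.coe_sub, Polynomial.coe_mul, Polynomial.coe_C, Polynomial.coe_X,
      Polynomial.coe_one, sub_mul, one_mul, mul_assoc, smul_eq_mul]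
    rcases lt_or_ge p 0 with hp | hp
    · rw [extS_neg _ hp, extS_neg _ hp, extS_neg _ (by omega)]; ring
    · obtain ⟨n, rfl⟩ := Int.eq_ofNat_of_zero_le hp
      rw [extS_natCast, extS_natCast, map_sub, PowerSeries.coeff_C_mul]
      rcases n with _ | n
      · rw [extS_neg _ (by simp)]; simp
      · rw [PowerSeries.coeff_succ_X_mul]
        push_cast
        rw [add_sub_cancel_right, extS_natCast]

/-- The exponential of -log(1 - az) is the geometric series. It satisfies the recursion of
`expC_unique`. -/
lemma lin_mul_expC (a : ℂ) :
    (lin a : PowerSeries ℂ) * PowerSeries.mk (expC fun m : ℕ => a ^ m / m) = 1 := by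
  have h : (fun n : ℕ => a ^ n) = expC fun m : ℕ => a ^ m / m := by
    refine expC_unique (fun _ _ => Commute.all _ _) (pow_zero a) fun n => ?_
    have h1 : ∀ p ∈ antidiagonal n, (p.1 : ℂ) • (a ^ p.1 / p.1 * a ^ p.2) =
        if p.1 = 0 then 0 else a ^ n := by
      intro p hp
      rw [mem_antidiagonal] at hp
      split_ifs with h0
      · simp [h0]
      · have : (p.1 : ℂ) ≠ 0 := by exact_mod_cast h0
        rw [smul_eq_mul, ← hp, pow_add]
        field_simp
    rw [Finset.sum_congr rfl h1, Finset.Nat.sum_antidiagonal_eq_sum_range_succ_mk]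
    rw [Finset.sum_range_succ']
    simp
  rw [← h, lin, Polynomial.coe_sub, Polynomial.coe_mul, Polynomial.coe_C, Polynomial.coe_X,
    Polynomial.coe_one, sub_mul, one_mul, mul_assoc]
  ext n
  rw [map_sub, PowerSeries.coeff_C_mul]
  rcases n with _ | n
  · simp
  · rw [PowerSeries.coeff_succ_X_mul, PowerSeries.coeff_mk, PowerSeries.coeff_mk,
      PowerSeries.coeff_one, if_neg (Nat.succ_ne_zero n)]
    ring

lemma polyL_mul_expC (D : List ℂ) :
    (polyL D : PowerSeries ℂ) * PowerSeries.mk (expC fun m : ℕ => psum D m / m) = 1 := by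
  induction D with
  | nil =>
    rw [show (fun m : ℕ => psum [] m / (m : ℂ)) = fun _ => 0 by funext; simp [psum]]
    have : PowerSeries.mk (expC fun _ : ℕ => (0 : ℂ)) = 1 := by
      ext n
      rw [PowerSeries.coeff_mk, expC_zero_fun, PowerSeries.coeff_one]
    rw [this]
    simp [polyL]
  | cons a D ih =>
    have : PowerSeries.mk (expC fun m : ℕ => psum (a :: D) m / (m : ℂ)) =
        PowerSeries.mk (expC fun m : ℕ => a ^ m / m) *
          PowerSeries.mk (expC fun m : ℕ => psum D m / m) := by
      rw [mk_expC_mul]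
      congr 2
      funext m
      rw [psum, List.map_cons, List.sum_cons, zpow_natCast, add_div]
      rfl
    rw [this, polyL_cons, Polynomial.coe_mul, mul_mul_mul_comm, lin_mul_expC, one_mul, ih]

lemma polyL_mul_ratC (D N : List ℂ) (e : ℤ) :
    (polyL (D.map (· ^ e)) : PowerSeries ℂ) * PowerSeries.mk (expC (ratC D N e)) =
      (polyL (N.map (· ^ e)) : PowerSeries ℂ) := by
  have h1 : ∀ L : List ℂ, ∀ m : ℕ, psum (L.map (· ^ e)) m = psum L (e * m) := by
    intro L m
    rw [psum, psum, List.map_map]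
    congr 2
    funext a
    simp [zpow_mul]
  have h2 : PowerSeries.mk (expC (ratC D N e)) *
      PowerSeries.mk (expC fun m : ℕ => psum (N.map (· ^ e)) m / m) =
        PowerSeries.mk (expC fun m : ℕ => psum (D.map (· ^ e)) m / m) := by
    rw [mk_expC_mul]
    congr 2
    funext m
    rw [ratC, h1, h1]
    ring
  have h3 := polyL_mul_expC (D.map (· ^ e))
  have h4 := polyL_mul_expC (N.map (· ^ e))
  rw [← h2] at h3
  linear_combination (polyL (N.map (· ^ e)) : PowerSeries ℂ) * h3 -
    (polyL (D.map (· ^ e)) : PowerSeries ℂ) * PowerSeries.mk (expC (ratC D N e)) * h4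

/-- The effect of the inversion of the variable. -/
lemma aeval_polyL_inv (D : List ℂ) (hD : ∀ a ∈ D, a ≠ 0) (f : ℤ → ℂ) (p : ℤ) :
    Polynomial.aeval shift (polyL (D.map (·⁻¹))) f (-p) =
      (D.map fun a => -a⁻¹).prod * Polynomial.aeval shift (polyL D) (fun q => f (-q))
        (p + D.length) := by
  induction D generalizing p with
  | nil => simp [polyL]
  | cons a D ih =>
    have ha := hD a (by simp)
    have ih := ih fun b hb => hD b (by simp [hb])
    have h1 := ih (p + 1)
    rw [show -(p + 1) = -p - 1 by ring] at h1
    rw [List.map_cons, aeval_polyL_cons, aeval_polyL_cons, ih p, h1, List.map_cons, List.prod_cons,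
      List.length_cons]
    push_cast
    rw [show p + ((D.length : ℤ) + 1) - 1 = p + D.length by ring,
      show p + ((D.length : ℤ) + 1) = p + 1 + D.length by ring, smul_eq_mul, smul_eq_mul]
    field_simp
    ring

/-- The expansion at zero. -/
lemma aeval_ratC_zero (D N : List ℂ) :
    Polynomial.aeval shift (polyL D) (extS (PowerSeries.mk (expC (ratC D N 1)))) =
      Polynomial.aeval shift (polyL N) (extS 1) := by
  have h := polyL_mul_ratC D N 1
  have h1 : ∀ L : List ℂ, L.map (· ^ (1 : ℤ)) = L := fun L => by simp
  rw [h1, h1] at h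
  rw [aeval_extS, aeval_extS, h, mul_one]

/-- The expansion at infinity. -/
lemma aeval_ratC_infty {D N : List ℂ} (hD : ∀ a ∈ D, a ≠ 0) (hN : ∀ a ∈ N, a ≠ 0)
    (hlen : N.length = D.length) (hprod : N.prod = D.prod) :
    Polynomial.aeval shift (polyL D) (fun p => extS (PowerSeries.mk (expC (ratC D N (-1)))) (-p)) =
      Polynomial.aeval shift (polyL N) (extS 1) := by
  have h := polyL_mul_ratC D N (-1)
  have h1 : ∀ L : List ℂ, L.map (· ^ (-1 : ℤ)) = L.map (·⁻¹) := fun L => by simp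
  rw [h1, h1] at h
  have h2 : Polynomial.aeval shift (polyL (D.map (·⁻¹)))
      (extS (PowerSeries.mk (expC (ratC D N (-1))))) =
        Polynomial.aeval shift (polyL (N.map (·⁻¹))) (extS 1) := by
    rw [aeval_extS, aeval_extS, h, mul_one]
  have h3 : (fun q => extS 1 (-q)) = extS 1 := by
    funext q
    rw [extS_one, extS_one]
    simp
  have h4 : ∀ L : List ℂ, (L.map fun a => -a⁻¹).prod = (-1) ^ L.length * L.prod⁻¹ := by
    intro L
    induction L with
    | nil => simp
    | cons a L ih => simp [ih, pow_succ]; ring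
  funext p
  -- Inverting the variable shifts the index by the length of the list and multiplies by a sign over
  -- the product of the list. Equal lengths and equal products make these two effects agree for `D`
  -- and `N`.
  have h5 := congrFun h2 (-(p - D.length))
  rw [aeval_polyL_inv D hD, aeval_polyL_inv N hN, h3, hlen, sub_add_cancel, h4, h4, hlen, hprod]
    at h5
  refine mul_left_cancel₀ (mul_ne_zero (pow_ne_zero _ (neg_ne_zero.2 one_ne_zero))
    (inv_ne_zero ?_)) h5
  exact List.prod_ne_zero fun h0 => hD 0 h0 rfl

/-! ### Expansions of Fock-space valued rational functions -/

section

variable {E : Type*} [AddCommGroup E] [Module ℂ E]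

/-- The convolution of a sequence and a Laurent polynomial. -/
def conv (e : ℤ → ℂ) (L : ℤ →₀ E) (p : ℤ) : E := L.sum fun q u => e (p - q) • u

lemma aeval_conv (P : Polynomial ℂ) (e : ℤ → ℂ) (L : ℤ →₀ E) :
    Polynomial.aeval shift P (conv e L) = conv (Polynomial.aeval shift P e) L := by
  funext p
  rw [aeval_shift_apply, conv, Finsupp.sum]
  simp only [conv, Finsupp.sum, Finset.smul_sum, aeval_shift_apply, Finset.sum_smul]
  rw [Finset.sum_comm]
  refine Finset.sum_congr rfl fun q _ => Finset.sum_congr rfl fun k _ => ?_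
  rw [smul_smul, smul_eq_mul, sub_right_comm]

lemma conv_one (L : ℤ →₀ E) : conv (extS 1) L = ⇑L := by
  classical
  funext p
  rw [conv, Finsupp.sum]
  simp only [extS_one, sub_eq_zero, ite_smul, one_smul, zero_smul, Finset.sum_ite_eq,
    Finsupp.mem_support_iff]
  split_ifs with h
  · rfl
  · exact (not_not.1 h).symm

lemma finsum_nat_eq_int (g : ℤ → E) (h : ∀ p < 0, g p = 0) : ∑ᶠ n : ℕ, g n = ∑ᶠ p : ℤ, g p := by
  rw [← finsum_mem_range (f := g) (g := fun n : ℕ => (n : ℤ)) Nat.cast_injective,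
    finsum_mem_def, Set.indicator_eq_self.2]
  intro p hp
  rw [Function.mem_support] at hp
  have : 0 ≤ p := not_lt.1 fun h' => hp (h p h')
  exact ⟨p.toNat, Int.toNat_of_nonneg this⟩

lemma conv_eq_finsum (e : ℤ → ℂ) (L : ℤ →₀ E) (p : ℤ) :
    conv e L p = ∑ᶠ l : ℤ, e l • L (p - l) := by
  rw [← finsum_comp_equiv (Equiv.subLeft p), conv, Finsupp.sum, finsum_eq_sum_of_support_subset]
  · refine Finset.sum_congr rfl fun q _ => ?_
    simp
  · intro q hq
    rw [Function.mem_support] at hq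
    rw [Finset.mem_coe, Finsupp.mem_support_iff]
    intro h
    exact hq (by simp [h])

lemma conv_extS (f : PowerSeries ℂ) (L : ℤ →₀ E) (p : ℤ) :
    conv (extS f) L p = ∑ᶠ l : ℕ, PowerSeries.coeff l f • L (p - l) := by
  rw [conv_eq_finsum, ← finsum_nat_eq_int]
  · simp only [extS_natCast]
  · intro l hl
    rw [extS_neg _ hl, zero_smul]

lemma conv_extS_neg (f : PowerSeries ℂ) (L : ℤ →₀ E) (p : ℤ) :
    conv (fun q => extS f (-q)) L p = ∑ᶠ l : ℕ, PowerSeries.coeff l f • L (p + l) := by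
  rw [conv_eq_finsum, ← finsum_comp_equiv (Equiv.neg ℤ), ← finsum_nat_eq_int]
  · refine finsum_congr fun l => ?_
    simp [extS_natCast]
  · intro l hl
    simp [extS_neg _ hl]

/-- The sequences `c` and `c'` are the expansions at zero and at infinity of the rational function
`R` with poles in `x ^ ℤ`. -/
def IsExpansion (x : ℂ) (c c' : ℤ → E) (R : ℂ → E) : Prop :=
  ∃ (D : List ℂ) (s : ℤ →₀ E), (∀ a ∈ D, ∃ n : ℤ, a = x ^ n) ∧
    Polynomial.aeval shift (polyL D) c = s ∧ Polynomial.aeval shift (polyL D) c' = s ∧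
    BddBelowSeq c ∧ BddAboveSeq c' ∧
    ∀ ζ, ζ ≠ 0 → (∀ n : ℤ, ζ ≠ x ^ n) → ev ζ s = (polyL D).eval ζ • R ζ

lemma IsExpansion.zero (x : ℂ) : IsExpansion x (0 : ℤ → E) 0 0 :=
  ⟨[], 0, by simp, by simp, by simp, ⟨0, fun _ _ => rfl⟩, ⟨0, fun _ _ => rfl⟩, by simp⟩

lemma IsExpansion.smul {x : ℂ} {c c' : ℤ → E} {R : ℂ → E} (h : IsExpansion x c c' R) (a : ℂ) :
    IsExpansion x (a • c) (a • c') (a • R) := by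
  obtain ⟨D, s, h1, h2, h3, ⟨B, hB⟩, ⟨B', hB'⟩, h6⟩ := h
  refine ⟨D, a • s, h1, by rw [map_smul, h2]; rfl, by rw [map_smul, h3]; rfl,
    ⟨B, fun p hp => by rw [Pi.smul_apply, hB p hp, smul_zero]⟩,
    ⟨B', fun p hp => by rw [Pi.smul_apply, hB' p hp, smul_zero]⟩, fun ζ h0 hζ => ?_⟩
  rw [map_smul, h6 ζ h0 hζ, Pi.smul_apply, smul_comm]

lemma IsExpansion.add {x : ℂ} {c c' d d' : ℤ → E} {R R' : ℂ → E} (h : IsExpansion x c c' R)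
    (h' : IsExpansion x d d' R') : IsExpansion x (c + d) (c' + d') (R + R') := by
  obtain ⟨D, s, h1, h2, h3, ⟨B, hB⟩, ⟨B', hB'⟩, h6⟩ := h
  obtain ⟨D', s', k1, k2, k3, ⟨A, hA⟩, ⟨A', hA'⟩, k6⟩ := h'
  obtain ⟨t, ht, ht'⟩ := exists_aeval_finsupp (polyL D') s
  obtain ⟨t', hh, hh'⟩ := exists_aeval_finsupp (polyL D) s'
  have e1 : ∀ b : ℤ → E, Polynomial.aeval shift (polyL (D ++ D')) b =
      Polynomial.aeval shift (polyL D') (Polynomial.aeval shift (polyL D) b) := fun b => by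
    rw [polyL_append, mul_comm, map_mul, Module.End.mul_apply]
  have e2 : ∀ b : ℤ → E, Polynomial.aeval shift (polyL (D ++ D')) b =
      Polynomial.aeval shift (polyL D) (Polynomial.aeval shift (polyL D') b) := fun b => by
    rw [polyL_append, map_mul, Module.End.mul_apply]
  refine ⟨D ++ D', t + t', ?_, ?_, ?_, ⟨min B A, ?_⟩, ⟨max B' A', ?_⟩, ?_⟩
  · intro a ha
    rcases List.mem_append.1 ha with ha | ha
    · exact h1 a ha
    · exact k1 a ha
  · rw [map_add, e1 c, e2 d, h2, k2, Finsupp.coe_add, ht, hh]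
  · rw [map_add, e1 c', e2 d', h3, k3, Finsupp.coe_add, ht, hh]
  · intro p hp
    rw [Pi.add_apply, hB p (lt_of_lt_of_le hp (min_le_left _ _)),
      hA p (lt_of_lt_of_le hp (min_le_right _ _)), add_zero]
  · intro p hp
    rw [Pi.add_apply, hB' p (lt_of_le_of_lt (le_max_left _ _) hp),
      hA' p (lt_of_le_of_lt (le_max_right _ _) hp), add_zero]
  · intro ζ h0 hζ
    rw [map_add, ht' ζ h0, hh' ζ h0, h6 ζ h0 hζ, k6 ζ h0 hζ, polyL_append, Polynomial.eval_mul,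
      Pi.add_apply, smul_add, smul_smul, smul_smul, mul_comm (Polynomial.eval ζ (polyL D'))]

lemma IsExpansion.list_sum {α : Type*} {x : ℂ} (S : List α) {c c' : α → ℤ → E} {R : α → ℂ → E}
    (h : ∀ t ∈ S, IsExpansion x (c t) (c' t) (R t)) :
    IsExpansion x (S.map c).sum (S.map c').sum (S.map R).sum := by
  induction S with
  | nil => exact IsExpansion.zero x
  | cons t S ih =>
    simp only [List.map_cons, List.sum_cons]
    exact (h t (by simp)).add (ih fun t' ht' => h t' (by simp [ht']))

/-- Removing the apparent poles of an expansion. -/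
lemma IsExpansion.aeval_eq {x : ℂ} (hx : x ≠ 0) {c c' : ℤ → E} {R : ℂ → E}
    (h : IsExpansion x c c' R) (Q : Polynomial ℂ) (M : ℤ →₀ E) {Z : Set ℂ} (hZ : Z.Infinite)
    (hM : ∀ ζ ∈ Z, ζ ≠ 0 ∧ (∀ n : ℤ, ζ ≠ x ^ n) ∧ ev ζ M = Q.eval ζ • R ζ) :
    Polynomial.aeval shift Q c = M ∧ Polynomial.aeval shift Q c' = M := by
  obtain ⟨D, s, h1, h2, h3, h4, h5, h6⟩ := h
  obtain ⟨t, ht, ht'⟩ := exists_aeval_finsupp (polyL D) M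
  obtain ⟨t', hh, hh'⟩ := exists_aeval_finsupp Q s
  -- At generic points both Laurent polynomials take the value of the two polynomials times `R`.
  -- Since `polyL D` acts injectively on sequences bounded on one side, the equations for `Q` can
  -- then be recovered from those for `polyL D`.
  have htt : t = t' := by
    refine finsupp_eq_of_ev hZ fun ζ hζ h0 => ?_
    obtain ⟨-, k2, k3⟩ := hM ζ hζ
    rw [ht' ζ h0, hh' ζ h0, k3, h6 ζ h0 k2, smul_comm]
  have hD : ∀ a ∈ D, a ≠ 0 := fun a ha => by
    obtain ⟨n, rfl⟩ := h1 a ha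
    exact zpow_ne_zero n hx
  have hcomm : ∀ b : ℤ → E, Polynomial.aeval shift (polyL D) (Polynomial.aeval shift Q b) =
      Polynomial.aeval shift Q (Polynomial.aeval shift (polyL D) b) := fun b => by
    rw [← Module.End.mul_apply, ← Module.End.mul_apply, ← map_mul, ← map_mul, mul_comm]
  constructor
  · rw [← sub_eq_zero]
    refine ((h4.aeval Q).sub (bddBelowSeq_finsupp M)).eq_zero D ?_
    rw [map_sub, hcomm, h2, ← ht, ← hh, htt, sub_self]
  · rw [← sub_eq_zero]
    refine ((h5.aeval Q).sub (bddAboveSeq_finsupp M)).eq_zero D hD ?_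
    rw [map_sub, hcomm, h3, ← ht, ← hh, htt, sub_self]

end

end Sequences

/-! ### The expansions of the products of currents -/

section

variable (C : RealizationCase) (r : ℝ) (ℓ : ℂ) (μ : Fin 2 → ℂ)

lemma currentTerms_spec (i : ℕ) : ∀ t ∈ currentTerms C r ℓ i,
    t.2.length = i ∧ t.2.Pairwise (rel C) := by
  rcases i with _ | _ | i
  · simp [currentTerms]
  · cases C <;> simp [currentTerms]
  · cases C <;>
    · intro t ht
      simp only [currentTerms, List.mem_cons, List.not_mem_nil, or_false] at ht
      rcases ht with rfl | rfl | rfl | rfl <;>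
        simp [List.pairwise_append, List.pairwise_replicate, rel, special] <;>
        (try omega)

lemma nop_nil (n : ℤ) (v : Fock) : nop C r ℓ μ [] n v = if n = 0 then v else 0 := by
  have ha : annC C r ℓ μ [] = fun _ => 0 := rfl
  have hc : creC C r ℓ μ [] = fun _ => 0 := rfl
  have hz : zeroPart C r ℓ μ [] = 1 := rfl
  rw [nop_eq_sum C r ℓ μ [] n v (K := 1) fun k hk => by
    rw [ha, expC_zero_fun, if_neg (by omega), LinearMap.zero_apply]]
  rw [Finset.sum_range_one, hz, one_smul, ha, hc, expC_zero, Module.End.one_apply, extZ]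
  simp only [expC_zero_fun]
  split_ifs <;> first | rfl | omega

/-- The convention T₀ = 1 agrees with the normally ordered product of the empty word, so the index
zero needs no separate treatment below. -/
lemma T_eq (i : ℕ) (n : ℤ) : T C r ℓ μ i n = ((currentTerms C r ℓ i).map fun t =>
    t.1 • nop C r ℓ μ (spread (xpow ℓ 1) t.2) n).sum := by
  rw [T]
  split_ifs with hi h
  · subst hi
    refine LinearMap.ext fun v => ?_
    simp [currentTerms, spread, nop_nil, h]
  · subst hi
    refine LinearMap.ext fun v => ?_
    simp [currentTerms, spread, nop_nil, h]
  · rfl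

/-- Every vector is annihilated by the high modes. -/
def Truncated (b : ℤ → Module.End ℂ Fock) : Prop := ∀ v, ∃ N : ℤ, ∀ n ≥ N, b n v = 0

lemma Truncated.support_finite {b : ℤ → Module.End ℂ Fock} (hb : Truncated b) (f : PowerSeries ℂ)
    (a : ℤ → Module.End ℂ Fock) (m n : ℤ) (v : Fock) :
    (Function.support fun l : ℕ => PowerSeries.coeff l f • a (m - l) (b (n + l) v)).Finite := by
  obtain ⟨N, hN⟩ := hb v
  refine ((Finset.range (N - n).toNat).finite_toSet).subset fun l hl => ?_
  rw [Function.mem_support] at hl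
  simp only [Finset.coe_range, Set.mem_Iio]
  by_contra hc
  exact hl (by rw [hN (n + l) (by omega)]; simp)

lemma prodCoeff_list_left {α : Type*} (S : List α) (f : PowerSeries ℂ)
    (a : α → ℤ → Module.End ℂ Fock) (e : α → ℂ) {b : ℤ → Module.End ℂ Fock} (hb : Truncated b)
    (m n : ℤ) (v : Fock) :
    prodCoeff f (fun n => (S.map fun t => e t • a t n).sum) b m n v =
      (S.map fun t => e t • prodCoeff f (a t) b m n v).sum := by
  induction S with
  | nil => simp [prodCoeff]
  | cons t S ih =>
    rw [List.map_cons, List.sum_cons, ← ih]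
    simp only [prodCoeff, List.map_cons, List.sum_cons, LinearMap.add_apply, LinearMap.smul_apply,
      smul_add]
    rw [finsum_add_distrib, smul_finsum]
    · congr 1
      exact finsum_congr fun l => smul_comm _ _ _
    · refine (hb.support_finite f (a t) m n v).subset fun l hl => ?_
      rw [Function.mem_support] at hl ⊢
      intro h
      exact hl (by rw [smul_comm, h, smul_zero])
    · exact hb.support_finite f (fun n => (S.map fun t => e t • a t n).sum) m n v

lemma prodCoeff_list_right {α : Type*} (S : List α) (f : PowerSeries ℂ)
    (a : ℤ → Module.End ℂ Fock) (e : α → ℂ) {b : α → ℤ → Module.End ℂ Fock}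
    (hb : ∀ t, Truncated (b t)) (m n : ℤ) (v : Fock) :
    prodCoeff f a (fun n => (S.map fun t => e t • b t n).sum) m n v =
      (S.map fun t => e t • prodCoeff f a (b t) m n v).sum := by
  have hS : ∀ S : List α, Truncated fun n => (S.map fun t => e t • b t n).sum := by
    intro S v
    induction S with
    | nil => exact ⟨0, fun n _ => by simp⟩
    | cons t S ih =>
      obtain ⟨N, hN⟩ := ih
      obtain ⟨M, hM⟩ := hb t v
      refine ⟨max N M, fun n hn => ?_⟩
      simp only [List.map_cons, List.sum_cons, LinearMap.add_apply, LinearMap.smul_apply] at hN ⊢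
      rw [hN n (le_trans (le_max_left _ _) hn), hM n (le_trans (le_max_right _ _) hn), smul_zero,
        add_zero]
  induction S with
  | nil => simp [prodCoeff]
  | cons t S ih =>
    rw [List.map_cons, List.sum_cons, ← ih]
    simp only [prodCoeff, List.map_cons, List.sum_cons, LinearMap.add_apply, LinearMap.smul_apply,
      map_add, map_smul, smul_add]
    rw [finsum_add_distrib, smul_finsum]
    · congr 1
      exact finsum_congr fun l => smul_comm _ _ _
    · refine ((hb t).support_finite f a m n v).subset fun l hl => ?_
      rw [Function.mem_support] at hl ⊢
      intro h
      exact hl (by rw [smul_comm, h, smul_zero])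
    · exact (hS S).support_finite f a m n v

lemma truncated_nop (W : List (Fin 3 × ℂ)) : Truncated fun n => nop C r ℓ μ W n :=
  nop_truncated C r ℓ μ W

lemma prodCoeff_T (f : PowerSeries ℂ) (i j : ℕ) (m n : ℤ) (v : Fock) :
    prodCoeff f (T C r ℓ μ i) (T C r ℓ μ j) m n v =
      ((currentTerms C r ℓ i).map fun t => ((currentTerms C r ℓ j).map fun t' => (t.1 * t'.1) •
        prodCoeff f (nop C r ℓ μ (spread (xpow ℓ 1) t.2)) (nop C r ℓ μ (spread (xpow ℓ 1) t'.2))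
          m n v).sum).sum := by
  have h1 : T C r ℓ μ i = fun n => ((currentTerms C r ℓ i).map fun t =>
    t.1 • nop C r ℓ μ (spread (xpow ℓ 1) t.2) n).sum := funext fun n => T_eq C r ℓ μ i n
  have h2 : T C r ℓ μ j = fun n => ((currentTerms C r ℓ j).map fun t =>
    t.1 • nop C r ℓ μ (spread (xpow ℓ 1) t.2) n).sum := funext fun n => T_eq C r ℓ μ j n
  rw [h1, prodCoeff_list_left _ _ _ _ (T_truncated C r ℓ μ j), h2]
  congr 2
  funext t
  rw [prodCoeff_list_right _ _ _ _ fun t' => truncated_nop C r ℓ μ _, List.smul_sum, List.map_map]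
  congr 2
  funext t'
  simp only [Function.comp_apply, smul_smul]

/-- The structure function of two words. -/
def phi (x t : ℂ) (w w' : List (Fin 3)) (ζ : ℂ) : ℂ :=
  (polyL (phiNum C x t w' (x ^ ((w.length : ℤ) - w'.length)) w)).eval ζ /
    (polyL (phiDen C x w' (x ^ ((w.length : ℤ) - w'.length)) w)).eval ζ

lemma eval_polyL (D : List ℂ) (ζ : ℂ) : (polyL D).eval ζ = (D.map fun a => 1 - a * ζ).prod := by
  induction D with
  | nil => simp [polyL]
  | cons a D ih => rw [polyL_cons, Polynomial.eval_mul, eval_lin, ih]; simp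

lemma phiNum_ne_zero {x t : ℂ} (hx : x ≠ 0) (ht : t ≠ 0) (w' : List (Fin 3)) {u : ℂ} (hu : u ≠ 0)
    (w : List (Fin 3)) : ∀ a ∈ phiNum C x t w' u w, a ≠ 0 := by
  induction w generalizing u with
  | nil => simp [phiNum]
  | cons k w ih =>
    intro a ha
    rw [phiNum, List.mem_append] at ha
    rcases ha with ha | ha
    · unfold rowNum at ha
      split_ifs at ha
      · simp at ha
      · simp only [List.mem_cons, List.not_mem_nil, or_false] at ha
        rcases ha with rfl | rfl
        · exact mul_ne_zero (mul_ne_zero ht (zpow_ne_zero _ hx)) hu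
        · exact mul_ne_zero (mul_ne_zero (inv_ne_zero ht) (zpow_ne_zero _ hx)) hu
    · exact ih (mul_ne_zero (pow_ne_zero _ (inv_ne_zero hx)) hu) a ha

/-- By Wick's theorem both orders are convolutions of the same Laurent polynomial, the coefficients
of `nop₂`. In one order it is convolved with the expansion of `phi` at zero, in the other with the
expansion at infinity. -/
lemma isExpansion_nop (hr : 1 < r) (h1 : ‖Complex.exp ℓ‖ < 1) {w w' : List (Fin 3)}
    (hw' : w'.Pairwise (rel C)) (hle : w.length ≤ w'.length) (N : ℤ) (v : Fock) :
    IsExpansion (xpow ℓ 1)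
      (fun p => prodCoeff (fser r ℓ w.length w'.length) (nop C r ℓ μ (spread (xpow ℓ 1) w))
        (nop C r ℓ μ (spread (xpow ℓ 1) w')) (N + p) (-p) v)
      (fun p => prodCoeff (fser r ℓ w'.length w.length) (nop C r ℓ μ (spread (xpow ℓ 1) w'))
        (nop C r ℓ μ (spread (xpow ℓ 1) w)) (-p) (N + p) v)
      (fun ζ => phi C (xpow ℓ 1) (xpow ℓ (2 * r)) w w' ζ •
        nop C r ℓ μ (spread (xpow ℓ 1) w ++ scaleW ζ (spread (xpow ℓ 1) w')) N v) := by
  set W := spread (xpow ℓ 1) w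
  set W' := spread (xpow ℓ 1) w'
  set u := xpow ℓ 1 ^ ((w.length : ℤ) - w'.length)
  have hx := xpow_ne_zero ℓ 1
  have hu : u ≠ 0 := zpow_ne_zero _ hx
  set D := phiDen C (xpow ℓ 1) w' u w
  set Nm := phiNum C (xpow ℓ 1) (xpow ℓ (2 * r)) w' u w
  set L : ℤ →₀ Fock := Finsupp.ofSupportFinite _ (nop₂_support_finite C r ℓ μ W W' N v) with hL
  have hLp : ∀ p, L p = nop₂ C r ℓ μ W W' (N + p) (-p) v := fun p => rfl
  have hDz : ∀ a ∈ D, ∃ n : ℤ, a = xpow ℓ 1 ^ n := phiDen_zpow C hx w' _ w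
  have hD : ∀ a ∈ D, a ≠ 0 := fun a ha => by
    obtain ⟨n, rfl⟩ := hDz a ha
    exact zpow_ne_zero n hx
  have hN : ∀ a ∈ Nm, a ≠ 0 := phiNum_ne_zero C hx (xpow_ne_zero _ _) w' hu w
  have hc : (fun p => prodCoeff (fser r ℓ w.length w'.length) (nop C r ℓ μ W) (nop C r ℓ μ W')
      (N + p) (-p) v) = conv (extS (PowerSeries.mk (expC (ratC D Nm 1)))) L := by
    funext p
    rw [prodCoeff_nop, ope C r ℓ hr h1 hw' hle, conv_extS]
    refine finsum_congr fun l => ?_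
    rw [hLp, add_sub_assoc, neg_sub', sub_neg_eq_add]
  have hc' : (fun p => prodCoeff (fser r ℓ w'.length w.length) (nop C r ℓ μ W') (nop C r ℓ μ W)
      (-p) (N + p) v) =
        conv (fun q => extS (PowerSeries.mk (expC (ratC D Nm (-1)))) (-q)) L := by
    funext p
    rw [prodCoeff_nop, ope_swap C r ℓ hr h1 hw' hle, conv_extS_neg]
    refine finsum_congr fun l => ?_
    rw [hLp, nop₂_comm, add_assoc, neg_add']
  obtain ⟨s, hs, hs'⟩ := exists_aeval_finsupp (polyL Nm) L
  rw [hc, hc']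
  refine ⟨D, s, hDz, ?_, ?_, ?_, ?_, ?_⟩
  · rw [aeval_conv, aeval_ratC_zero, ← aeval_conv, conv_one, hs]
  · rw [aeval_conv, aeval_ratC_infty hD hN (phiNum_length C _ _ _ _ _)
      (phiNum_prod C (xpow_ne_zero _ _) _ _ _), ← aeval_conv, conv_one, hs]
  · obtain ⟨B, hB⟩ := bddBelowSeq_finsupp L
    refine ⟨B, fun p hp => ?_⟩
    rw [conv_extS]
    exact finsum_eq_zero_of_forall_eq_zero fun l => by rw [hB _ (by omega), smul_zero]
  · obtain ⟨B, hB⟩ := bddAboveSeq_finsupp L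
    refine ⟨B, fun p hp => ?_⟩
    rw [conv_extS_neg]
    exact finsum_eq_zero_of_forall_eq_zero fun l => by rw [hB _ (by omega), smul_zero]
  · intro ζ h0 hζ
    have hne : (polyL D).eval ζ ≠ 0 := by
      rw [eval_polyL]
      refine List.prod_ne_zero fun hh => ?_
      rw [List.mem_map] at hh
      obtain ⟨a, ha, ha'⟩ := hh
      obtain ⟨n, rfl⟩ := hDz a ha
      refine hζ (-n) ?_
      rw [zpow_neg]
      exact eq_inv_of_mul_eq_one_right (sub_eq_zero.1 ha').symm
    have hev : ev ζ L = nop C r ℓ μ (W ++ scaleW ζ W') N v := by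
      rw [nop_append_scale C r ℓ μ W W' h0, ev_apply, Finsupp.sum, finsum_eq_sum_of_support_subset]
      · rfl
      · intro p hp
        rw [Function.mem_support] at hp
        rw [Finset.mem_coe, Finsupp.mem_support_iff, hLp]
        intro h
        exact hp (by rw [h, smul_zero])
    rw [hs' ζ h0, hev, smul_smul, phi, mul_div_cancel₀ _ hne]

/-- The rational function represented by the product of two currents. -/
def ratFun (x t : ℂ) (S S' : List (ℂ × List (Fin 3))) (F : List (Fin 3 × ℂ) → Fock) (ζ : ℂ) :
    Fock :=
  (S.map fun a => (S'.map fun b => (a.1 * b.1) • phi C x t a.2 b.2 ζ •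
    F (spread x a.2 ++ scaleW ζ (spread x b.2))).sum).sum

lemma list_sum_apply {α β : Type*} (S : List α) (g : α → β → Fock) (b : β) :
    (S.map g).sum b = (S.map fun a => g a b).sum := by
  induction S with
  | nil => rfl
  | cons a S ih => simp [ih]

lemma isExpansion_T (hr : 1 < r) (h1 : ‖Complex.exp ℓ‖ < 1) {i j : ℕ} (hij : i ≤ j) (N : ℤ)
    (v : Fock) :
    IsExpansion (xpow ℓ 1) (diagSeries (fser r ℓ i j) (T C r ℓ μ i) (T C r ℓ μ j) N v)
      (fun p => prodCoeff (fser r ℓ j i) (T C r ℓ μ j) (T C r ℓ μ i) (-p) (N + p) v)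
      (ratFun C (xpow ℓ 1) (xpow ℓ (2 * r)) (currentTerms C r ℓ i) (currentTerms C r ℓ j)
        fun W => nop C r ℓ μ W N v) := by
  have h := IsExpansion.list_sum (x := xpow ℓ 1) (currentTerms C r ℓ i) (c := fun t =>
    ((currentTerms C r ℓ j).map fun t' => (t.1 * t'.1) • fun p =>
      prodCoeff (fser r ℓ t.2.length t'.2.length) (nop C r ℓ μ (spread (xpow ℓ 1) t.2))
        (nop C r ℓ μ (spread (xpow ℓ 1) t'.2)) (N + p) (-p) v).sum)
    fun t ht => IsExpansion.list_sum _ fun t' ht' => (isExpansion_nop C r ℓ μ hr h1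
      (w := t.2) (w' := t'.2) (currentTerms_spec C r ℓ j t' ht').2
      (by rw [(currentTerms_spec C r ℓ i t ht).1, (currentTerms_spec C r ℓ j t' ht').1]; exact hij)
      N v).smul (t.1 * t'.1)
  convert h using 1
  · funext p
    rw [diagSeries, prodCoeff_T, list_sum_apply]
    refine congrArg List.sum (List.map_congr_left fun t ht => ?_)
    rw [list_sum_apply]
    refine congrArg List.sum (List.map_congr_left fun t' ht' => ?_)
    rw [(currentTerms_spec C r ℓ i t ht).1, (currentTerms_spec C r ℓ j t' ht').1]
    rfl
  · funext p
    rw [prodCoeff_T, list_sum_apply, list_sum_comm]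
    refine congrArg List.sum (List.map_congr_left fun t ht => ?_)
    rw [list_sum_apply]
    refine congrArg List.sum (List.map_congr_left fun t' ht' => ?_)
    rw [(currentTerms_spec C r ℓ i t ht).1, (currentTerms_spec C r ℓ j t' ht').1, mul_comm]
    rfl
  · funext ζ
    rw [ratFun, list_sum_apply]
    refine congrArg List.sum (List.map_congr_left fun t ht => ?_)
    rw [list_sum_apply]
    rfl

end

/-! ### Symmetrization over words -/

section

variable {E : Type*} [AddCommGroup E] [Module ℂ E] (C : RealizationCase)

/-- The inverse zeros of the normalized contraction of `Λ_k` and `Λ_l`. -/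
def trip (x t : ℂ) (k l : Fin 3) : List ℂ :=
  if k = l then (if k = special C then [1, t * x⁻¹ ^ 2, t⁻¹ * x ^ 2] else [1, x ^ 2, x⁻¹ ^ 2])
  else if k < l then [t * x⁻¹ ^ 2, t⁻¹, x ^ 2]
  else [t⁻¹ * x ^ 2, t, x⁻¹ ^ 2]

/-- The numerator of the normalized contraction of `Λ_k(y)` and `Λ_l(y')`. -/
def numer (x t : ℂ) (k l : Fin 3) (y y' : ℂ) : ℂ := ((trip C x t k l).map fun a => y - a * y').prod

/-- The three inverse zeros for (l, k) are the inverses of those for (k, l), and their product is 1.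
Hence each of the three factors changes by -1/a, and the product changes by -1. -/
lemma numer_swap {x t : ℂ} (hx : x ≠ 0) (ht : t ≠ 0) (k l : Fin 3) (y y' : ℂ) :
    numer C x t l k y' y = -numer C x t k l y y' := by
  unfold numer trip
  rcases lt_trichotomy k l with h | rfl | h
  · rw [if_neg h.ne', if_neg h.not_gt, if_neg h.ne, if_pos h]
    simp only [List.map_cons, List.map_nil, List.prod_cons, List.prod_nil]
    field_simp
    ring
  · rw [if_pos rfl]
    split_ifs
    all_goals
      simp only [List.map_cons, List.map_nil, List.prod_cons, List.prod_nil]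
      field_simp
      ring
  · rw [if_neg h.ne, if_pos h, if_neg h.ne', if_neg h.not_gt]
    simp only [List.map_cons, List.map_nil, List.prod_cons, List.prod_nil]
    field_simp
    ring

/-- The product of the numerators of the contractions of a letter with the letters of a word. -/
def rowN (x t : ℂ) (k : Fin 3) (y : ℂ) (Z : List (Fin 3 × ℂ)) : ℂ :=
  (Z.map fun lc => numer C x t k lc.1 y lc.2).prod

lemma rowN_cons (x t : ℂ) (k : Fin 3) (y : ℂ) (lc : Fin 3 × ℂ) (Z : List (Fin 3 × ℂ)) :
    rowN C x t k y (lc :: Z) = numer C x t k lc.1 y lc.2 * rowN C x t k y Z := by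
  rw [rowN, List.map_cons, List.prod_cons]; rfl

lemma rowN_append (x t : ℂ) (k : Fin 3) (y : ℂ) (Z Z' : List (Fin 3 × ℂ)) :
    rowN C x t k y (Z ++ Z') = rowN C x t k y Z * rowN C x t k y Z' := by
  rw [rowN, List.map_append, List.prod_append]; rfl

lemma rowN_perm (x t : ℂ) (k : Fin 3) (y : ℂ) {Z Z' : List (Fin 3 × ℂ)} (h : Z.Perm Z') :
    rowN C x t k y Z = rowN C x t k y Z' := (h.map _).prod_eq

/-- The weight of a letter. -/
def wgt (g : ℂ) (k : Fin 3) : ℂ := if k = special C then g else 1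

/-- The sum over all ways to assign letters to the points of a list. -/
def wordSum (x t g : ℂ) : (List (Fin 3 × ℂ) → E) → List ℂ → E
  | H, [] => H []
  | H, y :: L => ∑ k : Fin 3, wgt C g k •
      wordSum x t g (fun Z => rowN C x t k y Z • H ((k, y) :: Z)) L

/-- The Vandermonde product. -/
def vdm : List ℂ → ℂ
  | [] => 1
  | y :: L => (L.map fun y' => y - y').prod * vdm L

lemma wordSum_smul (x t g : ℂ) (a : ℂ) (H : List (Fin 3 × ℂ) → E) (L : List ℂ) :
    wordSum C x t g (fun Z => a • H Z) L = a • wordSum C x t g H L := by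
  induction L generalizing H with
  | nil => rfl
  | cons y L ih =>
    rw [wordSum, wordSum, Finset.smul_sum]
    refine Finset.sum_congr rfl fun k _ => ?_
    rw [smul_comm a, ← ih]
    congr 2
    funext Z
    rw [smul_comm]

lemma wordSum_neg (x t g : ℂ) (H : List (Fin 3 × ℂ) → E) (L : List ℂ) :
    wordSum C x t g (fun Z => -H Z) L = -wordSum C x t g H L := by
  have := wordSum_smul C x t g (-1) H L
  simpa using this

/-- Invariance under permutations. -/
def PermInv (H : List (Fin 3 × ℂ) → E) : Prop := ∀ {Z Z' : List (Fin 3 × ℂ)}, Z.Perm Z' → H Z = H Z'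

lemma PermInv.cons {H : List (Fin 3 × ℂ) → E} (hH : PermInv H) (x t : ℂ) (k : Fin 3) (y : ℂ) :
    PermInv fun Z => rowN C x t k y Z • H ((k, y) :: Z) := fun h => by
  simp only
  rw [rowN_perm C x t k y h, hH (h.cons _)]

/-- Exchanging the two summation letters leaves `H` unchanged and reverses the sign of the one
numerator that joins the two points. -/
lemma wordSum_swap {x t : ℂ} (hx : x ≠ 0) (ht : t ≠ 0) (g : ℂ) {H : List (Fin 3 × ℂ) → E}
    (hH : PermInv H) (y y' : ℂ) (L : List ℂ) :
    wordSum C x t g H (y' :: y :: L) = -wordSum C x t g H (y :: y' :: L) := by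
  simp only [wordSum, Finset.smul_sum]
  rw [Finset.sum_comm, ← Finset.sum_neg_distrib]
  refine Finset.sum_congr rfl fun k _ => ?_
  rw [← Finset.sum_neg_distrib]
  refine Finset.sum_congr rfl fun l _ => ?_
  rw [smul_comm, ← smul_neg, ← smul_neg, ← wordSum_neg]
  congr 3
  funext Z
  rw [rowN_cons, rowN_cons, hH (List.Perm.swap (k, y) (l, y') Z), smul_smul, smul_smul,
    numer_swap C hx ht k l, ← neg_smul]
  congr 1
  ring

/-- Both `wordSum` and `vdm` are antisymmetric, so one factor `ε` serves for both. Its actual value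
is never needed, only that it is nonzero and common to them. -/
lemma wordSum_perm {x t : ℂ} (hx : x ≠ 0) (ht : t ≠ 0) (g : ℂ) {L L' : List ℂ} (h : L.Perm L') :
    ∃ ε : ℂ, ε ≠ 0 ∧ (∀ H : List (Fin 3 × ℂ) → E, PermInv H →
      wordSum C x t g H L = ε • wordSum C x t g H L') ∧ vdm L = ε * vdm L' := by
  induction h with
  | nil => exact ⟨1, one_ne_zero, fun H _ => (one_smul _ _).symm, (one_mul _).symm⟩
  | @cons y L L' h ih =>
    obtain ⟨ε, h0, h1, h2⟩ := ih
    refine ⟨ε, h0, fun H hH => ?_, ?_⟩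
    · rw [wordSum, wordSum, Finset.smul_sum]
      refine Finset.sum_congr rfl fun k _ => ?_
      rw [h1 _ (hH.cons C x t k y), smul_comm]
    · rw [vdm, vdm, h2, (h.map _).prod_eq]
      ring
  | swap y y' L =>
    refine ⟨-1, neg_ne_zero.2 one_ne_zero, fun H hH => ?_, ?_⟩
    · rw [wordSum_swap C hx ht g hH, neg_one_smul]
    · simp only [vdm, List.map_cons, List.prod_cons]
      ring
  | trans _ _ ih ih' =>
    obtain ⟨ε, h0, h1, h2⟩ := ih
    obtain ⟨ε', h0', h1', h2'⟩ := ih'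
    exact ⟨ε * ε', mul_ne_zero h0 h0', fun H hH => by rw [h1 H hH, h1' H hH, smul_smul],
      by rw [h2, h2', mul_assoc]⟩

/-- An antisymmetric function vanishes when two of its points coincide, since 2 is invertible. -/
lemma wordSum_eq_zero {x t : ℂ} (hx : x ≠ 0) (ht : t ≠ 0) (g : ℂ) {H : List (Fin 3 × ℂ) → E}
    (hH : PermInv H) {L : List ℂ} (hL : ¬ L.Nodup) : wordSum C x t g H L = 0 := by
  obtain ⟨y, hy⟩ := List.exists_duplicate_iff_not_nodup.2 hL
  obtain ⟨L', hL'⟩ := (List.duplicate_iff_sublist.1 hy).exists_perm_append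
  obtain ⟨ε, -, h1, -⟩ := wordSum_perm (E := E) C hx ht g hL'
  rw [h1 H hH]
  have h2 : wordSum C x t g H (y :: y :: L') = 0 := by
    have h3 := wordSum_swap C hx ht g hH y y L'
    have h4 : (2 : ℂ) • wordSum C x t g H (y :: y :: L') = 0 := by
      rw [two_smul]
      nth_rewrite 1 [h3]
      exact neg_add_cancel _
    exact (smul_eq_zero.1 h4).resolve_left two_ne_zero
  exact smul_eq_zero_of_right _ h2

/-- The product of the numerators of the contractions of two words. -/
def cross (x t : ℂ) : List (Fin 3 × ℂ) → List (Fin 3 × ℂ) → ℂ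
  | [], _ => 1
  | (k, y) :: Z, Z' => rowN C x t k y Z' * cross x t Z Z'

lemma wordSum_append (x t g : ℂ) (H : List (Fin 3 × ℂ) → E) (L L' : List ℂ) :
    wordSum C x t g H (L ++ L') = wordSum C x t g (fun Z =>
      wordSum C x t g (fun Z' => cross C x t Z Z' • H (Z ++ Z')) L') L := by
  induction L generalizing H with
  | nil => simp [wordSum, cross]
  | cons y L ih =>
    rw [List.cons_append, wordSum, wordSum]
    refine Finset.sum_congr rfl fun k _ => ?_
    rw [ih]
    congr 2
    funext Z
    rw [← wordSum_smul]
    congr 1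
    funext Z'
    rw [rowN_append, cross, List.cons_append, smul_smul, smul_smul]
    congr 1
    ring

lemma vdm_append (L L' : List ℂ) : vdm (L ++ L') =
    vdm L * vdm L' * (L.map fun y => (L'.map fun y' => y - y').prod).prod := by
  induction L with
  | nil => simp [vdm]
  | cons y L ih =>
    rw [List.cons_append, vdm, ih, vdm, List.map_append, List.prod_append, List.map_cons,
      List.prod_cons]
    ring

lemma vdm_ne_zero {L : List ℂ} (h : L.Nodup) : vdm L ≠ 0 := by
  induction L with
  | nil => exact one_ne_zero
  | cons y L ih =>
    rw [List.nodup_cons] at h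
    refine mul_ne_zero (List.prod_ne_zero fun h0 => ?_) (ih h.2)
    rw [List.mem_map] at h0
    obtain ⟨y', hy', h1⟩ := h0
    exact h.1 (by rwa [sub_eq_zero.1 h1])

end

section

variable {E : Type*} [AddCommGroup E] [Module ℂ E] (C : RealizationCase) {ι : Type*} [Fintype ι]

lemma isLaurent_numer (x t : ℂ) (k l : Fin 3) (a b : ι) :
    IsLaurent fun Y : ι → ℂ => numer C x t k l (Y a) (Y b) :=
  IsLaurent.list_prod _ fun _ _ => (IsLaurent.coord a).sub ((IsLaurent.const _).mul
    (IsLaurent.coord b))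

/-- `H` is allowed to depend on `Y` so that the induction can absorb the numerators that join the
removed point to the remaining ones. -/
lemma isLaurent_wordSum (x t g : ℂ) (I : List ι) (H : (ι → ℂ) → List (Fin 3 × ℂ) → E)
    (hH : ∀ w : List (Fin 3), w.length = I.length → IsLaurent fun Y => H Y (w.zip (I.map Y))) :
    IsLaurent fun Y => wordSum C x t g (H Y) (I.map Y) := by
  induction I generalizing H with
  | nil => exact hH [] rfl
  | cons a I ih =>
    simp only [List.map_cons, wordSum]
    refine IsLaurent.sum _ fun k _ => IsLaurent.const_smul _
      (ih (fun Y Z => rowN C x t k (Y a) Z • H Y ((k, Y a) :: Z)) fun w hw => ?_)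
    refine IsLaurent.smul ?_ (hH (k :: w) (by rw [List.length_cons, List.length_cons, hw]))
    refine (IsLaurent.list_prod (w.zip I) fun lb _ =>
      isLaurent_numer C x t k lb.1 a lb.2).congr fun Y _ => ?_
    rw [rowN, List.zip_map_right, List.map_map]
    rfl

end

/-! ### Division by the Vandermonde product -/

section

variable {E : Type*} [AddCommGroup E] [Module ℂ E] {ι : Type*} [Fintype ι] [DecidableEq ι]

/-- A Laurent polynomial in one variable obtained by varying one coordinate. -/
lemma IsLaurent.update {f : (ι → ℂ) → E} (hf : IsLaurent f) {Y : ι → ℂ} (hY : ∀ a, Y a ≠ 0) (e : ι) :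
    IsLaurent fun s : Unit → ℂ => f (Function.update Y e (s ())) := by
  have h := hf.comp_monomial (κ := Unit) (Function.update Y e 1)
    (fun a => by
      by_cases h : a = e
      · subst h; simp
      · rw [Function.update_of_ne h]; exact hY a)
    (fun a _ => if a = e then 1 else 0)
  refine h.congr fun s _ => ?_
  congr 1
  funext a
  by_cases h : a = e
  · subst h; simp
  · simp [h]

/-- Division by a product of differences of coordinates. -/
lemma IsLaurent.exists_div {f : (ι → ℂ) → E} (hf : IsLaurent f) (S : List (ι × ι))
    (hne : ∀ p ∈ S, p.1 ≠ p.2)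
    (hS : S.Pairwise fun p q => ∃ e, (e = p.1 ∨ e = p.2) ∧ e ≠ q.1 ∧ e ≠ q.2)
    (h0 : ∀ p ∈ S, ∀ Y : ι → ℂ, (∀ a, Y a ≠ 0) → Y p.1 = Y p.2 → f Y = 0) :
    ∃ g : (ι → ℂ) → E, IsLaurent g ∧ ∀ Y, (∀ a, Y a ≠ 0) →
      f Y = (S.map fun p => Y p.1 - Y p.2).prod • g Y := by
  induction S generalizing f with
  | nil => exact ⟨f, hf, fun Y _ => by simp⟩
  | cons p S ih =>
    rw [List.pairwise_cons] at hS
    have hp := hne p (by simp)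
    obtain ⟨q, hq, hq'⟩ := hf.sub_update_dvd p.1 (g := fun Y => Y p.2) (g' := fun Y => Y p.2 ^ (-1 : ℤ))
      (IsLaurent.coord p.2) (IsLaurent.coord_zpow p.2 (-1))
      (fun Y hY => by rw [zpow_neg_one]; exact mul_inv_cancel₀ (hY p.2))
    have hfq : ∀ Y, (∀ a, Y a ≠ 0) → f Y = (Y p.1 - Y p.2) • q Y := by
      intro Y hY
      rw [← hq' Y hY, h0 p (by simp) (Function.update Y p.1 (Y p.2)), sub_zero]
      · intro a
        by_cases h : a = p.1
        · subst h; simpa using hY p.2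
        · rw [Function.update_of_ne h]; exact hY a
      · rw [Function.update_self, Function.update_of_ne hp.symm]
    obtain ⟨g, hg, hg'⟩ := ih hq (fun p' h => hne p' (by simp [h])) hS.2 fun p' hp' Y hY hYp => by
      -- The quotient must still vanish on the hyperplane of the later pair `p'`. The coordinate `e`
      -- belongs to `p` and not to `p'`, so it can be moved within that hyperplane. Away from two
      -- values of `e` the factor already divided out is nonzero and can be cancelled, and the
      -- identity theorem supplies the rest.
      obtain ⟨e, he, he1, he2⟩ := hS.1 p' hp'
      have hval : ∀ z, z ≠ 0 → q (Function.update Y e z) = 0 := by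
        intro z hz
        refine IsLaurent.eq_zero_of_infinite (f := fun z => q (Function.update Y e z))
          (hq.update hY e) (S := {Y p.1, Y p.2}ᶜ) (Set.Finite.infinite_compl (by simp)) ?_ hz
        intro z hz hz0
        have hne' : ∀ a, Function.update Y e z a ≠ 0 := fun a => by
          by_cases h : a = e
          · subst h; simpa using hz0
          · rw [Function.update_of_ne h]; exact hY a
        have h1 := hfq _ hne'
        rw [h0 p' (by simp [hp']) _ hne' (by
          rw [Function.update_of_ne he1.symm, Function.update_of_ne he2.symm, hYp])] at h1
        refine (smul_eq_zero.1 h1.symm).resolve_left ?_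
        simp only [Set.mem_compl_iff, Set.mem_insert_iff, Set.mem_singleton_iff, not_or] at hz
        rcases he with rfl | rfl
        · rw [Function.update_self, Function.update_of_ne hp.symm]
          exact sub_ne_zero.2 hz.2
        · rw [Function.update_self, Function.update_of_ne hp]
          exact sub_ne_zero.2 (Ne.symm hz.1)
      have := hval (Y e) (hY e)
      rwa [Function.update_eq_self] at this
    refine ⟨g, hg, fun Y hY => ?_⟩
    rw [hfq Y hY, hg' Y hY, smul_smul, List.map_cons, List.prod_cons]

end

/-! ### The Vandermonde product as a product over pairs -/

section

variable {ι : Type*}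

/-- The pairs of entries of a list. -/
def pairs : List ι → List (ι × ι)
  | [] => []
  | a :: L => (L.map fun b => (a, b)) ++ pairs L

lemma mem_of_mem_pairs {L : List ι} {p : ι × ι} (h : p ∈ pairs L) : p.1 ∈ L ∧ p.2 ∈ L := by
  induction L with
  | nil => simp [pairs] at h
  | cons a L ih =>
    rw [pairs, List.mem_append, List.mem_map] at h
    rcases h with ⟨b, hb, rfl⟩ | h
    · simp [hb]
    · simp [ih h]

lemma pairs_ne {L : List ι} (hL : L.Nodup) {p : ι × ι} (h : p ∈ pairs L) : p.1 ≠ p.2 := by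
  induction L with
  | nil => simp [pairs] at h
  | cons a L ih =>
    rw [List.nodup_cons] at hL
    rw [pairs, List.mem_append, List.mem_map] at h
    rcases h with ⟨b, hb, rfl⟩ | h
    · intro h
      have h' : a = b := h
      exact hL.1 (h' ▸ hb)
    · exact ih hL.2 h

/-- For two pairs with the same first entry the second entry of the earlier one is the free
coordinate; otherwise its first entry is. This is the independence condition of
`IsLaurent.exists_div`. -/
lemma pairs_pairwise {L : List ι} (hL : L.Nodup) :
    (pairs L).Pairwise fun p q => ∃ e, (e = p.1 ∨ e = p.2) ∧ e ≠ q.1 ∧ e ≠ q.2 := by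
  induction L with
  | nil => simp [pairs]
  | cons a L ih =>
    rw [List.nodup_cons] at hL
    rw [pairs, List.pairwise_append]
    refine ⟨?_, ih hL.2, ?_⟩
    · rw [List.pairwise_map]
      refine List.Pairwise.imp_of_mem ?_ hL.2
      intro b b' hb _ hbb
      exact ⟨b, Or.inr rfl, fun h => hL.1 ((show b = a from h) ▸ hb), hbb⟩
    · intro p hp q hq
      rw [List.mem_map] at hp
      obtain ⟨b, -, rfl⟩ := hp
      have := mem_of_mem_pairs hq
      exact ⟨a, Or.inl rfl, fun h => hL.1 (h ▸ this.1), fun h => hL.1 (h ▸ this.2)⟩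

lemma vdm_map (L : List ι) (Y : ι → ℂ) :
    vdm (L.map Y) = ((pairs L).map fun p => Y p.1 - Y p.2).prod := by
  induction L with
  | nil => rfl
  | cons a L ih =>
    rw [List.map_cons, vdm, pairs, List.map_append, List.prod_append, ih, List.map_map,
      List.map_map]
    rfl

end

/-! ### The symmetric Laurent polynomial of a family -/

section

variable (C : RealizationCase)

/-- The symmetric Laurent polynomial obtained from a family by summing over all words. -/
lemma exists_symmetric {x t : ℂ} (hx : x ≠ 0) (ht : t ≠ 0) (g : ℂ) {N : ℤ}
    {F : List (Fin 3 × ℂ) → Fock} (hF : IsFamily N F) (n : ℕ) :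
    ∃ G : (Fin n → ℂ) → Fock, IsLaurent G ∧ ∀ Y, (∀ a, Y a ≠ 0) →
      wordSum C x t g F (List.ofFn Y) = vdm (List.ofFn Y) • G Y := by
  have hmap : ∀ Y : Fin n → ℂ, List.ofFn Y = (List.finRange n).map Y := fun Y => List.ofFn_eq_map
  have hnd : (List.finRange n).Nodup := List.nodup_finRange n
  have hL : IsLaurent fun Y : Fin n → ℂ => wordSum C x t g F ((List.finRange n).map Y) := by
    refine isLaurent_wordSum C x t g (List.finRange n) (fun _ => F) fun w hw => ?_
    rw [List.length_finRange] at hw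
    subst hw
    refine (hF.laurent w.length w.get).congr fun Y _ => ?_
    congr 1
    refine List.ext_getElem (by simp) fun a h1 h2 => ?_
    simp
  obtain ⟨G, hG, hG'⟩ := hL.exists_div (pairs (List.finRange n)) (fun p hp => pairs_ne hnd hp)
    (pairs_pairwise hnd) fun p hp Y hY hYp => by
      refine wordSum_eq_zero C hx ht g hF.perm fun h => ?_
      exact pairs_ne hnd hp (List.inj_on_of_nodup_map h (mem_of_mem_pairs hp).1
        (mem_of_mem_pairs hp).2 hYp)
  exact ⟨G, hG, fun Y hY => by rw [hmap, hG' Y hY, vdm_map]⟩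

/-- The properties of the symmetric Laurent polynomials of all lengths. -/
structure IsSymm (x t g : ℂ) (F : List (Fin 3 × ℂ) → Fock) (G : List ℂ → Fock) : Prop where
  laurent : ∀ S : List (ℂ × ℤ), (∀ p ∈ S, p.1 ≠ 0) →
    IsLaurent fun Y : Unit → ℂ => G (S.map fun p => p.1 * Y () ^ p.2)
  eq : ∀ L : List ℂ, (∀ y ∈ L, y ≠ 0) → wordSum C x t g F L = vdm L • G L

lemma exists_isSymm {x t : ℂ} (hx : x ≠ 0) (ht : t ≠ 0) (g : ℂ) {N : ℤ}
    {F : List (Fin 3 × ℂ) → Fock} (hF : IsFamily N F) : ∃ G, IsSymm C x t g F G := by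
  choose G hG hG' using fun n => exists_symmetric C hx ht g hF n
  have hcast : ∀ (L : List ℂ) (n : ℕ) (h : L.length = n),
      G L.length L.get = G n fun a => L.get (a.cast h.symm) := by
    intro L n h
    subst h
    rfl
  refine ⟨fun L => G L.length L.get, ?_, ?_⟩
  · intro S hS
    have h := (hG S.length).comp_monomial (κ := Unit) (fun a => (S.get a).1)
      (fun a => hS _ (List.get_mem S a)) fun a _ => (S.get a).2
    refine h.congr fun Y _ => ?_
    rw [hcast _ S.length (by simp)]
    congr 1
    funext a
    simp
  · intro L hL
    have := hG' L.length L.get fun a => hL _ (List.get_mem L a)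
    rwa [List.ofFn_get] at this

lemma finite_pow_eq {c : ℂ} {e : ℕ} (he : 0 < e) : {s : ℂ | s ^ e = c}.Finite := by
  have h := Polynomial.X_pow_sub_C_ne_zero he c
  refine (Polynomial.finite_setOfPred_isRoot h).subset fun s hs => ?_
  have hs' : s ^ e = c := hs
  simp [hs']

/-- For distinct points, symmetry follows by cancelling the Vandermonde product. Coinciding points,
which do occur in unions of strings, are reached by a deformation: the points are moved along a
monomial curve on which they are generically distinct, and the identity theorem is applied at the
parameter 1. -/
lemma IsSymm.perm {x t g : ℂ} (hx : x ≠ 0) (ht : t ≠ 0) {F : List (Fin 3 × ℂ) → Fock}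
    (hF : PermInv F) {G : List ℂ → Fock} (hG : IsSymm C x t g F G) {L L' : List ℂ}
    (h : L.Perm L') (hL : ∀ y ∈ L, y ≠ 0) : G L = G L' := by
  -- Each point carries its position as the exponent of the deformation parameter. The exponents are
  -- distinct, so coinciding points are separated.
  set S : List (ℂ × ℤ) := L.zipIdx.map fun p => (p.1, (p.2 : ℤ)) with hS
  have hS1 : S.map Prod.fst = L := by
    rw [hS, List.map_map]
    exact List.zipIdx_map_fst 0 L
  have hS2 : S.Pairwise fun p q => p.2 < q.2 := by
    rw [hS, List.pairwise_map]
    have := List.pairwise_lt_range' (s := 0) (n := L.length) (step := 1)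
    rw [← List.zipIdx_map_snd, List.pairwise_map] at this
    exact this.imp fun h => Int.ofNat_lt.2 h
  have hF2 : List.Forall₂ (fun (y : ℂ) (p : ℂ × ℤ) => y = p.1) L S := by
    rw [← hS1]
    clear_value S
    clear hS hS1 hS2
    induction S with
    | nil => exact List.Forall₂.nil
    | cons p S ih => exact List.Forall₂.cons rfl ih
  obtain ⟨S', hS', hSS⟩ := (List.perm_comp_forall₂ h.symm hF2 :
    (Relation.Comp (List.Forall₂ fun (y : ℂ) (p : ℂ × ℤ) => y = p.1) List.Perm) L' S)
  have hS1' : S'.map Prod.fst = L' := by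
    clear h hSS
    induction hS' with
    | nil => rfl
    | cons h _ ih => rw [List.map_cons, ih, h]
  have hS0 : ∀ p ∈ S, p.1 ≠ 0 := fun p hp => hL _ (hS1 ▸ List.mem_map_of_mem hp)
  have hS0' : ∀ p ∈ S', p.1 ≠ 0 := fun p hp => hS0 p (hSS.subset hp)
  have hone : ∀ S : List (ℂ × ℤ), (S.map fun p => p.1 * (1 : ℂ) ^ p.2) = S.map Prod.fst := by
    intro S
    refine List.map_congr_left fun p _ => ?_
    rw [one_zpow, mul_one]
  have hlaur := (hG.laurent S hS0).sub (hG.laurent S' hS0')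
  have key := IsLaurent.eq_zero_of_infinite
    (f := fun s : ℂ => G (S.map fun p => p.1 * s ^ p.2) - G (S'.map fun p => p.1 * s ^ p.2)) hlaur
    -- The excluded parameters are those at which two deformed points collide; each pair of points
    -- excludes only finitely many.
    (S := (⋃ p ∈ S, ⋃ q ∈ S, {s : ℂ | p.2 < q.2 ∧ s ^ (q.2 - p.2).toNat = p.1 / q.1})ᶜ)
    (Set.Finite.infinite_compl (S.finite_toSet.biUnion fun p _ => S.finite_toSet.biUnion
      fun q _ => by
        by_cases hpq : p.2 < q.2
        · exact (finite_pow_eq (e := (q.2 - p.2).toNat) (by omega)).subset fun s hs => hs.2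
        · exact Set.finite_empty.subset fun s hs => hpq hs.1))
    (fun s hs hs0 => ?_) one_ne_zero
  · simp only [hone, hS1, hS1'] at key
    exact sub_eq_zero.1 key
  · have hperm : (S.map fun p => p.1 * s ^ p.2).Perm (S'.map fun p => p.1 * s ^ p.2) :=
      (hSS.map _).symm
    obtain ⟨ε, h0, h1, h2⟩ := wordSum_perm (E := Fock) C hx ht g hperm
    have hnd : (S.map fun p => p.1 * s ^ p.2).Nodup := by
      rw [List.Nodup, List.pairwise_map]
      refine hS2.imp_of_mem ?_
      intro p q hp hq hpq heq
      refine hs ?_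
      simp only [Set.mem_iUnion]
      refine ⟨p, hp, q, hq, hpq, ?_⟩
      rw [eq_div_iff (hS0 q hq), ← zpow_natCast, Int.toNat_of_nonneg (by omega), zpow_sub₀ hs0]
      have := zpow_ne_zero p.2 hs0
      field_simp
      linear_combination -heq
    have hv := vdm_ne_zero hnd
    have e1 := hG.eq (S.map fun p => p.1 * s ^ p.2) (by
      intro y hy
      rw [List.mem_map] at hy
      obtain ⟨p, hp, rfl⟩ := hy
      exact mul_ne_zero (hS0 p hp) (zpow_ne_zero _ hs0))
    have e2 := hG.eq (S'.map fun p => p.1 * s ^ p.2) (by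
      intro y hy
      rw [List.mem_map] at hy
      obtain ⟨p, hp, rfl⟩ := hy
      exact mul_ne_zero (hS0' p hp) (zpow_ne_zero _ hs0))
    rw [h1 F hF, e2, smul_smul, ← h2] at e1
    exact sub_eq_zero.2 (smul_right_injective Fock hv e1).symm

end

/-! ### The sum over words on strings of points -/

/-- The inverse of ∏(1 - az) is the exponential of its power sums. This turns factorizations of
rational functions into linear identities between characters. -/
lemma polyL_eq_of_psum {A B : List ℂ} (h : ∀ e : ℤ, psum A e = psum B e) : polyL A = polyL B := by
  have hA := polyL_mul_expC A
  have hB := polyL_mul_expC B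
  have h1 : (fun m : ℕ => psum A m / (m : ℂ)) = fun m : ℕ => psum B m / m := by
    funext m; rw [h]
  rw [h1] at hA
  have h2 : (polyL A : PowerSeries ℂ) = polyL B := by
    calc (polyL A : PowerSeries ℂ) = polyL A * ((polyL B : PowerSeries ℂ) *
          PowerSeries.mk (expC fun m : ℕ => psum B m / m)) := by rw [hB, mul_one]
      _ = (polyL A * PowerSeries.mk (expC fun m : ℕ => psum B m / m)) * polyL B := by ring
      _ = polyL B := by rw [hA, one_mul]
  exact_mod_cast h2

/-- The points `y, x² y, x⁴ y, …`. -/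
def pts (x : ℂ) : ℂ → ℕ → List ℂ
  | _, 0 => []
  | y, n + 1 => y :: pts x (x ^ 2 * y) n

lemma zpow_pow_two (x : ℂ) (e : ℤ) : (x ^ 2) ^ e = (x ^ e) ^ 2 := by
  rw [← zpow_natCast, ← zpow_natCast, ← zpow_mul, ← zpow_mul, mul_comm]

lemma zpow_inv_pow_two (x : ℂ) (e : ℤ) : (x⁻¹ ^ 2) ^ e = (x ^ e)⁻¹ ^ 2 := by
  rw [zpow_pow_two, inv_zpow]

lemma psum_cons (a : ℂ) (L : List ℂ) (e : ℤ) : psum (a :: L) e = a ^ e + psum L e := rfl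

lemma psum_nil (e : ℤ) : psum [] e = 0 := rfl

lemma psum_pts (x y : ℂ) (n : ℕ) (e : ℤ) : psum (pts x y n) e = y ^ e * geoS ((x ^ e) ^ 2) n := by
  induction n generalizing y with
  | zero => simp [pts, psum, geoS]
  | succ n ih =>
    rw [pts, psum_cons, ih, geoS_succ, mul_zpow, zpow_pow_two]
    ring

lemma psum_map_mul (L : List ℂ) (u : ℂ) (e : ℤ) : psum (L.map (· * u)) e = psum L e * u ^ e := by
  induction L with
  | nil => simp [psum]
  | cons a L ih => rw [List.map_cons, psum_cons, ih, psum_cons, mul_zpow]; ring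

section

variable (C : RealizationCase)

/-- The three poles 1, x², x⁻² are admitted for every pair of letters, at the price of numerators
that are always cubic. A denominator that ignores the letters is what allows a sum over all words.
-/
lemma chr_eq_trip (x t : ℂ) (k l : Fin 3) (e : ℤ) :
    chr C k l (x ^ e) (t ^ e) = 1 + (x ^ e) ^ 2 + (x ^ e)⁻¹ ^ 2 - psum (trip C x t k l) e := by
  unfold chr trip
  split_ifs <;>
  · simp only [psum_cons, psum_nil, mul_zpow, zpow_pow_two, inv_zpow, one_zpow]
    ring

/-- The inverse zeros of the row of the contractions of a letter with a word. -/
def rowTrip (x t : ℂ) (k : Fin 3) : ℂ → List (Fin 3) → List ℂ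
  | _, [] => []
  | u, l :: w => (trip C x t k l).map (· * u) ++ rowTrip x t k (x ^ 2 * u) w

lemma psum_rowTrip (x t : ℂ) (k : Fin 3) (u : ℂ) (w : List (Fin 3)) (e : ℤ) :
    psum (rowTrip C x t k u w) e = u ^ e * ((1 + (x ^ e) ^ 2 + (x ^ e)⁻¹ ^ 2) *
      geoS ((x ^ e) ^ 2) w.length - rowChr C (x ^ e) (t ^ e) k w) := by
  induction w generalizing u with
  | nil => simp [rowTrip, psum, geoS, rowChr]
  | cons l w ih =>
    rw [rowTrip, psum_append, psum_map_mul, ih, rowChr, List.length_cons, geoS_succ, chr_eq_trip,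
      mul_zpow, zpow_pow_two]
    ring

lemma numer_scale (x t : ℂ) (k l : Fin 3) (y u : ℂ) :
    numer C x t k l y (y * u) = y ^ 3 * ((trip C x t k l).map fun a => 1 - a * u).prod := by
  unfold numer trip
  split_ifs <;>
  · simp only [List.map_cons, List.map_nil, List.prod_cons, List.prod_nil]
    ring

lemma eval_polyL_append (A B : List ℂ) (ζ : ℂ) :
    (polyL (A ++ B)).eval ζ = (polyL A).eval ζ * (polyL B).eval ζ := by
  rw [polyL_append, Polynomial.eval_mul]

lemma rowN_place (x t : ℂ) (k : Fin 3) (y u ζ : ℂ) (w : List (Fin 3)) :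
    rowN C x t k y (place x (y * (u * ζ)) w) =
      y ^ (3 * w.length) * (polyL (rowTrip C x t k u w)).eval ζ := by
  induction w generalizing u with
  | nil => simp [place, rowN, rowTrip, polyL]
  | cons l w ih =>
    rw [place, rowN_cons, numer_scale, rowTrip, eval_polyL_append, List.length_cons,
      show x ^ 2 * (y * (u * ζ)) = y * (x ^ 2 * u * ζ) by ring, ih,
      eval_polyL ((trip C x t k l).map _), List.map_map]
    have : ((trip C x t k l).map fun a => 1 - a * (u * ζ)) =
        (trip C x t k l).map ((fun a => 1 - a * ζ) ∘ fun a => a * u) :=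
      List.map_congr_left fun a _ => by simp only [Function.comp_apply]; ring
    rw [this]
    ring

/-- The factorization of a row of contractions. -/
lemma psum_row {x t : ℂ} (hx : x ≠ 0) (k : Fin 3) {w : List (Fin 3)}
    (hw : w.Pairwise (rel C)) (u : ℂ) (e : ℤ) :
    psum (rowTrip C x t k u w) e + psum (rowDen C x u k w) e +
        psum [t * x⁻¹ ^ 2 * u, t⁻¹ * u] e =
      psum (rowNum C x t u k w) e + psum [x ^ (2 * w.length) * u, x⁻¹ ^ 2 * u] e +
        (psum (pts x u w.length) e + psum (pts x (t * x⁻¹ ^ 2 * u) w.length) e +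
          psum (pts x (t⁻¹ * u) w.length) e) := by
  have h := rowChr_eq C (zpow_ne_zero e hx) (t ^ e) k hw
  have h2 := rowVal_eq C (x := x) (t := t) e u k w
  rw [psum_rowTrip, psum_pts, psum_pts, psum_pts]
  simp only [psum_cons, psum_nil, mul_zpow, zpow_inv_pow_two, inv_zpow]
  have h3 : (x ^ (2 * w.length)) ^ e = 1 + ((x ^ e) ^ 2 - 1) * geoS ((x ^ e) ^ 2) w.length := by
    have h4 : ∀ (Z : ℂ) (n : ℕ), Z ^ n = 1 + (Z - 1) * geoS Z n := by
      intro Z n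
      induction n with
      | zero => simp [geoS]
      | succ n ih => rw [pow_succ', ih, geoS_succ]; ring
    rw [← h4, ← pow_mul, ← zpow_natCast, ← zpow_natCast, ← zpow_mul, ← zpow_mul, mul_comm]
  rw [h3]
  have h5 : chr1 (x ^ e) (t ^ e) = t ^ e * (x ^ e)⁻¹ ^ 2 + (t ^ e)⁻¹ - 1 - (x ^ e)⁻¹ ^ 2 := rfl
  rw [h5] at h
  linear_combination -u ^ e * h - h2

/-- The words in which every two letters are related. -/
def curWords : ℕ → List (List (Fin 3))
  | 0 => [[]]
  | n + 1 => [0, 1, 2].flatMap fun k =>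
      ((curWords n).filter fun w => ∀ l ∈ w, rel C k l).map fun w => k :: w

lemma curWords_spec (n : ℕ) : ∀ w ∈ curWords C n, w.length = n ∧ w.Pairwise (rel C) := by
  induction n with
  | zero => simp [curWords]
  | succ n ih =>
    intro w hw
    rw [curWords, List.mem_flatMap] at hw
    obtain ⟨k, -, hw⟩ := hw
    rw [List.mem_map] at hw
    obtain ⟨w', hw', rfl⟩ := hw
    rw [List.mem_filter, decide_eq_true_eq] at hw'
    have := ih w' hw'.1
    exact ⟨by rw [List.length_cons, this.1], List.pairwise_cons.2 ⟨hw'.2, this.2⟩⟩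

/-- The coefficients of the currents, where `τ = x ^ r`. -/
def dco (x τ : ℂ) (q : ℕ) : ℂ :=
  ∏ l ∈ Finset.Icc 1 q, (τ * x⁻¹ ^ l - τ⁻¹ * x ^ l) / (x ^ l - x⁻¹ ^ l)

lemma dco_succ (x τ : ℂ) (q : ℕ) : dco x τ (q + 1) =
    dco x τ q * ((τ * x⁻¹ ^ (q + 1) - τ⁻¹ * x ^ (q + 1)) / (x ^ (q + 1) - x⁻¹ ^ (q + 1))) := by
  rw [dco, Finset.prod_Icc_succ_top (by omega)]
  rfl

/-- The common factor of the contractions of a letter with a string. -/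
def strFactor (x t : ℂ) (n : ℕ) : ℂ :=
  (1 - x ^ (2 * n + 2)) * (polyL (pts x (x ^ 2) n ++ (pts x t n ++ pts x (t⁻¹ * x ^ 2) n))).eval 1

/-- The common factor of the contractions inside a string. -/
def strConst (x t : ℂ) : ℕ → ℂ → ℂ
  | 0, _ => 1
  | n + 1, y => strConst x t n (x ^ 2 * y) * (y ^ (3 * n) * (strFactor x t n / (1 - x ^ 2)))

/-- When `k` is related to all letters of `w`, nothing in `w` is before `k`, and the factorization
of the row depends on `w` only through its length and the multiplicity of `k`. The multiplicity
enters through the ratio of consecutive coefficients d_q. -/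
lemma rowTrip_string {x t : ℂ} (hx : x ≠ 0) (k : Fin 3) {w : List (Fin 3)}
    (hw : w.Pairwise (rel C)) (hk : ∀ l ∈ w, rel C k l) :
    (polyL (rowTrip C x t k (x ^ 2) w)).eval 1 *
        ((1 - x ^ (2 * w.count k + 2)) * (1 - t⁻¹ * x ^ 2)) =
      (1 - t⁻¹ * x ^ (2 * w.count k + 2)) * strFactor x t w.length := by
  have hmem : ¬ (k ≠ special C ∧ k ∈ w) := by
    rintro ⟨h1, h2⟩
    rcases hk k h2 with h | h
    · exact lt_irrefl _ h
    · exact h1 h.2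
  have hb : before k w = 0 := before_eq_zero fun l hl => rel_le C (hk l hl)
  have key : polyL (rowTrip C x t k (x ^ 2) w ++ [x ^ (2 * w.count k + 2), t⁻¹ * x ^ 2]) =
      polyL ([t⁻¹ * x ^ (2 * w.count k + 2), x ^ (2 * w.length + 2)] ++
        (pts x (x ^ 2) w.length ++ (pts x t w.length ++ pts x (t⁻¹ * x ^ 2) w.length))) := by
    refine polyL_eq_of_psum fun e => ?_
    have h := psum_row C (t := t) hx k hw (x ^ 2) e
    rw [rowDen, rowNum, if_neg hmem, if_neg hmem, hb] at h
    have e1 : x ^ (2 * ((0 : ℕ) : ℤ) + 2 * (w.count k : ℤ)) * x ^ 2 = x ^ (2 * w.count k + 2) := by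
      rw [pow_add, ← zpow_natCast x (2 * w.count k)]
      push_cast
      rw [zero_add]
    have e2 : x ^ (2 * ((0 : ℕ) : ℤ) - 2) * x ^ 2 = 1 := by
      rw [← zpow_natCast, ← zpow_add₀ hx]
      simp
    have e3 : x⁻¹ ^ 2 * x ^ 2 = 1 := by rw [inv_pow]; exact inv_mul_cancel₀ (pow_ne_zero 2 hx)
    rw [mul_assoc t, mul_assoc t, e2, e3, e1, mul_assoc t⁻¹ (x ^ (_ : ℤ)), e1, ← pow_add, mul_one] at h
    simp only [psum_append, psum_cons, psum_nil] at h ⊢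
    linear_combination h
  have h := congrArg (Polynomial.eval 1) key
  rw [eval_polyL_append, eval_polyL_append, eval_polyL [_, _], eval_polyL [_, _]] at h
  simp only [List.map_cons, List.map_nil, List.prod_cons, List.prod_nil, mul_one] at h
  rw [h, strFactor]
  ring

/-- Since `w` is itself admissible, a letter unrelated to some letter of `w` is unrelated to its
first letter. Then x⁻² is among the inverse zeros of that contraction, and the neighbouring point
x²y is exactly such a zero. -/
lemma rowTrip_string_eq_zero {x t : ℂ} (hx : x ≠ 0) (k : Fin 3) {w : List (Fin 3)}
    (hw : w.Pairwise (rel C)) (hk : ¬ ∀ l ∈ w, rel C k l) :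
    (polyL (rowTrip C x t k (x ^ 2) w)).eval 1 = 0 := by
  rcases w with _ | ⟨l, w⟩
  · simp at hk
  have hl : ¬ rel C k l := by
    intro hl
    refine hk fun l' hl' => ?_
    rcases List.mem_cons.1 hl' with rfl | hl'
    · exact hl
    · have h2 := (List.pairwise_cons.1 hw).1 l' hl'
      rcases hl with h | h
      · exact Or.inl (lt_of_lt_of_le h (rel_le C h2))
      · rw [h.1]
        exact h2
  have hx2 : x⁻¹ ^ 2 * x ^ 2 = 1 := by rw [inv_pow]; exact inv_mul_cancel₀ (pow_ne_zero 2 hx)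
  have hin : x⁻¹ ^ 2 ∈ trip C x t k l := by
    rw [rel, not_or, not_and] at hl
    unfold trip
    split_ifs with h1 h2
    · exact absurd h2 (hl.2 h1)
    · simp
    · exact absurd ‹_› hl.1
    · simp
  rw [rowTrip, eval_polyL_append, eval_polyL]
  refine mul_eq_zero_of_left (List.prod_eq_zero ?_) _
  rw [List.mem_map]
  exact ⟨1, List.mem_map.2 ⟨_, hin, hx2⟩, by simp⟩

variable {E : Type*} [AddCommGroup E] [Module ℂ E]

/-- The sum over all words on a string of points. -/
lemma wordSum_pts {x τ : ℂ} (hx : x ≠ 0) (hτ : τ ≠ 0) (hxr : ∀ n : ℤ, x ^ n = 1 → n = 0)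
    (hτr : ∀ n : ℤ, τ ^ 2 ≠ x ^ n) (n : ℕ) (H : List (Fin 3 × ℂ) → E) (y : ℂ) :
    wordSum C x (τ ^ 2) (dco x τ 1) H (pts x y n) = strConst x (τ ^ 2) n y •
      ((curWords C n).map fun w => dco x τ (w.count (special C)) • H (place x y w)).sum := by
  have hxq : ∀ q : ℕ, (1 : ℂ) - x ^ (q + 1) ≠ 0 := fun q h => by
    have := hxr (q + 1) (by exact_mod_cast (sub_eq_zero.1 h).symm)
    omega
  induction n generalizing H y with
  | zero => simp [pts, wordSum, strConst, curWords, place, dco]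
  | succ n ih =>
    -- Putting `k` in front of an admissible word gives zero unless the longer word is admissible.
    -- Otherwise it gives a factor independent of the letters, times d_{q+1}/d_q if `k` is special.
    -- The choice of d₁ as weight of the special letter makes the common factors agree; it requires
    -- τ² ≠ x².
    have hcoef : ∀ (k : Fin 3), ∀ w ∈ curWords C n, wgt C (dco x τ 1) k *
        (dco x τ (w.count (special C)) * rowN C x (τ ^ 2) k y (place x (x ^ 2 * y) w)) =
        (y ^ (3 * n) * (strFactor x (τ ^ 2) n / (1 - x ^ 2))) *
          if ∀ l ∈ w, rel C k l then dco x τ ((k :: w).count (special C)) else 0 := by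
      intro k w hw
      obtain ⟨hlen, hpw⟩ := curWords_spec C n w hw
      have h1 := rowN_place C x (τ ^ 2) k y (x ^ 2) 1 w
      rw [mul_one, mul_comm y] at h1
      rw [h1, hlen]
      split_ifs with hk
      · have h2 := rowTrip_string C (t := τ ^ 2) hx k hpw hk
        rw [hlen] at h2
        have h3 : 1 - (τ ^ 2)⁻¹ * x ^ 2 ≠ 0 := by
          intro h
          have hτ2 := pow_ne_zero 2 hτ
          field_simp at h
          have h' : τ ^ 2 = x ^ 2 := by linear_combination h
          exact hτr 2 (by exact_mod_cast h')
        have h4 := hxq (2 * w.count k + 1)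
        have h5 : x ^ 2 ≠ 1 := fun h => hxq 1 (by rw [h, sub_self])
        have h5' : 1 - x ^ 2 ≠ 0 := hxq 1
        have hP : (polyL (rowTrip C x (τ ^ 2) k (x ^ 2) w)).eval 1 =
            (1 - (τ ^ 2)⁻¹ * x ^ (2 * w.count k + 2)) * strFactor x (τ ^ 2) n /
              ((1 - x ^ (2 * w.count k + 2)) * (1 - (τ ^ 2)⁻¹ * x ^ 2)) := by
          rw [eq_div_iff (mul_ne_zero h4 h3), h2]
        rw [hP]
        have hd1 : dco x τ 1 = (τ * x⁻¹ - τ⁻¹ * x) / (x - x⁻¹) := by simp [dco]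
        by_cases hkg : k = special C
        · rw [wgt, if_pos hkg, ← hkg, List.count_cons_self, hd1, dco_succ]
          set q := w.count k
          have e1 : x ^ (2 * q + 2) = x ^ (q + 1) * x ^ (q + 1) := by rw [← pow_add]; congr 1; ring
          rw [e1] at h4 ⊢
          have e2 : x ^ (q + 1) - x⁻¹ ^ (q + 1) ≠ 0 := by
            rw [inv_pow]
            refine sub_inv_ne_zero (pow_ne_zero _ hx) ?_
            rw [pow_two]
            exact fun h => h4 (by rw [h, sub_self])
          have e3 : x - x⁻¹ ≠ 0 := sub_inv_ne_zero hx h5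
          rw [inv_pow x (q + 1)] at *
          have hX : x ^ (q + 1) ≠ 0 := pow_ne_zero _ hx
          generalize x ^ (q + 1) = X at *
          have e4 : (τ * x⁻¹ - τ⁻¹ * x) / (x - x⁻¹) = -(τ * (1 - (τ ^ 2)⁻¹ * x ^ 2) / (1 - x ^ 2)) := by
            rw [← div_neg, div_eq_div_iff e3 (neg_ne_zero.2 h5')]
            field_simp
            ring
          have e5 : (τ * X⁻¹ - τ⁻¹ * X) / (X - X⁻¹) =
              -(τ * (1 - (τ ^ 2)⁻¹ * (X * X)) / (1 - X * X)) := by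
            rw [← div_neg, div_eq_div_iff e2 (neg_ne_zero.2 h4)]
            field_simp
            ring
          rw [e4, e5]
          generalize 1 - (τ ^ 2)⁻¹ * x ^ 2 = a at *
          generalize 1 - (τ ^ 2)⁻¹ * (X * X) = b at *
          generalize 1 - X * X = c at *
          generalize 1 - x ^ 2 = d at *
          field_simp
        · have hq : w.count k = 0 := by
            rw [List.count_eq_zero]
            intro hm
            rcases hk k hm with h | h
            · exact lt_irrefl _ h
            · exact hkg h.2
          rw [wgt, if_neg hkg, hq, List.count_cons_of_ne hkg]
          rw [hq] at h4
          simp only [mul_zero, zero_add] at h4 ⊢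
          generalize 1 - (τ ^ 2)⁻¹ * x ^ 2 = a at *
          generalize 1 - x ^ 2 = d at *
          field_simp
      · rw [rowTrip_string_eq_zero C hx k hpw hk]
        ring
    have hterm : ∀ k : Fin 3, wgt C (dco x τ 1) k • wordSum C x (τ ^ 2) (dco x τ 1)
        (fun Z => rowN C x (τ ^ 2) k y Z • H ((k, y) :: Z)) (pts x (x ^ 2 * y) n) =
        strConst x (τ ^ 2) (n + 1) y • ((((curWords C n).filter fun w => ∀ l ∈ w, rel C k l).map
          fun w => k :: w).map fun w => dco x τ (w.count (special C)) • H (place x y w)).sum := by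
      intro k
      rw [ih, List.map_map, smul_comm, strConst, mul_smul]
      congr 1
      have hw : ∀ S : List (List (Fin 3)), (∀ w ∈ S, w ∈ curWords C n) →
          wgt C (dco x τ 1) k • (S.map fun w => dco x τ (w.count (special C)) •
            rowN C x (τ ^ 2) k y (place x (x ^ 2 * y) w) •
              H ((k, y) :: place x (x ^ 2 * y) w)).sum =
          (y ^ (3 * n) * (strFactor x (τ ^ 2) n / (1 - x ^ 2))) •
            ((S.filter fun w => ∀ l ∈ w, rel C k l).map ((fun w => dco x τ (w.count (special C)) •
              H (place x y w)) ∘ fun w => k :: w)).sum := by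
        intro S
        induction S with
        | nil => simp
        | cons w S ihS =>
          intro hS
          have h1 := hcoef k w (hS w (by simp))
          rw [List.map_cons, List.sum_cons, smul_add, ihS fun w' h => hS w' (by simp [h]),
            smul_smul, smul_smul, mul_assoc, h1]
          by_cases hk : ∀ l ∈ w, rel C k l
          · rw [if_pos hk, List.filter_cons_of_pos (by simpa using hk), List.map_cons,
              List.sum_cons, smul_add, mul_smul]
            rfl
          · rw [if_neg hk, List.filter_cons_of_neg (by simpa using hk), mul_zero, zero_smul,
              zero_add]
      exact hw _ fun _ h => h
    rw [pts, wordSum, curWords]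
    simp only [hterm]
    rw [Fin.sum_univ_three, ← smul_add, ← smul_add]
    congr 1
    simp only [List.flatMap_cons, List.flatMap_nil, List.append_nil, List.map_append,
      List.sum_append, add_assoc]

end

/-! ### The sum over words on two strings of points -/

/-- The products `x ^ (2 (b - a)) u`. -/
def grid (x : ℂ) (j : ℕ) : ℂ → ℕ → List ℂ
  | _, 0 => []
  | u, i + 1 => pts x u j ++ grid x j (x⁻¹ ^ 2 * u) i

/-- A monomial factor. -/
def mono (x : ℂ) (p : ℕ) : ℂ → ℕ → ℂ
  | _, 0 => 1
  | y, i + 1 => y ^ p * mono x p (x ^ 2 * y) i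

lemma mono_ne_zero {x : ℂ} (hx : x ≠ 0) (p : ℕ) {y : ℂ} (hy : y ≠ 0) (i : ℕ) :
    mono x p y i ≠ 0 := by
  induction i generalizing y with
  | zero => exact one_ne_zero
  | succ i ih => exact mul_ne_zero (pow_ne_zero _ hy) (ih (mul_ne_zero (pow_ne_zero _ hx) hy))

/-- The inverse zeros of the polynomial that removes the poles of the product of two currents. -/
def poleList (x v : ℂ) (i j : ℕ) : List ℂ :=
  pts x⁻¹ (x ^ (2 * j) * v) i ++ pts x⁻¹ (x⁻¹ ^ 2 * v) i

lemma exists_of_mem_pts {x c e : ℂ} {n : ℕ} (h : e ∈ pts x c n) :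
    ∃ b : ℕ, e = c * x ^ (2 * b) := by
  induction n generalizing c with
  | zero => simp [pts] at h
  | succ n ih =>
    rw [pts, List.mem_cons] at h
    rcases h with rfl | h
    · exact ⟨0, by simp⟩
    · obtain ⟨b, rfl⟩ := ih h
      exact ⟨b + 1, by ring⟩

lemma exists_zpow_of_mem_pts {x c e : ℂ} {n : ℕ} (h : e ∈ pts x c n) : ∃ b : ℤ, e = c * x ^ b := by
  obtain ⟨b, rfl⟩ := exists_of_mem_pts h
  exact ⟨2 * b, by rw [← zpow_natCast]; push_cast; rfl⟩

lemma exists_zpow_of_mem_pts_inv {x c e : ℂ} {n : ℕ} (h : e ∈ pts x⁻¹ c n) :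
    ∃ b : ℤ, e = c * x ^ b := by
  obtain ⟨b, rfl⟩ := exists_zpow_of_mem_pts h
  exact ⟨-b, by rw [zpow_neg, inv_zpow]⟩

lemma exists_zpow_of_mem_grid {x c e : ℂ} (hx : x ≠ 0) {i j : ℕ} (h : e ∈ grid x j c i) :
    ∃ b : ℤ, e = c * x ^ b := by
  induction i generalizing c with
  | zero => simp [grid] at h
  | succ i ih =>
    rw [grid, List.mem_append] at h
    rcases h with h | h
    · exact exists_zpow_of_mem_pts h
    · obtain ⟨b, rfl⟩ := ih h
      refine ⟨b - 2, ?_⟩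
      rw [zpow_sub₀ hx, zpow_ofNat, inv_pow, div_eq_mul_inv]
      ring

lemma eval_polyL_ne_zero {L : List ℂ} {ζ : ℂ} (h : ∀ a ∈ L, a * ζ ≠ 1) : (polyL L).eval ζ ≠ 0 := by
  rw [eval_polyL]
  refine List.prod_ne_zero fun h0 => ?_
  rw [List.mem_map] at h0
  obtain ⟨a, ha, h1⟩ := h0
  exact h a ha (sub_eq_zero.1 h1).symm

lemma pts_nodup {x : ℂ} (hxr : ∀ n : ℤ, x ^ n = 1 → n = 0) {y : ℂ} (hx : x ≠ 0) (hy : y ≠ 0)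
    (n : ℕ) : (pts x y n).Nodup := by
  induction n generalizing y with
  | zero => exact List.nodup_nil
  | succ n ih =>
    rw [pts, List.nodup_cons]
    refine ⟨fun h => ?_, ih (mul_ne_zero (pow_ne_zero _ hx) hy)⟩
    obtain ⟨b, hb⟩ := exists_of_mem_pts h
    have h1 : x ^ (2 * b + 2) = 1 := by
      refine mul_left_cancel₀ hy ?_
      rw [mul_one]
      nth_rewrite 2 [hb]
      ring
    have := hxr (2 * b + 2) (by exact_mod_cast h1)
    omega

lemma pts_ne_zero {x y : ℂ} (hx : x ≠ 0) (hy : y ≠ 0) (n : ℕ) : ∀ e ∈ pts x y n, e ≠ 0 := by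
  intro e he
  obtain ⟨b, rfl⟩ := exists_of_mem_pts he
  exact mul_ne_zero hy (pow_ne_zero _ hx)

lemma pts_mul (x c ζ : ℂ) (n : ℕ) : pts x (c * ζ) n = (pts x c n).map fun y => y * ζ := by
  induction n generalizing c with
  | zero => rfl
  | succ n ih =>
    rw [pts, pts, List.map_cons, ← ih, mul_assoc]

lemma pts_add (x y : ℂ) (m n : ℕ) :
    pts x y (m + n) = pts x y m ++ pts x (x ^ (2 * m) * y) n := by
  induction m generalizing y with
  | zero => simp [pts]
  | succ m ih =>
    rw [Nat.succ_add, pts, ih, pts, List.cons_append]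
    congr 3
    ring

lemma isLaurent_polyL (L : List ℂ) : IsLaurent fun Y : Unit → ℂ => (polyL L).eval (Y ()) := by
  refine (IsLaurent.list_prod L fun a _ => (IsLaurent.const (1 : ℂ)).sub
    ((IsLaurent.const a).mul (IsLaurent.coord ()))).congr fun Y _ => ?_
  rw [eval_polyL]

lemma isLaurent_vdm_pts (x c : ℂ) (n : ℕ) :
    IsLaurent fun Y : Unit → ℂ => vdm (pts x (c * Y ()) n) := by
  simp only [pts_mul]
  induction pts x c n with
  | nil => exact IsLaurent.const 1
  | cons y L ih =>
    simp only [List.map_cons, vdm, List.map_map]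
    refine IsLaurent.mul ?_ ih
    exact IsLaurent.list_prod L fun y' _ => ((IsLaurent.const y).mul (IsLaurent.coord ())).sub
      ((IsLaurent.const y').mul (IsLaurent.coord ()))

lemma isLaurent_pow {κ : Type*} [Fintype κ] {f : (κ → ℂ) → ℂ} (hf : IsLaurent f) (n : ℕ) :
    IsLaurent fun Y => f Y ^ n := by
  induction n with
  | zero => simpa using IsLaurent.const (1 : ℂ)
  | succ n ih =>
    simp only [pow_succ]
    exact ih.mul hf

lemma isLaurent_strConst (x t c : ℂ) (n : ℕ) :
    IsLaurent fun Y : Unit → ℂ => strConst x t n (c * Y ()) := by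
  induction n generalizing c with
  | zero => exact IsLaurent.const 1
  | succ n ih =>
    simp only [strConst, ← mul_assoc]
    exact ((ih (x ^ 2 * c)).mul (isLaurent_pow ((IsLaurent.const c).mul (IsLaurent.coord ())) _)).mul
      (IsLaurent.const _)

/-- The factors without τ are nonzero because `x` is not a root of unity, the others because τ² is
not an integral power of `x`. -/
lemma strConst_ne_zero {x τ : ℂ} (hx : x ≠ 0) (hxr : ∀ n : ℤ, x ^ n = 1 → n = 0)
    (hτr : ∀ n : ℤ, τ ^ 2 ≠ x ^ n) {y : ℂ} (hy : y ≠ 0) (n : ℕ) :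
    strConst x (τ ^ 2) n y ≠ 0 := by
  have hx1 : ∀ n : ℕ, (1 : ℂ) - x ^ (n + 1) ≠ 0 := fun n h => by
    have := hxr (n + 1) (by exact_mod_cast (sub_eq_zero.1 h).symm)
    omega
  induction n generalizing y with
  | zero => exact one_ne_zero
  | succ n ih =>
    refine mul_ne_zero (ih (mul_ne_zero (pow_ne_zero _ hx) hy)) (mul_ne_zero (pow_ne_zero _ hy)
      (div_ne_zero (mul_ne_zero (hx1 (2 * n + 1)) (eval_polyL_ne_zero fun a ha => ?_)) (hx1 1)))
    rw [mul_one]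
    simp only [List.mem_append] at ha
    rcases ha with ha | ha | ha
    · obtain ⟨b, rfl⟩ := exists_of_mem_pts ha
      rw [← pow_add, add_comm]
      exact fun h => hx1 (2 * b + 1) (by rw [← h, sub_self])
    · obtain ⟨b, rfl⟩ := exists_zpow_of_mem_pts ha
      intro h
      refine hτr (-b) ?_
      rw [zpow_neg]
      exact eq_inv_of_mul_eq_one_left h
    · obtain ⟨b, rfl⟩ := exists_zpow_of_mem_pts ha
      intro h
      refine hτr (2 + b) ?_
      rw [zpow_add₀ hx, zpow_ofNat]
      rw [mul_assoc, inv_mul_eq_one₀] at h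
      · exact h
      · intro h0
        rw [h0] at h
        simp at h

section

variable (C : RealizationCase)

/-- The inverse zeros of the contractions of two words. -/
def crossTrip (x t : ℂ) (w' : List (Fin 3)) : ℂ → List (Fin 3) → List ℂ
  | _, [] => []
  | u, k :: w => rowTrip C x t k u w' ++ crossTrip x t w' (x⁻¹ ^ 2 * u) w

lemma cross_place {x : ℂ} (hx : x ≠ 0) (t y v ζ : ℂ) (w w' : List (Fin 3)) :
    cross C x t (place x y w) (place x (y * (v * ζ)) w') =
      mono x (3 * w'.length) y w.length * (polyL (crossTrip C x t w' v w)).eval ζ := by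
  induction w generalizing y v with
  | nil => simp [place, cross, mono, crossTrip, polyL]
  | cons k w ih =>
    have h := ih (x ^ 2 * y) (x⁻¹ ^ 2 * v)
    have e : x ^ 2 * y * (x⁻¹ ^ 2 * v * ζ) = y * (v * ζ) := by field_simp
    rw [e] at h
    rw [place, cross, h, rowN_place, crossTrip, eval_polyL_append, List.length_cons, mono]
    ring

lemma vdm_cross {x : ℂ} (hx : x ≠ 0) (y v ζ : ℂ) (i j : ℕ) :
    ((pts x y i).map fun a => ((pts x (y * (v * ζ)) j).map fun b => a - b).prod).prod =
      mono x j y i * (polyL (grid x j v i)).eval ζ := by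
  have hrow : ∀ (u : ℂ) (j : ℕ) (y : ℂ), ((pts x (y * (u * ζ)) j).map fun b => y - b).prod =
      y ^ j * (polyL (pts x u j)).eval ζ := by
    intro u j
    induction j generalizing u with
    | zero => simp [pts, polyL]
    | succ j ih =>
      intro y
      rw [pts, List.map_cons, List.prod_cons, pts, polyL_cons, Polynomial.eval_mul, eval_lin,
        show x ^ 2 * (y * (u * ζ)) = y * (x ^ 2 * u * ζ) by ring, ih]
      ring
  induction i generalizing y v with
  | zero => simp [pts, mono, grid, polyL]
  | succ i ih =>
    have h := ih (x ^ 2 * y) (x⁻¹ ^ 2 * v)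
    have e : x ^ 2 * y * (x⁻¹ ^ 2 * v * ζ) = y * (v * ζ) := by field_simp
    rw [e] at h
    rw [pts, List.map_cons, List.prod_cons, h, hrow, grid, eval_polyL_append, mono]
    ring

/-- The factorization of the contractions of two words. -/
lemma psum_cross {x t : ℂ} (hx : x ≠ 0) {w' : List (Fin 3)} (hw' : w'.Pairwise (rel C)) (v : ℂ)
    (w : List (Fin 3)) (e : ℤ) :
    psum (crossTrip C x t w' v w) e + psum (phiDen C x w' v w) e +
        psum (pts x⁻¹ (t * x⁻¹ ^ 2 * v) w.length ++ pts x⁻¹ (t⁻¹ * v) w.length) e =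
      psum (phiNum C x t w' v w) e + psum (poleList x v w.length w'.length) e +
        (psum (grid x w'.length v w.length) e +
          psum (grid x w'.length (t * x⁻¹ ^ 2 * v) w.length ++
            grid x w'.length (t⁻¹ * v) w.length) e) := by
  induction w generalizing v with
  | nil => simp [crossTrip, phiDen, phiNum, pts, poleList, grid, psum]
  | cons k w ih =>
    have h1 := ih (x⁻¹ ^ 2 * v)
    have h2 := psum_row C (t := t) hx k hw' v e
    rw [poleList] at h1 ⊢
    simp only [crossTrip, phiDen, phiNum, pts, grid, List.length_cons, psum_append, psum_cons,
      psum_nil] at h1 h2 ⊢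
    simp only [show t * x⁻¹ ^ 2 * (x⁻¹ ^ 2 * v) = x⁻¹ ^ 2 * (t * x⁻¹ ^ 2 * v) by ring,
      show t⁻¹ * (x⁻¹ ^ 2 * v) = x⁻¹ ^ 2 * (t⁻¹ * v) by ring,
      show x ^ (2 * w'.length) * (x⁻¹ ^ 2 * v) = x⁻¹ ^ 2 * (x ^ (2 * w'.length) * v) by ring] at h1
    linear_combination h1 + h2

/-- The words of a current with their coefficients. -/
def wordTerms (x τ : ℂ) (i : ℕ) : List (ℂ × List (Fin 3)) :=
  (curWords C i).map fun w => (dco x τ (w.count (special C)), w)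

/-- The symmetric Laurent polynomial at two strings is, up to a factor, the rational function
represented by the product of two currents. -/
lemma exists_factor {x τ : ℂ} (hx : x ≠ 0) (hτ : τ ≠ 0) (hxr : ∀ n : ℤ, x ^ n = 1 → n = 0)
    (hτr : ∀ n : ℤ, τ ^ 2 ≠ x ^ n) (i j : ℕ) {κ : ℂ} (hκ : κ ≠ 0) :
    ∃ ρ₁ ρ₂ : ℂ → ℂ, IsLaurent (fun Y : Unit → ℂ => ρ₁ (Y ())) ∧
      IsLaurent (fun Y : Unit → ℂ => ρ₂ (Y ())) ∧
      (∀ n : ℤ, ρ₁ (x ^ n) ≠ 0 ∧ ρ₂ (x ^ n) ≠ 0) ∧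
      ∀ (N : ℤ) (F : List (Fin 3 × ℂ) → Fock) (G : List ℂ → Fock), IsFamily N F →
        IsSymm C x (τ ^ 2) (dco x τ 1) F G → ∀ ζ, ζ ≠ 0 → (∀ n : ℤ, ζ ≠ x ^ n) →
          ρ₁ ζ • G (pts x (κ * x ^ (1 - (i : ℤ))) i ++ pts x (κ * x ^ (1 - (j : ℤ)) * ζ) j) =
            ρ₂ ζ • (polyL (poleList x (x ^ ((i : ℤ) - j)) i j)).eval ζ • κ ^ (-N) •
              ratFun C x (τ ^ 2) (wordTerms C x τ i) (wordTerms C x τ j) F ζ := by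
  set y := κ * x ^ (1 - (i : ℤ)) with hy
  set v := x ^ ((i : ℤ) - j) with hv
  have hy0 : y ≠ 0 := mul_ne_zero hκ (zpow_ne_zero _ hx)
  have hv0 : v ≠ 0 := zpow_ne_zero _ hx
  have hyv : y * v = κ * x ^ (1 - (j : ℤ)) := by
    rw [hy, hv, mul_assoc, ← zpow_add₀ hx]
    congr 2
    ring
  have hT : τ ^ 2 ≠ 0 := pow_ne_zero 2 hτ
  set t := τ ^ 2 with ht
  set A := pts x⁻¹ (t * x⁻¹ ^ 2 * v) i ++ pts x⁻¹ (t⁻¹ * v) i with hA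
  set B := grid x j (t * x⁻¹ ^ 2 * v) i ++ grid x j (t⁻¹ * v) i with hB
  -- The zeros of the auxiliary polynomials `A` and `B` lie at integral powers of `x` times `t` or
  -- `t⁻¹`. For generic τ they avoid the integral powers of `x`, where the values are taken later.
  have ht1 : ∀ n m b : ℤ, t * x⁻¹ ^ 2 * x ^ m * x ^ b * x ^ n ≠ 1 := by
    intro n m b h
    refine hτr (-(-2 + m + b + n)) ?_
    rw [zpow_neg, zpow_add₀ hx, zpow_add₀ hx, zpow_add₀ hx, zpow_neg, zpow_ofNat]
    refine eq_inv_of_mul_eq_one_left ?_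
    rw [← h, inv_pow]
    ring
  have ht2 : ∀ n m b : ℤ, t⁻¹ * x ^ m * x ^ b * x ^ n ≠ 1 := by
    intro n m b h
    refine hτr (m + b + n) ?_
    rw [zpow_add₀ hx, zpow_add₀ hx]
    rw [mul_assoc, mul_assoc, inv_mul_eq_one₀ hT] at h
    rw [h]
    ring
  have hAn : ∀ n : ℤ, (polyL A).eval (x ^ n) ≠ 0 := fun n => eval_polyL_ne_zero fun a ha => by
    rw [hA, List.mem_append] at ha
    rcases ha with ha | ha
    · obtain ⟨b, rfl⟩ := exists_zpow_of_mem_pts_inv ha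
      exact ht1 _ _ _
    · obtain ⟨b, rfl⟩ := exists_zpow_of_mem_pts_inv ha
      exact ht2 _ _ _
  have hBn : ∀ n : ℤ, (polyL B).eval (x ^ n) ≠ 0 := fun n => eval_polyL_ne_zero fun a ha => by
    rw [hB, List.mem_append] at ha
    rcases ha with ha | ha
    · obtain ⟨b, rfl⟩ := exists_zpow_of_mem_grid hx ha
      exact ht1 _ _ _
    · obtain ⟨b, rfl⟩ := exists_zpow_of_mem_grid hx ha
      exact ht2 _ _ _
  have hz0 : ∀ n : ℤ, y * v * x ^ n ≠ 0 := fun n =>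
    mul_ne_zero (mul_ne_zero hy0 hv0) (zpow_ne_zero _ hx)
  -- `ρ₁` collects the Vandermonde products inside the two strings, and `ρ₂` the constants from
  -- `wordSum_pts`; the polynomials `A` and `B` balance `psum_cross`. The Vandermonde factor between
  -- the strings, up to a monomial, is the polynomial of `grid x j v i`. It occurs on both sides and
  -- is cancelled, so neither factor contains it.
  refine ⟨fun ζ => (polyL A).eval ζ * (vdm (pts x y i) * vdm (pts x (y * v * ζ) j) * mono x j y i),
    fun ζ => strConst x t i y * strConst x t j (y * v * ζ) * mono x (3 * j) y i * (polyL B).eval ζ,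
    ?_, ?_, ?_, ?_⟩
  · exact (isLaurent_polyL A).mul (((IsLaurent.const _).mul (isLaurent_vdm_pts x (y * v) j)).mul
      (IsLaurent.const _))
  · exact (((IsLaurent.const _).mul (isLaurent_strConst x t (y * v) j)).mul
      (IsLaurent.const _)).mul (isLaurent_polyL B)
  · intro n
    exact ⟨mul_ne_zero (hAn n) (mul_ne_zero (mul_ne_zero (vdm_ne_zero (pts_nodup hxr hx hy0 i))
        (vdm_ne_zero (pts_nodup hxr hx (hz0 n) j))) (mono_ne_zero hx _ hy0 _)),
      mul_ne_zero (mul_ne_zero (mul_ne_zero (strConst_ne_zero hx hxr hτr hy0 i)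
        (strConst_ne_zero hx hxr hτr (hz0 n) j)) (mono_ne_zero hx _ hy0 _)) (hBn n)⟩
  · intro N F G hF hG ζ hζ0 hζ
    have hvb : ∀ b : ℤ, v * x ^ b * ζ ≠ 1 := by
      intro b h
      refine hζ (-((i : ℤ) - j + b)) ?_
      rw [zpow_neg, zpow_add₀ hx]
      exact eq_inv_of_mul_eq_one_right h
    have hgn : (polyL (grid x j v i)).eval ζ ≠ 0 := eval_polyL_ne_zero fun a ha => by
      obtain ⟨b, rfl⟩ := exists_zpow_of_mem_grid hx ha
      exact hvb b
    rw [← hyv]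
    have hG1 := hG.eq (pts x y i ++ pts x (y * v * ζ) j) (by
      intro e he
      rcases List.mem_append.1 he with he | he
      · exact pts_ne_zero hx hy0 i e he
      · exact pts_ne_zero hx (mul_ne_zero (mul_ne_zero hy0 hv0) hζ0) j e he)
    rw [vdm_append, mul_assoc y, vdm_cross hx, wordSum_append, wordSum_pts C hx hτ hxr hτr] at hG1
    have hterm : ∀ w ∈ curWords C i, ∀ w' ∈ curWords C j,
        ((polyL A).eval ζ * cross C x t (place x y w) (place x (y * (v * ζ)) w')) •
          F (place x y w ++ place x (y * (v * ζ)) w') =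
        (mono x (3 * j) y i * (polyL B).eval ζ * (polyL (grid x j v i)).eval ζ *
          (polyL (poleList x v i j)).eval ζ * κ ^ (-N)) • phi C x t w w' ζ •
          F (spread x w ++ scaleW ζ (spread x w')) := by
      intro w hw w' hw'
      obtain ⟨hl, -⟩ := curWords_spec C i w hw
      obtain ⟨hl', hp'⟩ := curWords_spec C j w' hw'
      have hFs : F (place x y w ++ place x (y * (v * ζ)) w') =
          κ ^ (-N) • F (spread x w ++ scaleW ζ (spread x w')) := by
        rw [← hF.scale _ hκ]
        congr 1
        rw [scaleW, List.map_append, ← scaleW, ← scaleW, spread_eq_place hx, spread_eq_place hx,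
          scaleW_place, scaleW_place, scaleW_place, hl, hl', ← hy]
        congr 2
        rw [← mul_assoc, hyv]
        ring
      -- The linear identity `psum_cross` between power sums is converted into an identity between
      -- products of linear factors.
      have hpoly := congrArg (Polynomial.eval ζ) (polyL_eq_of_psum (A := crossTrip C x t w' v w ++
        (phiDen C x w' v w ++ A)) (B := phiNum C x t w' v w ++ (poleList x v i j ++
          (grid x j v i ++ B))) fun e => by
        have := psum_cross C (t := t) hx hp' v w e
        rw [hl, hl', ← hA, ← hB] at this
        simp only [psum_append] at this ⊢
        linear_combination this)
      simp only [eval_polyL_append] at hpoly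
      have hden : (polyL (phiDen C x w' v w)).eval ζ ≠ 0 := eval_polyL_ne_zero fun a ha => by
        obtain ⟨n, rfl⟩ := phiDen_zpow C hx w' _ w a ha
        intro h
        refine hζ (-n) ?_
        rw [zpow_neg]
        exact eq_inv_of_mul_eq_one_right h
      rw [hFs, cross_place C hx, hl, hl', smul_smul, smul_smul]
      congr 1
      rw [phi, hl, hl', ← hv, mul_div_assoc', eq_div_iff hden]
      linear_combination mono x (3 * j) y i * κ ^ (-N) * hpoly
    have hsum : (polyL A).eval ζ • ((curWords C i).map fun w => dco x τ (w.count (special C)) •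
        wordSum C x t (dco x τ 1) (fun Z' => cross C x t (place x y w) Z' •
          F (place x y w ++ Z')) (pts x (y * (v * ζ)) j)).sum =
        (strConst x t j (y * (v * ζ)) * (mono x (3 * j) y i * (polyL B).eval ζ *
          (polyL (grid x j v i)).eval ζ * (polyL (poleList x v i j)).eval ζ * κ ^ (-N))) •
          ratFun C x t (wordTerms C x τ i) (wordTerms C x τ j) F ζ := by
      rw [ratFun, List.smul_sum, List.smul_sum, List.map_map, wordTerms, wordTerms, List.map_map,
        List.map_map]
      refine congrArg List.sum (List.map_congr_left fun w hw => ?_)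
      simp only [Function.comp_apply]
      rw [wordSum_pts C hx hτ hxr hτr, List.map_map, List.smul_sum, List.smul_sum, List.smul_sum,
        List.smul_sum, List.map_map, List.map_map, List.map_map, List.map_map]
      refine congrArg List.sum (List.map_congr_left fun w' hw' => ?_)
      simp only [Function.comp_apply]
      have h := congrArg (fun u => (dco x τ (w.count (special C)) * strConst x t j (y * (v * ζ)) *
        dco x τ (w'.count (special C))) • u) (hterm w hw w' hw')
      simp only [smul_smul] at h ⊢
      convert h using 2 <;> ring
    have hfin := congrArg (fun u => (polyL A).eval ζ • u) hG1
    rw [smul_comm, hsum] at hfin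
    refine smul_right_injective Fock hgn ?_
    simp only [smul_smul] at hfin ⊢
    rw [mul_assoc y]
    convert hfin.symm using 2 <;> ring

end

/-! ### Analytic continuation in the two parameters -/

section

variable {E : Type*} [AddCommGroup E] [Module ℂ E]

/-- The function is a Laurent polynomial in two variables. -/
def IsLaurent₂ (M : ℂ → ℂ → E) : Prop := IsLaurent fun Y : Bool → ℂ => M (Y false) (Y true)

lemma IsLaurent₂.right {M : ℂ → ℂ → E} (h : IsLaurent₂ M) {τ : ℂ} (hτ : τ ≠ 0) :
    IsLaurent fun Y : Unit → ℂ => M τ (Y ()) := by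
  have h1 := IsLaurent.comp_monomial (κ := Unit) h (fun b => cond b 1 τ)
    (fun b => by cases b <;> simp [hτ]) fun b _ => cond b 1 0
  exact h1.congr fun Y _ => by simp

lemma IsLaurent₂.left {M : ℂ → ℂ → E} (h : IsLaurent₂ M) {ζ : ℂ} (hζ : ζ ≠ 0) :
    IsLaurent fun Y : Unit → ℂ => M (Y ()) ζ := by
  have h1 := IsLaurent.comp_monomial (κ := Unit) h (fun b => cond b ζ 1)
    (fun b => by cases b <;> simp [hζ]) fun b _ => cond b 0 1
  exact h1.congr fun Y _ => by simp

lemma IsLaurent.of_left {f : ℂ → E} (h : IsLaurent fun Y : Unit → ℂ => f (Y ())) :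
    IsLaurent₂ fun τ _ => f τ := by
  have h1 := IsLaurent.comp_monomial (κ := Bool) h (fun _ => 1) (fun _ => one_ne_zero)
    fun _ b => cond b 0 1
  exact h1.congr fun Y _ => by simp

lemma IsLaurent.of_right {f : ℂ → E} (h : IsLaurent fun Y : Unit → ℂ => f (Y ())) :
    IsLaurent₂ fun _ ζ => f ζ := by
  have h1 := IsLaurent.comp_monomial (κ := Bool) h (fun _ => 1) (fun _ => one_ne_zero)
    fun _ b => cond b 1 0
  exact h1.congr fun Y _ => by simp

/-- Vanishing at ζ = a⁻¹ for infinitely many τ implies vanishing there for all nonzero τ. Division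
by the linear factor is then possible in both variables at once. -/
lemma IsLaurent₂.exists_div {h : ℂ → ℂ → E} (hh : IsLaurent₂ h) {a : ℂ} (ha : a ≠ 0) {S : Set ℂ}
    (hS : S.Infinite) (h0 : ∀ τ ∈ S, τ ≠ 0 → h τ a⁻¹ = 0) :
    ∃ M : ℂ → ℂ → E, IsLaurent₂ M ∧
      ∀ τ ζ, τ ≠ 0 → ζ ≠ 0 → h τ ζ = (1 - a * ζ) • M τ ζ := by
  obtain ⟨q, hq, hq'⟩ := IsLaurent.sub_update_dvd hh true (IsLaurent.const a⁻¹) (IsLaurent.const a)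
    fun Y _ => inv_mul_cancel₀ ha
  refine ⟨fun τ ζ => (-a⁻¹) • q fun b => cond b ζ τ, ?_, fun τ ζ hτ hζ => ?_⟩
  · refine (hq.const_smul (-a⁻¹)).congr fun Y _ => ?_
    congr 2
    funext b
    cases b <;> rfl
  · have h1 := hq' (fun b => cond b ζ τ) fun b => by cases b <;> simp [hτ, hζ]
    have h2 : h τ a⁻¹ = 0 := IsLaurent.eq_zero_of_infinite (hh.left (inv_ne_zero ha)) hS h0 hτ
    simp only [Function.update_self, ne_eq, Bool.false_eq_true, not_false_eq_true,
      Function.update_of_ne, cond_true, cond_false, h2, sub_zero] at h1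
    rw [h1, smul_smul]
    congr 1
    field_simp
    ring

end

lemma isLaurent₂_polyL (L : List ℂ) : IsLaurent₂ fun _ ζ => (polyL L).eval ζ :=
  IsLaurent.of_right (f := fun ζ => (polyL L).eval ζ) (isLaurent_polyL L)

lemma IsLaurent₂.add {M M' : ℂ → ℂ → Fock} (h : IsLaurent₂ M) (h' : IsLaurent₂ M') :
    IsLaurent₂ fun τ ζ => M τ ζ + M' τ ζ := IsLaurent.add h h'

lemma IsLaurent₂.smul {s : ℂ → ℂ → ℂ} {M : ℂ → ℂ → Fock} (h : IsLaurent₂ s) (h' : IsLaurent₂ M) :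
    IsLaurent₂ fun τ ζ => s τ ζ • M τ ζ := IsLaurent.smul h h'

lemma infinite_generic (x : ℂ) : {ζ : ℂ | ζ ≠ 0 ∧ ∀ n : ℤ, ζ ≠ x ^ n}.Infinite := by
  intro hf
  have h1 : ({0} ∪ Set.range fun n : ℤ => x ^ n).Countable :=
    (Set.countable_singleton 0).union (Set.countable_range _)
  refine not_countable_complex ((hf.countable.union h1).mono fun ζ _ => ?_)
  by_contra hc
  simp only [Set.mem_union, Set.mem_singleton_iff, Set.mem_range, not_or] at hc
  exact hc.1 ⟨hc.2.1, fun n h => hc.2.2 ⟨n, h.symm⟩⟩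

lemma infinite_generic_sq (x : ℂ) : {τ : ℂ | τ ≠ 0 ∧ ∀ n : ℤ, τ ^ 2 ≠ x ^ n}.Infinite := by
  refine Set.Infinite.of_image (fun τ : ℂ => τ ^ 2) ((infinite_generic x).mono ?_)
  rintro ζ ⟨h0, h⟩
  obtain ⟨τ, hτ⟩ := IsAlgClosed.exists_pow_nat_eq ζ (n := 2) (by norm_num)
  refine ⟨τ, ⟨?_, fun n => hτ ▸ h n⟩, hτ⟩
  rintro rfl
  exact h0 (by rw [← hτ]; norm_num)

lemma IsLaurent.eq_of_generic {x : ℂ} {f g : ℂ → Fock}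
    (hf : IsLaurent fun Y : Unit → ℂ => f (Y ())) (hg : IsLaurent fun Y : Unit → ℂ => g (Y ()))
    (h : ∀ ζ, ζ ≠ 0 → (∀ n : ℤ, ζ ≠ x ^ n) → f ζ = g ζ) {ζ : ℂ} (hζ : ζ ≠ 0) : f ζ = g ζ :=
  sub_eq_zero.1 (IsLaurent.eq_zero_of_infinite (f := fun ζ => f ζ - g ζ) (hf.sub hg)
    (infinite_generic x) (fun ζ h1 _ => sub_eq_zero.2 (h ζ h1.1 h1.2)) hζ)

/-- Poles that cancel for generic values of the first parameter can be removed. -/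
lemma exists_cancel {x : ℂ} (hx : x ≠ 0) (D : List ℂ) (hD : ∀ a ∈ D, ∃ n : ℤ, a = x ^ n)
    {h : ℂ → ℂ → Fock} (hh : IsLaurent₂ h) {S : Set ℂ} (hS : S.Infinite)
    (H : ∀ τ ∈ S, τ ≠ 0 → ∃ (ρ : ℂ → ℂ) (K : ℂ → Fock),
      IsLaurent (fun Y : Unit → ℂ => ρ (Y ())) ∧ IsLaurent (fun Y : Unit → ℂ => K (Y ())) ∧
      (∀ n : ℤ, ρ (x ^ n) ≠ 0) ∧ ∀ ζ, ζ ≠ 0 → (∀ n : ℤ, ζ ≠ x ^ n) →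
        ρ ζ • h τ ζ = (polyL D).eval ζ • K ζ) :
    ∃ M : ℂ → ℂ → Fock, IsLaurent₂ M ∧
      ∀ τ ζ, τ ≠ 0 → ζ ≠ 0 → h τ ζ = (polyL D).eval ζ • M τ ζ := by
  induction D generalizing h with
  | nil => exact ⟨h, hh, fun τ ζ _ _ => by simp [polyL]⟩
  | cons a D ih =>
    obtain ⟨n, hn⟩ := hD a (by simp)
    have ha : a ≠ 0 := hn ▸ zpow_ne_zero n hx
    -- For generic τ the hypothesis extends to ζ = a⁻¹ by density. There the right side vanishes,
    -- while `ρ` does not, since a⁻¹ is an integral power of `x`.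
    obtain ⟨h', hh', e⟩ := hh.exists_div ha hS fun τ hτ hτ0 => by
      obtain ⟨ρ, K, hρ, hK, hne, heq⟩ := H τ hτ hτ0
      have h1 := IsLaurent.eq_of_generic (f := fun ζ => ρ ζ • h τ ζ)
        (g := fun ζ => (polyL (a :: D)).eval ζ • K ζ) (hρ.smul (hh.right hτ0))
        ((isLaurent_polyL _).smul hK) heq (inv_ne_zero ha)
      simp only [polyL_cons, Polynomial.eval_mul, eval_lin, mul_inv_cancel₀ ha, sub_self, zero_mul,
        zero_smul] at h1
      refine (smul_eq_zero.1 h1).resolve_left ?_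
      rw [hn, ← zpow_neg]
      exact hne _
    obtain ⟨M, hM, hM'⟩ := ih (fun b hb => hD b (by simp [hb])) hh' fun τ hτ hτ0 => by
      obtain ⟨ρ, K, hρ, hK, hne, heq⟩ := H τ hτ hτ0
      refine ⟨ρ, K, hρ, hK, hne, fun ζ h0 hζ => ?_⟩
      have h1 := heq ζ h0 hζ
      rw [e τ ζ hτ0 h0, polyL_cons, Polynomial.eval_mul, eval_lin, smul_comm, mul_smul] at h1
      refine smul_right_injective Fock (sub_ne_zero.2 fun h2 => hζ (-n) ?_) h1
      rw [zpow_neg, ← hn]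
      exact eq_inv_of_mul_eq_one_right h2.symm
    refine ⟨M, hM, fun τ ζ hτ hζ => ?_⟩
    rw [e τ ζ hτ hζ, hM' τ ζ hτ hζ, polyL_cons, Polynomial.eval_mul, eval_lin, mul_smul]

/-- A family of rational functions with all poles at integral powers of `x`. -/
def IsRat (x : ℂ) (R : ℂ → ℂ → Fock) : Prop :=
  ∃ (D : List ℂ) (h : ℂ → ℂ → Fock), (∀ a ∈ D, ∃ n : ℤ, a = x ^ n) ∧ IsLaurent₂ h ∧
    ∀ τ ζ, τ ≠ 0 → ζ ≠ 0 → (∀ n : ℤ, ζ ≠ x ^ n) → h τ ζ = (polyL D).eval ζ • R τ ζ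

lemma IsRat.zero (x : ℂ) : IsRat x fun _ _ => 0 :=
  ⟨[], fun _ _ => 0, by simp, IsLaurent.zero, by simp⟩

lemma IsRat.add {x : ℂ} {R R' : ℂ → ℂ → Fock} (hR : IsRat x R) (hR' : IsRat x R') :
    IsRat x fun τ ζ => R τ ζ + R' τ ζ := by
  obtain ⟨D, h, hD, hh, e⟩ := hR
  obtain ⟨D', h', hD', hh', e'⟩ := hR'
  refine ⟨D ++ D', fun τ ζ => (polyL D').eval ζ • h τ ζ + (polyL D).eval ζ • h' τ ζ, ?_, ?_, ?_⟩
  · intro a ha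
    rcases List.mem_append.1 ha with ha | ha
    · exact hD a ha
    · exact hD' a ha
  · exact ((isLaurent₂_polyL D').smul hh).add ((isLaurent₂_polyL D).smul hh')
  · intro τ ζ hτ hζ hn
    simp only
    rw [e τ ζ hτ hζ hn, e' τ ζ hτ hζ hn, eval_polyL_append, smul_add, smul_smul, smul_smul, mul_comm]

lemma IsRat.list_sum {x : ℂ} {α : Type*} (S : List α) {R : α → ℂ → ℂ → Fock}
    (h : ∀ s ∈ S, IsRat x (R s)) : IsRat x fun τ ζ => (S.map fun s => R s τ ζ).sum := by
  induction S with
  | nil => simpa using IsRat.zero x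
  | cons a S ih =>
    simp only [List.map_cons, List.sum_cons]
    exact (h a (by simp)).add (ih fun s hs => h s (by simp [hs]))

section

variable (C : RealizationCase)

lemma isLaurent_dco (x : ℂ) (q : ℕ) : IsLaurent fun Y : Unit → ℂ => dco x (Y ()) q := by
  refine IsLaurent.prod _ fun l _ => ?_
  simp only [div_eq_mul_inv]
  refine IsLaurent.mul (IsLaurent.sub ?_ ?_) (IsLaurent.const _)
  · exact (IsLaurent.coord ()).mul (IsLaurent.const _)
  · exact ((IsLaurent.coord_zpow () (-1)).mul (IsLaurent.const _)).congr fun Y _ => by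
      rw [zpow_neg_one]

lemma isLaurent_one_sub (a : ℂ) (n : ℤ) :
    IsLaurent₂ fun τ ζ => 1 - (τ ^ 2) ^ n * a * ζ := by
  refine (IsLaurent.const (1 : ℂ)).sub (IsLaurent.mul (IsLaurent.mul ?_ (IsLaurent.const _))
    (IsLaurent.coord true))
  exact (IsLaurent.coord_zpow false (2 * n)).congr fun Y _ => by rw [zpow_mul, zpow_ofNat]

lemma isLaurent_phiNum (x : ℂ) (w' : List (Fin 3)) (u : ℂ) (w : List (Fin 3)) :
    IsLaurent₂ fun τ ζ => (polyL (phiNum C x (τ ^ 2) w' u w)).eval ζ := by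
  induction w generalizing u with
  | nil =>
    simp only [phiNum, polyL]
    simpa [IsLaurent₂] using IsLaurent.const (ι := Bool) (1 : ℂ)
  | cons k w ih =>
    simp only [phiNum, eval_polyL_append]
    refine IsLaurent.mul ?_ (ih _)
    simp only [rowNum]
    split_ifs
    · simpa [polyL] using IsLaurent.const (ι := Bool) (1 : ℂ)
    · refine (IsLaurent.mul (isLaurent_one_sub (x ^ (2 * (before k w' : ℤ) - 2) * u) 1)
        (isLaurent_one_sub (x ^ (2 * (before k w' : ℤ) + 2 * w'.count k) * u) (-1))).congr
        fun Y _ => ?_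
      simp only [eval_polyL, List.map_cons, List.map_nil, List.prod_cons, List.prod_nil, zpow_one,
        zpow_neg_one]
      ring

lemma isLaurent_family_place {N : ℤ} {F : List (Fin 3 × ℂ) → Fock} (hF : IsFamily N F) {x y y' : ℂ}
    (hx : x ≠ 0) (hy : y ≠ 0) (hy' : y' ≠ 0) (w w' : List (Fin 3)) :
    IsLaurent fun Y : Unit → ℂ => F (place x y w ++ place x (y' * Y ()) w') := by
  have hne : ∀ (w : List (Fin 3)) (y : ℂ), y ≠ 0 → ∀ p ∈ place x y w, p.2 ≠ 0 := by
    intro w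
    induction w with
    | nil => simp [place]
    | cons k w ih =>
      intro y hy p hp
      rw [place, List.mem_cons] at hp
      rcases hp with rfl | hp
      · exact hy
      · exact ih _ (mul_ne_zero (pow_ne_zero _ hx) hy) p hp
  refine (hF.laurent_list ((place x y w).map (fun p => (p.1, p.2, 0)) ++
    (place x y' w').map fun p => (p.1, p.2, 1)) ?_).congr fun Y _ => ?_
  · intro p hp
    rw [List.mem_append, List.mem_map, List.mem_map] at hp
    rcases hp with ⟨q, hq, rfl⟩ | ⟨q, hq, rfl⟩
    · exact hne w y hy q hq
    · exact hne w' y' hy' q hq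
  · rw [List.map_append, List.map_map, List.map_map, mul_comm y', ← scaleW_place, scaleW]
    congr 2
    · simp [Function.comp_def]
    · refine List.map_congr_left fun p _ => ?_
      simp [mul_comm]

lemma isRat_term {N : ℤ} {F : List (Fin 3 × ℂ) → Fock} (hF : IsFamily N F) {x : ℂ} (hx : x ≠ 0)
    {d : ℂ → ℂ} (hd : IsLaurent fun Y : Unit → ℂ => d (Y ())) (w w' : List (Fin 3)) :
    IsRat x fun τ ζ => d τ • phi C x (τ ^ 2) w w' ζ • F (spread x w ++ scaleW ζ (spread x w')) := by
  set u : ℂ := x ^ ((w.length : ℤ) - w'.length) with hu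
  refine ⟨phiDen C x w' u w, fun τ ζ => d τ • (polyL (phiNum C x (τ ^ 2) w' u w)).eval ζ •
    F (spread x w ++ scaleW ζ (spread x w')), phiDen_zpow C hx w' _ w, ?_, ?_⟩
  · refine IsLaurent.smul hd.of_left ((isLaurent_phiNum C x w' u w).smul (IsLaurent.of_right
      (f := fun ζ => F (spread x w ++ scaleW ζ (spread x w'))) ?_))
    refine (isLaurent_family_place hF hx (zpow_ne_zero (1 - (w.length : ℤ)) hx)
      (zpow_ne_zero (1 - (w'.length : ℤ)) hx) w w').congr fun Y _ => ?_
    rw [spread_eq_place hx, spread_eq_place hx, scaleW_place, mul_comm]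
  · intro τ ζ hτ hζ hn
    have hne : (polyL (phiDen C x w' u w)).eval ζ ≠ 0 := eval_polyL_ne_zero fun a ha h => by
      obtain ⟨n, rfl⟩ := phiDen_zpow C hx w' _ w a ha
      refine hn (-n) ?_
      rw [zpow_neg]
      exact eq_inv_of_mul_eq_one_right h
    simp only [phi]
    rw [← hu, smul_smul, smul_smul, smul_smul]
    congr 1
    field_simp

lemma isRat_ratFun {N : ℤ} {F : List (Fin 3 × ℂ) → Fock} (hF : IsFamily N F) {x : ℂ} (hx : x ≠ 0)
    (i j : ℕ) : IsRat x fun τ ζ =>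
      ratFun C x (τ ^ 2) (wordTerms C x τ i) (wordTerms C x τ j) F ζ := by
  simp only [ratFun, wordTerms, List.map_map, Function.comp_def]
  exact IsRat.list_sum _ fun w _ => IsRat.list_sum _ fun w' _ => isRat_term C hF hx
    (d := fun τ => dco x τ (w.count (special C)) * dco x τ (w'.count (special C)))
    ((isLaurent_dco x _).mul (isLaurent_dco x _)) w w'

lemma IsSymm.isLaurent_pts {x t g : ℂ} (hx : x ≠ 0) {F : List (Fin 3 × ℂ) → Fock}
    {G : List ℂ → Fock} (hG : IsSymm C x t g F G) {y y' : ℂ} (hy : y ≠ 0) (hy' : y' ≠ 0)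
    (i j : ℕ) : IsLaurent fun Y : Unit → ℂ => G (pts x y i ++ pts x (y' * Y ()) j) := by
  refine (hG.laurent ((pts x y i).map (fun c => (c, 0)) ++ (pts x y' j).map fun c => (c, 1))
    ?_).congr fun Y _ => ?_
  · intro p hp
    rw [List.mem_append, List.mem_map, List.mem_map] at hp
    rcases hp with ⟨q, hq, rfl⟩ | ⟨q, hq, rfl⟩
    · exact pts_ne_zero hx hy i q hq
    · exact pts_ne_zero hx hy' j q hq
  · rw [List.map_append, List.map_map, List.map_map, pts_mul]
    simp [Function.comp_def]

/-- The rational function represented by the product of two currents has no other poles than those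
in `poleList`. -/
lemma exists_continuation {N : ℤ} {F : List (Fin 3 × ℂ) → Fock} (hF : IsFamily N F) {x : ℂ}
    (hx : x ≠ 0) (hxr : ∀ n : ℤ, x ^ n = 1 → n = 0) (i j : ℕ) :
    ∃ M : ℂ → ℂ → Fock, IsLaurent₂ M ∧ ∀ τ ζ, τ ≠ 0 → ζ ≠ 0 → (∀ n : ℤ, ζ ≠ x ^ n) →
      M τ ζ = (polyL (poleList x (x ^ ((i : ℤ) - j)) i j)).eval ζ •
        ratFun C x (τ ^ 2) (wordTerms C x τ i) (wordTerms C x τ j) F ζ := by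
  obtain ⟨D, h, hD, hh, e⟩ := isRat_ratFun C hF hx i j
  have hnz : ∀ ζ, ζ ≠ 0 → (∀ n : ℤ, ζ ≠ x ^ n) → (polyL D).eval ζ ≠ 0 := fun ζ h0 hn =>
    eval_polyL_ne_zero fun a ha h1 => by
      obtain ⟨n, rfl⟩ := hD a ha
      refine hn (-n) ?_
      rw [zpow_neg]
      exact eq_inv_of_mul_eq_one_right h1
  set Q := polyL (poleList x (x ^ ((i : ℤ) - j)) i j) with hQ
  -- `D` lists the denominators of all single terms. For generic τ the symmetric Laurent polynomial
  -- at two strings shows that, after multiplication by `Q`, none of these denominators is needed;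
  -- `exists_cancel` carries this over to all τ.
  obtain ⟨M, hM, hM'⟩ := exists_cancel hx D hD
    (h := fun τ ζ => Q.eval ζ • h τ ζ) ((isLaurent₂_polyL _).smul hh)
    (infinite_generic_sq x) fun τ hτ hτ0 => by
      obtain ⟨ρ₁, ρ₂, h1, h2, hne, hF'⟩ := exists_factor C hx hτ0 hxr hτ.2 i j one_ne_zero
      obtain ⟨G, hG⟩ := exists_isSymm C hx (pow_ne_zero 2 hτ0) (dco x τ 1) hF
      refine ⟨ρ₂, fun ζ => ρ₁ ζ • G (pts x (1 * x ^ (1 - (i : ℤ))) i ++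
        pts x (1 * x ^ (1 - (j : ℤ)) * ζ) j), h2, h1.smul (hG.isLaurent_pts C hx
          (mul_ne_zero one_ne_zero (zpow_ne_zero _ hx))
          (mul_ne_zero one_ne_zero (zpow_ne_zero _ hx)) i j), fun n => (hne n).2, ?_⟩
      intro ζ h0 hn
      simp only
      rw [hF' N F G hF hG ζ h0 hn, e τ ζ hτ0 h0 hn, one_zpow, one_smul, smul_smul, smul_smul,
        smul_smul, smul_smul]
      congr 1
      ring
  refine ⟨M, hM, fun τ ζ hτ hζ hn => ?_⟩
  have h1 := hM' τ ζ hτ hζ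
  rw [e τ ζ hτ hζ hn, smul_comm] at h1
  exact (smul_right_injective Fock (hnz ζ hζ hn) h1).symm

/-- The factors that relate the continuation to the symmetric Laurent polynomial. -/
lemma exists_factor_continuation {x τ : ℂ} (hx : x ≠ 0) (hτ : τ ≠ 0)
    (hxr : ∀ n : ℤ, x ^ n = 1 → n = 0) (hτr : ∀ n : ℤ, τ ^ 2 ≠ x ^ n) (i j : ℕ) {κ : ℂ}
    (hκ : κ ≠ 0) (n : ℤ) :
    ∃ ρ : ℂ, ρ ≠ 0 ∧ ∀ (N : ℤ) (F : List (Fin 3 × ℂ) → Fock) (G : List ℂ → Fock)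
      (M : ℂ → ℂ → Fock), IsFamily N F → IsSymm C x (τ ^ 2) (dco x τ 1) F G → IsLaurent₂ M →
      (∀ ζ, ζ ≠ 0 → (∀ n : ℤ, ζ ≠ x ^ n) →
        M τ ζ = (polyL (poleList x (x ^ ((i : ℤ) - j)) i j)).eval ζ •
          ratFun C x (τ ^ 2) (wordTerms C x τ i) (wordTerms C x τ j) F ζ) →
      G (pts x (κ * x ^ (1 - (i : ℤ))) i ++ pts x (κ * x ^ (1 - (j : ℤ)) * x ^ n) j) =
        ρ • κ ^ (-N) • M τ (x ^ n) := by
  obtain ⟨ρ₁, ρ₂, h1, h2, hne, hF'⟩ := exists_factor C hx hτ hxr hτr i j hκ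
  refine ⟨ρ₂ (x ^ n) / ρ₁ (x ^ n), div_ne_zero (hne n).2 (hne n).1, ?_⟩
  intro N F G M hF hG hM hM'
  have h3 := IsLaurent.eq_of_generic (x := x)
    (f := fun ζ => ρ₁ ζ • G (pts x (κ * x ^ (1 - (i : ℤ))) i ++
      pts x (κ * x ^ (1 - (j : ℤ)) * ζ) j)) (g := fun ζ => ρ₂ ζ • κ ^ (-N) • M τ ζ)
    (h1.smul (hG.isLaurent_pts C hx (mul_ne_zero hκ (zpow_ne_zero _ hx))
      (mul_ne_zero hκ (zpow_ne_zero _ hx)) i j)) (h2.smul ((hM.right hτ).const_smul _))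
    (fun ζ h0 hn => by
      rw [hF' N F G hF hG ζ h0 hn, hM' ζ h0 hn, smul_comm (κ ^ (-N))]) (zpow_ne_zero n hx)
  rw [div_eq_inv_mul, mul_smul, ← h3, smul_smul, inv_mul_cancel₀ (hne n).1, one_smul]

end

/-! ### The words of the currents -/

section

variable (C : RealizationCase)

/-- The words of the currents, listed explicitly. -/
def stdWords (C : RealizationCase) : ℕ → List (List (Fin 3))
  | 0 => [[]]
  | 1 => [[0], [1], [2]]
  | i + 2 =>
      match C with
      | .two => [[0, 1] ++ List.replicate i 2, [0] ++ List.replicate (i + 1) 2,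
          [1] ++ List.replicate (i + 1) 2, List.replicate (i + 2) 2]
      | .three => [[0] ++ List.replicate i 1 ++ [2], [0] ++ List.replicate (i + 1) 1,
          List.replicate (i + 1) 1 ++ [2], List.replicate (i + 2) 1]

lemma curWords_perm (n : ℕ) : (curWords C n).Perm (stdWords C n) := by
  induction n with
  | zero => exact List.Perm.refl _
  | succ n ih =>
    have h : (curWords C (n + 1)).Perm ([0, 1, 2].flatMap fun k =>
        ((stdWords C n).filter fun w => ∀ l ∈ w, rel C k l).map fun w => k :: w) :=
      List.Perm.flatMap_left _ fun k _ => (ih.filter _).map _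
    refine h.trans ?_
    rcases n with _ | _ | n
    · cases C <;> decide
    · cases C <;> decide
    · have e : ∀ (a b : Fin 3) (n : ℕ), (∀ l ∈ List.replicate (n + 1) a, rel C b l) ↔ rel C b a := by
        intro a b n
        simp [List.mem_replicate]
      cases C
      · simp [stdWords, List.filter_cons, rel, special, List.replicate_succ, List.mem_replicate]
      · simp only [stdWords, rel, special, List.replicate_succ]
        simp [List.filter_cons, List.mem_replicate]
        rw [if_pos, if_pos]
        · simp
        · rintro a (⟨-, rfl⟩ | rfl) <;> decide
        · rintro a (⟨-, rfl⟩ | rfl) <;> decide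

lemma sum_curWords (n : ℕ) (f : List (Fin 3) → Fock) (hf : ∀ w, (∃ l ∈ w, l ≠ special C) → f w = 0) :
    ((curWords C n).map f).sum = f (List.replicate n (special C)) := by
  rw [((curWords_perm C n).map f).sum_eq]
  rcases n with _ | _ | n
  · simp [stdWords]
  · cases C
    · simp [stdWords, special, hf [0] ⟨0, by decide⟩, hf [1] ⟨1, by decide⟩]
    · simp [stdWords, special, hf [0] ⟨0, by decide⟩, hf [2] ⟨2, by decide⟩]
  · cases C
    · simp only [stdWords, List.map_cons, List.map_nil, List.sum_cons, List.sum_nil]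
      rw [hf _ ⟨0, by simp, by decide⟩, hf _ ⟨0, by simp, by decide⟩, hf _ ⟨1, by simp, by decide⟩]
      simp [special]
    · simp only [stdWords, List.map_cons, List.map_nil, List.sum_cons, List.sum_nil]
      rw [hf _ ⟨0, by simp, by decide⟩, hf _ ⟨0, by simp, by decide⟩, hf _ ⟨2, by simp, by decide⟩]
      simp [special]

/-- The family that is the indicator of the words with special letters only. -/
def specialFamily (W : List (Fin 3 × ℂ)) : Fock := if ∀ p ∈ W, p.1 = special C then 1 else 0

lemma isFamily_specialFamily : IsFamily 0 (specialFamily C) := by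
  refine ⟨fun h => ?_, fun {κ} W _ => ?_, fun n w => ?_⟩
  · simp only [specialFamily, h.mem_iff]
  · simp only [specialFamily, scaleW, List.forall_mem_map, neg_zero, zpow_zero, one_smul]
  · simp only [specialFamily, List.forall_mem_ofFn_iff]
    exact IsLaurent.const _

lemma place_special (x y : ℂ) (w : List (Fin 3)) :
    (∀ p ∈ place x y w, p.1 = special C) ↔ ∀ l ∈ w, l = special C := by
  induction w generalizing y with
  | nil => simp [place]
  | cons k w ih => simp only [place, List.forall_mem_cons, ih]

/-- The zeros of the structure function of two words with special letters only. -/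
def zeroList (x t u : ℂ) (i j : ℕ) : List ℂ :=
  pts x⁻¹ (t * x⁻¹ ^ 2 * u) i ++ pts x⁻¹ (t⁻¹ * x ^ (2 * j) * u) i

lemma phiNum_special (x t u ζ : ℂ) (i j : ℕ) :
    (polyL (phiNum C x t (List.replicate j (special C)) u
      (List.replicate i (special C)))).eval ζ = (polyL (zeroList x t u i j)).eval ζ := by
  induction i generalizing u with
  | zero => rfl
  | succ i ih =>
    have hb : before (special C) (List.replicate j (special C)) = 0 :=
      before_eq_zero fun l hl => (List.eq_of_mem_replicate hl).ge
    rw [List.replicate_succ, phiNum, eval_polyL_append, ih, rowNum, if_neg (fun h => h.1 rfl), hb,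
      List.count_replicate_self]
    simp only [zeroList, pts, eval_polyL_append, polyL_cons, List.cons_append, Polynomial.eval_mul,
      eval_lin]
    have e1 : x ^ (2 * ((0 : ℕ) : ℤ) - 2) = x⁻¹ ^ 2 := by
      rw [show 2 * ((0 : ℕ) : ℤ) - 2 = -((2 : ℕ) : ℤ) by norm_num, zpow_neg, zpow_natCast, inv_pow]
    have e2 : x ^ (2 * ((0 : ℕ) : ℤ) + 2 * (j : ℤ)) = x ^ (2 * j) := by
      rw [← zpow_natCast]; push_cast; congr 1; ring
    rw [e1, e2, show x⁻¹ ^ 2 * (t * x⁻¹ ^ 2 * u) = t * x⁻¹ ^ 2 * (x⁻¹ ^ 2 * u) by ring,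
      show x⁻¹ ^ 2 * (t⁻¹ * x ^ (2 * j) * u) = t⁻¹ * x ^ (2 * j) * (x⁻¹ ^ 2 * u) by ring]
    simp only [polyL, List.map_nil, List.prod_nil, Polynomial.eval_one]
    ring

lemma phiDen_special (x u ζ : ℂ) (i j : ℕ) :
    (polyL (phiDen C x (List.replicate j (special C)) u
      (List.replicate i (special C)))).eval ζ = (polyL (poleList x u i j)).eval ζ := by
  induction i generalizing u with
  | zero => rfl
  | succ i ih =>
    have hb : before (special C) (List.replicate j (special C)) = 0 :=
      before_eq_zero fun l hl => (List.eq_of_mem_replicate hl).ge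
    rw [List.replicate_succ, phiDen, eval_polyL_append, ih, rowDen, if_neg (fun h => h.1 rfl), hb,
      List.count_replicate_self]
    simp only [poleList, pts, eval_polyL_append, polyL_cons, List.cons_append, Polynomial.eval_mul,
      eval_lin]
    have e1 : x ^ (2 * ((0 : ℕ) : ℤ) - 2) = x⁻¹ ^ 2 := by
      rw [show 2 * ((0 : ℕ) : ℤ) - 2 = -((2 : ℕ) : ℤ) by norm_num, zpow_neg, zpow_natCast, inv_pow]
    have e2 : x ^ (2 * ((0 : ℕ) : ℤ) + 2 * (j : ℤ)) = x ^ (2 * j) := by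
      rw [← zpow_natCast]; push_cast; congr 1; ring
    rw [e1, e2, show x⁻¹ ^ 2 * (x ^ (2 * j) * u) = x ^ (2 * j) * (x⁻¹ ^ 2 * u) by ring]
    simp only [polyL, List.map_nil, List.prod_nil, Polynomial.eval_one]
    ring

/-- The continuation of the coefficient of the words with special letters only. -/
def mfun (x : ℂ) (i j : ℕ) (τ ζ : ℂ) : ℂ :=
  dco x τ i * dco x τ j * (polyL (zeroList x (τ ^ 2) (x ^ ((i : ℤ) - j)) i j)).eval ζ

/-- Each current has exactly one word made of special letters, so the double sum has a single term.
Its zeros and poles are explicit, and its denominator is precisely the polynomial of `poleList`. -/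
lemma ratFun_specialFamily {x τ : ℂ} (hx : x ≠ 0) (i j : ℕ) {ζ : ℂ} (_ : ζ ≠ 0)
    (hn : ∀ n : ℤ, ζ ≠ x ^ n) :
    mfun x i j τ ζ • (1 : Fock) = (polyL (poleList x (x ^ ((i : ℤ) - j)) i j)).eval ζ •
      ratFun C x (τ ^ 2) (wordTerms C x τ i) (wordTerms C x τ j) (specialFamily C) ζ := by
  have hsp : ∀ w w' : List (Fin 3), specialFamily C (spread x w ++ scaleW ζ (spread x w')) =
      if (∀ l ∈ w, l = special C) ∧ ∀ l ∈ w', l = special C then 1 else 0 := by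
    intro w w'
    rw [spread_eq_place hx, spread_eq_place hx, scaleW_place, specialFamily]
    simp only [List.forall_mem_append, place_special]
  have h0 : ∀ w w' : List (Fin 3), (∃ l ∈ w, l ≠ special C) ∨ (∃ l ∈ w', l ≠ special C) →
      specialFamily C (spread x w ++ scaleW ζ (spread x w')) = 0 := by
    intro w w' h
    rw [hsp, if_neg]
    rintro ⟨h1, h2⟩
    rcases h with ⟨l, hl, h⟩ | ⟨l, hl, h⟩
    · exact h (h1 l hl)
    · exact h (h2 l hl)
  simp only [ratFun, wordTerms, List.map_map, Function.comp_def]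
  rw [sum_curWords C i _ fun w hw => ?_, sum_curWords C j _ fun w' hw' => ?_]
  · rw [hsp, if_pos ⟨fun l hl => List.eq_of_mem_replicate hl,
      fun l hl => List.eq_of_mem_replicate hl⟩, phi, phiNum_special, phiDen_special,
      List.count_replicate_self, List.count_replicate_self, List.length_replicate,
      List.length_replicate, smul_smul, smul_smul, mfun]
    have hne : (polyL (poleList x (x ^ ((i : ℤ) - j)) i j)).eval ζ ≠ 0 :=
      eval_polyL_ne_zero fun a ha h => by
        obtain ⟨n, rfl⟩ : ∃ n : ℤ, a = x ^ n := by
          rw [poleList, List.mem_append] at ha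
          rcases ha with ha | ha <;> obtain ⟨b, rfl⟩ := exists_zpow_of_mem_pts_inv ha
          · exact ⟨2 * j + (i - j) + b, by
              rw [zpow_add₀ hx, zpow_add₀ hx, ← zpow_natCast]; push_cast; rfl⟩
          · exact ⟨-2 + (i - j) + b, by
              rw [zpow_add₀ hx, zpow_add₀ hx, zpow_neg, inv_pow]; rfl⟩
        refine hn (-n) ?_
        rw [zpow_neg]
        exact eq_inv_of_mul_eq_one_right h
    congr 1
    field_simp
  · rw [h0 _ _ (Or.inr hw'), smul_zero, smul_zero]
  · rw [List.sum_eq_zero]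
    intro y hy
    rw [List.mem_map] at hy
    obtain ⟨w', -, rfl⟩ := hy
    rw [h0 _ _ (Or.inl hw), smul_zero, smul_zero]

lemma isLaurent₂_mfun (x : ℂ) (i j : ℕ) : IsLaurent₂ (mfun x i j) := by
  refine IsLaurent.mul (IsLaurent.mul
    (IsLaurent.of_left (f := fun τ => dco x τ i) (isLaurent_dco x i))
    (IsLaurent.of_left (f := fun τ => dco x τ j) (isLaurent_dco x j))) ?_
  have h := isLaurent_phiNum .two x (List.replicate j (special .two)) (x ^ ((i : ℤ) - j))
    (List.replicate i (special .two))
  simp only [phiNum_special] at h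
  exact h

lemma mfun_ne_zero {x τ : ℂ} (hx : x ≠ 0) (hτ : τ ≠ 0) (hxr : ∀ n : ℤ, x ^ n = 1 → n = 0)
    (hτr : ∀ n : ℤ, τ ^ 2 ≠ x ^ n) (i j : ℕ) (n : ℤ) : mfun x i j τ (x ^ n) ≠ 0 := by
  have hd : ∀ q, dco x τ q ≠ 0 := fun q => by
    refine Finset.prod_ne_zero_iff.2 fun l hl => div_ne_zero (fun h => ?_) fun h => ?_
    · refine hτr (2 * l) ?_
      rw [zpow_mul, zpow_natCast, zpow_ofNat, ← pow_mul, mul_comm 2 l, pow_mul]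
      have hX := pow_ne_zero l hx
      rw [inv_pow] at h
      have h2 : (τ * x ^ l) * (τ * (x ^ l)⁻¹ - τ⁻¹ * x ^ l) = τ ^ 2 - (x ^ l) ^ 2 := by field_simp
      rw [h, mul_zero] at h2
      exact sub_eq_zero.1 h2.symm
    · rw [Finset.mem_Icc] at hl
      have := hxr (2 * l) (by
        rw [inv_pow] at h
        rw [zpow_mul, zpow_natCast, zpow_ofNat, ← pow_mul, mul_comm 2 l, pow_mul]
        have hX := pow_ne_zero l hx
        have h2 : x ^ l * (x ^ l - (x ^ l)⁻¹) = (x ^ l) ^ 2 - 1 := by field_simp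
        rw [h, mul_zero] at h2
        exact sub_eq_zero.1 h2.symm)
      omega
  refine mul_ne_zero (mul_ne_zero (hd i) (hd j)) (eval_polyL_ne_zero fun a ha h => ?_)
  rw [zeroList, List.mem_append] at ha
  rcases ha with ha | ha <;> obtain ⟨b, rfl⟩ := exists_zpow_of_mem_pts_inv ha
  · refine hτr (-(-2 + (i - j) + b + n)) ?_
    rw [zpow_neg, zpow_add₀ hx, zpow_add₀ hx, zpow_add₀ hx, zpow_neg, zpow_ofNat]
    refine eq_inv_of_mul_eq_one_left ?_
    rw [← h, inv_pow]
    ring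
  · refine hτr (2 * j + (i - j) + b + n) ?_
    rw [zpow_add₀ hx, zpow_add₀ hx, zpow_add₀ hx]
    have h2 : x ^ (2 * (j : ℤ)) = x ^ (2 * j) := by rw [← zpow_natCast]; push_cast; rfl
    rw [mul_assoc, mul_assoc, mul_assoc, inv_mul_eq_one₀ (pow_ne_zero 2 hτ)] at h
    rw [h, h2]
    ring

/-- The relation between the continuations for two pairs of strings with the same points. -/
lemma relation_of_perm {N : ℤ} {F : List (Fin 3 × ℂ) → Fock} (hF : IsFamily N F) {x : ℂ}
    (hx : x ≠ 0) (hxr : ∀ n : ℤ, x ^ n = 1 → n = 0) {i j a b : ℕ} {n n' e : ℤ}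
    (hperm : (pts x (1 * x ^ (1 - (i : ℤ))) i ++ pts x (1 * x ^ (1 - (j : ℤ)) * x ^ n) j).Perm
      (pts x (x ^ e * x ^ (1 - (a : ℤ))) a ++ pts x (x ^ e * x ^ (1 - (b : ℤ)) * x ^ n') b))
    {M M' : ℂ → ℂ → Fock} (hM : IsLaurent₂ M) (hM' : IsLaurent₂ M')
    (h : ∀ τ ζ, τ ≠ 0 → ζ ≠ 0 → (∀ n : ℤ, ζ ≠ x ^ n) →
      M τ ζ = (polyL (poleList x (x ^ ((i : ℤ) - j)) i j)).eval ζ •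
        ratFun C x (τ ^ 2) (wordTerms C x τ i) (wordTerms C x τ j) F ζ)
    (h' : ∀ τ ζ, τ ≠ 0 → ζ ≠ 0 → (∀ n : ℤ, ζ ≠ x ^ n) →
      M' τ ζ = (polyL (poleList x (x ^ ((a : ℤ) - b)) a b)).eval ζ •
        ratFun C x (τ ^ 2) (wordTerms C x τ a) (wordTerms C x τ b) F ζ)
    {c : ℂ → ℂ} (hc : IsLaurent fun Y : Unit → ℂ => c (Y ()))
    (hm : ∀ τ, τ ≠ 0 → mfun x i j τ (x ^ n) = c τ * mfun x a b τ (x ^ n')) {τ : ℂ} (hτ : τ ≠ 0) :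
    M τ (x ^ n) = c τ • (x ^ e) ^ (-N) • M' τ (x ^ n') := by
  have key : ∀ τ ∈ {τ : ℂ | τ ≠ 0 ∧ ∀ n : ℤ, τ ^ 2 ≠ x ^ n}, τ ≠ 0 →
      M τ (x ^ n) - c τ • (x ^ e) ^ (-N) • M' τ (x ^ n') = 0 := by
    rintro τ ⟨-, hτr⟩ hτ
    obtain ⟨ρ, hρ, H⟩ := exists_factor_continuation C hx hτ hxr hτr i j one_ne_zero n
    obtain ⟨ρ', hρ', H'⟩ := exists_factor_continuation C hx hτ hxr hτr a b (zpow_ne_zero e hx) n'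
    have hT := pow_ne_zero 2 hτ
    have hpt : ∀ y ∈ pts x (1 * x ^ (1 - (i : ℤ))) i ++ pts x (1 * x ^ (1 - (j : ℤ)) * x ^ n) j,
        y ≠ 0 := fun y hy => by
      rcases List.mem_append.1 hy with hy | hy
      · exact pts_ne_zero hx (mul_ne_zero one_ne_zero (zpow_ne_zero _ hx)) _ y hy
      · exact pts_ne_zero hx (mul_ne_zero (mul_ne_zero one_ne_zero (zpow_ne_zero _ hx))
          (zpow_ne_zero _ hx)) _ y hy
    obtain ⟨G, hG⟩ := exists_isSymm C hx hT (dco x τ 1) hF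
    -- The factors `ρ` and `ρ'` are the same for every family. Comparing the two groupings of the
    -- points for the indicator family determines their ratio, which is then used for `F`.
    obtain ⟨G₀, hG₀⟩ := exists_isSymm C hx hT (dco x τ 1) (isFamily_specialFamily C)
    have e1 := hG.perm C hx hT (fun h => hF.perm h) hperm hpt
    have e2 := hG₀.perm C hx hT (fun h => (isFamily_specialFamily C).perm h) hperm hpt
    rw [H N F G M hF hG hM (h τ · hτ), H' N F G M' hF hG hM' (h' τ · hτ), one_zpow,
      one_smul] at e1
    have hl : ∀ i j, IsLaurent₂ fun τ ζ => mfun x i j τ ζ • (1 : Fock) := fun i j =>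
      (isLaurent₂_mfun x i j).smul (IsLaurent.const (1 : Fock))
    rw [H 0 _ G₀ (fun τ ζ => mfun x i j τ ζ • 1) (isFamily_specialFamily C) hG₀ (hl i j)
      (fun ζ => ratFun_specialFamily C hx i j), H' 0 _ G₀ (fun τ ζ => mfun x a b τ ζ • 1)
      (isFamily_specialFamily C) hG₀ (hl a b) (fun ζ => ratFun_specialFamily C hx a b), neg_zero,
      zpow_zero, zpow_zero, one_smul, one_smul, smul_smul, smul_smul, hm τ hτ] at e2
    have e3 := smul_left_injective ℂ (one_ne_zero (α := Fock)) e2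
    have e4 : ρ * c τ = ρ' := by
      refine mul_right_cancel₀ (mfun_ne_zero hx hτ hxr hτr a b n') ?_
      rw [mul_assoc, e3]
    rw [← e4, mul_smul] at e1
    exact sub_eq_zero.2 (smul_right_injective Fock hρ e1)
  -- The relation holds for generic τ, and both sides are Laurent polynomials in τ, so it holds for
  -- every nonzero τ.
  exact sub_eq_zero.1 (IsLaurent.eq_zero_of_infinite
    (f := fun τ => M τ (x ^ n) - c τ • (x ^ e) ^ (-N) • M' τ (x ^ n'))
    ((hM.left (zpow_ne_zero n hx)).sub (hc.smul ((hM'.left (zpow_ne_zero n' hx)).const_smul _)))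
    (infinite_generic_sq x) key hτ)

/-- The first `k` points of the shorter string end exactly one step before the other string begins.
Cutting them off and joining them to its front gives strings of lengths `a` and `j + k`. -/
lemma pts_perm_pos {x : ℂ} (hx : x ≠ 0) (a j k : ℕ) :
    (pts x (1 * x ^ (1 - ((a + k : ℕ) : ℤ))) (a + k) ++
      pts x (1 * x ^ (1 - (j : ℤ)) * x ^ ((j : ℤ) - (a + k : ℕ) + 2 * k)) j).Perm
    (pts x (x ^ (k : ℤ) * x ^ (1 - (a : ℤ))) a ++
      pts x (x ^ (k : ℤ) * x ^ (1 - ((j + k : ℕ) : ℤ)) * x ^ ((j : ℤ) - (a + k : ℕ))) (j + k)) := by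
  rw [add_comm a k, add_comm j k, pts_add, pts_add x _ k j]
  have e1 : x ^ (2 * k) = x ^ (2 * (k : ℤ)) := by rw [← zpow_natCast]; push_cast; rfl
  simp only [one_mul, e1, ← zpow_add₀ hx]
  have e2 : ∀ {p q : ℤ} (n : ℕ), p = q → pts x (x ^ p) n = pts x (x ^ q) n := by
    rintro p q n rfl; rfl
  rw [e2 (q := (k : ℤ) + (1 - a)) a (by push_cast; ring),
    e2 (p := (k : ℤ) + (1 - (k + j : ℕ)) + (j - (k + a : ℕ))) (q := 1 - (k + a : ℕ)) k
      (by push_cast; ring),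
    e2 (p := 1 - (j : ℤ) + (j - (k + a : ℕ) + 2 * k))
      (q := 2 * (k : ℤ) + ((k : ℤ) + (1 - (k + j : ℕ)) + (j - (k + a : ℕ)))) j
      (by push_cast; ring), List.append_assoc]
  exact List.perm_append_comm_assoc _ _ _

/-- Here the last `k` points of the first string are moved to the end of the other one. -/
lemma pts_perm_neg {x : ℂ} (hx : x ≠ 0) (a j k : ℕ) :
    (pts x (1 * x ^ (1 - ((a + k : ℕ) : ℤ))) (a + k) ++
      pts x (1 * x ^ (1 - (j : ℤ)) * x ^ (-((j : ℤ) - (a + k : ℕ) + 2 * k))) j).Perm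
    (pts x (x ^ (-(k : ℤ)) * x ^ (1 - (a : ℤ))) a ++
      pts x (x ^ (-(k : ℤ)) * x ^ (1 - ((j + k : ℕ) : ℤ)) * x ^ (-(j : ℤ) + (a + k : ℕ)))
        (j + k)) := by
  rw [pts_add, pts_add x _ j k]
  have e1 : ∀ k : ℕ, x ^ (2 * k) = x ^ (2 * (k : ℤ)) := fun k => by
    rw [← zpow_natCast]; push_cast; rfl
  simp only [one_mul, e1, ← zpow_add₀ hx]
  have e2 : ∀ {p q : ℤ} (n : ℕ), p = q → pts x (x ^ p) n = pts x (x ^ q) n := by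
    rintro p q n rfl; rfl
  rw [e2 (p := 1 - ((a + k : ℕ) : ℤ)) (q := -(k : ℤ) + (1 - a)) a (by push_cast; ring),
    e2 (p := -(k : ℤ) + (1 - (j + k : ℕ)) + (-j + (a + k : ℕ)))
      (q := 1 - (j : ℤ) + -(j - (a + k : ℕ) + 2 * k)) j (by push_cast; ring),
    e2 (p := 2 * (j : ℤ) + (-(k : ℤ) + (1 - (j + k : ℕ)) + (-j + (a + k : ℕ))))
      (q := 2 * (a : ℤ) + (1 - (a + k : ℕ))) k (by push_cast; ring), List.append_assoc]
  exact List.Perm.append_left _ List.perm_append_comm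

end

/-! ### The coefficients of the relations -/

/-- The constant `c(r, x)` in terms of `τ = x ^ r`. -/
def cfun (x τ : ℂ) : ℂ := (τ - τ⁻¹) * (τ * x⁻¹ - τ⁻¹ * x) / (x - x⁻¹)

/-- The value `Δ₁(x ^ (2 l + 1))` in terms of `τ = x ^ r`. -/
def deltaF (x τ : ℂ) (l : ℕ) : ℂ :=
  (1 - τ ^ 2 * x ^ (2 * (l : ℤ))) * (1 - (τ ^ 2)⁻¹ * x ^ (2 * ((l : ℤ) + 1))) /
    ((1 - x ^ (2 * ((l : ℤ) + 1))) * (1 - x ^ (2 * (l : ℤ))))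

/-- The residue factor. -/
def resFactor (x : ℂ) (n : ℤ) (i k : ℕ) : ℂ :=
  (∏ l ∈ Finset.Icc 1 i, (1 - x ^ (2 * (n + k + l)))) *
    ∏ l ∈ (Finset.Icc 1 i).erase k, (1 - x ^ (2 * ((k : ℤ) - l)))

lemma prod_Icc_one {M : Type*} [CommMonoid M] (f : ℕ → M) (n : ℕ) :
    ∏ l ∈ Finset.Icc 1 n, f l = ∏ e ∈ Finset.range n, f (e + 1) := by
  induction n with
  | zero => simp
  | succ n ih => rw [Finset.prod_Icc_succ_top (by omega), ih, Finset.prod_range_succ]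

lemma prod_Icc_one_erase {M : Type*} [CommMonoid M] (f : ℕ → M) (a k : ℕ) :
    ∏ l ∈ (Finset.Icc 1 (a + (k + 1))).erase (k + 1), f l =
      (∏ e ∈ Finset.range k, f (e + 1)) * ∏ e ∈ Finset.range a, f (k + 2 + e) := by
  induction a with
  | zero =>
    rw [zero_add, ← prod_Icc_one, Finset.prod_range_zero, mul_one]
    congr 1
    ext l
    simp only [Finset.mem_erase, Finset.mem_Icc]
    omega
  | succ a ih =>
    rw [Finset.prod_range_succ, ← mul_assoc, ← ih, mul_comm _ (f _), show k + 2 + a = a + 1 + (k + 1)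
      by ring, ← Finset.prod_insert (f := f)]
    · congr 1
      ext l
      simp only [Finset.mem_erase, Finset.mem_insert, Finset.mem_Icc]
      omega
    · simp only [Finset.mem_erase, Finset.mem_Icc]
      omega

lemma polyL_pts (x c : ℂ) (n : ℕ) :
    polyL (pts x⁻¹ c n) = ∏ e ∈ Finset.range n, lin (c * x ^ (-(2 * (e : ℤ)))) := by
  induction n generalizing c with
  | zero => simp [pts, polyL]
  | succ n ih =>
    rw [pts, polyL_cons, ih, Finset.prod_range_succ', mul_comm]
    congr 1
    · refine Finset.prod_congr rfl fun e _ => ?_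
      have : x⁻¹ ^ 2 * x ^ (-(2 * (e : ℤ))) = x ^ (-(2 * ((e + 1 : ℕ) : ℤ))) := by
        rw [zpow_neg, zpow_neg, ← inv_zpow, ← inv_zpow,
          show 2 * ((e + 1 : ℕ) : ℤ) = ((2 + 2 * e : ℕ) : ℤ) by push_cast; ring, zpow_natCast,
          pow_add, show 2 * (e : ℤ) = ((2 * e : ℕ) : ℤ) by push_cast; ring, zpow_natCast]
      rw [← this]
      ring_nf
    · simp

lemma eval_polyL_pts (x c ζ : ℂ) (n : ℕ) :
    (polyL (pts x⁻¹ c n)).eval ζ = ∏ e ∈ Finset.range n, (1 - c * x ^ (-(2 * (e : ℤ))) * ζ) := by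
  simp only [polyL_pts, Polynomial.eval_prod, eval_lin]

lemma dco_eq {x τ : ℂ} (hx : x ≠ 0) (hτ : τ ≠ 0) (q : ℕ) : dco x τ q = (-τ) ^ q *
    ((∏ e ∈ Finset.range q, (1 - (τ ^ 2)⁻¹ * x ^ (2 * ((e : ℤ) + 1)))) /
      ∏ e ∈ Finset.range q, (1 - x ^ (2 * ((e : ℤ) + 1)))) := by
  rw [dco, prod_Icc_one, ← Finset.prod_div_distrib]
  conv_rhs => rw [← Finset.card_range q, ← Finset.prod_const, Finset.card_range,
    ← Finset.prod_mul_distrib]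
  refine Finset.prod_congr rfl fun e _ => ?_
  have h : x ^ (2 * ((e : ℤ) + 1)) = (x ^ (e + 1)) ^ 2 := by
    rw [← pow_mul, ← zpow_natCast]; congr 1; push_cast; ring
  have hX := pow_ne_zero (e + 1) hx
  rw [h, inv_pow]
  set X := x ^ (e + 1)
  by_cases h1 : X ^ 2 = 1
  -- In this degenerate case both denominators vanish, and both quotients are zero by the convention
  -- for division by zero.
  · have : X - X⁻¹ = 0 := by
      field_simp
      rw [h1, sub_self, mul_zero]
    rw [this, h1]
    simp
  · have h2 : X - X⁻¹ ≠ 0 := fun h => h1 (by field_simp at h; exact sub_eq_zero.1 (by simpa using h))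
    have h3 : 1 - X ^ 2 ≠ 0 := fun h => h1 (sub_eq_zero.1 h).symm
    rw [mul_div_assoc', div_eq_div_iff h2 h3]
    field_simp
    ring

lemma eval_zeroList {x : ℂ} (hx : x ≠ 0) (t : ℂ) (u : ℤ) (i j : ℕ) (ζ : ℂ) :
    (polyL (zeroList x t (x ^ u) i j)).eval ζ =
      (∏ e ∈ Finset.range i, (1 - t * x ^ (u - 2 - 2 * e) * ζ)) *
        ∏ e ∈ Finset.range i, (1 - t⁻¹ * x ^ (u + 2 * j - 2 * e) * ζ) := by
  rw [zeroList, eval_polyL_append, eval_polyL_pts, eval_polyL_pts]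
  have e1 : x⁻¹ ^ 2 = x ^ (-2 : ℤ) := by rw [inv_pow, zpow_neg]; rfl
  have e2 : x ^ (2 * j) = x ^ (2 * (j : ℤ)) := by rw [← zpow_natCast]; push_cast; rfl
  congr 1
  · refine Finset.prod_congr rfl fun e _ => ?_
    rw [e1, mul_assoc t, ← zpow_add₀ hx, mul_assoc t, ← zpow_add₀ hx]
    congr 5; ring
  · refine Finset.prod_congr rfl fun e _ => ?_
    rw [e2, mul_assoc t⁻¹, ← zpow_add₀ hx, mul_assoc t⁻¹, ← zpow_add₀ hx]
    congr 5; ring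

lemma eval_poleList (x u : ℂ) (i j : ℕ) (ζ : ℂ) :
    (polyL (poleList x u i j)).eval ζ = (polyL (zeroList x 1 u i j)).eval ζ := by
  rw [poleList, zeroList, eval_polyL_append, eval_polyL_append, mul_comm, inv_one, one_mul, one_mul]

/-- Reversing the order of the factors exchanges the two groups of zeros. -/
lemma eval_zeroList_inv {x : ℂ} (hx : x ≠ 0) (t : ℂ) (i j : ℕ) (ζ : ℂ) :
    (polyL (zeroList x⁻¹ t⁻¹ (x⁻¹ ^ ((i : ℤ) - j)) i j)).eval ζ =
      (polyL (zeroList x t (x ^ ((i : ℤ) - j)) i j)).eval ζ := by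
  rw [eval_zeroList (inv_ne_zero hx), eval_zeroList hx, mul_comm, inv_inv]
  congr 1
  · rw [← Finset.prod_range_reflect]
    refine Finset.prod_congr rfl fun e he => ?_
    rw [Finset.mem_range] at he
    rw [inv_zpow']
    congr 4
    have : ((i - 1 - e : ℕ) : ℤ) = i - 1 - e := by omega
    rw [this]; ring
  · rw [← Finset.prod_range_reflect]
    refine Finset.prod_congr rfl fun e he => ?_
    rw [Finset.mem_range] at he
    rw [inv_zpow']
    congr 4
    have : ((i - 1 - e : ℕ) : ℤ) = i - 1 - e := by omega
    rw [this]; ring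

lemma dco_inv (x τ : ℂ) (q : ℕ) : dco x⁻¹ τ⁻¹ q = dco x τ q := by
  refine Finset.prod_congr rfl fun l _ => ?_
  rw [inv_inv, inv_inv, ← neg_div_neg_eq, neg_sub, neg_sub]

/-- With this symmetry the constants at the poles with negative exponents follow from those with
positive exponents. -/
lemma mfun_inv {x : ℂ} (hx : x ≠ 0) (i j : ℕ) (τ ζ : ℂ) :
    mfun x⁻¹ i j τ⁻¹ ζ = mfun x i j τ ζ := by
  rw [mfun, mfun, dco_inv, dco_inv, inv_pow, eval_zeroList_inv hx]

lemma cfun_inv (x τ : ℂ) : cfun x⁻¹ τ⁻¹ = -cfun x τ := by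
  simp only [cfun, inv_inv]
  rw [← neg_sub x x⁻¹, div_neg, ← neg_sub τ, ← neg_sub (τ * x⁻¹), neg_mul_neg]

lemma deltaF_inv {x τ : ℂ} (hx : x ≠ 0) (hτ : τ ≠ 0) (l : ℕ) :
    deltaF x⁻¹ τ⁻¹ l = deltaF x τ l := by
  have h1 := zpow_ne_zero (2 * (l : ℤ)) hx
  have h2 := zpow_ne_zero (2 * ((l : ℤ) + 1)) hx
  rw [deltaF, deltaF, inv_zpow, inv_zpow, inv_pow, inv_inv]
  set X := x ^ (2 * (l : ℤ))
  set Y := x ^ (2 * ((l : ℤ) + 1))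
  have e1 : (1 - (τ ^ 2)⁻¹ * X⁻¹) * (1 - τ ^ 2 * Y⁻¹) =
      (1 - τ ^ 2 * X) * (1 - (τ ^ 2)⁻¹ * Y) * (X⁻¹ * Y⁻¹) := by
    field_simp
    ring
  have e2 : (1 - Y⁻¹) * (1 - X⁻¹) = (1 - Y) * (1 - X) * (X⁻¹ * Y⁻¹) := by
    field_simp
    ring
  rw [e1, e2, mul_div_mul_right _ _ (mul_ne_zero (inv_ne_zero h1) (inv_ne_zero h2))]

/-! ### The identity between the coefficients -/

lemma eval_zeroList_zpow {x : ℂ} (hx : x ≠ 0) (t : ℂ) (i j : ℕ) {u n s : ℤ} (h : u + n = 2 * s) :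
    (polyL (zeroList x t (x ^ u) i j)).eval (x ^ n) =
      (∏ e ∈ Finset.range i, (1 - t * x ^ (2 * (s - 1 - e)))) *
        ∏ e ∈ Finset.range i, (1 - t⁻¹ * x ^ (2 * (s + j - e))) := by
  rw [eval_zeroList hx]
  congr 1
  · refine Finset.prod_congr rfl fun e _ => ?_
    rw [mul_assoc, ← zpow_add₀ hx]
    congr 3; linarith
  · refine Finset.prod_congr rfl fun e _ => ?_
    rw [mul_assoc, ← zpow_add₀ hx]
    congr 3; linarith

/-- The algebra behind `mfun_pos`, with every interval product replaced by a letter. `h1` and `h2`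
are the reflections of the products with negative arguments; both involve the same monomial `X`,
which drops out. -/
lemma coeff_identity_aux {P₁ P₂ P₃ P₄ α₀ β₁ β₂ g₁ g₂ pα pβ pg pk Bj Gj At bj gj B' A' Ba Ga Qg Qn
    Gk X : ℂ} (hP : P₁ * P₂ = P₃ * P₄) (h1 : pα * pβ = X * (Ba * A')) (h2 : X * Qn * Ga = pg * pk)
    (hpk : pk ≠ 0) (hGa : Ga ≠ 0) (hGk : Gk ≠ 0) (hgj : gj ≠ 0) :
    P₁ * (β₁ * β₂ * pβ / (g₁ * g₂ * pk)) * (P₂ * (Bj / Gj)) * (α₀ * At * pα * (bj * B')) *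
        (Qg * Qn) =
      α₀ * β₁ / g₁ * (At * β₂ / (Gk * g₂)) * (Qg * gj * (Gk * pg)) *
        (P₃ * (Ba / Ga) * (P₄ * (Bj * bj / (Gj * gj))) * (A' * B')) := by
  have hpg : pg = X * Qn * Ga / pk := by rw [h2, mul_div_cancel_right₀ _ hpk]
  calc _ = P₁ * P₂ * (pα * pβ) * (β₁ * β₂ / (g₁ * g₂ * pk) * (Bj / Gj) * (α₀ * At * (bj * B')) *
        (Qg * Qn)) := by ring
    _ = _ := by
      have e : gj * gj⁻¹ * (Gk * Gk⁻¹) * (Ga * Ga⁻¹) = 1 := by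
        rw [mul_inv_cancel₀ hgj, mul_inv_cancel₀ hGk, mul_inv_cancel₀ hGa, one_mul, one_mul]
      rw [hP, h1, hpg, ← mul_one (P₃ * P₄ * _ * _), ← e]
      simp only [div_eq_mul_inv, mul_inv]
      ring

/-- All quantities are products of α, β and g over intervals of integers. Splitting these intervals
at common endpoints leaves α(0)β(1)/g(1), which is c, the product of the values of Δ₁, and the
residue factor. Everything else occurs on both sides after the products over negative arguments are
reflected. -/
lemma mfun_pos {x τ : ℂ} (hx : x ≠ 0) (hτ : τ ≠ 0) (hxr : ∀ n : ℤ, x ^ n = 1 → n = 0)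
    (a j k : ℕ) :
    mfun x (a + (k + 1)) j τ (x ^ ((j : ℤ) - (a + (k + 1) : ℕ) + 2 * (k + 1 : ℕ))) *
        (polyL (poleList x (x ^ ((a : ℤ) - (j + (k + 1) : ℕ))) a (j + (k + 1)))).eval
          (x ^ ((j : ℤ) - (a + (k + 1) : ℕ))) =
      cfun x τ * (∏ l ∈ Finset.Icc 1 k, deltaF x τ l) *
        resFactor x ((j : ℤ) - (a + (k + 1) : ℕ)) (a + (k + 1)) (k + 1) *
        mfun x a (j + (k + 1)) τ (x ^ ((j : ℤ) - (a + (k + 1) : ℕ))) := by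
  set α : ℤ → ℂ := fun s => 1 - τ ^ 2 * x ^ (2 * s) with hα
  set β : ℤ → ℂ := fun s => 1 - (τ ^ 2)⁻¹ * x ^ (2 * s) with hβ
  set g : ℤ → ℂ := fun s => 1 - x ^ (2 * s) with hg
  have hg0 : ∀ s : ℤ, s ≠ 0 → g s ≠ 0 := fun s hs h => hs (by
    have := hxr (2 * s) (sub_eq_zero.1 h).symm
    omega)
  have hpg0 : ∀ (n : ℕ) (s : ℤ), 0 < s → ∏ e ∈ Finset.range n, g (s + e) ≠ 0 := fun n s hs =>
    Finset.prod_ne_zero_iff.2 fun e _ => hg0 _ (by omega)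
  have hαβ : ∀ s, α (-s) = -(τ ^ 2) * x ^ (2 * (-s)) * β s := by
    intro s
    simp only [hα, hβ]
    rw [mul_neg, zpow_neg]
    have := zpow_ne_zero (2 * s) hx
    field_simp
    ring
  have hgg : ∀ s, g (-s) = -x ^ (2 * (-s)) * g s := by
    intro s
    simp only [hg]
    rw [mul_neg, zpow_neg]
    have := zpow_ne_zero (2 * s) hx
    field_simp
    ring
  have hsplit : ∀ (f : ℤ → ℂ) (s : ℤ) (m n : ℕ), ∏ e ∈ Finset.range (m + n), f (s + e) =
      (∏ e ∈ Finset.range m, f (s + e)) * ∏ e ∈ Finset.range n, f (s + m + e) := by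
    intro f s m n
    rw [Finset.prod_range_add]
    congr 1
    exact Finset.prod_congr rfl fun e _ => by push_cast; rw [add_assoc]
  have hrev : ∀ (f : ℤ → ℂ) (s s' : ℤ) (n : ℕ), s = s' + n - 1 →
      ∏ e ∈ Finset.range n, f (s - e) = ∏ e ∈ Finset.range n, f (s' + e) := by
    intro f s s' n h
    rw [← Finset.prod_range_reflect]
    refine Finset.prod_congr rfl fun e he => ?_
    rw [Finset.mem_range] at he
    congr 1
    omega
  have hdco : ∀ q, dco x τ q = (-τ) ^ q * ((∏ e ∈ Finset.range q, β (1 + e)) /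
      ∏ e ∈ Finset.range q, g (1 + e)) := by
    intro q
    rw [dco_eq hx hτ]
    simp only [hβ, hg, add_comm (1 : ℤ)]
  -- The arguments run from `-a` to `k`. The zero argument belongs to c, the positive ones belong to
  -- Δ₁, and the negative ones have to be reflected.
  have hA : ∏ e ∈ Finset.range (a + (k + 1)), α ((k + 1 : ℕ) - 1 - e) =
      α 0 * (∏ e ∈ Finset.range k, α (1 + e)) * ∏ e ∈ Finset.range a, α (-(1 + e)) := by
    rw [hrev α _ (-a) _ (by push_cast; ring), hsplit α _ a (k + 1)]
    rw [mul_comm]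
    congr 1
    · rw [add_comm k 1, hsplit α _ 1 k, Finset.prod_range_one]
      simp
    · rw [← hrev α (-1) _ _ (by ring)]
      refine Finset.prod_congr rfl fun e _ => ?_
      rw [neg_add, sub_eq_add_neg]
  have hB : ∏ e ∈ Finset.range (a + (k + 1)), β ((k + 1 : ℕ) + j - e) =
      (∏ e ∈ Finset.range (k + 1), β (1 + j + e)) * ∏ e ∈ Finset.range a, β (j - e) := by
    rw [hrev β _ (j - a + 1) _ (by push_cast; ring), hsplit β _ a (k + 1), mul_comm]
    congr 1
    · refine Finset.prod_congr rfl fun e _ => ?_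
      congr 1; ring
    · exact (hrev β _ _ _ (by ring)).symm
  have hQ : ∏ e ∈ Finset.range (a + (k + 1)), g (j - a + 1 + e) =
      (∏ e ∈ Finset.range a, g (j - e)) * ∏ e ∈ Finset.range (k + 1), g (1 + j + e) := by
    rw [hsplit g _ a (k + 1)]
    congr 1
    · exact (hrev g _ _ _ (by ring)).symm
    · refine Finset.prod_congr rfl fun e _ => ?_
      congr 1; ring
  have hone : ∀ f : ℤ → ℂ, ∏ e ∈ Finset.range (k + 1), f (1 + e) =
      f 1 * ∏ e ∈ Finset.range k, f (2 + e) := by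
    intro f
    rw [add_comm k 1, hsplit f _ 1 k, Finset.prod_range_one]
    simp only [Nat.cast_zero, add_zero, Nat.cast_one, one_add_one_eq_two]
  have hΔ : ∏ l ∈ Finset.Icc 1 k, deltaF x τ l = (∏ e ∈ Finset.range k, α (1 + e)) *
      (∏ e ∈ Finset.range k, β (2 + e)) /
        ((∏ e ∈ Finset.range k, g (1 + e)) * ∏ e ∈ Finset.range k, g (2 + e)) := by
    rw [prod_Icc_one, ← Finset.prod_mul_distrib, ← Finset.prod_mul_distrib,
      ← Finset.prod_div_distrib]
    refine Finset.prod_congr rfl fun e _ => ?_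
    simp only [deltaF, hα, hβ, hg]
    rw [mul_comm (1 - x ^ (2 * (1 + (e : ℤ))))]
    push_cast
    congr 5 <;> ring
  have hc : cfun x τ = α 0 * β 1 / g 1 := by
    have h1 : g 1 ≠ 0 := hg0 1 one_ne_zero
    have e1 : x - x⁻¹ = -x⁻¹ * g 1 := by
      simp only [hg, mul_one, zpow_ofNat]
      field_simp
      ring
    have e2 : (τ - τ⁻¹) * (τ * x⁻¹ - τ⁻¹ * x) = -x⁻¹ * (α 0 * β 1) := by
      simp only [hα, hβ, mul_one, zpow_ofNat, mul_zero, pow_zero]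
      field_simp
      ring
    rw [cfun, e1, e2, mul_div_mul_left _ _ (neg_ne_zero.2 (inv_ne_zero hx))]
  have hres : resFactor x ((j : ℤ) - (a + (k + 1) : ℕ)) (a + (k + 1)) (k + 1) =
      (∏ e ∈ Finset.range (a + (k + 1)), g (j - a + 1 + e)) *
        ((∏ e ∈ Finset.range k, g (1 + e)) * ∏ e ∈ Finset.range a, g (-(1 + e))) := by
    rw [resFactor, prod_Icc_one, prod_Icc_one_erase]
    congr 1
    · refine Finset.prod_congr rfl fun e _ => ?_
      simp only [hg]
      congr 3; push_cast; ring
    congr 1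
    · rw [← hrev g k _ _ (by ring)]
      refine Finset.prod_congr rfl fun e _ => ?_
      simp only [hg]
      congr 3; push_cast; ring
    · refine Finset.prod_congr rfl fun e _ => ?_
      simp only [hg]
      congr 3; push_cast; ring
  -- Reflection turns α(-s) into β(s) with a monomial factor. The signs and the powers of τ agree on
  -- the two sides, and the quotient of the powers of `x` is the same for each `e`; `hx2` produces
  -- the same quotient from g.
  have hx1 : (∏ e ∈ Finset.range a, α (-(1 + e))) * ∏ e ∈ Finset.range a, β (1 + (k + 1 : ℕ) + e) =
      (∏ e ∈ Finset.range a, x ^ (2 * ((k : ℤ) + 1))) * ((∏ e ∈ Finset.range a, β (1 + e)) *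
        ∏ e ∈ Finset.range a, α (-(k + 1 : ℕ) - 1 - e)) := by
    rw [← Finset.prod_mul_distrib, ← Finset.prod_mul_distrib, ← Finset.prod_mul_distrib]
    refine Finset.prod_congr rfl fun e _ => ?_
    rw [hαβ, show -((k + 1 : ℕ) : ℤ) - 1 - e = -(1 + (k + 1 : ℕ) + e) by ring, hαβ,
      show 2 * -(1 + (e : ℤ)) = 2 * (k + 1) + 2 * -(1 + (k + 1 : ℕ) + e) by push_cast; ring,
      zpow_add₀ hx]
    ring
  have hx2 : (∏ e ∈ Finset.range a, x ^ (2 * ((k : ℤ) + 1))) *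
      (∏ e ∈ Finset.range a, g (-(k + 1 : ℕ) - 1 - e)) * ∏ e ∈ Finset.range a, g (1 + e) =
      (∏ e ∈ Finset.range a, g (-(1 + e))) * ∏ e ∈ Finset.range a, g (1 + (k + 1 : ℕ) + e) := by
    rw [← Finset.prod_mul_distrib, ← Finset.prod_mul_distrib, ← Finset.prod_mul_distrib]
    refine Finset.prod_congr rfl fun e _ => ?_
    rw [hgg, show -((k + 1 : ℕ) : ℤ) - 1 - e = -(1 + (k + 1 : ℕ) + e) by ring, hgg,
      show 2 * -(1 + (e : ℤ)) = 2 * (k + 1) + 2 * -(1 + (k + 1 : ℕ) + e) by push_cast; ring,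
      zpow_add₀ hx]
    ring
  have hβ' : ∏ e ∈ Finset.range a, β (-((k + 1 : ℕ) : ℤ) + (j + (k + 1) : ℕ) - e) =
      ∏ e ∈ Finset.range a, β (j - e) :=
    Finset.prod_congr rfl fun e _ => congrArg β (by push_cast; ring)
  have hg' : ∏ e ∈ Finset.range a, g (-((k + 1 : ℕ) : ℤ) + (j + (k + 1) : ℕ) - e) =
      ∏ e ∈ Finset.range a, g (j - e) :=
    Finset.prod_congr rfl fun e _ => congrArg g (by push_cast; ring)
  have hz := fun (t : ℂ) => eval_zeroList_zpow hx t a (j + (k + 1))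
    (u := (a : ℤ) - (j + (k + 1) : ℕ)) (n := (j : ℤ) - (a + (k + 1) : ℕ))
    (s := -((k + 1 : ℕ) : ℤ)) (by push_cast; ring)
  have hz' := eval_zeroList_zpow hx (τ ^ 2) (a + (k + 1)) j
    (u := ((a + (k + 1) : ℕ) : ℤ) - j) (n := (j : ℤ) - (a + (k + 1) : ℕ) + 2 * (k + 1 : ℕ))
    (s := ((k + 1 : ℕ) : ℤ)) (by ring)
  have hz1 := hz 1
  simp only [inv_one, one_mul] at hz1
  have hz2 := hz (τ ^ 2)
  change _ = (∏ e ∈ Finset.range a, g (-((k + 1 : ℕ) : ℤ) - 1 - e)) *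
    ∏ e ∈ Finset.range a, g (-((k + 1 : ℕ) : ℤ) + (j + (k + 1) : ℕ) - e) at hz1
  change _ = (∏ e ∈ Finset.range a, α (-((k + 1 : ℕ) : ℤ) - 1 - e)) *
    ∏ e ∈ Finset.range a, β (-((k + 1 : ℕ) : ℤ) + (j + (k + 1) : ℕ) - e) at hz2
  change _ = (∏ e ∈ Finset.range (a + (k + 1)), α (((k + 1 : ℕ) : ℤ) - 1 - e)) *
    ∏ e ∈ Finset.range (a + (k + 1)), β (((k + 1 : ℕ) : ℤ) + j - e) at hz'
  rw [mfun, mfun, eval_poleList, hz1, hz2, hz', hg', hβ', hA, hB, hres, hQ, hc, hΔ, hdco, hdco,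
    hdco, hdco, add_comm a (k + 1), hsplit β 1 (k + 1) a, hsplit g 1 (k + 1) a, hsplit β 1 j (k + 1),
    hsplit g 1 j (k + 1), hone β, hone g, mul_comm (∏ e ∈ Finset.range a, g (-(k + 1 : ℕ) - 1 - e))]
  refine coeff_identity_aux ?_ hx1 hx2 (hpg0 _ _ (by positivity)) (hpg0 _ _ one_pos)
    (hpg0 _ _ one_pos) (hpg0 _ _ (by positivity))
  ring

/-! ### The values of the continuations at the poles -/

/-- In the two groups of factors the exponents of `x` are negative and positive respectively, hence
never zero. This is the regularity of the products on the right side of the relations. -/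
lemma eval_poleList_ne_zero {x : ℂ} (hx : x ≠ 0) (hxr : ∀ n : ℤ, x ^ n = 1 → n = 0) {u n s : ℤ} {a b : ℕ} (h : u + n = 2 * s) (hs : s ≤ 0)
    (hb : (a : ℤ) ≤ s + b) : (polyL (poleList x (x ^ u) a b)).eval (x ^ n) ≠ 0 := by
  rw [eval_poleList, eval_zeroList_zpow hx 1 a b h]
  refine mul_ne_zero (Finset.prod_ne_zero_iff.2 fun e he h0 => ?_)
    (Finset.prod_ne_zero_iff.2 fun e he h0 => ?_)
  · rw [one_mul, sub_eq_zero] at h0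
    have := hxr _ h0.symm
    omega
  · rw [inv_one, one_mul, sub_eq_zero] at h0
    have := hxr _ h0.symm
    rw [Finset.mem_range] at he
    omega

lemma isLaurent_cfun (x : ℂ) : IsLaurent fun Y : Unit → ℂ => cfun x (Y ()) := by
  simp only [cfun, div_eq_mul_inv]
  have h1 : IsLaurent fun Y : Unit → ℂ => Y () := IsLaurent.coord ()
  have h2 : IsLaurent fun Y : Unit → ℂ => (Y ())⁻¹ :=
    (IsLaurent.coord_zpow () (-1)).congr fun Y _ => by rw [zpow_neg_one]
  exact ((h1.sub h2).mul ((h1.mul (IsLaurent.const _)).sub (h2.mul (IsLaurent.const _)))).mul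
    (IsLaurent.const _)

lemma isLaurent_deltaF (x : ℂ) (l : ℕ) : IsLaurent fun Y : Unit → ℂ => deltaF x (Y ()) l := by
  simp only [deltaF, div_eq_mul_inv]
  have h1 : IsLaurent fun Y : Unit → ℂ => Y () ^ 2 :=
    (IsLaurent.coord_zpow () 2).congr fun Y _ => by rw [zpow_ofNat]
  have h2 : IsLaurent fun Y : Unit → ℂ => (Y () ^ 2)⁻¹ :=
    (IsLaurent.coord_zpow () (-2)).congr fun Y _ => by rw [zpow_neg, zpow_ofNat]
  exact (((IsLaurent.const 1).sub (h1.mul (IsLaurent.const _))).mul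
    ((IsLaurent.const 1).sub (h2.mul (IsLaurent.const _)))).mul (IsLaurent.const _)

section

variable (C : RealizationCase)

/-- The function is the continuation of `ratFun`, with the poles removed. -/
structure IsContinuation (x : ℂ) (i j : ℕ) (F : List (Fin 3 × ℂ) → Fock) (M : ℂ → ℂ → Fock) :
    Prop where
  laurent : IsLaurent₂ M
  eq : ∀ τ ζ, τ ≠ 0 → ζ ≠ 0 → (∀ n : ℤ, ζ ≠ x ^ n) →
    M τ ζ = (polyL (poleList x (x ^ ((i : ℤ) - j)) i j)).eval ζ •
      ratFun C x (τ ^ 2) (wordTerms C x τ i) (wordTerms C x τ j) F ζ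

/-- The value of the denominator. -/
def poleVal (x : ℂ) (i j k : ℕ) (n : ℤ) : ℂ :=
  (polyL (poleList x (x ^ (((i - k : ℕ) : ℤ) - (j + k : ℕ))) (i - k) (j + k))).eval (x ^ n)

lemma poleVal_pos {x : ℂ} (hx : x ≠ 0) (hxr : ∀ n : ℤ, x ^ n = 1 → n = 0) {i j k : ℕ} (hki : k ≤ i)
    (hij : i ≤ j) : poleVal x i j k ((j : ℤ) - i) ≠ 0 :=
  eval_poleList_ne_zero hx hxr (s := -k) (by omega) (by omega) (by omega)

lemma poleVal_neg {x : ℂ} (hx : x ≠ 0) (hxr : ∀ n : ℤ, x ^ n = 1 → n = 0) {i j k : ℕ} (hki : k ≤ i)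
    (hij : i ≤ j) : poleVal x i j k (-(j : ℤ) + i) ≠ 0 :=
  eval_poleList_ne_zero hx hxr (s := (i : ℤ) - j - k) (by omega) (by omega) (by omega)

/-- The strings are regrouped by `pts_perm_pos`, and the scalar is supplied by `mfun_pos`. Dividing
by `poleVal` converts `M'`, from which the poles were removed, into the value of the product of
currents. -/
lemma value_pos {N : ℤ} {F : List (Fin 3 × ℂ) → Fock} (hF : IsFamily N F) {x : ℂ}
    (hx : x ≠ 0) (hxr : ∀ n : ℤ, x ^ n = 1 → n = 0) {i j k : ℕ} (hk : 1 ≤ k) (hki : k ≤ i)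
    (hij : i ≤ j) {M M' : ℂ → ℂ → Fock} (hM : IsContinuation C x i j F M)
    (hM' : IsContinuation C x (i - k) (j + k) F M') {τ : ℂ} (hτ : τ ≠ 0) :
    M τ (x ^ ((j : ℤ) - i + 2 * k)) = ((poleVal x i j k ((j : ℤ) - i))⁻¹ *
      (cfun x τ * (∏ l ∈ Finset.Icc 1 (k - 1), deltaF x τ l) * resFactor x ((j : ℤ) - i) i k)) •
        (x ^ (k : ℤ)) ^ (-N) • M' τ (x ^ ((j : ℤ) - i)) := by
  have hp := poleVal_pos hx hxr hki hij
  obtain ⟨k, rfl⟩ : ∃ k', k = k' + 1 := ⟨k - 1, by omega⟩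
  obtain ⟨a, rfl⟩ : ∃ a, i = a + (k + 1) := ⟨i - (k + 1), by omega⟩
  rw [poleVal] at hp ⊢
  rw [Nat.add_sub_cancel] at hM' hp ⊢
  refine relation_of_perm C hF hx hxr (e := ((k + 1 : ℕ) : ℤ)) (pts_perm_pos hx a j (k + 1))
    hM.laurent hM'.laurent hM.eq hM'.eq (c := fun τ => ((polyL (poleList x
      (x ^ ((a : ℤ) - (j + (k + 1) : ℕ))) a (j + (k + 1)))).eval
        (x ^ ((j : ℤ) - (a + (k + 1) : ℕ))))⁻¹ * (cfun x τ * (∏ l ∈ Finset.Icc 1 (k + 1 - 1),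
          deltaF x τ l) * resFactor x ((j : ℤ) - (a + (k + 1) : ℕ)) (a + (k + 1)) (k + 1))) ?_ ?_ hτ
  · exact (IsLaurent.const _).mul (((isLaurent_cfun x).mul (IsLaurent.prod _ fun l _ =>
      isLaurent_deltaF x l)).mul (IsLaurent.const _))
  · intro τ hτ
    have h := mfun_pos hx hτ hxr a j k
    rw [mul_assoc, Nat.add_sub_cancel, ← h, mul_left_comm, inv_mul_cancel₀ hp, mul_one]

lemma value_neg {N : ℤ} {F : List (Fin 3 × ℂ) → Fock} (hF : IsFamily N F) {x : ℂ}
    (hx : x ≠ 0) (hxr : ∀ n : ℤ, x ^ n = 1 → n = 0) {i j k : ℕ} (hk : 1 ≤ k) (hki : k ≤ i)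
    (hij : i ≤ j) {M M' : ℂ → ℂ → Fock} (hM : IsContinuation C x i j F M)
    (hM' : IsContinuation C x (i - k) (j + k) F M') {τ : ℂ} (hτ : τ ≠ 0) :
    M τ (x ^ (-((j : ℤ) - i + 2 * k))) = ((poleVal x i j k (-(j : ℤ) + i))⁻¹ *
      (-cfun x τ * (∏ l ∈ Finset.Icc 1 (k - 1), deltaF x τ l) *
        resFactor x⁻¹ ((j : ℤ) - i) i k)) •
        (x ^ (-(k : ℤ))) ^ (-N) • M' τ (x ^ (-(j : ℤ) + i)) := by
  have hp := poleVal_neg hx hxr hki hij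
  obtain ⟨k, rfl⟩ : ∃ k', k = k' + 1 := ⟨k - 1, by omega⟩
  obtain ⟨a, rfl⟩ : ∃ a, i = a + (k + 1) := ⟨i - (k + 1), by omega⟩
  rw [poleVal] at hp ⊢
  rw [Nat.add_sub_cancel] at hM' hp ⊢
  refine relation_of_perm C hF hx hxr (e := -((k + 1 : ℕ) : ℤ)) (pts_perm_neg hx a j (k + 1))
    hM.laurent hM'.laurent hM.eq hM'.eq (c := fun τ => ((polyL (poleList x
      (x ^ ((a : ℤ) - (j + (k + 1) : ℕ))) a (j + (k + 1)))).eval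
        (x ^ (-(j : ℤ) + (a + (k + 1) : ℕ))))⁻¹ * (-cfun x τ * (∏ l ∈ Finset.Icc 1 (k + 1 - 1),
          deltaF x τ l) * resFactor x⁻¹ ((j : ℤ) - (a + (k + 1) : ℕ)) (a + (k + 1)) (k + 1))) ?_ ?_ hτ
  · refine (IsLaurent.const _).mul ((IsLaurent.mul ?_ (IsLaurent.prod _ fun l _ =>
      isLaurent_deltaF x l)).mul (IsLaurent.const _))
    exact ((IsLaurent.const (-1)).mul (isLaurent_cfun x)).congr fun Y _ => by ring
  · intro τ hτ
    have hxr' : ∀ n : ℤ, x⁻¹ ^ n = 1 → n = 0 := fun n hn => hxr n (by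
      rwa [inv_zpow, inv_eq_one] at hn)
    -- The computation is repeated for x⁻¹ and τ⁻¹. Only `cfun` changes its sign, and this is the
    -- minus sign of the second delta function in the relations.
    have h := mfun_pos (inv_ne_zero hx) (inv_ne_zero hτ) hxr' a j k
    have e1 : -(j : ℤ) + (a + (k + 1) : ℕ) = -((j : ℤ) - (a + (k + 1) : ℕ)) := by ring
    have e2 := eval_zeroList_inv hx 1 a (j + (k + 1)) (x⁻¹ ^ ((j : ℤ) - (a + (k + 1) : ℕ)))
    rw [inv_one] at e2
    simp only [mfun_inv hx, eval_poleList, e2, cfun_inv, deltaF_inv hx hτ] at h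
    simp only [eval_poleList, e1] at hp ⊢
    rw [inv_zpow', inv_zpow'] at h
    rw [mul_assoc, Nat.add_sub_cancel, ← h, mul_left_comm, inv_mul_cancel₀ hp, mul_one]

end

/-! ### The relations of the currents -/

/-- An inverse pole of the product of two currents. -/
def poleAt (x : ℂ) (n : ℤ) (k : ℕ) : ℂ := x ^ (n + 2 * k)

/-- The set of the inverse poles of the product of two currents. -/
def poleSet (x : ℂ) (n : ℤ) (i : ℕ) : Finset ℂ :=
  open Classical in
  (Finset.Icc 1 i).image (poleAt x n) ∪ (Finset.Icc 1 i).image (poleAt x⁻¹ n)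

section

variable {x : ℂ}

lemma zpow_injective_of (hx : x ≠ 0) (hxr : ∀ n : ℤ, x ^ n = 1 → n = 0) {p q : ℤ}
    (h : x ^ p = x ^ q) : p = q := by
  have := hxr (p - q) (by rw [zpow_sub₀ hx, h, div_self (zpow_ne_zero _ hx)])
  omega

lemma poleAt_injective (hx : x ≠ 0) (hxr : ∀ n : ℤ, x ^ n = 1 → n = 0) (n : ℤ) :
    Function.Injective (poleAt x n) := fun k l h => by
  have := zpow_injective_of hx hxr h
  omega

lemma poleAt_inv (n : ℤ) (k : ℕ) : poleAt x⁻¹ n k = (poleAt x n k)⁻¹ := inv_zpow _ _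

lemma eq_zero_of_inv_zpow_eq_one (hxr : ∀ n : ℤ, x ^ n = 1 → n = 0) (n : ℤ) (hn : x⁻¹ ^ n = 1) : n = 0 :=
  hxr n (by rwa [inv_zpow, inv_eq_one] at hn)

/-- The exponent on one side is positive and on the other side nonpositive. Since `n` will be `j -
i`, this is where i ≤ j makes all poles simple. -/
lemma poleAt_ne (hx : x ≠ 0) (hxr : ∀ n : ℤ, x ^ n = 1 → n = 0) {n : ℤ} (hn : 0 ≤ n) {k l : ℕ}
    (hk : 1 ≤ k) : poleAt x n k ≠ poleAt x⁻¹ n l := fun h => by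
  rw [poleAt, poleAt, inv_zpow'] at h
  have := zpow_injective_of hx hxr h
  omega

lemma poleSet_disjoint [DecidableEq ℂ] (hx : x ≠ 0) (hxr : ∀ n : ℤ, x ^ n = 1 → n = 0) {n : ℤ}
    (hn : 0 ≤ n) (i : ℕ) :
    Disjoint ((Finset.Icc 1 i).image (poleAt x n)) ((Finset.Icc 1 i).image (poleAt x⁻¹ n)) := by
  rw [Finset.disjoint_left]
  intro a ha hb
  rw [Finset.mem_image] at ha hb
  obtain ⟨k, hk, rfl⟩ := ha
  obtain ⟨l, hl, h⟩ := hb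
  exact poleAt_ne hx hxr hn (Finset.mem_Icc.1 hk).1 h.symm

lemma sum_poleSet (hx : x ≠ 0) (hxr : ∀ n : ℤ, x ^ n = 1 → n = 0) {n : ℤ} (hn : 0 ≤ n) (i : ℕ)
    (f : ℂ → Fock) : ∑ a ∈ poleSet x n i, f a =
      ∑ k ∈ Finset.Icc 1 i, (f (poleAt x n k) + f (poleAt x⁻¹ n k)) := by
  classical
  have h1 := poleAt_injective hx hxr n
  have h2 := poleAt_injective (inv_ne_zero hx) (eq_zero_of_inv_zpow_eq_one hxr) n
  rw [Finset.sum_add_distrib, ← Finset.sum_image (f := f) h1.injOn,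
    ← Finset.sum_image (f := f) h2.injOn, ← Finset.sum_union (poleSet_disjoint hx hxr hn i)]
  congr 1

lemma prod_poleSet (hx : x ≠ 0) (hxr : ∀ n : ℤ, x ^ n = 1 → n = 0) {n : ℤ} (hn : 0 ≤ n) (i : ℕ)
    (f : ℂ → Polynomial ℂ) : ∏ a ∈ poleSet x n i, f a =
      (∏ k ∈ Finset.Icc 1 i, f (poleAt x n k)) * ∏ k ∈ Finset.Icc 1 i, f (poleAt x⁻¹ n k) := by
  classical
  have h1 := poleAt_injective hx hxr n
  have h2 := poleAt_injective (inv_ne_zero hx) (eq_zero_of_inv_zpow_eq_one hxr) n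
  rw [← Finset.prod_image (f := f) h1.injOn, ← Finset.prod_image (f := f) h2.injOn,
    ← Finset.prod_union (poleSet_disjoint hx hxr hn i)]
  congr 1

lemma poleSet_inv (n : ℤ) (i : ℕ) : poleSet x⁻¹ n i = poleSet x n i := by
  classical
  unfold poleSet
  rw [inv_inv, Finset.union_comm]

/-- This is the residue denominator at the inverse poles built from x⁻¹. Those built from `x` are
covered by replacing `x` with x⁻¹, since `poleSet` is invariant under it. -/
lemma prod_poleSet_erase (hx : x ≠ 0) (hxr : ∀ n : ℤ, x ^ n = 1 → n = 0) {n : ℤ} (hn : 0 ≤ n)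
    {i k : ℕ} :
    ∏ b ∈ (poleSet x n i).erase (poleAt x⁻¹ n k), (1 - b * (poleAt x⁻¹ n k)⁻¹) =
      resFactor x n i k := by
  classical
  have h1 := poleAt_injective hx hxr n
  have h2 := poleAt_injective (inv_ne_zero hx) (eq_zero_of_inv_zpow_eq_one hxr) n
  have e : (poleSet x n i).erase (poleAt x⁻¹ n k) = (Finset.Icc 1 i).image (poleAt x n) ∪
      ((Finset.Icc 1 i).erase k).image (poleAt x⁻¹ n) := by
    rw [Finset.image_erase h2]
    ext a
    simp only [poleSet, Finset.mem_erase, Finset.mem_union]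
    constructor
    · rintro ⟨h3, h4 | h4⟩
      · exact Or.inl (by convert h4)
      · exact Or.inr ⟨h3, by convert h4⟩
    · rintro (h4 | ⟨h3, h4⟩)
      · refine ⟨?_, Or.inl (by convert h4)⟩
        rintro rfl
        rw [Finset.mem_image] at h4
        obtain ⟨l, hl, hl'⟩ := h4
        exact poleAt_ne hx hxr hn (Finset.mem_Icc.1 hl).1 hl'
      · exact ⟨h3, Or.inr (by convert h4)⟩
  rw [e, Finset.prod_union ((poleSet_disjoint hx hxr hn i).mono_right
    (Finset.image_subset_image (Finset.erase_subset _ _))), Finset.prod_image h1.injOn,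
    Finset.prod_image h2.injOn, resFactor]
  congr 1
  · refine Finset.prod_congr rfl fun l _ => ?_
    rw [poleAt_inv, inv_inv, poleAt, poleAt, ← zpow_add₀ hx]
    congr 2; ring
  · refine Finset.prod_congr rfl fun l _ => ?_
    rw [poleAt_inv n k, inv_inv, poleAt, poleAt, inv_zpow', ← zpow_add₀ hx]
    congr 2; ring

lemma polyL_poleList (hx : x ≠ 0) (hxr : ∀ n : ℤ, x ^ n = 1 → n = 0) {i j : ℕ} (hij : i ≤ j) :
    polyL (poleList x (x ^ ((i : ℤ) - j)) i j) = ∏ a ∈ poleSet x ((j : ℤ) - i) i, lin a := by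
  rw [prod_poleSet hx hxr (by omega), prod_Icc_one, prod_Icc_one, poleList, polyL_append, polyL_pts,
    polyL_pts]
  congr 1
  · rw [← Finset.prod_range_reflect]
    refine Finset.prod_congr rfl fun e he => ?_
    rw [Finset.mem_range] at he
    have e2 : x ^ (2 * j) = x ^ (2 * (j : ℤ)) := by rw [← zpow_natCast]; push_cast; rfl
    rw [poleAt, e2, ← zpow_add₀ hx, ← zpow_add₀ hx]
    congr 2
    have : ((i - 1 - e : ℕ) : ℤ) = i - 1 - e := by omega
    rw [this]; push_cast; ring
  · refine Finset.prod_congr rfl fun e he => ?_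
    have e1 : x⁻¹ ^ 2 = x ^ (-2 : ℤ) := by rw [inv_pow, zpow_neg]; rfl
    rw [poleAt, inv_zpow', e1, ← zpow_add₀ hx, ← zpow_add₀ hx]
    congr 2
    push_cast; ring

end

/-- A Laurent polynomial in one variable as a finitely supported function. -/
lemma IsLaurent.exists_finsupp {f : ℂ → Fock} (hf : IsLaurent fun Y : Unit → ℂ => f (Y ())) :
    ∃ s : ℤ →₀ Fock, ∀ ζ, ζ ≠ 0 → ev ζ s = f ζ := by
  refine IsLaurent.induct (p := fun g : (Unit → ℂ) → Fock => ∃ s : ℤ →₀ Fock, ∀ ζ, ζ ≠ 0 →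
    ev ζ s = g fun _ => ζ) ?_ ?_ ?_ ?_ hf
  · rintro f g h ⟨s, hs⟩
    exact ⟨s, fun ζ hζ => by rw [hs ζ hζ, h _ fun _ => hζ]⟩
  · exact ⟨0, by simp⟩
  · rintro f g ⟨s, hs⟩ ⟨t, ht⟩
    exact ⟨s + t, fun ζ hζ => by rw [map_add, hs ζ hζ, ht ζ hζ]⟩
  · intro e u
    exact ⟨Finsupp.single (e ()) u, fun ζ _ => by rw [ev_single]; simp⟩

/-! ### The relations at τ = x^r -/

section

variable (C : RealizationCase) (r : ℝ) (ℓ : ℂ) (μ : Fin 2 → ℂ)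

lemma dcoef_eq (q : ℕ) (h1 : ‖Complex.exp ℓ‖ < 1) :
    dcoef r ℓ q = dco (xpow ℓ 1) (xpow ℓ r) q := by
  refine Finset.prod_congr rfl fun l _ => ?_
  have e1 : xpow ℓ (r - l) = xpow ℓ r * (xpow ℓ 1)⁻¹ ^ l := by
    rw [sub_eq_add_neg, xpow_add, xpow_neg, inv_pow, ← xpow_nat_mul, mul_one]
  have e2 : xpow ℓ l = xpow ℓ 1 ^ l := by rw [← xpow_nat_mul, mul_one]
  rw [qnum_eq, qnum_eq, div_div_div_cancel_right₀ (xdiff_ne_zero h1), e1, e2, mul_inv, inv_pow,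
    inv_inv]

lemma currentTerms_perm (h1 : ‖Complex.exp ℓ‖ < 1) (i : ℕ) :
    (currentTerms C r ℓ i).Perm (wordTerms C (xpow ℓ 1) (xpow ℓ r) i) := by
  refine List.Perm.trans ?_ ((curWords_perm C i).symm.map _)
  have h0 : dco (xpow ℓ 1) (xpow ℓ r) 0 = 1 := by simp [dco]
  refine List.Perm.of_eq ?_
  rcases i with _ | _ | i
  · simp [currentTerms, stdWords, h0]
  · cases C <;> simp [currentTerms, stdWords, special, dcoef_eq r ℓ _ h1, h0]
  · cases C <;> simp [currentTerms, stdWords, special, dcoef_eq r ℓ _ h1]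

lemma ratFun_perm {x t : ℂ} {S S' U U' : List (ℂ × List (Fin 3))} (h : S.Perm S') (h' : U.Perm U')
    (F : List (Fin 3 × ℂ) → Fock) (ζ : ℂ) : ratFun C x t S U F ζ = ratFun C x t S' U' F ζ := by
  unfold ratFun
  rw [(h.map _).sum_eq]
  congr 2
  funext a
  exact (h'.map _).sum_eq

/-- The continuation of the product of two currents. -/
lemma aeval_T (hr : 1 < r) (h1 : ‖Complex.exp ℓ‖ < 1) {i j : ℕ} (hij : i ≤ j) (N : ℤ) (v : Fock)
    {M : ℂ → ℂ → Fock}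
    (hM : IsContinuation C (xpow ℓ 1) i j (fun W => nop C r ℓ μ W N v) M) :
    ∃ s : ℤ →₀ Fock, (∀ ζ, ζ ≠ 0 → ev ζ s = M (xpow ℓ r) ζ) ∧
      Polynomial.aeval shift (polyL (poleList (xpow ℓ 1) (xpow ℓ 1 ^ ((i : ℤ) - j)) i j))
        (diagSeries (fser r ℓ i j) (T C r ℓ μ i) (T C r ℓ μ j) N v) = s ∧
      Polynomial.aeval shift (polyL (poleList (xpow ℓ 1) (xpow ℓ 1 ^ ((i : ℤ) - j)) i j))
        (fun p => prodCoeff (fser r ℓ j i) (T C r ℓ μ j) (T C r ℓ μ i) (-p) (N + p) v) = s := by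
  obtain ⟨s, hs⟩ := (hM.laurent.right (xpow_ne_zero ℓ r)).exists_finsupp
    (f := fun ζ => M (xpow ℓ r) ζ)
  have h := isExpansion_T C r ℓ μ hr h1 hij N v
  refine ⟨s, hs, h.aeval_eq (xpow_ne_zero ℓ 1) _ s (infinite_generic (xpow ℓ 1)) ?_⟩
  rintro ζ ⟨h0, hn⟩
  refine ⟨h0, hn, ?_⟩
  have e : xpow ℓ r ^ 2 = xpow ℓ (2 * r) := by
    rw [← xpow_nat_mul]; norm_num
  rw [hs ζ h0, hM.eq _ ζ (xpow_ne_zero ℓ r) h0 hn, e, ratFun_perm C (currentTerms_perm C r ℓ h1 i)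
    (currentTerms_perm C r ℓ h1 j)]

lemma hasValueAt_T (hr : 1 < r) (h1 : ‖Complex.exp ℓ‖ < 1) {i j : ℕ} (hij : i ≤ j) (N : ℤ)
    (v : Fock) {M : ℂ → ℂ → Fock}
    (hM : IsContinuation C (xpow ℓ 1) i j (fun W => nop C r ℓ μ W N v) M) {ζ : ℂ} (hζ : ζ ≠ 0)
    (hQ : (polyL (poleList (xpow ℓ 1) (xpow ℓ 1 ^ ((i : ℤ) - j)) i j)).eval ζ ≠ 0) :
    HasValueAt (diagSeries (fser r ℓ i j) (T C r ℓ μ i) (T C r ℓ μ j) N v) ζ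
      (((polyL (poleList (xpow ℓ 1) (xpow ℓ 1 ^ ((i : ℤ) - j)) i j)).eval ζ)⁻¹ •
        M (xpow ℓ r) ζ) := by
  obtain ⟨s, hs, hs', -⟩ := aeval_T C r ℓ μ hr h1 hij N v hM
  obtain ⟨_, _, _, _, _, hB, _, _⟩ := isExpansion_T C r ℓ μ hr h1 hij N v
  refine ⟨hB, _, s, hQ, fun p => ?_, ?_⟩
  · rw [← aeval_shift_apply, hs']
  · rw [← ev_apply, hs ζ hζ, smul_smul, mul_inv_cancel₀ hQ, one_smul]

lemma valueAt_eq {c : ℤ → Fock} {ζ : ℂ} {g : Fock} (hζ : ζ ≠ 0) (h : HasValueAt c ζ g) :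
    valueAt c ζ = g := by
  have h' : ∃ g, HasValueAt c ζ g := ⟨g, h⟩
  rw [valueAt, dif_pos h']
  exact h'.choose_spec.unique hζ h

lemma cconst_eq (h1 : ‖Complex.exp ℓ‖ < 1) : cconst r ℓ = cfun (xpow ℓ 1) (xpow ℓ r) := by
  have h := xdiff_ne_zero h1
  have e : xpow ℓ (r - 1) = xpow ℓ r * (xpow ℓ 1)⁻¹ := by
    rw [sub_eq_add_neg, xpow_add, xpow_neg]
  rw [cconst, qnum_eq, qnum_eq, e, mul_inv, inv_inv, cfun, ← xpow_neg ℓ 1, ← xdiff]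
  field_simp

lemma Delta_eq (l : ℕ) : Delta r ℓ 1 (xpow ℓ 1 ^ (2 * l + 1)) = deltaF (xpow ℓ 1) (xpow ℓ r) l := by
  have hx := xpow_ne_zero ℓ 1
  have e0 : xpow ℓ 1 ^ (2 * l + 1) = xpow ℓ 1 ^ (2 * (l : ℤ) + 1) := by
    rw [← zpow_natCast]; push_cast; rfl
  have e : xpow ℓ r ^ 2 = xpow ℓ (2 * r) := by
    rw [← xpow_nat_mul]; norm_num
  rw [Delta, deltaF, e0, e, Nat.cast_one, sub_eq_add_neg (2 * (r : ℂ)), xpow_add, xpow_add, xpow_neg,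
    xpow_neg, mul_assoc, mul_assoc]
  set x := xpow ℓ 1
  have e1 : x⁻¹ * x ^ (2 * (l : ℤ) + 1) = x ^ (2 * (l : ℤ)) := by
    rw [zpow_add_one₀ hx]; field_simp
  have e2 : x * x ^ (2 * (l : ℤ) + 1) = x ^ (2 * ((l : ℤ) + 1)) := by
    rw [← zpow_one_add₀ hx]; congr 1; ring
  rw [e1, e2]

end

lemma resFactor_ne_zero {x : ℂ} (hxr : ∀ n : ℤ, x ^ n = 1 → n = 0) {n : ℤ} (hn : 0 ≤ n) {i k : ℕ}
    (hk : 1 ≤ k) : resFactor x n i k ≠ 0 := by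
  refine mul_ne_zero (Finset.prod_ne_zero_iff.2 fun l _ h => ?_)
    (Finset.prod_ne_zero_iff.2 fun l hl h => ?_)
  · have := hxr _ (sub_eq_zero.1 h).symm
    omega
  · have := hxr _ (sub_eq_zero.1 h).symm
    exact Finset.ne_of_mem_erase hl (by omega)

lemma smul_add_smul_eq {R R' : ℂ} (hR : R ≠ 0) (hR' : R' ≠ 0) {A A' P P' c D B B' : ℂ}
    (U U' : Fock) :
    (A * R⁻¹) • (P⁻¹ * (c * D * R)) • B • U + (A' * R'⁻¹) • (P'⁻¹ * (-c * D * R')) • B' • U' =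
      c • D • (A • B • P⁻¹ • U - A' • B' • P'⁻¹ • U') := by
  simp only [smul_sub, smul_smul]
  rw [sub_eq_add_neg, ← neg_smul]
  congr 2
  · rw [show A * R⁻¹ * (P⁻¹ * (c * D * R) * B) = A * B * P⁻¹ * c * D * (R⁻¹ * R) by ring,
      inv_mul_cancel₀ hR]
    ring
  · rw [show A' * R'⁻¹ * (P'⁻¹ * (-c * D * R') * B') = -(A' * B' * P'⁻¹ * c * D * (R'⁻¹ * R'))
      by ring, inv_mul_cancel₀ hR']
    ring

section

variable (C : RealizationCase) (r : ℝ) (ℓ : ℂ) (μ : Fin 2 → ℂ)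

lemma xpow_one_zpow_eq_one {ℓ : ℂ} (h1 : ‖Complex.exp ℓ‖ < 1) (n : ℤ) (h : xpow ℓ 1 ^ n = 1) :
    n = 0 := by
  by_contra hn
  refine xpow_real_ne_one h1 (a := n) (Int.cast_ne_zero.2 hn) ?_
  rw [← h, ← xpow_int_mul, mul_one]
  norm_num

lemma exists_isContinuation (h1 : ‖Complex.exp ℓ‖ < 1) (i j : ℕ) (N : ℤ) (v : Fock) :
    ∃ M, IsContinuation C (xpow ℓ 1) i j (fun W => nop C r ℓ μ W N v) M := by
  obtain ⟨M, hM, hM'⟩ := exists_continuation C (isFamily_nop C r ℓ μ N v) (xpow_ne_zero ℓ 1)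
    (xpow_one_zpow_eq_one h1) i j
  exact ⟨M, hM, hM'⟩

/-- The difference of the two orders is the sum of delta functions given by `sub_eq_sum`, and
`value_pos` and `value_neg` evaluate its residues. The inverse pole `poleAt x⁻¹` yields the first
delta function and `poleAt x` the second. -/
lemma current_relations (hr : 1 < r) (h1 : ‖Complex.exp ℓ‖ < 1) {i j : ℕ} (hi : 1 ≤ i)
    (hij : i ≤ j) (m n : ℤ) (v : Fock) :
    prodCoeff (fser r ℓ i j) (T C r ℓ μ i) (T C r ℓ μ j) m n v -
        prodCoeff (fser r ℓ j i) (T C r ℓ μ j) (T C r ℓ μ i) n m v =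
      cconst r ℓ • ∑ k ∈ Finset.Icc 1 i,
        (∏ l ∈ Finset.Icc 1 (k - 1), Delta r ℓ 1 (xpow ℓ 1 ^ (2 * l + 1))) •
          (deltaTerm (xpow ℓ 1 ^ (-(j : ℤ) + i - 2 * k)) (dilate (xpow ℓ 1 ^ (k : ℤ))
              (fused (fser r ℓ (i - k) (j + k)) (T C r ℓ μ (i - k)) (T C r ℓ μ (j + k))
                (xpow ℓ 1 ^ ((j : ℤ) - i)))) m n v -
            deltaTerm (xpow ℓ 1 ^ ((j : ℤ) - i + 2 * k)) (dilate (xpow ℓ 1 ^ (-(k : ℤ)))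
              (fused (fser r ℓ (i - k) (j + k)) (T C r ℓ μ (i - k)) (T C r ℓ μ (j + k))
                (xpow ℓ 1 ^ (-(j : ℤ) + i)))) m n v) := by
  have hx := xpow_ne_zero ℓ 1
  have hxr := xpow_one_zpow_eq_one h1
  have hτ := xpow_ne_zero ℓ r
  have hn0 : (0 : ℤ) ≤ (j : ℤ) - i := by omega
  have hF := isFamily_nop C r ℓ μ (m + n) v
  obtain ⟨M, hM⟩ := exists_isContinuation C r ℓ μ h1 i j (m + n) v
  obtain ⟨s, hs, hc, hc'⟩ := aeval_T C r ℓ μ hr h1 hij (m + n) v hM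
  obtain ⟨_, _, _, _, _, hB, hB', _⟩ := isExpansion_T C r ℓ μ hr h1 hij (m + n) v
  rw [polyL_poleList hx hxr hij] at hc hc'
  have hne : (poleSet (xpow ℓ 1) ((j : ℤ) - i) i).Nonempty := by
    unfold poleSet
    exact Finset.Nonempty.inl ((Finset.nonempty_Icc.2 hi).image _)
  have h0 : ∀ a ∈ poleSet (xpow ℓ 1) ((j : ℤ) - i) i, a ≠ 0 := by
    intro a ha
    rw [poleSet, Finset.mem_union, Finset.mem_image, Finset.mem_image] at ha
    rcases ha with ⟨k, -, rfl⟩ | ⟨k, -, rfl⟩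
    · exact zpow_ne_zero _ hx
    · exact zpow_ne_zero _ (inv_ne_zero hx)
  -- The coefficient of z₁^{-m} z₂^{-n} is the coefficient of ζ^{-n} at total degree m + n.
  have key := sub_eq_sum hne h0 hB hB' hc hc' (-n)
  rw [diagSeries, neg_neg, add_neg_cancel_right, sum_poleSet hx hxr hn0] at key
  rw [key, Finset.smul_sum]
  refine Finset.sum_congr rfl fun k hk => ?_
  obtain ⟨hk1, hki⟩ := Finset.mem_Icc.1 hk
  obtain ⟨M', hM'⟩ := exists_isContinuation C r ℓ μ h1 (i - k) (j + k) (m + n) v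
  have hp := poleVal_pos hx hxr hki hij
  have hp' := poleVal_neg hx hxr hki hij
  have f1 := valueAt_eq (zpow_ne_zero _ hx)
    (hasValueAt_T C r ℓ μ hr h1 (by omega) (m + n) v hM' (zpow_ne_zero _ hx) hp)
  have f2 := valueAt_eq (zpow_ne_zero _ hx)
    (hasValueAt_T C r ℓ μ hr h1 (by omega) (m + n) v hM' (zpow_ne_zero _ hx) hp')
  have v1 := value_pos C hF hx hxr hk1 hki hij hM hM' hτ
  have v2 := value_neg C hF hx hxr hk1 hki hij hM hM' hτ
  have r1 := resFactor_ne_zero hxr hn0 (i := i) hk1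
  have r2 := resFactor_ne_zero (eq_zero_of_inv_zpow_eq_one hxr) hn0 (i := i) hk1
  have q1 := prod_poleSet_erase hx hxr hn0 (i := i) (k := k)
  have q2 := prod_poleSet_erase (inv_ne_zero hx) (eq_zero_of_inv_zpow_eq_one hxr) hn0 (i := i) (k := k)
  rw [poleSet_inv, inv_inv] at q2
  have a1 : poleAt (xpow ℓ 1)⁻¹ ((j : ℤ) - i) k = xpow ℓ 1 ^ (-(j : ℤ) + i - 2 * k) := by
    rw [poleAt, inv_zpow']; congr 1; ring
  have a2 : (poleAt (xpow ℓ 1) ((j : ℤ) - i) k)⁻¹ = xpow ℓ 1 ^ (-((j : ℤ) - i + 2 * k)) := by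
    rw [poleAt, ← zpow_neg]
  have a3 : (poleAt (xpow ℓ 1)⁻¹ ((j : ℤ) - i) k)⁻¹ = xpow ℓ 1 ^ ((j : ℤ) - i + 2 * k) := by
    rw [poleAt_inv, inv_inv, poleAt]
  -- The continuation is evaluated at the reciprocal of each inverse pole, so the negative exponent
  -- goes with `poleAt x` and the positive one with `poleAt x⁻¹`.
  rw [q1, q2, a2, a3, hs _ (zpow_ne_zero _ hx), hs _ (zpow_ne_zero _ hx), v1, v2, a1, poleAt,
    Finset.prod_congr rfl fun l _ => Delta_eq r ℓ l, cconst_eq r ℓ h1]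
  simp only [deltaTerm, dilate, fused]
  rw [f1, f2, ← poleVal, ← poleVal, add_comm]
  exact smul_add_smul_eq r1 r2 _ _

end

end DeformedW

end

theorem mainTheorem1 (r : ℝ) (x ℓ : ℂ) (hr : 1 < r) (hx0 : 0 < ‖x‖) (hx1 : ‖x‖ < 1)
    (hℓ : Complex.exp ℓ = x) (C : DeformedW.RealizationCase) (μ : Fin 2 → ℂ)
    (i j : ℕ) (hi : 1 ≤ i) (hij : i ≤ j) :
    (∀ k ∈ Finset.Icc 1 i,
      DeformedW.RegularAt (DeformedW.fser r ℓ (i - k) (j + k))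
        (DeformedW.T C r ℓ μ (i - k)) (DeformedW.T C r ℓ μ (j + k)) (x ^ ((j : ℤ) - i)) ∧
      DeformedW.RegularAt (DeformedW.fser r ℓ (i - k) (j + k))
        (DeformedW.T C r ℓ μ (i - k)) (DeformedW.T C r ℓ μ (j + k)) (x ^ (-(j : ℤ) + i))) ∧
    ∀ (m n : ℤ) (v : DeformedW.Fock),
      DeformedW.prodCoeff (DeformedW.fser r ℓ i j)
          (DeformedW.T C r ℓ μ i) (DeformedW.T C r ℓ μ j) m n v -
        DeformedW.prodCoeff (DeformedW.fser r ℓ j i)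
          (DeformedW.T C r ℓ μ j) (DeformedW.T C r ℓ μ i) n m v =
      DeformedW.cconst r ℓ • ∑ k ∈ Finset.Icc 1 i,
        (∏ l ∈ Finset.Icc 1 (k - 1), DeformedW.Delta r ℓ 1 (x ^ (2 * l + 1))) •
          (DeformedW.deltaTerm (x ^ (-(j : ℤ) + i - 2 * k))
              (DeformedW.dilate (x ^ (k : ℤ))
                (DeformedW.fused (DeformedW.fser r ℓ (i - k) (j + k))
                  (DeformedW.T C r ℓ μ (i - k)) (DeformedW.T C r ℓ μ (j + k))
                  (x ^ ((j : ℤ) - i)))) m n v -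
            DeformedW.deltaTerm (x ^ ((j : ℤ) - i + 2 * k))
              (DeformedW.dilate (x ^ (-(k : ℤ)))
                (DeformedW.fused (DeformedW.fser r ℓ (i - k) (j + k))
                  (DeformedW.T C r ℓ μ (i - k)) (DeformedW.T C r ℓ μ (j + k))
                  (x ^ (-(j : ℤ) + i)))) m n v) := by
  rw [← DeformedW.xpow_one] at hℓ
  have h1 : ‖Complex.exp ℓ‖ < 1 := by rwa [← DeformedW.xpow_one, hℓ]
  subst hℓ
  have hx := DeformedW.xpow_ne_zero ℓ 1
  have hxr := DeformedW.xpow_one_zpow_eq_one h1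
  refine ⟨fun k hk => ?_, DeformedW.current_relations C r ℓ μ hr h1 hi hij⟩
  obtain ⟨hk1, hki⟩ := Finset.mem_Icc.1 hk
  constructor <;> intro N v <;>
    obtain ⟨M, hM⟩ := DeformedW.exists_isContinuation C r ℓ μ h1 (i - k) (j + k) N v
  · exact ⟨_, DeformedW.hasValueAt_T C r ℓ μ hr h1 (by omega) N v hM (zpow_ne_zero _ hx)
      (DeformedW.poleVal_pos hx hxr hki hij)⟩
  · exact ⟨_, DeformedW.hasValueAt_T C r ℓ μ hr h1 (by omega) N v hM (zpow_ne_zero _ hx)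
      (DeformedW.poleVal_neg hx hxr hki hij)⟩
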